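/- Let $k$ be a commutative ring and let $CC_*(Cacti^1)=\bigoplus_{n\ge 0} CC_*(Cacti^1(n))$ be the cellular chains, with coefficients in $k$, of the spaces of normalized cacti. The cells are indexed by the planar planted bipartite (black/white) trees with white leaves, whose $n$ white vertices are labelled bijectively, with a spine decoration: each white vertex carries either one marked flag or one marked angle. Such a tree describes a cactus: a white vertex $v$ is a lobe, its flags are special points on the lobe, and the mark is the local zero, either at a special point or inside an arc. The degree of a cell is the number of white edges plus the number of marked angles, i.e. the sum over the lobes of (number of arcs $-1$); for $n=0$ there is the single cell $1$, a point. The boundary $\partial$ is the signed sum over the contractions of arcs (on lobes with at least two arcs), and $\sigma\circ_i\tau$ is the signed sum over all ways of identifying the outside circle of $\tau$ with the lobe $i$ of $\sigma$, global zero with local zero, such that the remaining special points of the lobe fall into the interior of arcs of $\tau$, in the given order (degenerate results count as $0$); let $\gamma$ be the induced operadic composition. Signs come from orienting each cell by the positions of the special points of the lobes relative to the local zeros, taken in the order of the outside circle. Let $\tau_2^b$ be the tree with two white vertices $1,2$ attached to the black root, $\tau_1$ the tree with the white vertex $1$ at the root and the white vertex $2$ above it, and $O'$ the tree with one white vertex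 and one spine (a marked angle), as a circle oriented by the position of the local zero measured from the global zero along the outside circle. For homogeneous chains $a,b,c$ set $$ab=\gamma(\tau_2^b;a,b),\qquad \delta(a)=\gamma(O';a),\qquad a*b=(-1)^{|a|}\gamma(\tau_1;a,b),\qquad \{a,b\}=a*b-(-1)^{(|a|+1)(|b|+1)}\,b*a ,$$ where in all formulas terms in which the arguments occur in another order are relabelled by the block permutation, so that the lobes of $a$ come first, then those of $b$, then those of $c$. For an $r$-ary operation $F$ write $F\sim 0$ if there is a chain $h$ on $Cacti^1(r)$, independent of the arguments, such that $$F(a_1,\dots,a_r)=\partial\gamma(h;a_1,\dots,a_r)-(-1)^{|h|}\sum_{j}(-1)^{|a_1|+\dots+|a_{j-1}|}\gamma(h;a_1,\dots,\partial a_j,\dots,a_r)$$ for all homogeneous $a_1,\dots,a_r$ (of any arities), and $F\sim G$ if $F-G\sim0$. \textbf{Proposition.} $CC_*(Cacti^1)$ is a GBV algebra up to homotopy: 1. $\partial^2=0$; $\partial$, the product, $\delta$ and the bracket are homogeneous of degrees $-1,0,1,1$, and $\partial(ab)=(\partial a)b+(-1)^{|a|}a\,\partial b$, $\ \partial\delta(a)=-\delta(\partial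 a)$, $\ \partial\{a,b\}=\{\partial a,b\}+(-1)^{|a|+1}\{a,\partial b\}$. 2. The product is associative with unit $1$, and commutative up to homotopy: $(-1)^{|a||b|}ba-ab\sim 0$ by $h=\tau_1$. 3. The bracket is a Gerstenhaber bracket up to homotopy: $\{a,b\}=-(-1)^{(|a|+1)(|b|+1)}\{b,a\}$, $$(-1)^{|b|}\{a,\{b,c\}\}\sim(-1)^{|b|}\bigl(\{\{a,b\},c\}+(-1)^{(|a|+1)(|b|+1)}\{b,\{a,c\}\}\bigr),$$ $$(-1)^{|a|}\{a,bc\}\sim(-1)^{|a|}\bigl(\{a,b\}c+(-1)^{(|a|+1)|b|}b\{a,c\}\bigr).$$ 4. $\delta^2=0$, and $\delta$ is a BV operator up to homotopy: $$\delta(abc)\sim\delta(ab)c+(-1)^{|a|}a\,\delta(bc)+(-1)^{(|a|+1)|b|}b\,\delta(ac)-\delta(a)bc-(-1)^{|a|}a\,\delta(b)c-(-1)^{|a|+|b|}ab\,\delta(c).$$ 5. The bracket is the one given by the BV operator, up to homotopy: $$(-1)^{|a|}\{a,b\}\sim\delta(ab)-\delta(a)b-(-1)^{|a|}a\,\delta(b).$$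 -/

import Mathlib

noncomputable section

namespace Cacti

/-! ## Planar planted bipartite trees with spines

A white vertex of (the realization of) a spine decorated planar planted bipartite tree: it has
a label, a marked flag, and the ordered list of its black children, each black child being the
ordered list of its own white children.  The flags of the vertex, in the planar order, are the
edges to the black children `0, …, r - 1` followed by the outgoing edge (number `r`, where
`r = branches.length`); `mark` is the number of the marked flag, i.e. of the flag that is the
smallest one for the linear order given by the spine decoration.

* If the marked flag is an edge of the undecorated tree, the `ℤ/2` decoration is `0` and this
  edge carries the marking.
* If the `ℤ/2` decoration is `1` and an angle is marked, the realization has one more edge in this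
  angle, leading to a new black leaf (the spine vertex), and `mark` points to it.
  So a spine vertex is a black child `[]`.
-/
inductive WTree : Type
  | node (label : ℕ) (mark : ℕ) (branches : List (List WTree)) : WTree

mutual
/-- The labels of the white vertices of a subtree. -/
def WTree.labels : WTree → List ℕ
  | .node l _ bs => l :: branchLabels bs
def branchLabels : List (List WTree) → List ℕ
  | [] => []
  | b :: bs => forestLabels b ++ branchLabels bs
def forestLabels : List WTree → List ℕ
  | [] => []
  | t :: ts => t.labels ++ forestLabels ts
end

mutual
/-- The number of white edges: the edges from a black vertex (spine vertices included) to the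
white vertex below it. -/
def WTree.whiteEdges : WTree → ℕ
  | .node _ _ bs => branchWhiteEdges bs
def branchWhiteEdges : List (List WTree) → ℕ
  | [] => 0
  | b :: bs => 1 + forestWhiteEdges b + branchWhiteEdges bs
def forestWhiteEdges : List WTree → ℕ
  | [] => 0
  | t :: ts => t.whiteEdges + forestWhiteEdges ts
end

mutual
/-- The mark is a flag of the vertex, and a black leaf is only allowed as the spine vertex, that
is, as the black child to which the mark points. -/
def WTree.Valid : WTree → Prop
  | .node _ f bs => f ≤ bs.length ∧ (∀ j, bs[j]? = some [] → j = f) ∧ BranchesValid bs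
def BranchesValid : List (List WTree) → Prop
  | [] => True
  | b :: bs => ForestValid b ∧ BranchesValid bs
def ForestValid : List WTree → Prop
  | [] => True
  | t :: ts => t.Valid ∧ ForestValid ts
end

/-- An arc of a cactus, as it is met along the outside circle: the lobe on which it lies, and
whether it is the arc that ends (in the direction of the outside circle) at the local zero of its
lobe. -/
abbrev Arc := ℕ × Bool

mutual
/-- The walk around a tree, i.e. along the outside circle of the cactus of which it is the dual
tree, starting at the root (the global zero).  A white vertex with `r` black children is a lobe
with `r + 1` arcs: the walk runs through arc `0`, then around branch `0`, then through arc `1`,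
and so on. The arc number `j` ends at the flag number `j`, so it is the last arc before the local
zero iff `j` is the mark. -/
def WTree.walk : WTree → List Arc
  | .node l f bs => branchWalk l f 0 bs
def branchWalk (l f : ℕ) : ℕ → List (List WTree) → List Arc
  | j, [] => [(l, j == f)]
  | j, b :: bs => (l, j == f) :: (forestWalk b ++ branchWalk l f (j + 1) bs)
def forestWalk : List WTree → List Arc
  | [] => []
  | t :: ts => t.walk ++ forestWalk ts
end

/-- The cells of the spaces of normalized cacti: planar planted bipartite trees with white leaves
and with a spine decoration, `n`-labelled for some `n`. The root is black and it is given by the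
ordered list of the white vertices above it. The labels are `0, …, n - 1`, each occurring once. -/
def Cell : Type :=
  {τ : List WTree // ForestValid τ ∧ ∃ n, (forestLabels τ).Perm (List.range n)}

/-- The number of lobes. -/
def Cell.arity (τ : Cell) : ℕ := (forestLabels τ.1).length

/-- The dimension of a cell: the number of white edges, which is the number of white edges of the
undecorated tree plus the number of vertices whose `ℤ/2` decoration is `1`. -/
def Cell.degree (τ : Cell) : ℕ := forestWhiteEdges τ.1

/-- The arcs of the cactus in the order of the outside circle. -/
def Cell.walk (τ : Cell) : List Arc := forestWalk τ.1

/-! The walk determines the tree. -/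

mutual
theorem WTree.mem_labels_of_mem_walk : ∀ (t : WTree) {x : Arc}, x ∈ t.walk → x.1 ∈ t.labels
  | .node l f bs, x, h => by
    simpa [WTree.labels] using mem_labels_of_mem_branchWalk l f 0 bs (by simpa [WTree.walk] using h)
theorem mem_labels_of_mem_branchWalk : ∀ (l f j : ℕ) (bs : List (List WTree)) {x : Arc},
    x ∈ branchWalk l f j bs → x.1 = l ∨ x.1 ∈ branchLabels bs
  | l, f, j, [], x, h => by
    simp only [branchWalk, List.mem_singleton] at h
    simp [h]
  | l, f, j, b :: bs, x, h => by
    simp only [branchWalk, List.mem_cons, List.mem_append] at h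
    simp only [branchLabels, List.mem_append]
    rcases h with h | h | h
    · simp [h]
    · exact Or.inr (Or.inl (mem_labels_of_mem_forestWalk b h))
    · rcases mem_labels_of_mem_branchWalk l f (j + 1) bs h with h | h
      · exact Or.inl h
      · exact Or.inr (Or.inr h)
theorem mem_labels_of_mem_forestWalk : ∀ (ts : List WTree) {x : Arc},
    x ∈ forestWalk ts → x.1 ∈ forestLabels ts
  | [], x, h => by simp [forestWalk] at h
  | t :: ts, x, h => by
    simp only [forestWalk, List.mem_append] at h
    simp only [forestLabels, List.mem_append]
    rcases h with h | h
    · exact Or.inl (WTree.mem_labels_of_mem_walk t h)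
    · exact Or.inr (mem_labels_of_mem_forestWalk ts h)
end

theorem append_cons_cancel {l : ℕ} : ∀ (a a' : List Arc) {x x' : Arc} {b b' : List Arc},
    x.1 = l → x'.1 = l → (∀ y ∈ a, y.1 ≠ l) → (∀ y ∈ a', y.1 ≠ l) →
    a ++ x :: b = a' ++ x' :: b' → a = a' ∧ x :: b = x' :: b'
  | [], [], x, x', b, b', _, _, _, _, h => ⟨rfl, h⟩
  | [], y :: a', x, x', b, b', hx, _, _, ha', h => by
    simp only [List.nil_append, List.cons_append, List.cons.injEq] at h
    exact absurd (h.1 ▸ hx) (ha' y (by simp))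
  | y :: a, [], x, x', b, b', _, hx', ha, _, h => by
    simp only [List.nil_append, List.cons_append, List.cons.injEq] at h
    exact absurd (h.1 ▸ hx') (ha y (by simp))
  | y :: a, y' :: a', x, x', b, b', hx, hx', ha, ha', h => by
    simp only [List.cons_append, List.cons.injEq] at h
    have := append_cons_cancel a a' hx hx' (fun z hz => ha z (by simp [hz]))
      (fun z hz => ha' z (by simp [hz])) h.2
    exact ⟨by rw [h.1, this.1], this.2⟩

theorem branchWalk_eq_cons (l f j : ℕ) (bs : List (List WTree)) :
    ∃ r, branchWalk l f j bs = (l, j == f) :: r := by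
  cases bs <;> simp [branchWalk]

mutual
theorem branchWalk_injective : ∀ (bs bs' : List (List WTree)) (l f f' j : ℕ) (w w' : List Arc),
    BranchesValid bs → BranchesValid bs' →
    l ∉ branchLabels bs → l ∉ branchLabels bs' → (∀ x ∈ w, x.1 ≠ l) → (∀ x ∈ w', x.1 ≠ l) →
    (branchLabels bs).Nodup → (branchLabels bs').Nodup →
    branchWalk l f j bs ++ w = branchWalk l f' j bs' ++ w' →
    bs = bs' ∧ (∀ i, j ≤ i → i ≤ j + bs.length → (i = f ↔ i = f')) ∧ w = w'
  | [], [], l, f, f', j, w, w', _, _, _, _, _, _, _, _, h => by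
    simp only [branchWalk, List.cons_append, List.nil_append, List.cons.injEq, Prod.mk.injEq,
      true_and] at h
    refine ⟨rfl, fun i h1 h2 => ?_, h.2⟩
    obtain rfl : i = j := le_antisymm (by simpa using h2) h1
    have := h.1
    rw [Bool.eq_iff_iff] at this
    simpa using this
  | [], b :: bs, l, f, f', j, w, w', _, _, _, _, hw, _, _, _, h => by
    obtain ⟨r, hr⟩ := branchWalk_eq_cons l f' (j + 1) bs
    simp only [branchWalk, List.cons_append, List.nil_append, List.cons.injEq] at h
    exact absurd rfl (hw (l, j + 1 == f') (by rw [h.2, hr]; simp))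
  | b :: bs, [], l, f, f', j, w, w', _, _, _, _, _, hw', _, _, h => by
    obtain ⟨r, hr⟩ := branchWalk_eq_cons l f (j + 1) bs
    simp only [branchWalk, List.cons_append, List.nil_append, List.cons.injEq] at h
    exact absurd rfl (hw' (l, j + 1 == f) (by rw [← h.2, hr]; simp))
  | b :: bs, b' :: bs', l, f, f', j, w, w', hv, hv', hl, hl', hw, hw', hn, hn', h => by
    obtain ⟨r, hr⟩ := branchWalk_eq_cons l f (j + 1) bs
    obtain ⟨r', hr'⟩ := branchWalk_eq_cons l f' (j + 1) bs'
    simp only [BranchesValid] at hv hv'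
    simp only [branchLabels, List.mem_append, not_or] at hl hl'
    simp only [branchLabels, List.nodup_append] at hn hn'
    simp only [branchWalk, List.cons_append, List.append_assoc, List.cons.injEq, Prod.mk.injEq,
      true_and] at h
    obtain ⟨h1, h2⟩ := h
    have h3 := append_cons_cancel (l := l) (x := (l, j + 1 == f)) (x' := (l, j + 1 == f'))
      (b := r ++ w) (b' := r' ++ w') (forestWalk b) (forestWalk b') rfl rfl
      (fun y hy e => hl.1 (e ▸ mem_labels_of_mem_forestWalk b hy))
      (fun y hy e => hl'.1 (e ▸ mem_labels_of_mem_forestWalk b' hy))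
      (by rw [hr, hr'] at h2; simpa using h2)
    have h4 := forestWalk_injective b b' hv.1 hv'.1 hn.1 hn'.1 h3.1
    have h5 := branchWalk_injective bs bs' l f f' (j + 1) w w' hv.2 hv'.2 hl.2 hl'.2 hw hw'
      hn.2.1 hn'.2.1 (by rw [hr, hr']; simpa using h3.2)
    refine ⟨by rw [h4, h5.1], fun i hi hi' => ?_, h5.2.2⟩
    rcases Nat.eq_or_lt_of_le hi with rfl | hi
    · rw [Bool.eq_iff_iff] at h1
      simpa using h1
    · exact h5.2.1 i hi (by simp only [List.length_cons] at hi'; omega)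
theorem forestWalk_injective : ∀ (ts ts' : List WTree), ForestValid ts → ForestValid ts' →
    (forestLabels ts).Nodup → (forestLabels ts').Nodup → forestWalk ts = forestWalk ts' → ts = ts'
  | [], [], _, _, _, _, _ => rfl
  | [], .node l f bs :: ts, _, _, _, _, h => by
    obtain ⟨r, hr⟩ := branchWalk_eq_cons l f 0 bs
    simp [forestWalk, WTree.walk, hr] at h
  | .node l f bs :: ts, [], _, _, _, _, h => by
    obtain ⟨r, hr⟩ := branchWalk_eq_cons l f 0 bs
    simp [forestWalk, WTree.walk, hr] at h
  | .node l f bs :: ts, .node l' f' bs' :: ts', hv, hv', hn, hn', h => by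
    obtain ⟨r, hr⟩ := branchWalk_eq_cons l f 0 bs
    obtain ⟨r', hr'⟩ := branchWalk_eq_cons l' f' 0 bs'
    simp only [ForestValid, WTree.Valid] at hv hv'
    simp only [forestLabels, WTree.labels, List.cons_append, List.nodup_cons, List.mem_append,
      not_or, List.nodup_append] at hn hn'
    simp only [forestWalk, WTree.walk] at h
    obtain rfl : l = l' := by
      rw [hr, hr'] at h
      simp only [List.cons_append, List.cons.injEq, Prod.mk.injEq] at h
      exact h.1.1
    have h1 := branchWalk_injective bs bs' l f f' 0 (forestWalk ts) (forestWalk ts')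
      hv.1.2.2 hv'.1.2.2 hn.1.1 hn'.1.1
      (fun y hy e => hn.1.2 (e ▸ mem_labels_of_mem_forestWalk ts hy))
      (fun y hy e => hn'.1.2 (e ▸ mem_labels_of_mem_forestWalk ts' hy)) hn.2.1 hn'.2.1 h
    have h2 := forestWalk_injective ts ts' hv.2 hv'.2 hn.2.2.1 hn'.2.2.1 h1.2.2
    have h3 : f = f' := (h1.2.1 f (Nat.zero_le _) (by simpa using hv.1.1)).1 rfl
    rw [h1.1, h2, h3]
end

theorem Cell.walk_injective : Function.Injective Cell.walk := fun σ τ h => by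
  obtain ⟨n, hn⟩ := σ.2.2
  obtain ⟨m, hm⟩ := τ.2.2
  exact Subtype.ext (forestWalk_injective _ _ σ.2.1 τ.2.1 (hn.nodup_iff.2 List.nodup_range)
    (hm.nodup_iff.2 List.nodup_range) h)

/-! ## The complex of cellular chains -/

/-- The module of cellular chains of all the spaces of normalized cacti (the direct sum over the
number of lobes), with one basis element for each cell.

Orientation of the cells: the arcs of a lobe cut it at the ends of its arcs. For a lobe with `m`
arcs, its local zero is one of these `m` points, and the positions of the other `m - 1` points,
measured from the local zero, are the coordinates of the simplex of this lobe. So the coordinates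
of a cell correspond to the arcs `(l, false)` that do not end at a local zero, and the cell has the
orientation of the wedge product of these coordinates in the order of the outside circle. -/
abbrev CC (k : Type*) [CommRing k] := Cell →₀ k

variable (k : Type*) [CommRing k]

/-- The chains of degree `p` on the cacti with `n` lobes. -/
def chains (n p : ℕ) : Submodule k (CC k) :=
  Finsupp.supported k k {τ | τ.arity = n ∧ τ.degree = p}

open Classical in
/-- The cell with a given walk, or `0` if there is none, i.e. if the walk is degenerate. -/
def ofWalk (w : List Arc) : CC k :=
  if h : ∃ τ : Cell, τ.walk = w then Finsupp.single h.choose 1 else 0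

/-- The number of coordinates. -/
def numFree (w : List Arc) : ℕ := w.countP fun x => !x.2

/-- The arc that precedes the arc number `p` in the cyclic order of its lobe, if the lobe has more
than one arc. -/
def prevArc (w : List Arc) (p : ℕ) : Option ℕ :=
  ((List.range p).reverse ++ (List.range' (p + 1) (w.length - (p + 1))).reverse).find?
    fun q => w[q]?.map Prod.fst == w[p]?.map Prod.fst

/-- The face at which the arc number `p` is contracted (that is, an angle of a white vertex is
collapsed), with its sign. If the contracted arc ends at the local zero, then the preceding arc of
the lobe ends there afterwards. The arc of a lobe with a single arc is not contracted. -/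
def faceTerm (w : List Arc) (p : ℕ) : CC k :=
  match prevArc w p with
  | none => 0
  | some q =>
    if (w.getD p (0, false)).2 = true then
      -((-1 : k) ^ numFree (w.take q) •
        ofWalk k ((w.set q ((w.getD q (0, false)).1, true)).eraseIdx p))
    else (-1 : k) ^ numFree (w.take p) • ofWalk k (w.eraseIdx p)

/-- The cellular boundary. -/
def boundary : CC k →ₗ[k] CC k :=
  Finsupp.linearCombination k fun τ => ∑ p ∈ Finset.range τ.walk.length, faceTerm k τ.walk p

/-- Relabelling of the lobes (the action of a permutation). -/
def relabel (f : ℕ → ℕ) : CC k →ₗ[k] CC k :=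
  Finsupp.linearCombination k fun τ => ofWalk k (τ.walk.map fun x => (f x.1, x.2))

/-- The permutation of labels that moves a first block of `m` labels behind the next `n` labels. -/
def swapBlocks (m n : ℕ) (l : ℕ) : ℕ :=
  if l < m then l + n else if l < m + n then l - m else l

/-! ## The operadic composition

In `σ ∘ᵢ τ` the outside circle of `τ` is identified with the lobe `i` of `σ`, the global zero of
`τ` with the local zero of this lobe. For trees: the branches at the vertex `i` of `σ` are grafted
to `τ`, in all ways that are compatible with their order at this vertex (starting at its marked
flag) and with the order of the angles along `τ`. -/

/-- An arc of a composed cactus. The tag records to which coordinate of the two composed cells the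
end of the arc belongs (if it is not a local zero). -/
structure TaggedArc where
  label : ℕ
  final : Bool
  tag : Option ℕ

/-- All ways to cut the walk `w` at `m` successive points that lie in the interior of arcs. An arc
that is cut gives two arcs, and the second one ends where the original arc does. -/
def cuts : ℕ → List TaggedArc → List (List (List TaggedArc))
  | 0, w => [[w]]
  | m + 1, w => (w.zipIdx).flatMap fun (x, t) =>
      (cuts m (w.drop t)).map fun S => (w.take t ++ [⟨x.label, false, none⟩]) :: S

/-- Replace the arcs of the lobe `i` in a walk, in turn, by the segments `S`, and shift the labels
above `i` to make place for `n` labels instead of one. -/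
def plug (i n : ℕ) : List (Arc × ℕ) → List (List TaggedArc) → List TaggedArc
  | [], _ => []
  | ((l, f), t) :: u, S =>
    if l = i then
      (S.headD []).map (fun x => { x with tag := some (x.tag.getD t) }) ++ plug i n u S.tail
    else ⟨if l < i then l else l + n - 1, f, some t⟩ :: plug i n u S

/-- The number of inversions of a list. -/
def inversions : List ℕ → ℕ
  | [] => 0
  | a :: l => l.countP (· < a) + inversions l

/-- The tags of the coordinates in their order along the outside circle. -/
def coordTags (v : List TaggedArc) : List ℕ :=
  v.filterMap fun x => if x.final then none else x.tag

/-- All the walks that occur when a walk `w` with `n` labels is inserted in the lobe `i` of the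
walk `u`. The segments of `w`, in their order along `w`, replace the arcs of the lobe `i` in the
order that starts at the local zero of the lobe. -/
def insertions (i n : ℕ) (u w : List Arc) : List (List TaggedArc) :=
  let lobe := u.filter fun x => x.1 = i
  let w' := (w.zipIdx u.length).map fun x => (⟨x.1.1 + i, x.1.2, some x.2⟩ : TaggedArc)
  (cuts (lobe.length - 1) w').map fun S =>
    plug i n u.zipIdx (S.rotate (lobe.length - 1 - lobe.findIdx fun x => x.2))

/-- The composition of two cells; the sign compares the orientation of the product of the two cells
(first the coordinates of `u`, then those of `w`) with the orientation of the composed cell. -/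
def circWalk (i n : ℕ) (u w : List Arc) : CC k :=
  ((insertions i n u w).map fun v =>
    (-1 : k) ^ inversions (coordTags v) • ofWalk k (v.map fun x => (x.label, x.final))).sum

/-- The composition `∘ᵢ` of chains; it is `0` on the cells of `σ` that have no lobe `i`. -/
def circ (i : ℕ) : CC k →ₗ[k] CC k →ₗ[k] CC k :=
  Finsupp.linearCombination k fun σ => Finsupp.linearCombination k fun τ =>
    if i < σ.arity then circWalk k i τ.arity σ.walk τ.walk else 0

variable {k}

/-- Insert the given chains, in turn, in the lobes of `x` from the lobe `i` on. -/
def gammaFrom (i : ℕ) (x : CC k) : List (CC k) → CC k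
  | [] => x
  | a :: as => a.sum fun τ r => r • gammaFrom (i + τ.arity) (circ k i x (Finsupp.single τ 1)) as

/-- The operadic composition `γ(x; a₁, …, aₙ)`. -/
def gamma (x : CC k) (as : List (CC k)) : CC k := gammaFrom 0 x as

variable (k)

/-! ## The operations -/

/-- The point, the tree without white vertices. -/
def unitCell : Cell := ⟨[], by simp [ForestValid], 0, by simp [forestLabels]⟩

/-- Two white vertices attached to the black root. -/
def tauTwoB : Cell := ⟨[.node 0 0 [], .node 1 0 []],
  by simp [ForestValid, WTree.Valid, BranchesValid], 2,
  by simp [forestLabels, WTree.labels, branchLabels, List.range_succ]⟩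

/-- A white vertex `0` attached to the root, with one white vertex `1` above it, without spines. -/
def tauOne : Cell := ⟨[.node 0 1 [[.node 1 0 []]]],
  by simp [ForestValid, WTree.Valid, BranchesValid]; rintro (_ | _) <;> simp, 2,
  by simp [forestLabels, WTree.labels, branchLabels, List.range_succ]⟩

/-- One white vertex with a spine. -/
def oPrime : Cell := ⟨[.node 0 0 [[]]],
  by simp [ForestValid, WTree.Valid, BranchesValid]; rintro (_ | _) <;> simp, 1,
  by simp [forestLabels, WTree.labels, branchLabels, List.range_succ]⟩

variable {k}

/-- The product `a · b = γ(τ₂ᵇ; a, b)`. -/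
def cmul (a b : CC k) : CC k := gamma (Finsupp.single tauTwoB 1) [a, b]

/-- The operator `δ(a) = γ(O'; a)`. The cell `O'`, a circle, is oriented by the position of the
local zero, measured from the global zero along the outside circle; this is the opposite of the
orientation by the position of the global zero measured from the local zero. -/
def delta (a : CC k) : CC k := gamma (-Finsupp.single oPrime 1) [a]

variable (k)

/-- The operation `a * b = (-1)^|a| γ(τ₁; a, b)`. -/
def preLie : CC k →ₗ[k] CC k →ₗ[k] CC k :=
  Finsupp.linearCombination k fun σ => Finsupp.linearCombination k fun τ =>
    (-1 : k) ^ σ.degree •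
      gamma (Finsupp.single tauOne 1) [Finsupp.single σ 1, Finsupp.single τ 1]

/-- The bracket `{a, b} = a * b - (-1)^((|a| + 1) (|b| + 1)) b * a`, where the lobes of `b * a` are
relabelled such that those of `a` come first. -/
def bracket : CC k →ₗ[k] CC k →ₗ[k] CC k :=
  Finsupp.linearCombination k fun σ => Finsupp.linearCombination k fun τ =>
    preLie k (Finsupp.single σ 1) (Finsupp.single τ 1) -
      (-1 : k) ^ ((σ.degree + 1) * (τ.degree + 1)) •
        relabel k (swapBlocks τ.arity σ.arity) (preLie k (Finsupp.single τ 1) (Finsupp.single σ 1))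

variable {k}

/-- The differential of the operation `γ(h; -, -)`, evaluated at `a` and `b`, where `h` has degree
`d` and `a` has degree `p`. -/
def opDiffTwo (h : CC k) (d p : ℕ) (a b : CC k) : CC k :=
  boundary k (gamma h [a, b]) -
    (-1 : k) ^ d • (gamma h [boundary k a, b] + (-1 : k) ^ p • gamma h [a, boundary k b])

/-- The differential of the operation `γ(h; -, -, -)`, evaluated at `a`, `b` and `c`, where `h`
has degree `d`, and `a` and `b` have the degrees `p` and `q`. -/
def opDiffThree (h : CC k) (d p q : ℕ) (a b c : CC k) : CC k :=
  boundary k (gamma h [a, b, c]) -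
    (-1 : k) ^ d • (gamma h [boundary k a, b, c] + (-1 : k) ^ p • gamma h [a, boundary k b, c] +
      (-1 : k) ^ (p + q) • gamma h [a, b, boundary k c])

end Cacti

end

open Cacti

/-!
The cells of normalized cacti are given by trees, but all operations on them are defined by the
walk along the outside circle. Such a walk is a word in arcs, where each arc belongs to a lobe and
may end at the local zero of its lobe. The walks of cells are the words that are noncrossing, with
one local zero on each lobe, and nondegenerate (`IsWord.exists_cell`), so that trees can be
forgotten.

The signs come from the order of the special points, which are the coordinates of a cell. To
control them, the ends of the arcs get names (`Letter`), and `tw` is the chain of a word in which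
the cell is oriented by the order of the names. In these terms the composition has no signs, if the
names in the outer word are smaller than those in the inner word: it is the sum over the ways to
cut the inner word at the slots of a lobe, whose arcs are then replaced by the segments
(`circ_tw`). The boundary is the alternating sum of the words in which one arc is contracted
(`boundary_tw`). Degenerate words are allowed in both formulas, since the terms that come from them
cancel or vanish.

The combinatorics of cuts gives the structure of a differential graded operad. Sequential and
parallel associativity (`circ_circ`, `circ_circ_comm`) hold since cuts can be made in any order.
The square of the boundary vanishes (`boundary_boundary`), as two contractions can be interchanged.
For the Leibniz rule (`boundary_circ`), a face of a composed word is either a composition with a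
face, or a cut moves to a point between two arcs; it arrives there from either side, by contraction
of the second or of the first part of an arc (`faceAt_of_cut`, `lsum_faceF_slot`), and these faces
cancel. Compositions are equivariant (`relabel_circ`).

Hence the terms of each identity are iterated compositions of `a`, `b`, `c` with a chain of arity
at most three that does not depend on the arguments (`nest_left`, `nest_right`, `relabel_three`),
and `∂γ(h; …)` minus the terms with boundaries of arguments is the operation of `∂h`
(`opDiffThree_eq`). What remains are equations between explicit chains, which are checked by
computing with integral combinations of words (`chainOf_eq_of_collect`). The Jacobi identity holds
strictly (`jacobi_chains`). For the other identities the homotopies are `tauOne` (`boundary_tau`),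
one cell of arity three for the Poisson identity (`poisson_chains`), two cells for the comparison
of the bracket with the BV operator (`bvLie_chains`), and eight cells for the seven term relation
(`seven_chains`).
-/

noncomputable section

namespace Cacti

section

/-! ### Sums over lists -/

/-- The sum of the values of `f` over a list, with multiplicities. -/
def lsum {ι M : Type*} [AddCommMonoid M] (l : List ι) (f : ι → M) : M := (l.map f).sum

section lsum
variable {ι κ M N : Type*} [AddCommMonoid M] [AddCommMonoid N]

@[simp] theorem lsum_nil (f : ι → M) : lsum [] f = 0 := rfl
@[simp] theorem lsum_cons (a : ι) (l : List ι) (f : ι → M) : lsum (a :: l) f = f a + lsum l f := by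
  simp [lsum]
theorem lsum_singleton (a : ι) (f : ι → M) : lsum [a] f = f a := by simp
@[simp] theorem lsum_append (l l' : List ι) (f : ι → M) :
    lsum (l ++ l') f = lsum l f + lsum l' f := by simp [lsum]
@[simp] theorem lsum_map (l : List ι) (g : ι → κ) (f : κ → M) :
    lsum (l.map g) f = lsum l fun x => f (g x) := by simp [lsum, Function.comp_def]
theorem lsum_congr {l : List ι} {f g : ι → M} (h : ∀ x ∈ l, f x = g x) : lsum l f = lsum l g := by
  unfold lsum; rw [List.map_congr_left h]
@[simp] theorem lsum_zero (l : List ι) : lsum l (fun _ => (0 : M)) = 0 := by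
  induction l <;> simp_all
theorem lsum_eq_zero {l : List ι} {f : ι → M} (h : ∀ x ∈ l, f x = 0) : lsum l f = 0 := by
  rw [lsum_congr h, lsum_zero]
theorem lsum_add (l : List ι) (f g : ι → M) :
    lsum l (fun x => f x + g x) = lsum l f + lsum l g := by
  induction l with
  | nil => simp
  | cons a l ih => simp only [lsum_cons, ih]; abel
theorem lsum_comm (l : List ι) (l' : List κ) (f : ι → κ → M) :
    lsum l (fun x => lsum l' (f x)) = lsum l' fun y => lsum l fun x => f x y := by
  induction l with
  | nil => simp
  | cons a l ih => simp only [lsum_cons, ih, lsum_add]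
theorem map_lsum {F : Type*} [FunLike F M N] [AddMonoidHomClass F M N] (φ : F) (l : List ι)
    (f : ι → M) : φ (lsum l f) = lsum l fun x => φ (f x) := by
  simp only [lsum, map_list_sum, List.map_map, Function.comp_def]
theorem lsum_perm {l l' : List ι} (h : l.Perm l') (f : ι → M) : lsum l f = lsum l' f :=
  (h.map f).sum_eq
theorem lsum_smul {R : Type*} [Monoid R] [DistribMulAction R M] (c : R) (l : List ι) (f : ι → M) :
    lsum l (fun x => c • f x) = c • lsum l f := by
  induction l with
  | nil => simp
  | cons a l ih => simp only [lsum_cons, ih, smul_add]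
theorem lsum_neg {M : Type*} [AddCommGroup M] (l : List ι) (f : ι → M) :
    lsum l (fun x => -f x) = -lsum l f := by
  induction l with
  | nil => simp
  | cons a l ih => simp only [lsum_cons, ih, neg_add]
theorem lsum_sub {M : Type*} [AddCommGroup M] (l : List ι) (f g : ι → M) :
    lsum l (fun x => f x - g x) = lsum l f - lsum l g := by
  simp only [sub_eq_add_neg, lsum_add, lsum_neg]
theorem lsum_filter (p : ι → Bool) (l : List ι) (f : ι → M) :
    lsum (l.filter p) f = lsum l fun x => if p x then f x else 0 := by
  induction l with
  | nil => simp
  | cons a l ih => by_cases h : p a <;> simp [h, ih]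

end lsum

/-- All the ways to write a list as `A ++ y :: B`. -/
def splits {α : Type*} : List α → List (List α × α × List α)
  | [] => []
  | x :: l => ([], x, l) :: (splits l).map fun s => (x :: s.1, s.2.1, s.2.2)

/-- All the ways to write a list as `A ++ B`. -/
def unappend {α : Type*} : List α → List (List α × List α)
  | [] => [([], [])]
  | x :: l => ([], x :: l) :: (unappend l).map fun s => (x :: s.1, s.2)

theorem eq_of_mem_splits {α : Type*} : ∀ {l : List α} {s}, s ∈ splits l → l = s.1 ++ s.2.1 :: s.2.2
  | [], s, h => by simp [splits] at h
  | x :: l, s, h => by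
    simp only [splits, List.mem_cons, List.mem_map] at h
    rcases h with rfl | ⟨t, ht, rfl⟩
    · simp
    · simp [eq_of_mem_splits ht]

theorem lsum_splits {α M : Type*} [AddCommMonoid M] (f : α → M) : ∀ l : List α,
    lsum (splits l) (fun s => f s.2.1) = lsum l f
  | [] => by simp [splits]
  | x :: l => by simp [splits, lsum_splits f l]

theorem sum_range_splits {α M : Type*} [AddCommMonoid M] (l : List α) (F : ℕ → M) :
    ∑ p ∈ Finset.range l.length, F p = lsum (splits l) fun s => F s.1.length := by
  induction l generalizing F with
  | nil => simp [splits]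
  | cons a l ih =>
    simp only [List.length_cons, Finset.sum_range_succ', splits, lsum_cons, lsum_map,
      List.length_nil, ih (fun p => F (p + 1))]
    abel

/-! ### Signs of orders -/

/-- The sign of the permutation that sorts a list. -/
def sgn (k : Type*) [CommRing k] (L : List ℕ) : k := (-1) ^ inversions L

section sgn
variable {k : Type*} [CommRing k]

theorem neg_one_pow_mul_self (n : ℕ) : (-1 : k) ^ n * (-1) ^ n = 1 := by
  rw [← pow_add, Even.neg_one_pow ⟨n, rfl⟩]

theorem sgn_mul_self (L : List ℕ) : sgn k L * sgn k L = 1 := neg_one_pow_mul_self _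

theorem inversions_append_cons : ∀ (P Q : List ℕ) (t : ℕ),
    inversions (P ++ t :: Q) = inversions (P ++ Q) + P.countP (t < ·) + Q.countP (· < t)
  | [], Q, t => by simp [inversions, add_comm]
  | a :: P, Q, t => by
    have := inversions_append_cons P Q t
    simp only [List.cons_append, inversions, List.countP_append, List.countP_cons] at this ⊢
    rw [this]
    by_cases h : t < a <;> simp [h] <;> omega

/-- Removing the coordinate `t` from an orientation: moving it to the front gives the sign of its
position, and this is compared with the number of the smaller coordinates. -/
theorem sgn_append_cons (P Q : List ℕ) (t : ℕ) (h : t ∉ P) :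
    (-1) ^ P.length * sgn k (P ++ t :: Q) =
      (-1) ^ ((P ++ Q).countP (· < t)) * sgn k (P ++ Q) := by
  have h1 : P.length = P.countP (· < t) + P.countP (t < ·) := by
    rw [List.length_eq_countP_add_countP (p := fun x => decide (x < t))]
    congr 1
    apply List.countP_congr
    intro x hx
    have : x ≠ t := fun e => h (e ▸ hx)
    simp; omega
  simp only [sgn]
  rw [← pow_add, ← pow_add, inversions_append_cons, List.countP_append]
  have h2 : P.length + (inversions (P ++ Q) + P.countP (t < ·) + Q.countP (· < t)) =
    (P.countP (· < t) + Q.countP (· < t) + inversions (P ++ Q)) +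
      (P.countP (t < ·) + P.countP (t < ·)) := by omega
  have h3 : Even (P.countP (t < ·) + P.countP (t < ·)) := ⟨_, rfl⟩
  rw [h2, pow_add, h3.neg_one_pow, mul_one]

/-- Replacing the coordinate `s` by `t` in an orientation. -/
theorem sgn_replace (P Q : List ℕ) (s t : ℕ) (hs : s ∉ P) (ht : t ∉ P) :
    (-1) ^ ((P ++ Q).countP (· < s)) * sgn k (P ++ s :: Q) =
      (-1) ^ ((P ++ Q).countP (· < t)) * sgn k (P ++ t :: Q) := by
  have h1 := sgn_append_cons (k := k) P Q s hs
  have h2 := sgn_append_cons (k := k) P Q t ht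
  have e1 := neg_one_pow_mul_self (k := k) P.length
  have e2 := neg_one_pow_mul_self (k := k) ((P ++ Q).countP (· < s))
  have e3 := neg_one_pow_mul_self (k := k) ((P ++ Q).countP (· < t))
  generalize (-1 : k) ^ P.length = a at *
  generalize (-1 : k) ^ ((P ++ Q).countP (· < s)) = b at *
  generalize (-1 : k) ^ ((P ++ Q).countP (· < t)) = c at *
  generalize sgn k (P ++ s :: Q) = x at *
  generalize sgn k (P ++ t :: Q) = y at *
  generalize sgn k (P ++ Q) = z at *
  have hx : x = a * b * z := by linear_combination a * h1 - x * e1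
  have hy : y = a * c * z := by linear_combination a * h2 - y * e1
  rw [hx, hy]
  linear_combination a * z * e2 - a * z * e3

theorem sgn_of_sorted : ∀ {L : List ℕ}, L.Pairwise (· < ·) → sgn k L = 1
  | [], _ => by simp [sgn, inversions]
  | a :: L, h => by
    rw [List.pairwise_cons] at h
    have : sgn k L = 1 := sgn_of_sorted h.2
    have h0 : L.countP (· < a) = 0 := by
      rw [List.countP_eq_zero]; intro x hx; have := h.1 x hx; simp; omega
    simpa [sgn, inversions, h0] using this

theorem inversions_append (P Q : List ℕ) (h : ∀ x ∈ P, ∀ y ∈ Q, x < y) :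
    inversions (P ++ Q) = inversions P + inversions Q := by
  induction P with
  | nil => simp [inversions]
  | cons a P ih =>
    have h0 : Q.countP (· < a) = 0 := by
      rw [List.countP_eq_zero]; intro x hx; have := h a (by simp) x hx; simp; omega
    simp [inversions, ih fun x hx => h x (by simp [hx]), h0, add_assoc]

theorem sgn_append (P Q : List ℕ) (h : ∀ x ∈ P, ∀ y ∈ Q, x < y) :
    sgn k (P ++ Q) = sgn k P * sgn k Q := by
  rw [sgn, inversions_append P Q h, pow_add]; rfl

theorem inversions_append' (P Q : List ℕ) (h : ∀ x ∈ P, ∀ y ∈ Q, y < x) :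
    inversions (P ++ Q) = inversions P + inversions Q + P.length * Q.length := by
  induction P with
  | nil => simp [inversions]
  | cons a P ih =>
    have h0 : Q.countP (· < a) = Q.length := by
      rw [List.countP_eq_length]; intro x hx; have := h a (by simp) x hx; simp; omega
    simp only [List.cons_append, inversions, List.countP_append, List.length_cons,
      ih fun x hx => h x (by simp [hx]), h0]
    ring

theorem sgn_append' (P Q : List ℕ) (h : ∀ x ∈ P, ∀ y ∈ Q, y < x) :
    sgn k (P ++ Q) = (-1) ^ (P.length * Q.length) * (sgn k P * sgn k Q) := by
  rw [sgn, inversions_append' P Q h, pow_add, pow_add, mul_comm]; rfl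

/-- The comparison of two orders of the same coordinates does not depend on their names. -/
theorem sgn_mul_sgn_map {L L' : List ℕ} (h : L.Perm L') (g : ℕ → ℕ) (hg : (L.map g).Nodup) :
    sgn k L * sgn k L' = sgn k (L.map g) * sgn k (L'.map g) := by
  induction h with
  | nil => simp [sgn, inversions]
  | @cons x l1 l2 h ih =>
    simp only [List.map_cons, List.nodup_cons] at hg
    have ih := ih hg.2
    simp only [sgn, List.map_cons, inversions, pow_add] at ih ⊢
    rw [h.countP_eq, (h.map g).countP_eq]
    have e1 := neg_one_pow_mul_self (k := k) (l2.countP (· < x))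
    have e2 := neg_one_pow_mul_self (k := k) ((l2.map g).countP (· < g x))
    generalize (-1 : k) ^ l2.countP (· < x) = a at *
    generalize (-1 : k) ^ (l2.map g).countP (· < g x) = b at *
    linear_combination ih + (-1) ^ inversions l1 * (-1) ^ inversions l2 * e1 -
      (-1) ^ inversions (l1.map g) * (-1) ^ inversions (l2.map g) * e2
  | swap x y l =>
    simp only [List.map_cons, List.nodup_cons, List.mem_cons, not_or] at hg
    have hne : g x ≠ g y := fun e => hg.1.1 e.symm
    have hxy : x ≠ y := fun e => hne (by rw [e])
    have key : ∀ (a b : ℕ) (M : List ℕ), a ≠ b →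
        sgn k (b :: a :: M) * sgn k (a :: b :: M) = -1 := by
      intro a b M hab
      simp only [sgn, inversions, List.countP_cons, ← pow_add]
      rcases lt_or_gt_of_ne hab with h | h
      · simp only [h, not_lt.2 h.le, decide_true, decide_false]
        apply Odd.neg_one_pow
        simp only [if_true, Bool.false_eq_true, if_false]
        exact ⟨M.countP (· < b) + M.countP (· < a) + inversions M, by omega⟩
      · simp only [h, not_lt.2 h.le, decide_true, decide_false]
        apply Odd.neg_one_pow
        simp only [if_true, Bool.false_eq_true, if_false]
        exact ⟨M.countP (· < b) + M.countP (· < a) + inversions M, by omega⟩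
    simp only [List.map_cons]
    rw [key _ _ _ hxy, key _ _ _ hne]
  | trans h1 h2 ih1 ih2 =>
    have i1 := ih1 hg
    have i2 := ih2 (((h1.map g).nodup_iff).1 hg)
    rename_i l1 l2 l3
    have e1 := sgn_mul_self (k := k) l2
    have e2 := sgn_mul_self (k := k) (l2.map g)
    generalize sgn k l1 = a at *
    generalize sgn k l2 = b at *
    generalize sgn k l3 = c at *
    generalize sgn k (l1.map g) = a' at *
    generalize sgn k (l2.map g) = b' at *
    generalize sgn k (l3.map g) = c' at *
    linear_combination (b * c) * i1 + (a' * b') * i2 - a * c * e1 + a' * c' * e2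

end sgn

end

/-! ### Noncrossing lists -/

/-- No two values of the list alternate as in `a, b, a, b`. -/
def NC (L : List ℕ) : Prop := ∀ a b, a ≠ b → ¬ [a, b, a, b].Sublist L

theorem NC.sublist {L L' : List ℕ} (h : NC L) (h' : L'.Sublist L) : NC L' :=
  fun a b hab hs => h a b hab (hs.trans h')

/-- A block between two lists with other values does not produce crossings. -/
theorem NC.insert {P A Q : List ℕ} (hA : NC A) (hPQ : NC (P ++ Q))
    (hP : ∀ x ∈ P, x ∉ A) (hQ : ∀ x ∈ Q, x ∉ A) : NC (P ++ A ++ Q) := by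
  intro a b hab hs
  rw [List.append_assoc, List.sublist_append_iff] at hs
  obtain ⟨s1, s', hs, h1, h'⟩ := hs
  rw [List.sublist_append_iff] at h'
  obtain ⟨s2, s3, rfl, h2, h3⟩ := h'
  have key : ∀ x ∈ s2, x ∉ s1 ∧ x ∉ s3 := fun x hx =>
    ⟨fun h => hP x (h1.subset h) (h2.subset hx), fun h => hQ x (h3.subset h) (h2.subset hx)⟩
  by_cases h2e : s2 = []
  · subst h2e
    exact hPQ a b hab (by rw [hs]; simpa using h1.append h3)
  · suffices h : s1 = [] ∧ s3 = [] by
      obtain ⟨rfl, rfl⟩ := h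
      exact hA a b hab (by simpa [hs] using h2)
    rcases s1 with _ | ⟨x1, _ | ⟨x2, _ | ⟨x3, _ | ⟨x4, s1⟩⟩⟩⟩ <;>
      rcases s2 with _ | ⟨y1, _ | ⟨y2, _ | ⟨y3, _ | ⟨y4, s2⟩⟩⟩⟩ <;>
        simp_all <;> grind

theorem NC.append {P Q : List ℕ} (hP : NC P) (hQ : NC Q) (h : ∀ x ∈ P, x ∉ Q) : NC (P ++ Q) := by
  simpa using hQ.insert (Q := []) (by simpa using hP) h (by simp)

theorem NC.replicate (n a : ℕ) : NC (List.replicate n a) := fun x y hxy h =>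
  hxy ((List.eq_of_mem_replicate (h.subset (by simp))).trans
    (List.eq_of_mem_replicate (h.subset (by simp))).symm)

/-- Repetitions of the elements of a list do not produce new alternating sublists. -/
theorem sublist_of_sublist_stutter {α : Type*} : ∀ (M : List (ℕ × α)) (L : List α),
    L.IsChain (· ≠ ·) → L.Sublist (M.flatMap fun x => List.replicate x.1 x.2) →
    L.Sublist (M.map (·.2))
  | [], L, _, h => by simpa using h
  | (n, x) :: M, L, hL, h => by
    rw [List.flatMap_cons, List.sublist_append_iff] at h
    obtain ⟨L1, L2, rfl, h1, h2⟩ := h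
    rw [List.isChain_append] at hL
    have ih := sublist_of_sublist_stutter M L2 hL.2.1 h2
    have h3 : L1.Sublist [x] := by
      obtain ⟨m, -, rfl⟩ := List.sublist_replicate_iff.1 h1
      have hc := hL.1
      rcases m with _ | _ | m
      · simp
      · simp
      · simp [List.replicate_succ] at hc
    simpa using h3.append ih

/-- This is the form in which cutting arcs, which repeats labels, preserves noncrossing words. -/
theorem NC.stutter {M : List (ℕ × ℕ)} (h : NC (M.map (·.2))) :
    NC (M.flatMap fun x => List.replicate x.1 x.2) := fun a b hab hs =>
  h a b hab (sublist_of_sublist_stutter M _ (by simp [hab, hab.symm]) hs)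

theorem NC.rotate_append {P Q : List ℕ} (h : NC (P ++ Q)) : NC (Q ++ P) := by
  intro a b hab hs
  rw [List.sublist_append_iff] at hs
  obtain ⟨s1, s2, hs, h1, h2⟩ := hs
  have h3 := h2.append h1
  rcases s1 with _ | ⟨x1, _ | ⟨x2, _ | ⟨x3, _ | ⟨x4, s1⟩⟩⟩⟩ <;> simp at hs
  · subst hs; exact h a b hab (by simpa using h3)
  · obtain ⟨rfl, rfl⟩ := hs; exact h b a hab.symm (by simpa using h3)
  · obtain ⟨rfl, rfl, rfl⟩ := hs; exact h a b hab (by simpa using h3)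
  · obtain ⟨rfl, rfl, rfl, rfl⟩ := hs; exact h b a hab.symm (by simpa using h3)
  · obtain ⟨rfl, rfl, rfl, rfl, rfl, rfl⟩ := hs; exact h a b hab (by simpa using h3)

/-! ### The words that are walks of cells -/

/-- The labels of the arcs that end at local zeros. -/
def finalLabels (w : List Arc) : List ℕ := (w.filter (·.2)).map (·.1)

/-- A word in which each of the labels `0, …, n - 1` has one local zero, and no other label
occurs, and in which the lobes do not cross. Such a word may be degenerate. -/
structure IsWord (n : ℕ) (w : List Arc) : Prop where
  perm : (finalLabels w).Perm (List.range n)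
  lt : ∀ x ∈ w, x.1 < n
  nc : NC (w.map (·.1))

/-- No arc of a lobe is followed, along the outside circle, by the next arc of the same lobe,
unless the arcs are separated by the local zero. -/
def Nondeg (w : List Arc) : Prop := w.IsChain fun x y => x.1 = y.1 → x.2 = true

instance (w : List Arc) : Decidable (Nondeg w) :=
  inferInstanceAs (Decidable (List.IsChain _ _))

/-- Auxiliary form of `IsWord`, for an arbitrary set of labels. -/
def PreWord (w : List Arc) : Prop :=
  NC (w.map (·.1)) ∧ ∀ x ∈ w, (finalLabels w).count x.1 = 1

theorem finalLabels_append (u v : List Arc) :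
    finalLabels (u ++ v) = finalLabels u ++ finalLabels v := by simp [finalLabels]

theorem mem_of_mem_finalLabels {w : List Arc} {l : ℕ} (h : l ∈ finalLabels w) :
    l ∈ w.map (·.1) := by
  simp only [finalLabels, List.mem_map, List.mem_filter] at h ⊢
  obtain ⟨x, hx, rfl⟩ := h; exact ⟨x, hx.1, rfl⟩

mutual
theorem perm_finalLabels_walk : ∀ t : WTree, t.Valid → (finalLabels t.walk).Perm t.labels
  | .node l f bs, h => by
    simp only [WTree.Valid] at h
    have := perm_finalLabels_branchWalk l f 0 bs h.2.2
    simp only [Nat.zero_le, Nat.zero_add, h.1, and_self, if_true] at this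
    simpa [WTree.walk, WTree.labels] using this
theorem perm_finalLabels_branchWalk : ∀ (l f j : ℕ) (bs : List (List WTree)), BranchesValid bs →
    (finalLabels (branchWalk l f j bs)).Perm
      ((if j ≤ f ∧ f ≤ j + bs.length then [l] else []) ++ branchLabels bs)
  | l, f, j, [], _ => by
    simp only [branchWalk, branchLabels, finalLabels]
    by_cases h : j = f
    · simp [h]
    · have : ¬ (j ≤ f ∧ f ≤ j + ([] : List (List WTree)).length) := by simp; omega
      rw [if_neg this]
      simp [h]
  | l, f, j, b :: bs, h => by
    simp only [BranchesValid] at h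
    have h1 := perm_finalLabels_forestWalk b h.1
    have h2 := perm_finalLabels_branchWalk l f (j + 1) bs h.2
    simp only [branchWalk, branchLabels]
    rw [← List.singleton_append, finalLabels_append, finalLabels_append]
    refine ((h1.append h2).append_left _).trans ?_
    simp only [List.length_cons]
    by_cases h : j = f
    · subst h
      rw [if_neg (by omega), if_pos (by omega)]
      simp [finalLabels]
    · have : (j ≤ f ∧ f ≤ j + (bs.length + 1)) ↔ (j + 1 ≤ f ∧ f ≤ j + 1 + bs.length) := by omega
      simp only [this]
      split_ifs
      · simp only [finalLabels, beq_iff_eq, h, not_false_eq_true, List.filter_cons_of_neg,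
          List.filter_nil, List.map_nil, List.nil_append, List.singleton_append]
        exact List.perm_middle
      · simp [finalLabels, h]
theorem perm_finalLabels_forestWalk : ∀ ts : List WTree, ForestValid ts →
    (finalLabels (forestWalk ts)).Perm (forestLabels ts)
  | [], _ => by simp [finalLabels, forestWalk, forestLabels]
  | t :: ts, h => by
    simp only [ForestValid] at h
    simp only [forestWalk, forestLabels, finalLabels_append]
    exact (perm_finalLabels_walk t h.1).append (perm_finalLabels_forestWalk ts h.2)
end

mutual
theorem numFree_walk : ∀ t : WTree, t.Valid → numFree t.walk = t.whiteEdges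
  | .node l f bs, h => by
    simp only [WTree.Valid] at h
    have := numFree_branchWalk l f 0 bs h.2.2
    simp only [Nat.zero_le, Nat.zero_add, h.1, and_self, if_true] at this
    simp only [WTree.walk, WTree.whiteEdges]; omega
theorem numFree_branchWalk : ∀ (l f j : ℕ) (bs : List (List WTree)), BranchesValid bs →
    numFree (branchWalk l f j bs) + (if j ≤ f ∧ f ≤ j + bs.length then 1 else 0) =
      1 + branchWhiteEdges bs
  | l, f, j, [], _ => by
    simp only [branchWalk, branchWhiteEdges, numFree]
    by_cases h : j = f
    · simp [h]
    · have : ¬ (j ≤ f ∧ f ≤ j + ([] : List (List WTree)).length) := by simp; omega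
      rw [if_neg this]
      simp [h]
  | l, f, j, b :: bs, h => by
    simp only [BranchesValid] at h
    have h1 := numFree_forestWalk b h.1
    have h2 := numFree_branchWalk l f (j + 1) bs h.2
    simp only [branchWalk, branchWhiteEdges, List.length_cons]
    simp only [numFree, List.countP_cons, List.countP_append] at h1 h2 ⊢
    by_cases h : j = f
    · subst h
      have hn : ¬ (j + 1 ≤ j ∧ j ≤ j + 1 + bs.length) := by omega
      have hp : j ≤ j ∧ j ≤ j + (bs.length + 1) := by omega
      simp only [hn, if_false] at h2
      simp only [hp, beq_self_eq_true, Bool.not_true, Bool.false_eq_true, if_false, if_true,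
        and_self]
      omega
    · have : (j ≤ f ∧ f ≤ j + (bs.length + 1)) ↔ (j + 1 ≤ f ∧ f ≤ j + 1 + bs.length) := by omega
      simp only [this, beq_eq_false_iff_ne.2 h, Bool.not_false, if_true]
      omega
theorem numFree_forestWalk : ∀ ts : List WTree, ForestValid ts →
    numFree (forestWalk ts) = forestWhiteEdges ts
  | [], _ => by simp [numFree, forestWalk, forestWhiteEdges]
  | t :: ts, h => by
    simp only [ForestValid] at h
    have h1 := numFree_walk t h.1
    have h2 := numFree_forestWalk ts h.2
    simp only [forestWalk, forestWhiteEdges]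
    simp only [numFree, List.countP_append] at h1 h2 ⊢
    omega
end

mutual
theorem nc_walk : ∀ t : WTree, t.labels.Nodup → NC (t.walk.map (·.1))
  | .node l f bs, h => by
    simp only [WTree.labels, List.nodup_cons] at h
    simpa [WTree.walk] using nc_branchWalk l f 0 0 bs h.1 h.2
theorem nc_branchWalk : ∀ (l f j n : ℕ) (bs : List (List WTree)), l ∉ branchLabels bs →
    (branchLabels bs).Nodup → NC (List.replicate n l ++ (branchWalk l f j bs).map (·.1))
  | l, f, j, n, [], _, _ => by
    simpa [branchWalk, ← List.replicate_succ'] using NC.replicate (n + 1) l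
  | l, f, j, n, b :: bs, hl, h => by
    simp only [branchLabels, List.mem_append, not_or, List.nodup_append] at hl h
    have h1 := nc_forestWalk b h.1
    have h2 := nc_branchWalk l f (j + 1) (n + 1) bs hl.2 h.2.1
    have h3 := h1.insert h2 ?_ ?_
    · simpa [branchWalk, List.replicate_succ'] using h3
    · intro x hx hx'
      obtain rfl := List.eq_of_mem_replicate hx
      simp only [List.mem_map] at hx'
      obtain ⟨y, hy, rfl⟩ := hx'
      exact hl.1 (mem_labels_of_mem_forestWalk b hy)
    · intro x hx hx'
      simp only [List.mem_map] at hx hx'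
      obtain ⟨y, hy, rfl⟩ := hx
      obtain ⟨z, hz, hzy⟩ := hx'
      have hz' := mem_labels_of_mem_forestWalk b hz
      rcases mem_labels_of_mem_branchWalk l f (j + 1) bs hy with e | e
      · exact hl.1 (by rw [← e, ← hzy]; exact hz')
      · exact h.2.2 _ hz' _ e hzy
theorem nc_forestWalk : ∀ ts : List WTree, (forestLabels ts).Nodup →
    NC ((forestWalk ts).map (·.1))
  | [], _ => by simpa [forestWalk] using NC.replicate 0 0
  | t :: ts, h => by
    simp only [forestLabels, List.nodup_append] at h
    simp only [forestWalk, List.map_append]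
    refine (nc_walk t h.1).append (nc_forestWalk ts h.2.1) fun x hx hx' => ?_
    simp only [List.mem_map] at hx hx'
    obtain ⟨y, hy, rfl⟩ := hx
    obtain ⟨z, hz, hzy⟩ := hx'
    exact h.2.2 _ (WTree.mem_labels_of_mem_walk t hy) _ (mem_labels_of_mem_forestWalk ts hz) hzy.symm
end

theorem Nondeg.append_of_disjoint {u v : List Arc} (hu : Nondeg u) (hv : Nondeg v)
    (h : ∀ x ∈ u, ∀ y ∈ v, x.1 ≠ y.1) : Nondeg (u ++ v) := by
  rw [Nondeg, List.isChain_append]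
  exact ⟨hu, hv, fun x hx y hy e => absurd e
    (h x (List.mem_of_mem_getLast? hx) y (List.mem_of_mem_head? hy))⟩

mutual
theorem nondeg_walk : ∀ t : WTree, t.Valid → t.labels.Nodup → Nondeg t.walk
  | .node l f bs, hv, h => by
    simp only [WTree.labels, List.nodup_cons] at h
    simp only [WTree.Valid] at hv
    simpa [WTree.walk] using
      nondeg_branchWalk l f 0 bs hv.2.2 (by simpa using hv.2.1) h.1 h.2
theorem nondeg_branchWalk : ∀ (l f j : ℕ) (bs : List (List WTree)), BranchesValid bs →
    (∀ i, bs[i]? = some [] → j + i = f) → l ∉ branchLabels bs →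
    (branchLabels bs).Nodup → Nondeg (branchWalk l f j bs)
  | l, f, j, [], _, _, _, _ => by simp [branchWalk, Nondeg]
  | l, f, j, b :: bs, hv, hf, hl, h => by
    simp only [branchLabels, List.mem_append, not_or, List.nodup_append] at hl h
    simp only [BranchesValid] at hv
    have h1 := nondeg_forestWalk b hv.1 h.1
    have h2 := nondeg_branchWalk l f (j + 1) bs hv.2
      (fun i hi => by have := hf (i + 1) (by simpa using hi); omega) hl.2 h.2.1
    have hd : ∀ x ∈ forestWalk b, x.1 ≠ l := fun x hx e =>
      hl.1 (e ▸ mem_labels_of_mem_forestWalk b hx)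
    have h3 : Nondeg (forestWalk b ++ branchWalk l f (j + 1) bs) := by
      obtain ⟨r, hr⟩ := branchWalk_eq_cons l f (j + 1) bs
      rw [Nondeg, List.isChain_append]
      refine ⟨h1, h2, fun x hx y hy e => absurd e ?_⟩
      rw [hr] at hy
      simp at hy
      rw [← hy]
      exact hd x (List.mem_of_mem_getLast? hx)
    simp only [branchWalk]
    rw [Nondeg, List.isChain_cons]
    refine ⟨fun y hy e => ?_, h3⟩
    rcases b with _ | ⟨t, b⟩
    · simpa using hf 0 (by simp)
    · exfalso
      obtain ⟨l', f', bs'⟩ := t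
      obtain ⟨r, hr⟩ := branchWalk_eq_cons l' f' 0 bs'
      have hm : y ∈ forestWalk (.node l' f' bs' :: b) := by
        simp only [forestWalk, WTree.walk, hr] at hy ⊢
        simp at hy; simp [hy]
      exact hd y hm e.symm
theorem nondeg_forestWalk : ∀ ts : List WTree, ForestValid ts → (forestLabels ts).Nodup →
    Nondeg (forestWalk ts)
  | [], _, _ => by simp [forestWalk, Nondeg]
  | t :: ts, hv, h => by
    simp only [forestLabels, List.nodup_append] at h
    simp only [ForestValid] at hv
    simp only [forestWalk]
    exact (nondeg_walk t hv.1 h.1).append_of_disjoint (nondeg_forestWalk ts hv.2 h.2.1)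
      fun x hx y hy e => h.2.2 _ (WTree.mem_labels_of_mem_walk t hx) _
        (mem_labels_of_mem_forestWalk ts hy) e
end

theorem Cell.perm_range (τ : Cell) : (forestLabels τ.1).Perm (List.range τ.arity) := by
  obtain ⟨n, hn⟩ := τ.2.2
  have : τ.arity = n := by simpa [Cell.arity] using hn.length_eq
  rw [this]; exact hn

theorem Cell.isWord (τ : Cell) : IsWord τ.arity τ.walk where
  perm := (perm_finalLabels_forestWalk _ τ.2.1).trans τ.perm_range
  lt x hx := by
    simpa using τ.perm_range.subset (mem_labels_of_mem_forestWalk _ hx)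
  nc := nc_forestWalk _ (τ.perm_range.nodup_iff.2 List.nodup_range)

theorem Cell.nondeg (τ : Cell) : Nondeg τ.walk :=
  nondeg_forestWalk _ τ.2.1 (τ.perm_range.nodup_iff.2 List.nodup_range)

/-- The decomposition of a word that starts on the lobe `l` into the branches at this lobe and the
part after the lobe. The words between the arcs of the lobe are assumed to be walks of forests. -/
theorem exists_branches (l N : ℕ) (H : ∀ v : List Arc, v.length ≤ N → PreWord v → Nondeg v →
      ∃ ts, ForestValid ts ∧ forestWalk ts = v) :
    ∀ (n : ℕ) (w : List Arc) (b : Bool) (j : ℕ), w.length ≤ n → n ≤ N → NC (l :: w.map (·.1)) →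
      (∀ x ∈ w, x.1 ≠ l → (finalLabels w).count x.1 = 1) → Nondeg ((l, b) :: w) →
      ∃ bs D, D.length ≤ w.length ∧ PreWord D ∧ Nondeg D ∧ BranchesValid bs ∧
        ((finalLabels ((l, b) :: w)).count l = 0 → ∀ f < j,
          (l, b) :: w = branchWalk l f j bs ++ D ∧ ∀ i : ℕ, bs[i]? ≠ some []) ∧
        ((finalLabels ((l, b) :: w)).count l = 1 → ∃ f, j ≤ f ∧ f ≤ j + bs.length ∧
          (l, b) :: w = branchWalk l f j bs ++ D ∧ ∀ i : ℕ, bs[i]? = some [] → j + i = f) := by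
  intro n
  induction n with
  | zero =>
    intro w b j hw _ _ _ _
    obtain rfl : w = [] := by simpa using hw
    refine ⟨[], [], by simp, ⟨by simpa using NC.replicate 0 0, by simp⟩, by simp [Nondeg],
      by simp [BranchesValid], ?_, ?_⟩
    · intro h f hf
      have hb : b = false := by cases b <;> simp_all [finalLabels]
      have : (j == f) = false := by simp; omega
      simp [branchWalk, hb, this]
    · intro h
      have hb : b = true := by cases b <;> simp_all [finalLabels]
      exact ⟨j, by simp [branchWalk, hb]⟩
  | succ n ih =>
    intro w b j hw hN hnc hc hnd
    -- `C` is the branch up to the next arc of the lobe; noncrossing separates it from what follows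
    by_cases hl : l ∈ w.map (·.1)
    · obtain ⟨C, w', hCw, hCl⟩ : ∃ (C w' : List Arc) , (∃ b', w = C ++ (l, b') :: w') ∧
          ∀ x ∈ C, x.1 ≠ l := by
        clear hw hN hnc hc hnd
        induction w with
        | nil => simp at hl
        | cons x w ih' =>
          by_cases hx : x.1 = l
          · exact ⟨[], w, ⟨x.2, by simp [← hx]⟩, by simp⟩
          · obtain ⟨C, w', ⟨b', rfl⟩, h⟩ := ih' (by
              simp only [List.map_cons, List.mem_cons] at hl
              exact hl.resolve_left (fun e => hx e.symm))
            exact ⟨x :: C, w', ⟨b', by simp⟩, by simpa [hx] using h⟩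
      obtain ⟨b', rfl⟩ := hCw
      have hdis : ∀ x ∈ C, ∀ y ∈ w', x.1 ≠ y.1 := by
        intro x hx y hy e
        refine hnc l x.1 (hCl x hx).symm ?_
        have h1 : [x.1].Sublist (C.map (·.1)) := by
          simp only [List.singleton_sublist, List.mem_map]; exact ⟨x, hx, rfl⟩
        have h2 : [x.1].Sublist (w'.map (·.1)) := by
          simp only [List.singleton_sublist, List.mem_map]; exact ⟨y, hy, e.symm⟩
        simpa using (h1.append (h2.cons_cons l))
      have hCc : ∀ x ∈ C, (finalLabels ((l, b') :: w')).count x.1 = 0 := by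
        intro x hx
        rw [List.count_eq_zero]
        intro h
        have := mem_of_mem_finalLabels h
        simp only [List.map_cons, List.mem_cons, List.mem_map] at this
        rcases this with h | ⟨y, hy, e⟩
        · exact hCl x hx h
        · exact hdis x hx y hy e.symm
      have hCw : ∀ x ∈ w', (finalLabels C).count x.1 = 0 := by
        intro x hx
        rw [List.count_eq_zero]
        intro h
        have := mem_of_mem_finalLabels h
        simp only [List.mem_map] at this
        obtain ⟨y, hy, e⟩ := this
        exact hdis y hy x hx e
      have hnd1 : Nondeg C := hnd.infix ⟨[(l, b)], (l, b') :: w', by simp⟩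
      have hnd2 : Nondeg ((l, b') :: w') := hnd.infix ⟨(l, b) :: C, [], by simp⟩
      obtain ⟨c, hc1, hc2⟩ := H C (by simp at hw; omega)
        ⟨hnc.sublist (by simp), fun x hx => by
          have := hc x (by simp [hx]) (hCl x hx)
          rw [finalLabels_append, List.count_append, hCc x hx] at this
          simpa using this⟩ hnd1
      obtain ⟨bs, D, h1, h2, h3, h4, h5, h6⟩ := ih w' b' (j + 1) (by simp at hw; omega) (by omega)
        (hnc.sublist (by
          simp only [List.map_append, List.map_cons]
          exact (List.sublist_append_right _ _).trans (List.sublist_cons_self _ _)))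
        (fun x hx hxl => by
          have := hc x (by simp [hx]) hxl
          rw [finalLabels_append, List.count_append, hCw x hx, ← List.singleton_append,
            finalLabels_append, List.count_append] at this
          have h0 : (finalLabels [(l, b')]).count x.1 = 0 := by
            rw [List.count_eq_zero]; intro h; have := mem_of_mem_finalLabels h
            simp at this; exact hxl this
          omega) hnd2
      have hcl : (finalLabels ((l, b) :: (C ++ (l, b') :: w'))).count l =
          (if b then 1 else 0) + (finalLabels ((l, b') :: w')).count l := by
        have h0 : (finalLabels C).count l = 0 := by
          rw [List.count_eq_zero]; intro h; have := mem_of_mem_finalLabels h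
          simp only [List.mem_map] at this
          obtain ⟨y, hy, e⟩ := this
          exact hCl y hy e
        rw [← List.singleton_append, finalLabels_append, finalLabels_append, List.count_append,
          List.count_append, h0]
        cases b <;> simp [finalLabels]
      refine ⟨c :: bs, D, by simp; omega, h2, h3, by simp [BranchesValid, hc1, h4], ?_, ?_⟩
      · intro h f hf
        rw [hcl] at h
        have hb : b = false := by cases b <;> simp_all
        obtain ⟨e1, e2⟩ := h5 (by omega) f (by omega)
        have : (j == f) = false := by simp; omega
        refine ⟨by simp [branchWalk, hb, this, hc2, e1], fun i hi => ?_⟩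
        rcases i with _ | i
        · simp only [List.getElem?_cons_zero, Option.some.injEq] at hi
          subst hi
          simp only [forestWalk] at hc2
          subst hc2 hb
          simp [Nondeg] at hnd
        · exact e2 i (by simpa using hi)
      · intro h
        rw [hcl] at h
        cases b with
        | true =>
          obtain ⟨e1, e2⟩ := h5 (by simpa using h) j (by omega)
          refine ⟨j, le_refl _, by omega, by simp [branchWalk, hc2, e1], fun i hi => ?_⟩
          rcases i with _ | i
          · rfl
          · exact absurd (by simpa using hi) (e2 i)
        | false =>
          obtain ⟨f, e1, e2, e3, e4⟩ := h6 (by simpa using h)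
          have : (j == f) = false := by simp; omega
          refine ⟨f, by omega, by simp; omega, by simp [branchWalk, this, hc2, e3], fun i hi => ?_⟩
          rcases i with _ | i
          · simp only [List.getElem?_cons_zero, Option.some.injEq] at hi
            subst hi
            simp only [forestWalk] at hc2
            subst hc2
            simp [Nondeg] at hnd
          · have := e4 i (by simpa using hi)
            omega
    · have hcl : (finalLabels ((l, b) :: w)).count l = if b then 1 else 0 := by
        have h0 : (finalLabels w).count l = 0 := by
          rw [List.count_eq_zero]; intro h; exact hl (mem_of_mem_finalLabels h)
        rw [← List.singleton_append, finalLabels_append, List.count_append, h0]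
        cases b <;> simp [finalLabels]
      refine ⟨[], w, le_refl _, ⟨hnc.sublist (by simp), fun x hx => hc x hx fun e => hl ?_⟩,
        hnd.infix ⟨[(l, b)], [], by simp⟩, by simp [BranchesValid], ?_, ?_⟩
      · simp only [List.mem_map]; exact ⟨x, hx, e⟩
      · intro h f hf
        have hb : b = false := by cases b <;> simp_all
        have : (j == f) = false := by simp; omega
        simp [branchWalk, hb, this]
      · intro h
        have hb : b = true := by cases b <;> simp_all
        exact ⟨j, by simp [branchWalk, hb]⟩

/-- Words are decomposed from the left: the lobe of the first arc with its branches is the first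
tree of the forest, and the part after this lobe is shorter. -/
theorem exists_forest : ∀ (N : ℕ) (w : List Arc), w.length ≤ N → PreWord w → Nondeg w →
    ∃ ts, ForestValid ts ∧ forestWalk ts = w
  | _, [], _, _, _ => ⟨[], by simp [ForestValid, forestWalk]⟩
  | N + 1, (l, b) :: w, hN, hw, hnd => by
    obtain ⟨bs, D, h1, h2, h3, h4, -, h6⟩ := exists_branches l N (exists_forest N) N w b 0
      (by simpa using hN) le_rfl hw.1 (fun x hx hxl => by
        have := hw.2 x (by simp [hx])
        rw [← List.singleton_append, finalLabels_append, List.count_append] at this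
        have h0 : (finalLabels [(l, b)]).count x.1 = 0 := by
          rw [List.count_eq_zero]; intro h; have := mem_of_mem_finalLabels h
          simp at this; exact hxl this
        omega) hnd
    obtain ⟨f, -, h7, h8, h9⟩ := h6 (hw.2 (l, b) (by simp))
    obtain ⟨ts, h10, h11⟩ := exists_forest N D (by simp at hN; omega) h2 h3
    refine ⟨.node l f bs :: ts, ?_, by simp [forestWalk, WTree.walk, h8, h11]⟩
    simp only [ForestValid, WTree.Valid]
    exact ⟨⟨by simpa using h7, by simpa using h9, h4⟩, h10⟩

/-- The nondegenerate words are the walks of cells. -/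
theorem IsWord.exists_cell {n : ℕ} {w : List Arc} (h : IsWord n w) (hw : Nondeg w) :
    ∃ τ : Cell, τ.walk = w ∧ τ.arity = n := by
  obtain ⟨ts, h1, h2⟩ := exists_forest w.length w le_rfl ⟨h.nc, fun x hx => by
    rw [h.perm.count_eq]
    exact List.count_eq_one_of_mem List.nodup_range (by simpa using h.lt x hx)⟩ hw
  have h3 : (forestLabels ts).Perm (List.range n) :=
    ((perm_finalLabels_forestWalk ts h1).symm.trans (by rw [h2])).trans h.perm
  exact ⟨⟨ts, h1, n, h3⟩, h2, by simpa [Cell.arity] using h3.length_eq⟩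

theorem Cell.degree_eq (τ : Cell) : τ.degree = numFree τ.walk := (numFree_forestWalk _ τ.2.1).symm

/-! ### Words with named coordinates -/

/-- An arc of a cactus, together with a name `tag` for the point at which it ends. If this point is
not a local zero, it is a coordinate of the cell. -/
structure Letter where
  lab : ℕ
  fin : Bool
  tag : ℕ

/-- The arc without the name of its end. -/
def Letter.arc (x : Letter) : Arc := (x.lab, x.fin)

/-- The first part of an arc that is cut at a point with the name `t`. -/
def Letter.cut (x : Letter) (t : ℕ) : Letter := ⟨x.lab, false, t⟩

@[simp] theorem Letter.cut_lab (x : Letter) (t : ℕ) : (x.cut t).lab = x.lab := rfl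
@[simp] theorem Letter.cut_fin (x : Letter) (t : ℕ) : (x.cut t).fin = false := rfl
@[simp] theorem Letter.cut_tag (x : Letter) (t : ℕ) : (x.cut t).tag = t := rfl
@[simp] theorem Letter.cut_cut (x : Letter) (s t : ℕ) : (x.cut t).cut s = x.cut s := rfl

/-- The word without the names of the points. -/
def forget (X : List Letter) : List Arc := X.map Letter.arc

/-- The names of the coordinates, in the order of the outside circle. -/
def frees (X : List Letter) : List ℕ := (X.filter (!·.fin)).map Letter.tag

@[simp] theorem forget_append (X Y : List Letter) : forget (X ++ Y) = forget X ++ forget Y := by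
  simp [forget]
@[simp] theorem forget_cons (x : Letter) (Y : List Letter) :
    forget (x :: Y) = x.arc :: forget Y := rfl
@[simp] theorem frees_append (X Y : List Letter) : frees (X ++ Y) = frees X ++ frees Y := by
  simp [frees]
@[simp] theorem frees_nil : frees [] = [] := rfl
theorem frees_cons (x : Letter) (Y : List Letter) :
    frees (x :: Y) = if x.fin then frees Y else x.tag :: frees Y := by
  cases h : x.fin <;> simp [frees, h]
@[simp] theorem frees_cons_cut (x : Letter) (t : ℕ) (Y : List Letter) :
    frees (x.cut t :: Y) = t :: frees Y := by simp [frees_cons]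

theorem frees_sublist (X : List Letter) : (frees X).Sublist (X.map Letter.tag) :=
  List.filter_sublist.map _

theorem length_frees (X : List Letter) : (frees X).length = numFree (forget X) := by
  simp [frees, numFree, forget, ← List.countP_eq_length_filter, List.countP_map,
    Function.comp_def, Letter.arc]

/-- The chain of a word with named coordinates: the cell, with the orientation in which the
coordinates are ordered by their names, or `0` if the word is degenerate. -/
def tw (k : Type*) [CommRing k] (X : List Letter) : CC k := sgn k (frees X) • ofWalk k (forget X)

/-! ### Cuts -/

/-- Attach a list to the first segment. -/
def appendHead {α : Type*} (s : List α) (S : List (List α)) : List (List α) :=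
  (s ++ S.headD []) :: S.tail

/-- Join the last segment of `S` with the first segment of `T`. -/
def glue {α : Type*} : List (List α) → List (List α) → List (List α)
  | [], T => T
  | [s], T => appendHead s T
  | s :: s' :: S, T => s :: glue (s' :: S) T

/-- All ways to cut the word `w` in the interiors of arcs, at points with the names `ts`, in this
order. An arc that is cut gives two arcs, and the second one ends where the original arc does. -/
def cutAt : List ℕ → List Letter → List (List (List Letter))
  | [], w => [[w]]
  | _ :: _, [] => []
  | t :: ts, x :: w =>
    (cutAt ts (x :: w)).map ([x.cut t] :: ·) ++ (cutAt (t :: ts) w).map (appendHead [x])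
  termination_by ts w => ts.length + w.length

@[simp] theorem cutAt_nil (w : List Letter) : cutAt [] w = [[w]] := by rw [cutAt]
@[simp] theorem cutAt_cons_nil (t : ℕ) (ts : List ℕ) : cutAt (t :: ts) [] = [] := by rw [cutAt]
theorem cutAt_cons_cons (t : ℕ) (ts : List ℕ) (x : Letter) (w : List Letter) :
    cutAt (t :: ts) (x :: w) =
      (cutAt ts (x :: w)).map ([x.cut t] :: ·) ++ (cutAt (t :: ts) w).map (appendHead [x]) := by
  rw [cutAt]

/-- Induction along the recursion of `cutAt`. -/
theorem cutAt_induction {P : List ℕ → List Letter → Prop} (h0 : ∀ w, P [] w)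
    (h1 : ∀ t ts, P (t :: ts) [])
    (h2 : ∀ t ts x w, P ts (x :: w) → P (t :: ts) w → P (t :: ts) (x :: w)) : ∀ ts w, P ts w
  | [], w => h0 w
  | t :: ts, [] => h1 t ts
  | t :: ts, x :: w => h2 t ts x w (cutAt_induction h0 h1 h2 ts (x :: w))
      (cutAt_induction h0 h1 h2 (t :: ts) w)
  termination_by ts w => ts.length + w.length

@[simp] theorem length_appendHead {α : Type*} (s : List α) (S : List (List α)) :
    (appendHead s S).length = S.length - 1 + 1 := by simp [appendHead]

@[simp] theorem flatten_appendHead {α : Type*} (s : List α) (S : List (List α)) :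
    (appendHead s S).flatten = s ++ S.flatten := by
  cases S <;> simp [appendHead]

@[simp] theorem flatten_glue {α : Type*} : ∀ (S T : List (List α)),
    (glue S T).flatten = S.flatten ++ T.flatten
  | [], T => by simp [glue]
  | [s], T => by simp [glue]
  | s :: s' :: S, T => by simp [glue, flatten_glue (s' :: S) T]

theorem length_of_mem_cutAt : ∀ (ts : List ℕ) (w : List Letter), ∀ S ∈ cutAt ts w,
    S.length = ts.length + 1 := by
  refine cutAt_induction ?_ ?_ ?_
  · simp
  · simp
  · intro t ts x w h1 h2 S hS
    rw [cutAt_cons_cons, List.mem_append, List.mem_map, List.mem_map] at hS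
    rcases hS with ⟨S, hS, rfl⟩ | ⟨S, hS, rfl⟩
    · simp [h1 S hS]
    · simp [h2 S hS]

theorem ne_nil_of_mem_cutAt {ts : List ℕ} {w : List Letter} {S} (h : S ∈ cutAt ts w) : S ≠ [] := by
  intro e; have := length_of_mem_cutAt _ _ _ h; simp [e] at this

theorem lsum_cutAt_cons_cons {M : Type*} [AddCommMonoid M] (t : ℕ) (ts : List ℕ) (x : Letter)
    (w : List Letter) (G : List (List Letter) → M) :
    lsum (cutAt (t :: ts) (x :: w)) G =
      lsum (cutAt ts (x :: w)) (fun S => G ([x.cut t] :: S)) +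
        lsum (cutAt (t :: ts) w) fun S => G (appendHead [x] S) := by
  rw [cutAt_cons_cons, lsum_append, lsum_map, lsum_map]

@[simp] theorem appendHead_nil {α : Type*} {S : List (List α)} (h : S ≠ []) :
    appendHead [] S = S := by
  cases S <;> simp_all [appendHead]

@[simp] theorem glue_singleton {α : Type*} (s : List α) (T : List (List α)) :
    glue [s] T = appendHead s T := by rw [glue]
theorem glue_cons {α : Type*} (s : List α) {S : List (List α)} (T : List (List α)) (h : S ≠ []) :
    glue (s :: S) T = s :: glue S T := by
  cases S with
  | nil => simp at h
  | cons a S => rw [glue]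

theorem appendHead_appendHead {α : Type*} (s s' : List α) (S : List (List α)) :
    appendHead s (appendHead s' S) = appendHead (s ++ s') S := by simp [appendHead]

theorem glue_appendHead {α : Type*} (s : List α) : ∀ (S : List (List α)) (T : List (List α)),
    S ≠ [] → glue (appendHead s S) T = appendHead s (glue S T)
  | [s'], T, _ => by simp [appendHead, glue]
  | s' :: s'' :: S, T, _ => by simp [appendHead, glue]

/-- The cuts of a concatenation. -/
theorem lsum_cutAt_append {M : Type*} [AddCommMonoid M] (B : List Letter) :
    ∀ (ts : List ℕ) (A : List Letter) (G : List (List Letter) → M),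
    lsum (cutAt ts (A ++ B)) G = lsum (unappend ts) fun s =>
      lsum (cutAt s.1 A) fun S => lsum (cutAt s.2 B) fun R => G (glue S R) := by
  refine cutAt_induction ?_ ?_ ?_
  · intro w G
    simp [unappend, glue, appendHead]
  · intro t ts G
    simp only [unappend, lsum_cons, cutAt_nil, lsum_nil, lsum_map, cutAt_cons_nil, lsum_zero,
      add_zero, List.nil_append, glue_singleton]
    exact lsum_congr fun S hS => by rw [appendHead_nil (ne_nil_of_mem_cutAt hS)]
  · intro t ts x w h1 h2 G
    rw [List.cons_append, lsum_cutAt_cons_cons, ← List.cons_append, h1, h2]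
    simp only [unappend, lsum_cons, cutAt_nil, lsum_nil, lsum_map, lsum_cutAt_cons_cons, lsum_add,
      add_zero]
    have e1 : ∀ s : List ℕ × List ℕ, (lsum (cutAt s.1 (x :: w)) fun S =>
        lsum (cutAt s.2 B) fun R => G ([x.cut t] :: glue S R)) =
        lsum (cutAt s.1 (x :: w)) fun S =>
          lsum (cutAt s.2 B) fun R => G (glue ([x.cut t] :: S) R) := fun s =>
      lsum_congr fun S hS => by simp only [glue_cons _ _ (ne_nil_of_mem_cutAt hS)]
    have e2 : ∀ s : List ℕ × List ℕ, (lsum (cutAt (t :: s.1) w) fun S =>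
        lsum (cutAt s.2 B) fun R => G (appendHead [x] (glue S R))) =
        lsum (cutAt (t :: s.1) w) fun S =>
          lsum (cutAt s.2 B) fun R => G (glue (appendHead [x] S) R) := fun s =>
      lsum_congr fun S hS => by simp only [glue_appendHead _ _ _ (ne_nil_of_mem_cutAt hS)]
    simp only [e1, e2, glue_singleton, appendHead_appendHead, List.singleton_append]
    rw [← add_assoc, ← add_assoc]
    congr 1
    exact add_comm _ _

theorem appendHead_append {α : Type*} (s : List α) {S : List (List α)} (R : List (List α))
    (h : S ≠ []) : appendHead s (S ++ R) = appendHead s S ++ R := by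
  cases S <;> simp_all [appendHead]

/-- The cuts with a distinguished cut. -/
theorem lsum_cutAt_splits {M : Type*} [AddCommMonoid M] (t : ℕ) (ts2 : List ℕ) :
    ∀ (ts1 : List ℕ) (w : List Letter) (G : List (List Letter) → M),
    lsum (cutAt (ts1 ++ t :: ts2) w) G = lsum (splits w) fun s =>
      lsum (cutAt ts1 (s.1 ++ [s.2.1.cut t])) fun S =>
        lsum (cutAt ts2 (s.2.1 :: s.2.2)) fun R => G (S ++ R) := by
  refine cutAt_induction ?_ ?_ ?_
  · intro w
    induction w with
    | nil => simp [splits]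
    | cons x w ih =>
      intro G
      simp only [List.nil_append] at ih ⊢
      rw [lsum_cutAt_cons_cons, ih]
      simp [splits, appendHead]
  · intro t ts G
    simp [splits]
  · intro s ts x w h1 h2 G
    rw [List.cons_append, lsum_cutAt_cons_cons, ← List.cons_append, h1, h2]
    simp only [splits, lsum_cons, lsum_map, List.nil_append, List.cons_append,
      lsum_cutAt_cons_cons, Letter.cut_cut, cutAt_cons_nil, lsum_nil, add_zero, lsum_add]
    rw [add_assoc]
    congr 2
    refine lsum_congr fun r _ => lsum_congr fun S hS => ?_
    simp only [appendHead_append _ _ (ne_nil_of_mem_cutAt hS)]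

/-- Cuts commute with the maps of letters that are compatible with the cuts of arcs. -/
theorem cutAt_map (φ : Letter → Letter) (g : ℕ → ℕ) : ∀ (ts : List ℕ) (w : List Letter),
    (∀ x ∈ w, ∀ t ∈ ts, (φ x).cut (g t) = φ (x.cut t)) →
    cutAt (ts.map g) (w.map φ) = (cutAt ts w).map (List.map (List.map φ)) := by
  refine cutAt_induction ?_ ?_ ?_
  · simp
  · simp
  · intro t ts x w h1 h2 h
    simp only [List.map_cons] at h1 h2 ⊢
    rw [cutAt_cons_cons, cutAt_cons_cons, h1 fun y hy s hs => h y hy s (by simp [hs]),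
      h2 fun y hy s hs => h y (by simp [hy]) s hs, h x (by simp) t (by simp)]
    simp only [List.map_append, List.map_map]
    congr 2
    funext S
    cases S <;> simp [appendHead]

theorem mem_flatten_of_mem_cutAt : ∀ (ts : List ℕ) (w : List Letter), ∀ S ∈ cutAt ts w,
    ∀ y ∈ S.flatten, y ∈ w ∨ ∃ x ∈ w, ∃ t ∈ ts, y = x.cut t := by
  refine cutAt_induction ?_ ?_ ?_
  · simp
  · simp
  · intro t ts x w h1 h2 S hS y hy
    rw [cutAt_cons_cons, List.mem_append, List.mem_map, List.mem_map] at hS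
    rcases hS with ⟨S, hS, rfl⟩ | ⟨S, hS, rfl⟩
    · simp only [List.flatten_cons, List.singleton_append, List.mem_cons] at hy
      rcases hy with rfl | hy
      · exact Or.inr ⟨x, by simp, t, by simp, rfl⟩
      · rcases h1 S hS y hy with h | ⟨z, hz, s, hs, h⟩
        · exact Or.inl h
        · exact Or.inr ⟨z, hz, s, by simp [hs], h⟩
    · simp only [flatten_appendHead, List.singleton_append, List.mem_cons] at hy
      rcases hy with rfl | hy
      · simp
      · rcases h2 S hS y hy with h | ⟨z, hz, s, hs, h⟩
        · exact Or.inl (by simp [h])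
        · exact Or.inr ⟨z, by simp [hz], s, hs, h⟩

theorem perm_tags_of_mem_cutAt : ∀ (ts : List ℕ) (w : List Letter), ∀ S ∈ cutAt ts w,
    (S.flatten.map Letter.tag).Perm (ts ++ w.map Letter.tag) := by
  refine cutAt_induction ?_ ?_ ?_
  · simp
  · simp
  · intro t ts x w h1 h2 S hS
    rw [cutAt_cons_cons, List.mem_append, List.mem_map, List.mem_map] at hS
    rcases hS with ⟨S, hS, rfl⟩ | ⟨S, hS, rfl⟩
    · simpa using h1 S hS
    · simp only [flatten_appendHead, List.singleton_append, List.map_cons]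
      exact ((h2 S hS).cons _).trans (List.perm_middle.symm)

theorem perm_frees_of_mem_cutAt : ∀ (ts : List ℕ) (w : List Letter), ∀ S ∈ cutAt ts w,
    (frees S.flatten).Perm (ts ++ frees w) := by
  refine cutAt_induction ?_ ?_ ?_
  · simp
  · simp
  · intro t ts x w h1 h2 S hS
    rw [cutAt_cons_cons, List.mem_append, List.mem_map, List.mem_map] at hS
    rcases hS with ⟨S, hS, rfl⟩ | ⟨S, hS, rfl⟩
    · simpa using h1 S hS
    · simp only [flatten_appendHead, List.singleton_append, frees_cons]
      split
      · exact h2 S hS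
      · exact ((h2 S hS).cons _).trans (List.perm_middle.symm)

/-- The final letters are not affected by cuts. -/
theorem filter_fin_of_mem_cutAt : ∀ (ts : List ℕ) (w : List Letter), ∀ S ∈ cutAt ts w,
    S.flatten.filter (·.fin) = w.filter (·.fin) := by
  refine cutAt_induction ?_ ?_ ?_
  · simp
  · simp
  · intro t ts x w h1 h2 S hS
    rw [cutAt_cons_cons, List.mem_append, List.mem_map, List.mem_map] at hS
    rcases hS with ⟨S, hS, rfl⟩ | ⟨S, hS, rfl⟩
    · simpa using h1 S hS
    · simp [List.filter_cons, h2 S hS]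

/-- Cutting arcs repeats labels. -/
theorem stutter_of_mem_cutAt : ∀ (ts : List ℕ) (w : List Letter), ∀ S ∈ cutAt ts w,
    ∃ M : List (ℕ × ℕ), M.map (·.2) = w.map Letter.lab ∧
      S.flatten.map Letter.lab = M.flatMap fun x => List.replicate x.1 x.2 := by
  refine cutAt_induction ?_ ?_ ?_
  · intro w S hS
    simp only [cutAt_nil, List.mem_singleton] at hS
    subst hS
    exact ⟨w.map fun x => (1, x.lab), by simp, by rw [List.map_eq_flatMap]; simp [List.flatMap_map]⟩
  · simp
  · intro t ts x w h1 h2 S hS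
    rw [cutAt_cons_cons, List.mem_append, List.mem_map, List.mem_map] at hS
    rcases hS with ⟨S, hS, rfl⟩ | ⟨S, hS, rfl⟩
    · obtain ⟨M, e1, e2⟩ := h1 S hS
      rcases M with _ | ⟨⟨n, y⟩, M⟩
      · simp at e1
      · simp only [List.map_cons, List.cons.injEq] at e1
        refine ⟨(n + 1, y) :: M, by simp [e1], ?_⟩
        simp [e2, e1, List.replicate_succ]
    · obtain ⟨M, e1, e2⟩ := h2 S hS
      exact ⟨(1, x.lab) :: M, by simp [e1], by simp [e2]⟩

/-! ### Lobes -/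

/-- The arcs of a lobe in the order of the outside circle. -/
def lobe (i : ℕ) (X : List Letter) : List Letter := X.filter fun x => x.lab = i

/-- The arcs of a lobe are given in the order of the outside circle; the same arcs in the order that
starts at the local zero. -/
def fromZero (L : List Letter) : List Letter := L.rotate (L.findIdx (·.fin) + 1)

/-- The arcs of a lobe, in the order that starts at the local zero. -/
def cyc (i : ℕ) (X : List Letter) : List Letter := fromZero (lobe i X)

/-- The names of the special points of a lobe, except for the local zero, in the order that starts
at the local zero. -/
def slotTags (i : ℕ) (X : List Letter) : List ℕ := (cyc i X).dropLast.map Letter.tag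

/-- The number of arcs of a lobe after the local zero, in the order of the outside circle. -/
def rot (L : List Letter) : ℕ := L.length - 1 - L.findIdx (·.fin)

/-- A list of arcs in which exactly one arc ends at a local zero. -/
def OneFinal (L : List Letter) : Prop :=
  ∃ A z B, L = A ++ z :: B ∧ z.fin = true ∧ (∀ x ∈ A, x.fin = false) ∧ ∀ x ∈ B, x.fin = false

theorem findIdx_final {A B : List Letter} {z : Letter} (hz : z.fin = true)
    (hA : ∀ x ∈ A, x.fin = false) : (A ++ z :: B).findIdx (·.fin) = A.length := by
  induction A with
  | nil => simp [List.findIdx_cons, hz]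
  | cons a A ih =>
    simp [List.findIdx_cons, hA a (by simp), ih fun x hx => hA x (by simp [hx])]

theorem fromZero_eq {A B : List Letter} {z : Letter} (hz : z.fin = true)
    (hA : ∀ x ∈ A, x.fin = false) : fromZero (A ++ z :: B) = B ++ A ++ [z] := by
  rw [fromZero, findIdx_final hz hA, List.append_cons]
  have : A.length + 1 = (A ++ [z]).length := by simp
  rw [this, List.rotate_append_length_eq, List.append_assoc]

theorem rot_eq {A B : List Letter} {z : Letter} (hz : z.fin = true)
    (hA : ∀ x ∈ A, x.fin = false) : rot (A ++ z :: B) = B.length := by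
  rw [rot, findIdx_final hz hA]; simp

theorem fromZero_append_comm {P Q : List Letter} (h : OneFinal (P ++ Q)) :
    fromZero (P ++ Q) = fromZero (Q ++ P) := by
  obtain ⟨A, z, B, e, hz, hA, hB⟩ := h
  rw [e, fromZero_eq hz hA]
  rcases List.append_eq_append_iff.1 e with ⟨C, rfl, rfl⟩ | ⟨C, rfl, h2⟩
  · rw [List.append_assoc C, List.cons_append, fromZero_eq hz]
    · simp
    · intro x hx; exact hA x (by simp [hx])
  · rcases C with _ | ⟨y, C⟩
    · simp only [List.nil_append] at h2
      subst h2
      have := fromZero_eq (A := []) (B := B ++ A) hz (by simp)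
      simpa using this.symm
    · simp only [List.cons_append, List.cons.injEq] at h2
      obtain ⟨rfl, rfl⟩ := h2
      rw [← List.append_assoc, fromZero_eq hz]
      · simp
      · intro x hx
        simp only [List.mem_append] at hx
        rcases hx with hx | hx
        · exact hB x (by simp [hx])
        · exact hA x hx

theorem oneFinal_of_filter {L : List Letter} {z : Letter} (h : L.filter (·.fin) = [z]) :
    OneFinal L := by
  induction L with
  | nil => simp at h
  | cons x L ih =>
    by_cases hx : x.fin
    · simp only [List.filter_cons, hx, if_true, List.cons.injEq] at h
      refine ⟨[], x, L, rfl, hx, by simp, fun y hy => ?_⟩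
      have := List.filter_eq_nil_iff.1 h.2 y hy
      simpa using this
    · simp only [List.filter_cons, hx] at h
      obtain ⟨A, z, B, rfl, h1, h2, h3⟩ := ih (by simpa using h)
      exact ⟨x :: A, z, B, rfl, h1, by simpa [hx] using h2, h3⟩

@[simp] theorem lobe_append (i : ℕ) (X Y : List Letter) :
    lobe i (X ++ Y) = lobe i X ++ lobe i Y := by simp [lobe]
@[simp] theorem lobe_nil (i : ℕ) : lobe i [] = [] := rfl
theorem lobe_cons (i : ℕ) (x : Letter) (Y : List Letter) :
    lobe i (x :: Y) = if x.lab = i then x :: lobe i Y else lobe i Y := by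
  by_cases h : x.lab = i <;> simp [lobe, h]

/-- A word, possibly degenerate, with different names for the ends of its arcs. -/
structure IsTagged (n : ℕ) (X : List Letter) : Prop where
  word : IsWord n (forget X)
  nodup : (X.map Letter.tag).Nodup

theorem finalLabels_forget (X : List Letter) :
    finalLabels (forget X) = (X.filter (·.fin)).map Letter.lab := by
  simp [finalLabels, forget, List.filter_map, Function.comp_def, Letter.arc]

theorem IsWord.filter_lobe {n : ℕ} {X : List Letter} (h : IsWord n (forget X)) {i : ℕ}
    (hi : i < n) : ∃ z, (lobe i X).filter (·.fin) = [z] := by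
  have h1 : ((lobe i X).filter (·.fin)).length = 1 := by
    have := h.perm.count_eq i
    rw [List.count_eq_one_of_mem List.nodup_range (by simpa using hi), finalLabels_forget,
      List.count_eq_countP, List.countP_map, List.countP_filter] at this
    rw [lobe, List.filter_filter, ← List.countP_eq_length_filter, ← this]
    congr 1; funext x; simp [Bool.and_comm, Bool.beq_eq_decide_eq]
  exact List.length_eq_one_iff.1 h1

theorem IsTagged.oneFinal {n : ℕ} {X : List Letter} (h : IsTagged n X) {i : ℕ} (hi : i < n) :
    OneFinal (lobe i X) := by
  obtain ⟨z, hz⟩ := h.word.filter_lobe hi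
  exact oneFinal_of_filter hz

/-- The decomposition of a word at the local zero of a lobe. -/
theorem OneFinal.exists_split {i : ℕ} {X : List Letter} (h : OneFinal (lobe i X)) :
    ∃ X1 z X2, X = X1 ++ z :: X2 ∧ z.lab = i ∧ z.fin = true ∧
      (∀ x ∈ lobe i X1, x.fin = false) ∧ ∀ x ∈ lobe i X2, x.fin = false := by
  obtain ⟨A, z, B, e, hz, hA, hB⟩ := h
  rw [lobe, List.filter_eq_append_iff] at e
  obtain ⟨X1, X2, rfl, rfl, h2⟩ := e
  rw [List.filter_eq_cons_iff] at h2
  obtain ⟨Y1, Y2, rfl, h3, h4, rfl⟩ := h2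
  have : Y1.filter (fun x => decide (x.lab = i)) = [] := by
    rw [List.filter_eq_nil_iff]; exact h3
  refine ⟨X1 ++ Y1, z, Y2, by simp, by simpa using h4, hz, fun x hx => ?_, hB⟩
  simp only [lobe, List.filter_append, this, List.append_nil] at hx
  exact hA x hx

theorem cyc_split {i : ℕ} {X1 X2 : List Letter} {z : Letter} (hi : z.lab = i) (hz : z.fin = true)
    (h1 : ∀ x ∈ lobe i X1, x.fin = false) :
    cyc i (X1 ++ z :: X2) = lobe i X2 ++ lobe i X1 ++ [z] := by
  rw [cyc, lobe_append, lobe_cons, if_pos hi, fromZero_eq hz h1]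

theorem slotTags_split {i : ℕ} {X1 X2 : List Letter} {z : Letter} (hi : z.lab = i)
    (hz : z.fin = true) (h1 : ∀ x ∈ lobe i X1, x.fin = false) :
    slotTags i (X1 ++ z :: X2) = (lobe i X2).map Letter.tag ++ (lobe i X1).map Letter.tag := by
  rw [slotTags, cyc_split hi hz h1, List.dropLast_concat, List.map_append]

theorem rot_split {i : ℕ} {X1 X2 : List Letter} {z : Letter} (hi : z.lab = i)
    (hz : z.fin = true) (h1 : ∀ x ∈ lobe i X1, x.fin = false) :
    rot (lobe i (X1 ++ z :: X2)) = (lobe i X2).length := by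
  rw [lobe_append, lobe_cons, if_pos hi, rot_eq hz h1]

theorem perm_cyc (i : ℕ) (X : List Letter) : (cyc i X).Perm (lobe i X) := List.rotate_perm _ _

theorem length_slotTags (i : ℕ) (X : List Letter) :
    (slotTags i X).length = (lobe i X).length - 1 := by
  rw [slotTags, List.length_map, List.length_dropLast, (perm_cyc i X).length_eq]

/-! ### Substitution of segments for the arcs of a lobe -/

/-- Change the label of a letter. -/
def Letter.mapLab (f : ℕ → ℕ) (x : Letter) : Letter := ⟨f x.lab, x.fin, x.tag⟩

@[simp] theorem Letter.mapLab_lab (f : ℕ → ℕ) (x : Letter) : (x.mapLab f).lab = f x.lab := rfl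
@[simp] theorem Letter.mapLab_fin (f : ℕ → ℕ) (x : Letter) : (x.mapLab f).fin = x.fin := rfl
@[simp] theorem Letter.mapLab_tag (f : ℕ → ℕ) (x : Letter) : (x.mapLab f).tag = x.tag := rfl
theorem Letter.mapLab_cut (f : ℕ → ℕ) (x : Letter) (t : ℕ) :
    (x.mapLab f).cut t = (x.cut t).mapLab f := rfl

/-- Replace the arcs with the label `i`, in turn, by the segments `S`, and change the other labels
by `f`. -/
def sub (i : ℕ) (f : ℕ → ℕ) : List Letter → List (List Letter) → List Letter
  | [], _ => []
  | x :: X, S => if x.lab = i then S.headD [] ++ sub i f X S.tail else x.mapLab f :: sub i f X S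

theorem sub_cons_pos {i : ℕ} {f : ℕ → ℕ} {x : Letter} (X : List Letter) (S : List (List Letter))
    (h : x.lab = i) : sub i f (x :: X) S = S.headD [] ++ sub i f X S.tail := by rw [sub, if_pos h]
theorem sub_cons_neg {i : ℕ} {f : ℕ → ℕ} {x : Letter} (X : List Letter) (S : List (List Letter))
    (h : x.lab ≠ i) : sub i f (x :: X) S = x.mapLab f :: sub i f X S := by rw [sub, if_neg h]
@[simp] theorem sub_nil (i : ℕ) (f : ℕ → ℕ) (S : List (List Letter)) : sub i f [] S = [] := rfl

theorem sub_append (i : ℕ) (f : ℕ → ℕ) : ∀ (X Y : List Letter) (S : List (List Letter)),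
    sub i f (X ++ Y) S = sub i f X S ++ sub i f Y (S.drop (lobe i X).length)
  | [], Y, S => by simp
  | x :: X, Y, S => by
    by_cases h : x.lab = i
    · simp [sub_cons_pos _ _ h, sub_append i f X, lobe_cons, h]
    · simp [sub_cons_neg _ _ h, sub_append i f X, lobe_cons, h]

theorem sub_append_segments (i : ℕ) (f : ℕ → ℕ) : ∀ (X : List Letter) (S T : List (List Letter)),
    S.length = (lobe i X).length → sub i f X (S ++ T) = sub i f X S
  | [], S, T, _ => by simp
  | x :: X, S, T, h => by
    by_cases hx : x.lab = i
    · rcases S with _ | ⟨s, S⟩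
      · simp [lobe_cons, hx] at h
      · simp only [lobe_cons, hx, if_true, List.length_cons, Nat.add_right_cancel_iff] at h
        simp [sub_cons_pos _ _ hx, sub_append_segments i f X S T h]
    · rw [sub_cons_neg _ _ hx, sub_cons_neg _ _ hx, sub_append_segments i f X]
      simpa [lobe_cons, hx] using h

theorem sub_append' {i : ℕ} {f : ℕ → ℕ} {X Y : List Letter} {S T : List (List Letter)}
    (h : S.length = (lobe i X).length) :
    sub i f (X ++ Y) (S ++ T) = sub i f X S ++ sub i f Y T := by
  rw [sub_append, sub_append_segments i f X S T h, ← h, List.drop_left]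

theorem sub_of_lobe_eq_nil {i : ℕ} {f : ℕ → ℕ} : ∀ {X : List Letter} (S : List (List Letter)),
    lobe i X = [] → sub i f X S = X.map (Letter.mapLab f)
  | [], S, _ => by simp
  | x :: X, S, h => by
    rw [lobe_cons] at h
    split at h
    · simp at h
    · rename_i hx
      rw [sub_cons_neg _ _ hx, sub_of_lobe_eq_nil S h, List.map_cons]

/-- The arcs of the other lobes. -/
def others (i : ℕ) (X : List Letter) : List Letter := X.filter fun x => x.lab ≠ i

theorem others_cons (i : ℕ) (x : Letter) (Y : List Letter) :
    others i (x :: Y) = if x.lab = i then others i Y else x :: others i Y := by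
  by_cases h : x.lab = i <;> simp [others, h]

theorem perm_lobe_others (i : ℕ) (X : List Letter) : X.Perm (lobe i X ++ others i X) := by
  have := List.filter_append_perm (fun x : Letter => decide (x.lab = i)) X
  simpa [lobe, others] using this.symm

theorem perm_sub (i : ℕ) (f : ℕ → ℕ) : ∀ (X : List Letter) (S : List (List Letter)),
    S.length = (lobe i X).length →
    (sub i f X S).Perm ((others i X).map (Letter.mapLab f) ++ S.flatten)
  | [], S, h => by
    obtain rfl : S = [] := by simpa using h
    simp [others]
  | x :: X, S, h => by
    by_cases hx : x.lab = i
    · rcases S with _ | ⟨s, S⟩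
      · simp [lobe_cons, hx] at h
      · simp only [lobe_cons, hx, if_true, List.length_cons, Nat.add_right_cancel_iff] at h
        simp only [sub_cons_pos _ _ hx, List.headD_cons, List.tail_cons, others_cons, hx, if_true,
          List.flatten_cons]
        refine ((perm_sub i f X S h).append_left s).trans ?_
        rw [← List.append_assoc, ← List.append_assoc]
        exact List.perm_append_comm.append_right _
    · simp only [sub_cons_neg _ _ hx, others_cons, hx, if_false, List.map_cons, List.cons_append]
      exact (perm_sub i f X S (by simpa [lobe_cons, hx] using h)).cons _

theorem map_sub {i i' : ℕ} {f f' : ℕ → ℕ} {φ ψ : Letter → Letter} :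
    ∀ {X : List Letter} (S : List (List Letter)),
    (∀ x ∈ X, (φ x).lab = i' ↔ x.lab = i) →
    (∀ x ∈ X, x.lab ≠ i → ψ (x.mapLab f) = (φ x).mapLab f') →
    (sub i f X S).map ψ = sub i' f' (X.map φ) (S.map (List.map ψ))
  | [], S, _, _ => by simp
  | x :: X, S, h1, h2 => by
    have ih := fun S => map_sub (i := i) (i' := i') (f := f) (f' := f') (φ := φ) (ψ := ψ) (X := X)
      S (fun y hy => h1 y (by simp [hy])) (fun y hy => h2 y (by simp [hy]))
    by_cases hx : x.lab = i
    · have hx' := (h1 x (by simp)).2 hx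
      rw [sub_cons_pos _ _ hx, List.map_append, ih, List.map_cons, sub_cons_pos _ _ hx']
      cases S <;> simp
    · have hx' := fun e => hx ((h1 x (by simp)).1 e)
      rw [sub_cons_neg _ _ hx, List.map_cons, ih, List.map_cons, sub_cons_neg _ _ hx',
        h2 x (by simp) hx]

/-! ### The composition of words -/

/-- The new label of a lobe when `m` lobes are inserted in the lobe `i`. -/
def outer (i m l : ℕ) : ℕ := if l < i then l else l + m - 1

/-- The word in which the arcs of the lobe `i`, in the order that starts at its local zero, are
replaced by the segments `S`. -/
def fill (i m : ℕ) (X : List Letter) (S : List (List Letter)) : List Letter :=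
  sub i (outer i m) X (S.rotate (rot (lobe i X)))

theorem length_lobe_pos {i : ℕ} {X : List Letter} (h : OneFinal (lobe i X)) :
    0 < (lobe i X).length := by
  obtain ⟨A, z, B, e, -⟩ := h
  simp [e]

theorem length_eq_of_mem_cutAt_slotTags {i : ℕ} {X w : List Letter} {S : List (List Letter)}
    (h : OneFinal (lobe i X)) (hS : S ∈ cutAt (slotTags i X) w) :
    S.length = (lobe i X).length := by
  have := length_lobe_pos h
  rw [length_of_mem_cutAt _ _ _ hS, length_slotTags]; omega

theorem perm_fill {i m : ℕ} {X : List Letter} {S : List (List Letter)}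
    (h : S.length = (lobe i X).length) :
    (fill i m X S).Perm ((others i X).map (Letter.mapLab (outer i m)) ++ S.flatten) :=
  (perm_sub _ _ _ _ (by simpa using h)).trans
    (((List.rotate_perm S _).flatten).append_left _)

theorem frees_perm {X Y : List Letter} (h : X.Perm Y) : (frees X).Perm (frees Y) :=
  (h.filter _).map _

@[simp] theorem frees_map_mapLab (f : ℕ → ℕ) (X : List Letter) :
    frees (X.map (Letter.mapLab f)) = frees X := by
  simp [frees, List.filter_map, Function.comp_def]

@[simp] theorem tags_map_mapLab (f : ℕ → ℕ) (X : List Letter) :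
    (X.map (Letter.mapLab f)).map Letter.tag = X.map Letter.tag := by simp

theorem frees_eq_of_forall {X : List Letter} (h : ∀ x ∈ X, x.fin = false) :
    frees X = X.map Letter.tag := by
  rw [frees, List.filter_eq_self.2]; simpa using h

theorem frees_lobe_perm {i : ℕ} {X : List Letter} (h : OneFinal (lobe i X)) :
    (frees (lobe i X)).Perm (slotTags i X) := by
  obtain ⟨X1, z, X2, rfl, hi, hz, h1, h2⟩ := h.exists_split
  rw [slotTags_split hi hz h1, lobe_append, lobe_cons, if_pos hi, frees_append, frees_cons,
    if_pos hz, frees_eq_of_forall h1, frees_eq_of_forall h2]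
  exact List.perm_append_comm

theorem tags_lobe_perm {i : ℕ} {X : List Letter} (h : OneFinal (lobe i X)) :
    ∃ t, ((lobe i X).map Letter.tag).Perm (slotTags i X ++ [t]) := by
  obtain ⟨X1, z, X2, rfl, hi, hz, h1, h2⟩ := h.exists_split
  refine ⟨z.tag, ?_⟩
  rw [slotTags_split hi hz h1, lobe_append, lobe_cons, if_pos hi, ← List.map_append,
    ← List.map_singleton, ← List.map_append]
  refine List.Perm.map _ ?_
  exact List.perm_append_comm.trans (List.perm_append_singleton z _).symm

theorem perm_frees_fill {i m : ℕ} {X V : List Letter} {S : List (List Letter)}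
    (h : OneFinal (lobe i X)) (hS : S ∈ cutAt (slotTags i X) (V.map (Letter.mapLab (· + i)))) :
    (frees (fill i m X S)).Perm (frees X ++ frees V) := by
  have h1 := frees_perm (perm_fill (m := m) (length_eq_of_mem_cutAt_slotTags h hS))
  have h2 := perm_frees_of_mem_cutAt _ _ _ hS
  have h3 := frees_perm (perm_lobe_others i X)
  rw [frees_append] at h1 h3
  rw [frees_map_mapLab] at h1 h2
  refine h1.trans ((h2.append_left _).trans ?_)
  rw [← List.append_assoc]
  refine List.Perm.append_right _ (List.Perm.trans ?_ h3.symm)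
  exact List.perm_append_comm.trans ((frees_lobe_perm h).symm.append_right _)

theorem perm_tags_fill {i m : ℕ} {X V : List Letter} {S : List (List Letter)}
    (h : OneFinal (lobe i X)) (hS : S ∈ cutAt (slotTags i X) (V.map (Letter.mapLab (· + i)))) :
    ∃ t, (t :: (fill i m X S).map Letter.tag).Perm (X.map Letter.tag ++ V.map Letter.tag) := by
  have h1 := (perm_fill (m := m) (length_eq_of_mem_cutAt_slotTags h hS)).map Letter.tag
  have h2 := perm_tags_of_mem_cutAt _ _ _ hS
  have h3 := (perm_lobe_others i X).map Letter.tag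
  obtain ⟨t, h4⟩ := tags_lobe_perm h
  refine ⟨t, ?_⟩
  rw [List.map_append] at h1 h3
  rw [tags_map_mapLab] at h1 h2
  refine (h1.cons t).trans ?_
  refine List.Perm.trans ?_ ((h3.trans (h4.append_right _)).append_right _).symm
  rw [List.perm_iff_count] at h2 ⊢
  intro a
  have := h2 a
  simp only [List.count_cons, List.count_append, List.count_nil] at this ⊢
  omega

theorem nodup_tags_fill {i m : ℕ} {X V : List Letter} {S : List (List Letter)}
    (h : OneFinal (lobe i X)) (hS : S ∈ cutAt (slotTags i X) (V.map (Letter.mapLab (· + i))))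
    (hn : (X.map Letter.tag ++ V.map Letter.tag).Nodup) :
    ((fill i m X S).map Letter.tag).Nodup := by
  obtain ⟨t, ht⟩ := perm_tags_fill (m := m) h hS
  exact (List.nodup_cons.1 (ht.nodup_iff.2 hn)).2

theorem mem_tags_fill {i m : ℕ} {X V : List Letter} {S : List (List Letter)}
    (h : OneFinal (lobe i X)) (hS : S ∈ cutAt (slotTags i X) (V.map (Letter.mapLab (· + i))))
    {y : Letter} (hy : y ∈ fill i m X S) :
    (∃ x ∈ X, x.tag = y.tag) ∨ ∃ x ∈ V, x.tag = y.tag := by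
  obtain ⟨t, ht⟩ := perm_tags_fill (m := m) h hS
  have := ht.subset (List.mem_cons_of_mem t (List.mem_map_of_mem hy))
  simpa using this

/-- The label of the lobe from which a lobe of the composed cactus comes. -/
def collapse (i m l : ℕ) : ℕ := if l < i then l else if l < i + m then i else l + 1 - m

theorem collapse_outer {i m l : ℕ} (h : l ≠ i) : collapse i m (outer i m l) = l := by
  unfold collapse outer; split_ifs <;> omega

/-- The labels of the segments are collapsed to `i`, so that up to repetitions the labels of the
outer word remain. -/
theorem stutter_sub {i m : ℕ} : ∀ (X : List Letter) (T : List (List Letter)),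
    T.length = (lobe i X).length → (∀ s ∈ T, ∀ y ∈ s, i ≤ y.lab ∧ y.lab < i + m) →
    ∃ M : List (ℕ × ℕ), M.map (·.2) = X.map Letter.lab ∧
      (sub i (outer i m) X T).map (fun x => collapse i m x.lab) =
        M.flatMap fun x => List.replicate x.1 x.2
  | [], T, _, _ => ⟨[], by simp⟩
  | x :: X, T, h, hT => by
    by_cases hx : x.lab = i
    · rcases T with _ | ⟨s, T⟩
      · simp [lobe_cons, hx] at h
      · simp only [lobe_cons, hx, if_true, List.length_cons, Nat.add_right_cancel_iff] at h
        obtain ⟨M, e1, e2⟩ := stutter_sub X T h fun r hr => hT r (by simp [hr])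
        refine ⟨(s.length, i) :: M, by simp [e1, hx], ?_⟩
        rw [sub_cons_pos _ _ hx, List.headD_cons, List.tail_cons, List.map_append, e2,
          List.flatMap_cons]
        congr 1
        rw [List.eq_replicate_iff]
        refine ⟨by simp, fun l hl => ?_⟩
        obtain ⟨y, hy, rfl⟩ := List.mem_map.1 hl
        have := hT s (by simp) y hy
        unfold collapse; split_ifs <;> omega
    · obtain ⟨M, e1, e2⟩ := stutter_sub X T (by simpa [lobe_cons, hx] using h) hT
      refine ⟨(1, x.lab) :: M, by simp [e1], ?_⟩
      rw [sub_cons_neg _ _ hx, List.map_cons, e2]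
      simp [collapse_outer hx]

theorem filter_inner_sub {i m : ℕ} {p : Letter → Bool} : ∀ (X : List Letter)
    (T : List (List Letter)), T.length = (lobe i X).length →
    (∀ x ∈ X, x.lab ≠ i → p (x.mapLab (outer i m)) = false) →
    (sub i (outer i m) X T).filter p = T.flatten.filter p
  | [], T, h, _ => by
    obtain rfl : T = [] := by simpa using h
    simp
  | x :: X, T, h, hp => by
    by_cases hx : x.lab = i
    · rcases T with _ | ⟨s, T⟩
      · simp [lobe_cons, hx] at h
      · simp only [lobe_cons, hx, if_true, List.length_cons, Nat.add_right_cancel_iff] at h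
        simp [sub_cons_pos _ _ hx,
          filter_inner_sub X T h fun y hy => hp y (by simp [hy])]
    · rw [sub_cons_neg _ _ hx, List.filter_cons_of_neg (by simp [hp x (by simp) hx])]
      exact filter_inner_sub X T (by simpa [lobe_cons, hx] using h)
        fun y hy => hp y (by simp [hy])

theorem outer_not_inner {i m l : ℕ} (h : l ≠ i) : ¬ (i ≤ outer i m l ∧ outer i m l < i + m) := by
  unfold outer; split_ifs <;> omega

theorem flatten_rotate {α : Type*} (S : List (List α)) (n : ℕ) (h : n ≤ S.length) :
    (S.rotate n).flatten = (S.drop n).flatten ++ (S.take n).flatten := by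
  rw [List.rotate_eq_drop_append_take h, List.flatten_append]

theorem rot_le (L : List Letter) : rot L ≤ L.length := by unfold rot; omega

theorem NC.map {L : List ℕ} (f : ℕ → ℕ) (hf : ∀ x ∈ L, ∀ y ∈ L, f x = f y → x = y) (h : NC L) :
    NC (L.map f) := by
  intro a b hab hs
  obtain ⟨L', hL', e⟩ := List.sublist_map_iff.1 hs
  rcases L' with _ | ⟨x, _ | ⟨y, _ | ⟨z, _ | ⟨w, _ | ⟨v, L'⟩⟩⟩⟩⟩ <;> simp at e
  obtain ⟨rfl, rfl, h3, h4⟩ := e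
  have hx : x ∈ L := hL'.subset (by simp)
  have hy : y ∈ L := hL'.subset (by simp)
  obtain rfl := hf x hx z (hL'.subset (by simp)) h3
  obtain rfl := hf y hy w (hL'.subset (by simp)) h4
  exact h x y (fun e => hab (by rw [e])) hL'

@[simp] theorem labels_forget (X : List Letter) : (forget X).map (·.1) = X.map Letter.lab := by
  simp [forget, Function.comp_def, Letter.arc]

theorem lt_of_isWord {n : ℕ} {X : List Letter} (h : IsWord n (forget X)) {x : Letter}
    (hx : x ∈ X) : x.lab < n := h.lt x.arc (List.mem_map_of_mem hx)

theorem inner_of_mem_cutAt {i m : ℕ} {ts : List ℕ} {V : List Letter} {S : List (List Letter)}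
    (hV : IsWord m (forget V)) (hS : S ∈ cutAt ts (V.map (Letter.mapLab (· + i)))) :
    ∀ y ∈ S.flatten, i ≤ y.lab ∧ y.lab < i + m := by
  intro y hy
  have key : ∀ z ∈ V.map (Letter.mapLab (· + i)), i ≤ z.lab ∧ z.lab < i + m := by
    intro z hz
    obtain ⟨v, hv, rfl⟩ := List.mem_map.1 hz
    have := lt_of_isWord hV hv
    simp only [Letter.mapLab_lab]; omega
  rcases mem_flatten_of_mem_cutAt _ _ _ hS y hy with h | ⟨z, hz, t, _, rfl⟩
  · exact key y h
  · exact key z hz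

/-- Labels that alternate in the composed word would alternate in the inner word if they collapse to
the same label, and in the outer word if not. -/
theorem nc_fill {n m i : ℕ} {X V : List Letter} {S : List (List Letter)}
    (hX : IsWord n (forget X)) (hV : IsWord m (forget V)) (h : OneFinal (lobe i X))
    (hS : S ∈ cutAt (slotTags i X) (V.map (Letter.mapLab (· + i)))) :
    NC ((fill i m X S).map Letter.lab) := by
  have hl := length_eq_of_mem_cutAt_slotTags h hS
  have hin := inner_of_mem_cutAt hV hS
  intro a b hab hs
  by_cases hc : collapse i m a = collapse i m b
  · have hab' : (i ≤ a ∧ a < i + m) ∧ (i ≤ b ∧ b < i + m) := by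
      unfold collapse at hc; split_ifs at hc <;> omega
    have h1 : [a, b, a, b].Sublist
        (((fill i m X S).filter fun x => decide (i ≤ x.lab ∧ x.lab < i + m)).map Letter.lab) := by
      have := hs.filter fun l => decide (i ≤ l ∧ l < i + m)
      rw [List.filter_map] at this
      simpa [hab', Function.comp_def] using this
    rw [fill, filter_inner_sub _ _ (by simpa using hl) (by
      intro x _ hx; exact decide_eq_false_iff_not.2 (outer_not_inner (m := m) hx))] at h1
    have h2 := h1.trans (List.filter_sublist.map _)
    rw [flatten_rotate _ _ (by rw [hl]; exact rot_le _), List.map_append] at h2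
    refine NC.rotate_append ?_ a b hab h2
    rw [← List.map_append, ← List.flatten_append, List.take_append_drop]
    obtain ⟨M, e1, e2⟩ := stutter_of_mem_cutAt _ _ _ hS
    rw [e2]
    refine NC.stutter ?_
    rw [e1]
    have := (hV.nc).map (· + i) (by simp)
    simpa [Function.comp_def] using this
  · have h1 := hs.map (collapse i m)
    obtain ⟨M, e1, e2⟩ := stutter_sub (m := m) X (S.rotate (rot (lobe i X))) (by simpa using hl)
      (fun s hs y hy => hin y (by
        rw [List.mem_rotate] at hs
        exact List.mem_flatten.2 ⟨s, hs, hy⟩))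
    rw [List.map_map] at h1
    have h2 := NC.stutter (M := M) (by rw [e1]; simpa using hX.nc)
    rw [← e2] at h2
    exact h2 _ _ hc (by simpa [fill, Function.comp_def] using h1)

theorem perm_range_insert {n m i : ℕ} (hi : i < n) :
    (((List.range n).filter (fun l => l ≠ i)).map (outer i m) ++ (List.range m).map (· + i)).Perm
      (List.range (n + m - 1)) := by
  have h1 : (((List.range n).filter (fun l => l ≠ i)).map (outer i m)).Nodup := by
    refine List.Nodup.map_on ?_ (List.nodup_range.filter _)
    intro x hx y hy e
    simp only [List.mem_filter, decide_eq_true_eq] at hx hy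
    rw [← collapse_outer (m := m) hx.2, e, collapse_outer hy.2]
  have h2 : ((List.range m).map (· + i)).Nodup :=
    List.nodup_range.map (fun a b e => Nat.add_right_cancel e)
  refine (List.perm_ext_iff_of_nodup (h1.append h2 ?_) List.nodup_range).2 fun l => ?_
  · intro l hl hl'
    simp only [List.mem_map, List.mem_filter, List.mem_range, decide_eq_true_eq] at hl hl'
    obtain ⟨x, hx, rfl⟩ := hl
    obtain ⟨y, hy, e⟩ := hl'
    exact outer_not_inner (m := m) hx.2 (by omega)
  · simp only [List.mem_append, List.mem_map, List.mem_filter, List.mem_range, decide_eq_true_eq]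
    constructor
    · rintro (⟨x, hx, rfl⟩ | ⟨x, hx, rfl⟩)
      · unfold outer; split_ifs <;> omega
      · omega
    · intro h
      by_cases h1 : l < i
      · exact Or.inl ⟨l, ⟨by omega, by omega⟩, by simp [outer, h1]⟩
      · by_cases h2 : l < i + m
        · exact Or.inr ⟨l - i, by omega, by omega⟩
        · refine Or.inl ⟨l + 1 - m, ⟨by omega, by omega⟩, ?_⟩
          unfold outer; split_ifs <;> omega

theorem isWord_fill {n m i : ℕ} {X V : List Letter} {S : List (List Letter)} (hi : i < n)
    (hX : IsWord n (forget X)) (hV : IsWord m (forget V)) (h : OneFinal (lobe i X))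
    (hS : S ∈ cutAt (slotTags i X) (V.map (Letter.mapLab (· + i)))) :
    IsWord (n + m - 1) (forget (fill i m X S)) := by
  have hl := length_eq_of_mem_cutAt_slotTags h hS
  have hp : (finalLabels (forget (fill i m X S))).Perm (List.range (n + m - 1)) := by
    refine List.Perm.trans ?_ (perm_range_insert hi)
    rw [finalLabels_forget]
    refine (((perm_fill (m := m) hl).filter _).map _).trans ?_
    rw [List.filter_append, List.map_append, filter_fin_of_mem_cutAt _ _ _ hS]
    refine List.Perm.append ?_ ?_
    · have := (hX.perm.filter (fun l => decide (l ≠ i))).map (outer i m)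
      refine List.Perm.trans (List.Perm.of_eq ?_) this
      rw [finalLabels_forget, others]
      simp [List.filter_map, List.filter_filter, Function.comp_def, Bool.and_comm]
    · have := hV.perm.map (· + i)
      refine List.Perm.trans (List.Perm.of_eq ?_) this
      rw [finalLabels_forget]
      simp [List.filter_map, Function.comp_def]
  refine ⟨hp, fun x hx => ?_, by simpa using nc_fill hX hV h hS⟩
  obtain ⟨y, hy, rfl⟩ := List.mem_map.1 hx
  have hy := (perm_fill (m := m) hl).subset hy
  simp only [List.mem_append, List.mem_map] at hy
  show y.lab < _
  rcases hy with ⟨z, hz, rfl⟩ | hy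
  · simp only [others, List.mem_filter, decide_eq_true_eq] at hz
    have := lt_of_isWord hX hz.1
    simp only [Letter.mapLab_lab, outer]; split_ifs <;> omega
  · have := inner_of_mem_cutAt hV hS y hy
    omega

theorem IsTagged.fill {n m i : ℕ} {X V : List Letter} {S : List (List Letter)} (hi : i < n)
    (hX : IsTagged n X) (hV : IsTagged m V) (hXV : ∀ x ∈ X, ∀ y ∈ V, x.tag < y.tag)
    (hS : S ∈ cutAt (slotTags i X) (V.map (Letter.mapLab (· + i)))) :
    IsTagged (n + m - 1) (fill i m X S) := by
  refine ⟨isWord_fill hi hX.word hV.word (hX.oneFinal hi) hS,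
    nodup_tags_fill (hX.oneFinal hi) hS (hX.nodup.append hV.nodup fun t h1 h2 => ?_)⟩
  obtain ⟨x, hx, rfl⟩ := List.mem_map.1 h1
  obtain ⟨y, hy, e⟩ := List.mem_map.1 h2
  exact absurd e (hXV x hx y hy).ne'

/-! ### Degenerate words -/

/-- Two successive arcs of the word lie on the same lobe, and the point between them is not the
local zero. -/
def Degen (X : List Letter) : Prop :=
  ∃ A x y B, X = A ++ x :: y :: B ∧ x.lab = y.lab ∧ x.fin = false

theorem not_nondeg_iff : ∀ {X : List Letter}, ¬ Nondeg (forget X) ↔ Degen X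
  | [] => by simp [Nondeg, Degen, forget]
  | [x] => by
    simp only [Nondeg, forget, List.map_cons, List.map_nil, List.isChain_singleton,
      not_true_eq_false, false_iff]
    rintro ⟨A, a, b, B, e, -⟩
    have := congrArg List.length e
    simp at this; omega
  | x :: y :: X => by
    have ih := not_nondeg_iff (X := y :: X)
    simp only [Nondeg, forget, List.map_cons, List.isChain_cons_cons, not_and_or] at ih ⊢
    rw [ih]
    constructor
    · rintro (h | ⟨A, a, b, B, e, h⟩)
      · simp only [Letter.arc, Classical.not_imp, Bool.not_eq_true] at h
        exact ⟨[], x, y, X, rfl, h⟩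
      · exact ⟨x :: A, a, b, B, by simp [e], h⟩
    · rintro ⟨A, a, b, B, e, h⟩
      rcases A with _ | ⟨c, A⟩
      · simp only [List.nil_append, List.cons.injEq] at e
        obtain ⟨rfl, rfl, rfl⟩ := e
        left; simp [Letter.arc, h]
      · simp only [List.cons_append, List.cons.injEq] at e
        exact Or.inr ⟨A, a, b, B, e.2, h⟩

theorem Degen.append_right {X : List Letter} (h : Degen X) (Y : List Letter) : Degen (X ++ Y) := by
  obtain ⟨A, x, y, B, rfl, h⟩ := h
  exact ⟨A, x, y, B ++ Y, by simp, h⟩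

theorem Degen.append_left {X : List Letter} (h : Degen X) (Y : List Letter) : Degen (Y ++ X) := by
  obtain ⟨A, x, y, B, rfl, h⟩ := h
  exact ⟨Y ++ A, x, y, B, by simp, h⟩

theorem ofWalk_walk (k : Type*) [CommRing k] (τ : Cell) :
    ofWalk k τ.walk = Finsupp.single τ 1 := by
  have h : ∃ σ : Cell, σ.walk = τ.walk := ⟨τ, rfl⟩
  rw [ofWalk, dif_pos h, Cell.walk_injective h.choose_spec]

theorem ofWalk_eq_zero (k : Type*) [CommRing k] {w : List Arc} (h : ¬ Nondeg w) :
    ofWalk k w = 0 := by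
  rw [ofWalk, dif_neg]
  rintro ⟨τ, rfl⟩
  exact h τ.nondeg

theorem tw_eq_zero (k : Type*) [CommRing k] {X : List Letter} (h : Degen X) : tw k X = 0 := by
  rw [tw, ofWalk_eq_zero k (not_nondeg_iff.2 h), smul_zero]

theorem exists_head_of_mem_cutAt (y : Letter) : ∀ (ts : List ℕ) (w : List Letter),
    ∀ S ∈ cutAt ts (y :: w), ∃ y' r S', S = (y' :: r) :: S' ∧ y'.lab = y.lab
  | [], w, S, hS => by
    simp only [cutAt_nil, List.mem_singleton] at hS
    exact ⟨y, w, [], hS, rfl⟩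
  | t :: ts, w, S, hS => by
    rw [cutAt_cons_cons, List.mem_append, List.mem_map, List.mem_map] at hS
    rcases hS with ⟨S, hS, rfl⟩ | ⟨S, hS, rfl⟩
    · exact ⟨y.cut t, [], S, rfl, rfl⟩
    · exact ⟨y, S.headD [], S.tail, rfl, rfl⟩

/-- At a cut, the same arc ends and begins. -/
theorem degen_of_mem_cutAt : ∀ (ts : List ℕ) (w : List Letter), ∀ S ∈ cutAt ts w,
    ∀ S1 s s' S2, S = S1 ++ s :: s' :: S2 → Degen (s ++ s') := by
  refine cutAt_induction ?_ ?_ ?_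
  · intro w S hS S1 s s' S2 e
    simp only [cutAt_nil, List.mem_singleton] at hS
    have := congrArg List.length (hS.symm.trans e)
    simp at this; omega
  · simp
  · intro t ts x w h1 h2 S hS S1 s s' S2 e
    rw [cutAt_cons_cons, List.mem_append, List.mem_map, List.mem_map] at hS
    rcases hS with ⟨S, hS, rfl⟩ | ⟨S, hS, rfl⟩
    · rcases S1 with _ | ⟨r, S1⟩
      · simp only [List.nil_append, List.cons.injEq] at e
        obtain ⟨y', r, S', rfl, hy⟩ := exists_head_of_mem_cutAt _ _ _ _ hS
        obtain ⟨rfl, e⟩ := e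
        simp only [List.cons.injEq] at e
        exact ⟨[], x.cut t, y', r, by simp [← e.1], by simp [hy], rfl⟩
      · simp only [List.cons_append, List.cons.injEq] at e
        exact h1 S hS S1 s s' S2 e.2
    · rcases S with _ | ⟨r0, S⟩
      · exact absurd rfl (ne_nil_of_mem_cutAt hS)
      · simp only [appendHead, List.headD_cons, List.tail_cons] at e
        rcases S1 with _ | ⟨r, S1⟩
        · simp only [List.nil_append, List.cons.injEq] at e
          obtain ⟨rfl, rfl⟩ := e
          rw [List.append_assoc]
          exact (h2 _ hS [] r0 s' S2 rfl).append_left _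
        · simp only [List.cons_append, List.cons.injEq] at e
          exact h2 _ hS (r0 :: S1) s s' S2 (by simp [e.2])

theorem exists_degen_of_mem_cutAt : ∀ (ts : List ℕ) (w : List Letter), Degen w →
    ∀ S ∈ cutAt ts w, ∃ s ∈ S, Degen s := by
  refine cutAt_induction ?_ ?_ ?_
  · intro w h S hS
    simp only [cutAt_nil, List.mem_singleton] at hS
    exact ⟨w, by simp [hS], h⟩
  · simp
  · intro t ts x w h1 h2 h S hS
    rw [cutAt_cons_cons, List.mem_append, List.mem_map, List.mem_map] at hS
    rcases hS with ⟨S, hS, rfl⟩ | ⟨S, hS, rfl⟩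
    · obtain ⟨s, hs, h⟩ := h1 h S hS
      exact ⟨s, by simp [hs], h⟩
    · obtain ⟨A, a, b, B, e, hab, ha⟩ := h
      rcases A with _ | ⟨a', A⟩
      · simp only [List.nil_append, List.cons.injEq] at e
        obtain ⟨rfl, rfl⟩ := e
        obtain ⟨y', r, S', rfl, hy⟩ := exists_head_of_mem_cutAt _ _ _ _ hS
        exact ⟨x :: y' :: r, by simp [appendHead], [], x, y', r, rfl, by rw [hab, hy], ha⟩
      · simp only [List.cons_append, List.cons.injEq] at e
        obtain ⟨s, hs, h⟩ := h2 ⟨A, a, b, B, e.2, hab, ha⟩ S hS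
        rcases S with _ | ⟨r0, S⟩
        · simp at hs
        · simp only [List.mem_cons] at hs
          rcases hs with rfl | hs
          · exact ⟨x :: s, by simp [appendHead], h.append_left [x]⟩
          · exact ⟨s, by simp [appendHead, hs], h⟩

theorem degen_sub_of_mem {i : ℕ} {f : ℕ → ℕ} : ∀ (X : List Letter) (T : List (List Letter)),
    T.length = (lobe i X).length → (∃ s ∈ T, Degen s) → Degen (sub i f X T)
  | [], T, h, ⟨s, hs, _⟩ => by
    obtain rfl : T = [] := by simpa using h
    simp at hs
  | x :: X, T, h, hT => by
    by_cases hx : x.lab = i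
    · rcases T with _ | ⟨r, T⟩
      · simp at hT
      · simp only [lobe_cons, hx, if_true, List.length_cons, Nat.add_right_cancel_iff] at h
        rw [sub_cons_pos _ _ hx]
        obtain ⟨s, hs, hd⟩ := hT
        simp only [List.mem_cons] at hs
        rcases hs with rfl | hs
        · exact hd.append_right _
        · exact (degen_sub_of_mem X T h ⟨s, hs, hd⟩).append_left _
    · rw [sub_cons_neg _ _ hx]
      exact (degen_sub_of_mem X T (by simpa [lobe_cons, hx] using h) hT).append_left [_]

theorem degen_rotate {S : List (List Letter)} {b a : ℕ} (hb : b ≤ S.length)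
    (hS : ∀ S1 s s' S2, S = S1 ++ s :: s' :: S2 → Degen (s ++ s')) (ha : a + 1 < S.length)
    (hab : a + 1 + b ≠ S.length) :
    ∃ T1 s s' T2, S.rotate b = T1 ++ s :: s' :: T2 ∧ T1.length = a ∧ Degen (s ++ s') := by
  have h1 : a + 1 < (S.rotate b).length := by simpa using ha
  refine ⟨(S.rotate b).take a, (S.rotate b)[a], (S.rotate b)[a + 1], (S.rotate b).drop (a + 2),
    ?_, by simp; omega, ?_⟩
  · rw [← List.drop_eq_getElem_cons h1, ← List.drop_eq_getElem_cons, List.take_append_drop]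
  · rw [List.getElem_rotate, List.getElem_rotate]
    have h2 : (a + 1 + b) % S.length = (a + b) % S.length + 1 := by
      rcases lt_or_gt_of_ne hab with h | h
      · rw [Nat.mod_eq_of_lt h, Nat.mod_eq_of_lt (by omega)]; omega
      · rw [Nat.mod_eq_sub_mod (by omega), Nat.mod_eq_sub_mod (a := a + b) (by omega),
          Nat.mod_eq_of_lt (by omega), Nat.mod_eq_of_lt (by omega)]; omega
    simp only [h2]
    have h3 : (a + b) % S.length + 1 < S.length := by
      rw [← h2]; exact Nat.mod_lt _ (by omega)
    refine hS (S.take ((a + b) % S.length)) _ _ (S.drop ((a + b) % S.length + 2)) ?_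
    rw [← List.drop_eq_getElem_cons h3, ← List.drop_eq_getElem_cons, List.take_append_drop]

/-- If one of the two words is degenerate, then so are the words composed of them. -/
theorem degen_fill {i m : ℕ} {X w : List Letter} {S : List (List Letter)}
    (h : OneFinal (lobe i X)) (hS : S ∈ cutAt (slotTags i X) w) (hd : Degen X ∨ Degen w) :
    Degen (fill i m X S) := by
  have hl := length_eq_of_mem_cutAt_slotTags h hS
  rcases hd with ⟨A, x, y, B, rfl, hxy, hx⟩ | hd
  · by_cases hi : x.lab = i
    · have hr : (lobe i A).length + 1 + rot (lobe i (A ++ x :: y :: B)) ≠ S.length := by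
        obtain ⟨X1, z, X2, e, hzi, hz, h1, h2⟩ := h.exists_split
        rw [hl]
        rw [e, rot_split hzi hz h1]
        intro e'
        simp only [lobe_append, lobe_cons, hzi, if_true, List.length_append,
          List.length_cons] at e'
        have e3 := congrArg (fun L => L[(lobe i A).length]?) (congrArg (lobe i) e)
        have e4 : (lobe i A).length = (lobe i X1).length := by omega
        simp only [lobe_append, lobe_cons, hi, if_true, hzi] at e3
        rw [List.getElem?_append_right le_rfl, e4, List.getElem?_append_right le_rfl] at e3
        simp only [Nat.sub_self, List.getElem?_cons_zero, Option.some.injEq] at e3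
        rw [e3, hz] at hx
        simp at hx
      obtain ⟨T1, s, s', T2, e1, e2, e3⟩ := degen_rotate (S := S)
        (b := rot (lobe i (A ++ x :: y :: B))) (a := (lobe i A).length)
        (by rw [hl]; exact rot_le _) (degen_of_mem_cutAt _ _ _ hS)
        (by rw [hl]; simp [lobe_cons, hi, ← hxy]) hr
      rw [fill, e1, sub_append' e2, sub_cons_pos _ _ hi, sub_cons_pos _ _ (hxy ▸ hi),
        ← List.append_assoc (List.headD _ _)]
      exact (Degen.append_right (by simpa using e3) _).append_left _
    · rw [fill, sub_append, sub_cons_neg _ _ hi, sub_cons_neg _ _ (hxy ▸ hi)]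
      exact ⟨_, _, _, _, rfl, by simp [hxy], hx⟩
  · refine degen_sub_of_mem _ _ (by simpa using hl) ?_
    obtain ⟨s, hs, hd⟩ := exists_degen_of_mem_cutAt _ _ hd _ hS
    exact ⟨s, List.mem_rotate.2 hs, hd⟩

theorem Degen.map_mapLab {X : List Letter} (h : Degen X) (f : ℕ → ℕ) :
    Degen (X.map (Letter.mapLab f)) := by
  obtain ⟨A, x, y, B, rfl, h1, h2⟩ := h
  exact ⟨A.map (Letter.mapLab f), x.mapLab f, y.mapLab f, B.map (Letter.mapLab f), by simp,
    by simp [h1], h2⟩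

/-! ### The composition of cells in terms of words with named coordinates -/

/-- The word whose arcs have the numbers `a, a + 1, …` as names of their ends. -/
def numbered (a : ℕ) (w : List Arc) : List Letter :=
  (w.zipIdx a).map fun x => ⟨x.1.1, x.1.2, x.2⟩

/-- The translation of a letter. -/
def Letter.tagged (x : Letter) : TaggedArc := ⟨x.lab, x.fin, some x.tag⟩

/-- Give the name `t` to the ends of the arcs that have no name. -/
def fillTag (S : List TaggedArc) (t : ℕ) : List Letter :=
  S.map fun x => ⟨x.label, x.final, x.tag.getD t⟩

theorem cuts_succ_cons (m : ℕ) (x : TaggedArc) (w : List TaggedArc) :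
    cuts (m + 1) (x :: w) = (cuts m (x :: w)).map ([⟨x.label, false, none⟩] :: ·) ++
      (cuts (m + 1) w).map (appendHead [x]) := by
  simp only [cuts, List.zipIdx_cons, List.flatMap_cons, List.drop_zero, List.take_zero,
    List.nil_append, zero_add, List.map_flatMap]
  congr 1
  rw [List.zipIdx_succ, List.flatMap_map]
  congr 1
  funext y
  simp [appendHead, Function.comp_def]

theorem length_of_mem_cuts : ∀ (m : ℕ) (w : List TaggedArc), ∀ S ∈ cuts m w, S.length = m + 1
  | 0, w, S, hS => by
    simp only [cuts, List.mem_singleton] at hS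
    simp [hS]
  | m + 1, w, S, hS => by
    simp only [cuts, List.mem_flatMap, List.mem_map] at hS
    obtain ⟨x, -, S, hS, rfl⟩ := hS
    simp [length_of_mem_cuts m _ S hS]

theorem zipWith_appendHead {x : Letter} {S : List (List TaggedArc)} {L : List ℕ} (hS : S ≠ [])
    (hL : L ≠ []) : List.zipWith fillTag (appendHead [x.tagged] S) L =
      appendHead [x] (List.zipWith fillTag S L) := by
  cases S <;> cases L <;> simp_all [appendHead, fillTag, Letter.tagged]

theorem cutAt_eq_cuts (l : ℕ) : ∀ (ts : List ℕ) (w : List Letter),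
    cutAt ts w = (cuts ts.length (w.map Letter.tagged)).map
      fun S => List.zipWith fillTag S (ts ++ [l]) := by
  refine cutAt_induction ?_ ?_ ?_
  · intro w
    simp [cuts, fillTag, Letter.tagged, Function.comp_def]
  · intro t ts
    simp [cuts]
  · intro t ts x w h1 h2
    rw [cutAt_cons_cons, h1, h2, List.length_cons, List.map_cons, cuts_succ_cons]
    simp only [List.map_append, List.map_map]
    congr 1
    refine List.map_congr_left fun S hS => ?_
    have : S ≠ [] := by
      intro e; have := length_of_mem_cuts _ _ _ hS; simp [e] at this
    simp only [Function.comp_apply]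
    rw [zipWith_appendHead this (by simp)]

theorem plug_eq (i n : ℕ) : ∀ (X : List Letter) (S : List (List TaggedArc)),
    plug i n (X.map fun x => ((x.lab, x.fin), x.tag)) S =
      (sub i (outer i n) X (List.zipWith fillTag S ((lobe i X).map Letter.tag))).map Letter.tagged
  | [], S => by simp [plug]
  | x :: X, S => by
    have ih := fun S => plug_eq i n X S
    by_cases hx : x.lab = i
    · simp only [List.map_cons, plug, hx, if_true, ih, lobe_cons]
      rw [sub_cons_pos _ _ hx]
      cases S <;> simp [fillTag, Letter.tagged, Function.comp_def]
    · simp only [List.map_cons, plug, hx, if_false, ih, lobe_cons]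
      rw [sub_cons_neg _ _ hx]
      simp [Letter.tagged, outer]

theorem coordTags_tagged (X : List Letter) : coordTags (X.map Letter.tagged) = frees X := by
  induction X with
  | nil => rfl
  | cons x X ih =>
    simp only [coordTags, List.map_cons, List.filterMap_cons] at ih ⊢
    rw [frees_cons]
    cases h : x.fin <;> simp [Letter.tagged, h] <;> simpa [Letter.tagged] using ih

theorem forget_tagged (X : List Letter) :
    (X.map Letter.tagged).map (fun x => (x.label, x.final)) = forget X := by
  simp [forget, Function.comp_def, Letter.tagged, Letter.arc]

@[simp] theorem forget_numbered (a : ℕ) (w : List Arc) : forget (numbered a w) = w := by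
  simp only [forget, numbered, List.map_map, Function.comp_def, Letter.arc]
  exact List.zipIdx_map_fst a w

theorem tags_numbered (a : ℕ) (w : List Arc) :
    (numbered a w).map Letter.tag = List.range' a w.length := by
  simp only [numbered, List.map_map, Function.comp_def]
  exact List.zipIdx_map_snd a w

theorem cyc_rotate {i : ℕ} {X : List Letter} (h : OneFinal (lobe i X)) :
    (cyc i X).rotate (rot (lobe i X)) = lobe i X := by
  obtain ⟨A, z, B, e, hz, hA, -⟩ := h
  rw [cyc, e, fromZero_eq hz hA, rot_eq hz hA, List.append_assoc, List.rotate_append_length_eq]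
  simp

/-- If the coordinates are numbered in the order of the two walks, then the coordinates that are
used in the definition of the composition of cells are the names of the ends of the arcs. -/
theorem circWalk_eq (k : Type*) [CommRing k] {i : ℕ} (n : ℕ) {X V : List Letter}
    (hX : X = numbered 0 (forget X)) (hV : V = numbered (forget X).length (forget V))
    (h : OneFinal (lobe i X)) :
    circWalk k i n (forget X) (forget V) =
      lsum (cutAt (slotTags i X) (V.map (Letter.mapLab (· + i)))) fun S => tw k (fill i n X S) := by
  obtain ⟨l, hl⟩ : ∃ l, (cyc i X).map Letter.tag = slotTags i X ++ [l] := by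
    have : cyc i X ≠ [] := by
      intro e
      have h1 := (perm_cyc i X).length_eq
      have h2 := length_lobe_pos h
      rw [e, List.length_nil] at h1
      omega
    refine ⟨((cyc i X).getLast this).tag, ?_⟩
    rw [slotTags, ← List.map_singleton (f := Letter.tag), ← List.map_append,
      List.dropLast_append_getLast]
  have e1 : (forget X).filter (fun x => x.1 = i) = (lobe i X).map Letter.arc := by
    simp only [forget, lobe, List.filter_map, Function.comp_def]
    rfl
  have e2 : ((forget V).zipIdx (forget X).length).map
      (fun x => (⟨x.1.1 + i, x.1.2, some x.2⟩ : TaggedArc)) =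
      (V.map (Letter.mapLab (· + i))).map Letter.tagged := by
    conv_rhs => rw [hV]
    simp [numbered, Function.comp_def, Letter.tagged]
  have e3 : (forget X).zipIdx = X.map fun x => ((x.lab, x.fin), x.tag) := by
    conv_rhs => rw [hX]
    simp [numbered, Function.comp_def]
  have e4 : (((lobe i X).map Letter.arc).findIdx fun x => x.2) =
      (lobe i X).findIdx (·.fin) := by
    rw [List.findIdx_map]; rfl
  rw [circWalk, insertions]
  simp only [e1, e2, e3, e4, List.length_map]
  rw [cutAt_eq_cuts l, length_slotTags, lsum_map, List.map_map]
  refine lsum_congr fun S hS => ?_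
  have hlen := length_of_mem_cuts _ _ _ hS
  have hpos := length_lobe_pos h
  simp only [Function.comp_apply]
  rw [plug_eq, coordTags_tagged, forget_tagged]
  have e5 : List.zipWith fillTag (S.rotate (rot (lobe i X))) ((lobe i X).map Letter.tag) =
      (List.zipWith fillTag S (slotTags i X ++ [l])).rotate (rot (lobe i X)) := by
    rw [List.zipWith_rotate_distrib _ _ _ _ (by simp [length_slotTags, hlen]), ← hl,
      ← List.map_rotate, cyc_rotate h]
  rw [rot] at e5
  rw [e5]
  rfl

/-- Change the name of the end of an arc. -/
def Letter.retag (g : ℕ → ℕ) (x : Letter) : Letter := ⟨x.lab, x.fin, g x.tag⟩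

theorem lobe_map {i i' : ℕ} (φ : Letter → Letter) {X : List Letter}
    (h : ∀ x ∈ X, (φ x).lab = i' ↔ x.lab = i) : lobe i' (X.map φ) = (lobe i X).map φ := by
  rw [lobe, lobe, List.filter_map]
  congr 1
  refine List.filter_congr fun x hx => ?_
  simp [h x hx]

theorem findIdx_map_fin (φ : Letter → Letter) {L : List Letter}
    (h : ∀ x ∈ L, (φ x).fin = x.fin) : (L.map φ).findIdx (·.fin) = L.findIdx (·.fin) := by
  induction L with
  | nil => simp
  | cons x L ih =>
    simp [List.findIdx_cons, h x (by simp), ih fun y hy => h y (by simp [hy])]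

theorem fromZero_map (φ : Letter → Letter) {L : List Letter}
    (h : ∀ x ∈ L, (φ x).fin = x.fin) : fromZero (L.map φ) = (fromZero L).map φ := by
  rw [fromZero, fromZero, findIdx_map_fin φ h, List.map_rotate]

theorem rot_map (φ : Letter → Letter) {L : List Letter}
    (h : ∀ x ∈ L, (φ x).fin = x.fin) : rot (L.map φ) = rot L := by
  rw [rot, rot, findIdx_map_fin φ h, List.length_map]

theorem slotTags_map {i i' : ℕ} (φ : Letter → Letter) (g : ℕ → ℕ) {X : List Letter}
    (h : ∀ x ∈ X, (φ x).lab = i' ↔ x.lab = i) (hf : ∀ x ∈ X, (φ x).fin = x.fin)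
    (hg : ∀ x ∈ X, (φ x).tag = g x.tag) :
    slotTags i' (X.map φ) = (slotTags i X).map g := by
  have h1 : ∀ x ∈ lobe i X, x ∈ X := fun x hx => List.mem_of_mem_filter hx
  rw [slotTags, cyc, lobe_map φ h, fromZero_map φ fun x hx => hf x (h1 x hx), ← List.map_dropLast,
    List.map_map, slotTags, List.map_map]
  refine List.map_congr_left fun x hx => ?_
  exact hg x (h1 x ((perm_cyc i X).subset (List.mem_of_mem_dropLast hx)))

theorem fill_map {i i' m : ℕ} (φ ψ : Letter → Letter) {X : List Letter} (S : List (List Letter))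
    (h : ∀ x ∈ X, (φ x).lab = i' ↔ x.lab = i) (hf : ∀ x ∈ X, (φ x).fin = x.fin)
    (hφ : ∀ x ∈ X, x.lab ≠ i → ψ (x.mapLab (outer i m)) = (φ x).mapLab (outer i' m)) :
    (fill i m X S).map ψ = fill i' m (X.map φ) (S.map (List.map ψ)) := by
  have h1 : ∀ x ∈ lobe i X, (φ x).fin = x.fin := fun x hx => hf x (List.mem_of_mem_filter hx)
  rw [fill, fill, map_sub _ h hφ, lobe_map φ h, rot_map φ h1, List.map_rotate]

theorem frees_map_retag (g : ℕ → ℕ) (X : List Letter) :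
    frees (X.map (Letter.retag g)) = (frees X).map g := by
  simp [frees, List.filter_map, Function.comp_def, Letter.retag]

theorem forget_map_retag (g : ℕ → ℕ) (X : List Letter) :
    forget (X.map (Letter.retag g)) = forget X := by
  simp [forget, Function.comp_def, Letter.retag, Letter.arc]

theorem frees_numbered_sorted (u w : List Arc) :
    (frees (numbered 0 u) ++ frees (numbered u.length w)).Pairwise (· < ·) := by
  rw [← frees_append]
  refine List.Pairwise.sublist (frees_sublist _) ?_
  rw [List.map_append, tags_numbered, tags_numbered]
  have : List.range' 0 u.length ++ List.range' u.length w.length =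
      List.range' 0 (u.length + w.length) := by
    rw [← List.range'_append]; simp
  rw [this]
  exact List.pairwise_lt_range'

theorem numbered_append (a : ℕ) (u w : List Arc) :
    numbered a (u ++ w) = numbered a u ++ numbered (a + u.length) w := by
  simp [numbered, List.zipIdx_append]

theorem exists_retag (X : List Letter) :
    ∃ g : ℕ → ℕ, X = (numbered 0 (forget X)).map (Letter.retag g) := by
  refine ⟨fun p => (X.map Letter.tag).getD p 0, ?_⟩
  refine List.ext_getElem (by simp [numbered, forget]) fun p h1 h2 => ?_
  simp [numbered, forget, Letter.retag, Letter.arc, h1]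

theorem IsWord.tw_eq {k : Type*} [CommRing k] {n : ℕ} {X : List Letter}
    (h : IsWord n (forget X)) (hX : Nondeg (forget X)) :
    ∃ τ : Cell, τ.walk = forget X ∧ τ.arity = n ∧
      tw k X = sgn k (frees X) • Finsupp.single τ 1 := by
  obtain ⟨τ, h1, h2⟩ := h.exists_cell hX
  exact ⟨τ, h1, h2, by rw [tw, ← h1, ofWalk_walk]⟩

theorem circ_single (k : Type*) [CommRing k] (i : ℕ) (σ τ : Cell) :
    circ k i (Finsupp.single σ 1) (Finsupp.single τ 1) =
      if i < σ.arity then circWalk k i τ.arity σ.walk τ.walk else 0 := by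
  simp [circ, Finsupp.linearCombination_single]

/-- The composition in terms of words with named coordinates. If the names that occur in the second
word are larger than the ones in the first word, there are no signs. -/
theorem circ_tw (k : Type*) [CommRing k] {n m i : ℕ} {X V : List Letter} (hX : IsTagged n X)
    (hV : IsTagged m V) (hi : i < n) (hXV : ∀ x ∈ X, ∀ y ∈ V, x.tag < y.tag) :
    circ k i (tw k X) (tw k V) =
      lsum (cutAt (slotTags i X) (V.map (Letter.mapLab (· + i)))) fun S => tw k (fill i m X S) := by
  have h := hX.oneFinal hi
  by_cases hnd : Nondeg (forget X) ∧ Nondeg (forget V)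
  · obtain ⟨σ, hσ, hn, eX⟩ := hX.word.tw_eq (k := k) hnd.1
    obtain ⟨τ, hτ, hm, eV⟩ := hV.word.tw_eq (k := k) hnd.2
    obtain ⟨g, hg⟩ := exists_retag (X ++ V)
    rw [forget_append, numbered_append, List.map_append, zero_add] at hg
    obtain ⟨gX, gV⟩ := List.append_inj hg (by simp [numbered, forget])
    have hX0 : numbered 0 (forget X) = numbered 0 (forget (numbered 0 (forget X))) := by simp
    have hV0 : numbered (forget X).length (forget V) =
      numbered (forget (numbered 0 (forget X))).length
        (forget (numbered (forget X).length (forget V))) := by simp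
    have hX0t : IsTagged n (numbered 0 (forget X)) :=
      ⟨by simpa using hX.word, by rw [tags_numbered]; exact List.nodup_range'⟩
    have h0 := hX0t.oneFinal hi
    have key := circWalk_eq k m hX0 hV0 h0
    rw [forget_numbered, forget_numbered] at key
    have e1 : slotTags i X = (slotTags i (numbered 0 (forget X))).map g := by
      conv_lhs => rw [gX]
      exact slotTags_map _ g (fun _ _ => Iff.rfl) (fun _ _ => rfl) fun _ _ => rfl
    have e2 : V.map (Letter.mapLab (· + i)) =
        ((numbered (forget X).length (forget V)).map (Letter.mapLab (· + i))).map
          (Letter.retag g) := by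
      conv_lhs => rw [gV]
      simp [Letter.mapLab, Letter.retag]
    rw [eX, eV, map_smul, map_smul, LinearMap.smul_apply, circ_single, if_pos (by omega), hm, hσ,
      hτ, key, e1, e2, cutAt_map _ g _ _ (fun x _ t _ => rfl), lsum_map, ← lsum_smul, ← lsum_smul]
    refine lsum_congr fun S hS => ?_
    have e3 : fill i m X (S.map (List.map (Letter.retag g))) =
        (fill i m (numbered 0 (forget X)) S).map (Letter.retag g) := by
      conv_lhs => rw [gX]
      exact (fill_map (Letter.retag g) (Letter.retag g) S (fun _ _ => Iff.rfl) (fun _ _ => rfl) fun _ _ _ => rfl).symm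
    rw [e3, tw, tw, frees_map_retag, forget_map_retag, smul_smul, smul_smul]
    congr 1
    have hp := perm_frees_fill (m := m) h0 hS
    have hmap : (frees (numbered 0 (forget X)) ++
        frees (numbered (forget X).length (forget V))).map g = frees X ++ frees V := by
      rw [List.map_append, ← frees_map_retag, ← frees_map_retag, ← gX, ← gV]
    have hlt : ∀ x ∈ frees X, ∀ y ∈ frees V, x < y := by
      intro x hx y hy
      obtain ⟨a, ha, rfl⟩ := List.mem_map.1 hx
      obtain ⟨b, hb, rfl⟩ := List.mem_map.1 hy
      exact hXV a (List.mem_of_mem_filter ha) b (List.mem_of_mem_filter hb)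
    have hnodup : (frees X ++ frees V).Nodup := by
      refine (hX.nodup.sublist (frees_sublist _)).append (hV.nodup.sublist (frees_sublist _)) ?_
      intro t h1 h2
      exact absurd rfl (hlt t h1 t h2).ne
    have hs := sgn_mul_sgn_map (k := k) hp g ((hp.map g).nodup_iff.2 (by rw [hmap]; exact hnodup))
    rw [hmap, sgn_of_sorted (frees_numbered_sorted _ _), sgn_append _ _ hlt] at hs
    have e4 := sgn_mul_self (k := k) (frees X)
    have e5 := sgn_mul_self (k := k) (frees V)
    generalize sgn k (frees X) = a at *
    generalize sgn k (frees V) = b at *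
    generalize sgn k (frees (fill i m (numbered 0 (forget X)) S)) = c at *
    generalize sgn k ((frees (fill i m (numbered 0 (forget X)) S)).map g) = d at *
    linear_combination a * b * hs + b * b * d * e4 + d * e5
  · rw [lsum_eq_zero]
    · rw [not_and_or, not_nondeg_iff, not_nondeg_iff] at hnd
      rcases hnd with hnd | hnd <;> simp [tw_eq_zero k hnd]
    · intro S hS
      refine tw_eq_zero k (degen_fill h hS ?_)
      rw [not_and_or, not_nondeg_iff, not_nondeg_iff] at hnd
      exact hnd.imp_right fun h => h.map_mapLab _

section

/-! ### Iterated compositions in one lobe -/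

/-- The names of the ends of the arcs of a lobe, in the order of the outside circle. -/
def tagsOf (j : ℕ) (X : List Letter) : List ℕ := (lobe j X).map Letter.tag

@[simp] theorem tagsOf_append (j : ℕ) (X Y : List Letter) :
    tagsOf j (X ++ Y) = tagsOf j X ++ tagsOf j Y := by simp [tagsOf]

@[simp] theorem length_tagsOf (j : ℕ) (X : List Letter) :
    (tagsOf j X).length = (lobe j X).length := by simp [tagsOf]

/-- The ways to cut a word into as many segments as there are tags. -/
def famCut (a : List ℕ) (W : List Letter) : List (List (List Letter)) :=
  if a = [] then [[]] else cutAt a.dropLast W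

@[simp] theorem famCut_nil (W : List Letter) : famCut [] W = [[]] := by simp [famCut]
theorem famCut_concat (a : List ℕ) (t : ℕ) (W : List Letter) :
    famCut (a ++ [t]) W = cutAt a W := by simp [famCut]

theorem length_of_mem_famCut {a : List ℕ} {W : List Letter} {R : List (List Letter)}
    (h : R ∈ famCut a W) : R.length = a.length := by
  rcases List.eq_nil_or_concat' a with rfl | ⟨a, t, rfl⟩
  · simp at h; simp [h]
  · rw [famCut_concat] at h
    simp [length_of_mem_cutAt _ _ _ h]

/-- The pairs of words among which the segments are distributed, when two families of segments are
cut from one word. The arguments are the last tags of the two families. -/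
def wsplit (s t : Option ℕ) (W : List Letter) : List (List Letter × List Letter) :=
  match s, t with
  | none, _ => [([], W)]
  | some _, none => [(W, [])]
  | some s, some _ => (splits W).map fun r => (r.1 ++ [r.2.1.cut s], r.2.1 :: r.2.2)

theorem lsum_famCut_append {M : Type*} [AddCommMonoid M] (a b : List ℕ) (W : List Letter)
    (F : List (List Letter) → M) :
    lsum (famCut (a ++ b) W) F = lsum (wsplit a.getLast? b.getLast? W) fun p =>
      lsum (famCut a p.1) fun R => lsum (famCut b p.2) fun R' => F (R ++ R') := by
  rcases List.eq_nil_or_concat' a with rfl | ⟨a, s, rfl⟩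
  · simp [wsplit]
  · rcases List.eq_nil_or_concat' b with rfl | ⟨b, t, rfl⟩
    · simp [wsplit]
    · rw [← List.append_assoc, famCut_concat, List.getLast?_concat, List.getLast?_concat,
        List.append_assoc, List.singleton_append, lsum_cutAt_splits]
      simp only [wsplit, lsum_map, famCut_concat]

theorem getLast_of_mem_cutAt (j : ℕ) : ∀ (ts : List ℕ) (w : List Letter), ∀ S ∈ cutAt ts w,
    (tagsOf j S.flatten).getLast? = (tagsOf j w).getLast? := by
  refine cutAt_induction ?_ ?_ ?_
  · intro w S hS
    simp only [cutAt_nil, List.mem_singleton] at hS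
    simp [hS]
  · simp
  · intro t ts x w h1 h2 S hS
    rw [cutAt_cons_cons, List.mem_append, List.mem_map, List.mem_map] at hS
    rcases hS with ⟨S, hS, rfl⟩ | ⟨S, hS, rfl⟩
    · rw [List.flatten_cons, tagsOf_append, List.getLast?_append, h1 S hS]
      by_cases hx : x.lab = j
      · have : (tagsOf j (x :: w)).getLast?.isSome := by simp [tagsOf, lobe_cons, hx]
        obtain ⟨l, hl⟩ := Option.isSome_iff_exists.1 this
        rw [hl]; rfl
      · simp [tagsOf, lobe_cons, hx]
    · rw [flatten_appendHead, tagsOf_append, List.getLast?_append, h2 S hS]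
      conv_rhs => rw [← List.singleton_append, tagsOf_append, List.getLast?_append]

/-- Substitution in the letters of a list of segments, in turn. -/
def subs (j : ℕ) (g : ℕ → ℕ) : List (List Letter) → List (List Letter) → List (List Letter)
  | [], _ => []
  | s :: S, R => sub j g s R :: subs j g S (R.drop (lobe j s).length)

@[simp] theorem length_subs (j : ℕ) (g : ℕ → ℕ) : ∀ S R : List (List Letter),
    (subs j g S R).length = S.length
  | [], _ => rfl
  | s :: S, R => by simp [subs, length_subs j g S]

theorem subs_append {j : ℕ} {g : ℕ → ℕ} : ∀ {S S' R R' : List (List Letter)},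
    R.length = (lobe j S.flatten).length →
    subs j g (S ++ S') (R ++ R') = subs j g S R ++ subs j g S' R'
  | [], S', R, R', h => by
    obtain rfl : R = [] := by simpa using h
    simp [subs]
  | s :: S, S', R, R', h => by
    simp only [List.flatten_cons, lobe_append, List.length_append] at h
    have h1 : (R.take (lobe j s).length).length = (lobe j s).length := by simp; omega
    have h2 : (R.drop (lobe j s).length).length = (lobe j S.flatten).length := by simp; omega
    simp only [List.cons_append, subs]
    rw [← subs_append h2]
    congr 1
    · conv_lhs => rw [← List.take_append_drop (lobe j s).length R, List.append_assoc]
      conv_rhs => rw [← List.take_append_drop (lobe j s).length R]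
      rw [sub_append_segments _ _ _ _ _ h1, sub_append_segments _ _ _ _ _ h1]
    · rw [List.drop_append_of_le_length (by omega)]

theorem subs_glue {j : ℕ} {g : ℕ → ℕ} : ∀ {S S' R R' : List (List Letter)}, S ≠ [] → S' ≠ [] →
    R.length = (lobe j S.flatten).length →
    subs j g (glue S S') (R ++ R') = glue (subs j g S R) (subs j g S' R')
  | [s], s' :: S', R, R', _, _, h => by
    simp only [List.flatten_cons, List.flatten_nil, List.append_nil] at h
    simp only [glue, appendHead, subs, List.headD_cons, List.tail_cons]
    rw [sub_append' h]
    congr 2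
    rw [lobe_append, List.length_append, ← List.drop_drop, ← h, List.drop_left]
  | s :: s' :: S, S', R, R', _, h', h => by
    simp only [List.flatten_cons (l := s), lobe_append, List.length_append] at h
    have h1 : (R.take (lobe j s).length).length = (lobe j s).length := by simp; omega
    have h2 : (R.drop (lobe j s).length).length = (lobe j (s' :: S).flatten).length := by
      simp at h ⊢; omega
    have ih := subs_glue (g := g) (S := s' :: S) (R' := R') (by simp) h' h2
    rw [glue_cons _ _ (by simp), subs, subs]
    conv_rhs => rw [glue_cons _ _ (by simp [subs]), ← ih]
    congr 1
    · conv_lhs => rw [← List.take_append_drop (lobe j s).length R, List.append_assoc]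
      conv_rhs => rw [← List.take_append_drop (lobe j s).length R]
      rw [sub_append_segments _ _ _ _ _ h1, sub_append_segments _ _ _ _ _ h1]
    · rw [List.drop_append_of_le_length (by omega)]

theorem subs_of_lobe_eq_nil {j : ℕ} {g : ℕ →
    ℕ} : ∀ {S : List (List Letter)} (R : List (List Letter)),
    lobe j S.flatten = [] → subs j g S R = S.map (List.map (Letter.mapLab g))
  | [], _, _ => rfl
  | s :: S, R, h => by
    simp only [List.flatten_cons, lobe_append, List.append_eq_nil_iff] at h
    rw [subs, sub_of_lobe_eq_nil _ h.1, subs_of_lobe_eq_nil _ h.2, List.map_cons]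

/-- The property that cutting a word and then substituting the segments of `W` for the arcs of a
lobe amounts to substituting first and then cutting. -/
def CutSub (M : Type*) [AddCommMonoid M] (j : ℕ) (g : ℕ → ℕ) (V : List Letter) : Prop :=
  ∀ (ts : List ℕ) (W : List Letter) (G : List (List Letter) → M),
    lsum (cutAt ts V) (fun S => lsum (famCut (tagsOf j S.flatten) W) fun R => G (subs j g S R)) =
      lsum (famCut (tagsOf j V) W) fun R => lsum (cutAt ts (sub j g V R)) G

section CutSub
variable {M : Type*} [AddCommMonoid M] {j : ℕ} {g : ℕ → ℕ}

/-- The simultaneous treatment of two words, among which the segments of one word are distributed.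
It is used both for a concatenation and for its rotation. -/
theorem CutSub.block {A B : List Letter} (hA : CutSub M j g A) (hB : CutSub M j g B)
    (ts1 ts2 : List ℕ) (W : List Letter) (H : List (List Letter) → List (List Letter) → M) :
    (lsum (cutAt ts1 A) fun S1 => lsum (cutAt ts2 B) fun S2 =>
      lsum (famCut (tagsOf j S1.flatten ++ tagsOf j S2.flatten) W) fun R =>
        H (subs j g S1 (R.take (lobe j S1.flatten).length))
          (subs j g S2 (R.drop (lobe j S1.flatten).length))) =
    lsum (famCut (tagsOf j A ++ tagsOf j B) W) fun R =>
      lsum (cutAt ts1 (sub j g A (R.take (lobe j A).length))) fun S1 =>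
        lsum (cutAt ts2 (sub j g B (R.drop (lobe j A).length))) fun S2 => H S1 S2 := by
  have e1 : (lsum (cutAt ts1 A) fun S1 => lsum (cutAt ts2 B) fun S2 =>
      lsum (famCut (tagsOf j S1.flatten ++ tagsOf j S2.flatten) W) fun R =>
        H (subs j g S1 (R.take (lobe j S1.flatten).length))
          (subs j g S2 (R.drop (lobe j S1.flatten).length))) =
      lsum (cutAt ts1 A) fun S1 => lsum (cutAt ts2 B) fun S2 =>
        lsum (wsplit (tagsOf j A).getLast? (tagsOf j B).getLast? W) fun p =>
          lsum (famCut (tagsOf j S1.flatten) p.1) fun R =>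
            lsum (famCut (tagsOf j S2.flatten) p.2) fun R' =>
              H (subs j g S1 R) (subs j g S2 R') := by
    refine lsum_congr fun S1 h1 => lsum_congr fun S2 h2 => ?_
    rw [lsum_famCut_append, getLast_of_mem_cutAt j _ _ _ h1, getLast_of_mem_cutAt j _ _ _ h2]
    refine lsum_congr fun p _ => lsum_congr fun R hR => lsum_congr fun R' _ => ?_
    have := length_of_mem_famCut hR
    rw [length_tagsOf] at this
    rw [← this, List.take_left, List.drop_left]
  have e2 : (lsum (famCut (tagsOf j A ++ tagsOf j B) W) fun R =>
      lsum (cutAt ts1 (sub j g A (R.take (lobe j A).length))) fun S1 =>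
        lsum (cutAt ts2 (sub j g B (R.drop (lobe j A).length))) fun S2 => H S1 S2) =
      lsum (wsplit (tagsOf j A).getLast? (tagsOf j B).getLast? W) fun p =>
        lsum (famCut (tagsOf j A) p.1) fun R => lsum (famCut (tagsOf j B) p.2) fun R' =>
          lsum (cutAt ts1 (sub j g A R)) fun S1 => lsum (cutAt ts2 (sub j g B R')) fun S2 =>
            H S1 S2 := by
    rw [lsum_famCut_append]
    refine lsum_congr fun p _ => lsum_congr fun R hR => lsum_congr fun R' _ => ?_
    have := length_of_mem_famCut hR
    rw [length_tagsOf] at this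
    rw [← this, List.take_left, List.drop_left]
  rw [e1, e2]
  simp only [lsum_comm (cutAt ts2 B) (wsplit _ _ _)]
  rw [lsum_comm]
  refine lsum_congr fun p _ => ?_
  have e4 : ∀ S1 : List (List Letter), (lsum (cutAt ts2 B) fun S2 =>
      lsum (famCut (tagsOf j S1.flatten) p.1) fun R =>
      lsum (famCut (tagsOf j S2.flatten) p.2) fun R' => H (subs j g S1 R) (subs j g S2 R')) =
      lsum (famCut (tagsOf j S1.flatten) p.1) fun R =>
        lsum (famCut (tagsOf j B) p.2) fun R' => lsum (cutAt ts2 (sub j g B R')) fun S2 =>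
          H (subs j g S1 R) S2 := by
    intro S1
    rw [lsum_comm]
    exact lsum_congr fun R _ => hB ts2 p.2 fun S => H (subs j g S1 R) S
  simp only [e4]
  rw [hA ts1 p.1 fun T => lsum (famCut (tagsOf j B) p.2) fun R' =>
    lsum (cutAt ts2 (sub j g B R')) fun S2 => H T S2]
  exact lsum_congr fun R _ => lsum_comm _ _ _

theorem CutSub.append {A B : List Letter} (hA : CutSub M j g A) (hB : CutSub M j g B) :
    CutSub M j g (A ++ B) := by
  intro ts W G
  have key := fun s : List ℕ × List ℕ => hA.block hB s.1 s.2 W fun S T => G (glue S T)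
  rw [lsum_cutAt_append, tagsOf_append]
  have e1 : ∀ R ∈ famCut (tagsOf j A ++ tagsOf j B) W,
      lsum (cutAt ts (sub j g (A ++ B) R)) G = lsum (unappend ts) fun s =>
        lsum (cutAt s.1 (sub j g A (R.take (lobe j A).length))) fun S1 =>
          lsum (cutAt s.2 (sub j g B (R.drop (lobe j A).length))) fun S2 => G (glue S1 S2) := by
    intro R hR
    have := length_of_mem_famCut hR
    simp only [List.length_append, length_tagsOf] at this
    rw [← lsum_cutAt_append, ← sub_append' (by simp; omega), List.take_append_drop]
  rw [lsum_congr e1, lsum_comm]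
  refine lsum_congr fun s _ => ?_
  rw [← key s]
  refine lsum_congr fun S1 h1 => lsum_congr fun S2 h2 => ?_
  rw [flatten_glue, tagsOf_append]
  refine lsum_congr fun R hR => ?_
  have := length_of_mem_famCut hR
  simp only [List.length_append, length_tagsOf] at this
  rw [← subs_glue (ne_nil_of_mem_cutAt h1) (ne_nil_of_mem_cutAt h2) (by simp; omega),
    List.take_append_drop]

theorem cutAt_singleton (x : Letter) : ∀ ts : List ℕ,
    cutAt ts [x] = [ts.map (fun t => [x.cut t]) ++ [[x]]]
  | [] => by simp
  | t :: ts => by rw [cutAt_cons_cons, cutAt_singleton x ts]; simp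

theorem subs_singletons {x : Letter} (hx : x.lab = j) : ∀ (ts : List ℕ) (R : List (List Letter)),
    R.length = ts.length + 1 → subs j g (ts.map (fun t => [x.cut t]) ++ [[x]]) R = R
  | [], [r], _ => by simp [subs, sub, hx]
  | t :: ts, r :: R, h => by
    have ih := subs_singletons hx ts R (by simpa using h)
    simp [subs, sub, hx, lobe_cons, ih]

/-- A single arc of the lobe `j` that is cut is replaced by as many segments as it has parts, and
these are the cuts of the segment that replaces the whole arc. Concatenation gives the general
case. -/
theorem cutSub (V : List Letter) : CutSub M j g V := by
  induction V with
  | nil =>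
    intro ts W G
    cases ts <;> simp [tagsOf, subs]
  | cons x V ih =>
    refine CutSub.append (A := [x]) (fun ts W G => ?_) ih
    by_cases hx : x.lab = j
    · have e1 : tagsOf j (ts.map (fun t => [x.cut t]) ++ [[x]]).flatten = ts ++ [x.tag] := by
        have : ∀ ts : List ℕ, tagsOf j (ts.map fun t => [x.cut t]).flatten = ts := by
          intro ts
          induction ts with
          | nil => rfl
          | cons t ts ih =>
            simp only [List.map_cons, List.flatten_cons, tagsOf_append, ih]
            simp [tagsOf, lobe_cons, hx]
        rw [List.flatten_append, tagsOf_append, this]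
        simp [tagsOf, lobe_cons, hx]
      have e2 : tagsOf j [x] = [] ++ [x.tag] := by simp [tagsOf, lobe_cons, hx]
      rw [cutAt_singleton, lsum_singleton, e1, e2, famCut_concat, famCut_concat, cutAt_nil,
        lsum_singleton, sub_cons_pos _ _ hx]
      simp only [List.headD_cons, sub_nil, List.append_nil]
      exact lsum_congr fun R hR => by
        rw [subs_singletons hx _ _ (length_of_mem_cutAt _ _ _ hR)]
    · have e2 : tagsOf j [x] = [] := by simp [tagsOf, lobe_cons, hx]
      have e3 := cutAt_map (Letter.mapLab g) id ts [x] (fun _ _ _ _ => rfl)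
      simp only [List.map_id, List.map_cons, List.map_nil] at e3
      rw [e2, famCut_nil, lsum_singleton, sub_cons_neg _ _ hx, sub_nil, e3, lsum_map]
      refine lsum_congr fun S hS => ?_
      have h4 : lobe j S.flatten = [] := by
        have := getLast_of_mem_cutAt j _ _ _ hS
        rw [e2] at this
        simpa [tagsOf] using this
      have h5 : tagsOf j S.flatten = [] := by simp [tagsOf, h4]
      rw [h5, famCut_nil, lsum_singleton, subs_of_lobe_eq_nil _ h4]

theorem rotate_eq_append {α : Type*} {R : List α} {n : ℕ} (h : n ≤ R.length) :
    R.rotate n = R.drop n ++ R.take n := List.rotate_eq_drop_append_take h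

theorem concat_of_mem_cutAt (z : Letter) : ∀ (ts : List ℕ) (w : List Letter),
    ∀ S ∈ cutAt ts (w ++ [z]), ∃ F, S.flatten = F ++ [z] ∧
      ∀ x ∈ F, x ∈ w ∨ x.fin = false := by
  refine cutAt_induction ?_ ?_ ?_
  · intro w S hS
    simp only [cutAt_nil, List.mem_singleton] at hS
    exact ⟨w, by simp [hS], fun x hx => Or.inl hx⟩
  · intro t ts S hS
    rw [List.nil_append, cutAt_singleton, List.mem_singleton] at hS
    refine ⟨((t :: ts).map fun t => [z.cut t]).flatten, by rw [hS, List.flatten_append]; simp,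
      fun x hx => ?_⟩
    simp only [List.mem_flatten, List.mem_map] at hx
    obtain ⟨_, ⟨s, _, rfl⟩, hx⟩ := hx
    simp only [List.mem_singleton] at hx
    right; simp [hx]
  · intro t ts x w h1 h2 S hS
    rw [List.cons_append, cutAt_cons_cons, List.mem_append, List.mem_map, List.mem_map] at hS
    rcases hS with ⟨S, hS, rfl⟩ | ⟨S, hS, rfl⟩
    · obtain ⟨F, e, h⟩ := h1 S hS
      exact ⟨x.cut t :: F, by simp [e], by simpa using h⟩
    · obtain ⟨F, e, h⟩ := h2 S hS
      refine ⟨x :: F, by simp [e], fun y hy => ?_⟩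
      simp only [List.mem_cons] at hy ⊢
      rcases hy with rfl | hy
      · simp
      · exact (h y hy).imp_left Or.inr

/-- Substitution in a word that is cut afterwards, where the segments replace the arcs of the lobe
in the order that starts at its local zero. -/
theorem lsum_cutAt_fill (ts : List ℕ) {V : List Letter} (W : List Letter)
    (h : OneFinal (lobe j V)) (G : List (List Letter) → M) :
    (lsum (cutAt ts V) fun S => lsum (cutAt (slotTags j S.flatten) W) fun R =>
      G (subs j g S (R.rotate (rot (lobe j S.flatten))))) =
    lsum (cutAt (slotTags j V) W) fun R =>
      lsum (cutAt ts (sub j g V (R.rotate (rot (lobe j V))))) G := by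
  obtain ⟨V1, z, V2, rfl, hi, hz, h1, h2⟩ := h.exists_split
  rw [List.append_cons, ← List.singleton_append (l := []), List.append_nil]
  have key := fun s : List ℕ × List ℕ => (cutSub (M := M) (j := j) (g := g) V2).block
    (cutSub (M := M) (j := j) (g := g) (V1 ++ [z])) s.2 s.1 W fun S2 S1 => G (glue S1 S2)
  have hV : slotTags j (V1 ++ [z] ++ V2) = (tagsOf j V2 ++ tagsOf j (V1 ++ [z])).dropLast := by
    rw [List.append_assoc, List.singleton_append, slotTags_split hi hz h1, tagsOf_append,
      ← List.append_assoc]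
    simp [tagsOf, lobe_cons, hi]
  have hfam : ∀ a b : List ℕ, b ≠ [] → famCut (a ++ b) W = cutAt (a ++ b).dropLast W := by
    intro a b hb; simp [famCut, hb]
  have hne : ∀ X : List Letter, tagsOf j (X ++ [z]) ≠ [] := by
    intro X; simp [tagsOf, lobe_cons, hi]
  rw [lsum_cutAt_append, hV, ← hfam _ _ (hne _)]
  have e1 : ∀ R ∈ famCut (tagsOf j V2 ++ tagsOf j (V1 ++ [z])) W,
      lsum (cutAt ts (sub j g (V1 ++ [z] ++ V2)
        (R.rotate (rot (lobe j (V1 ++ [z] ++ V2)))))) G =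
      lsum (unappend ts) fun s =>
        lsum (cutAt s.1 (sub j g (V1 ++ [z]) (R.drop (lobe j V2).length))) fun S1 =>
          lsum (cutAt s.2 (sub j g V2 (R.take (lobe j V2).length))) fun S2 => G (glue S1 S2) := by
    intro R hR
    have := length_of_mem_famCut hR
    simp only [List.length_append, length_tagsOf] at this
    rw [← lsum_cutAt_append, ← sub_append' (by simp at this ⊢; omega),
      List.append_assoc, List.singleton_append, rot_split hi hz h1,
      rotate_eq_append (by omega)]
  rw [lsum_congr e1, lsum_comm]
  refine lsum_congr fun s _ => ?_
  have e2 : ∀ R : List (List Letter),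
      (lsum (cutAt s.1 (sub j g (V1 ++ [z]) (R.drop (lobe j V2).length))) fun S1 =>
          lsum (cutAt s.2 (sub j g V2 (R.take (lobe j V2).length))) fun S2 => G (glue S1 S2)) =
      (lsum (cutAt s.2 (sub j g V2 (R.take (lobe j V2).length))) fun S2 =>
        lsum (cutAt s.1 (sub j g (V1 ++ [z]) (R.drop (lobe j V2).length))) fun S1 =>
          G (glue S1 S2)) := fun R => lsum_comm _ _ _
  simp only [e2]
  rw [← key s, lsum_comm]
  refine lsum_congr fun S2 hS2 => lsum_congr fun S1 hS1 => ?_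
  obtain ⟨F, eF, hF⟩ := concat_of_mem_cutAt _ _ _ _ hS1
  have hF' : ∀ x ∈ lobe j F, x.fin = false := by
    intro x hx
    simp only [lobe, List.mem_filter, decide_eq_true_eq] at hx
    rcases hF x hx.1 with h | h
    · exact h1 x (by simp [lobe, h, hx.2])
    · exact h
  have e3 : slotTags j (glue S1 S2).flatten =
      (tagsOf j S2.flatten ++ tagsOf j S1.flatten).dropLast := by
    rw [flatten_glue, eF, List.append_assoc, List.singleton_append, slotTags_split hi hz hF',
      tagsOf_append, ← List.append_assoc]
    simp [tagsOf, lobe_cons, hi]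
  rw [e3, ← hfam _ _ (by rw [eF]; exact hne _)]
  refine lsum_congr fun R hR => ?_
  have := length_of_mem_famCut hR
  simp only [List.length_append, length_tagsOf] at this
  rw [flatten_glue, eF, List.append_assoc, List.singleton_append, rot_split hi hz hF',
    rotate_eq_append (by omega), subs_glue (ne_nil_of_mem_cutAt hS1) (ne_nil_of_mem_cutAt hS2)]
  rw [List.length_drop]; omega

end CutSub

end

section

/-! ### Associativity of the composition -/

theorem lobe_sub_inner {i J : ℕ} {f : ℕ → ℕ} : ∀ (X : List Letter) (T : List (List Letter)),
    T.length = (lobe i X).length → (∀ x ∈ X, x.lab ≠ i → f x.lab ≠ J) →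
    lobe J (sub i f X T) = lobe J T.flatten
  | [], T, h, _ => by
    obtain rfl : T = [] := by simpa using h
    simp
  | x :: X, T, h, hp => by
    by_cases hx : x.lab = i
    · rcases T with _ | ⟨s, T⟩
      · simp [lobe_cons, hx] at h
      · simp only [lobe_cons, hx, if_true, List.length_cons, Nat.add_right_cancel_iff] at h
        simp [sub_cons_pos _ _ hx, lobe_sub_inner X T h fun y hy => hp y (by simp [hy])]
    · rw [sub_cons_neg _ _ hx, lobe_cons, Letter.mapLab_lab, if_neg (hp x (by simp) hx)]
      exact lobe_sub_inner X T (by simpa [lobe_cons, hx] using h) fun y hy => hp y (by simp [hy])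

theorem lobe_sub_outer {i l J : ℕ} {f : ℕ → ℕ} (hli : l ≠ i) :
    ∀ (X : List Letter) (T : List (List Letter)),
    (∀ x ∈ X, x.lab ≠ i → (f x.lab = J ↔ x.lab = l)) → (∀ s ∈ T, ∀ y ∈ s, y.lab ≠ J) →
    lobe J (sub i f X T) = (lobe l X).map (Letter.mapLab f)
  | [], T, _, _ => by simp
  | x :: X, T, hp, hT => by
    have ih := fun T => lobe_sub_outer hli X T fun y hy => hp y (by simp [hy])
    by_cases hx : x.lab = i
    · have hxl : x.lab ≠ l := fun e => hli (e ▸ hx)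
      rw [sub_cons_pos _ _ hx, lobe_append, lobe_cons, if_neg hxl,
        ih _ fun s hs => hT s (List.mem_of_mem_tail hs)]
      rcases T with _ | ⟨s, T⟩
      · simp
      · have hh : lobe J s = [] := by
          simp only [lobe, List.filter_eq_nil_iff, decide_eq_true_eq]
          exact hT s (by simp)
        simp [hh]
    · rw [sub_cons_neg _ _ hx, lobe_cons, lobe_cons, Letter.mapLab_lab, ih _ hT]
      by_cases h : x.lab = l
      · rw [if_pos ((hp x (by simp) hx).2 h), if_pos h, List.map_cons]
      · simp [mt (hp x (by simp) hx).1 h, h]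

/-- Substitution in the outer word and then in the segments is a substitution of segments in which
one has already substituted. -/
theorem sub_sub {i J : ℕ} {f g h : ℕ → ℕ} : ∀ (X : List Letter) (T Q : List (List Letter)),
    T.length = (lobe i X).length → (∀ x ∈ X, x.lab ≠ i → f x.lab ≠ J ∧ g (f x.lab) = h x.lab) →
    sub J g (sub i f X T) Q = sub i h X (subs J g T Q)
  | [], T, Q, hl, _ => by simp
  | x :: X, T, Q, hl, hp => by
    by_cases hx : x.lab = i
    · rcases T with _ | ⟨s, T⟩
      · simp [lobe_cons, hx] at hl
      · simp only [lobe_cons, hx, if_true, List.length_cons, Nat.add_right_cancel_iff] at hl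
        rw [sub_cons_pos _ _ hx, sub_cons_pos _ _ hx, sub_append]
        simp only [List.headD_cons, List.tail_cons, subs]
        rw [sub_sub X T _ hl fun y hy => hp y (by simp [hy])]
    · rw [sub_cons_neg _ _ hx, sub_cons_neg _ _ hx, sub_cons_neg _ _ (hp x (by simp) hx).1,
        sub_sub X T Q (by simpa [lobe_cons, hx] using hl) fun y hy => hp y (by simp [hy])]
      congr 1
      simp [Letter.mapLab, (hp x (by simp) hx).2]

theorem rot_append_comm {P Q : List Letter} (h : OneFinal (P ++ Q)) {α : Type*} {R : List α}
    (hR : R.length = (P ++ Q).length) :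
    R.rotate (rot (Q ++ P)) = (R.rotate (rot (P ++ Q))).rotate P.length := by
  rw [List.rotate_rotate, ← List.rotate_mod, ← List.rotate_mod R (_ + _), hR]
  congr 1
  obtain ⟨A, z, B, e, hz, hA, hB⟩ := h
  rw [e, rot_eq hz hA]
  have e' := congrArg List.length e
  simp only [List.length_append, List.length_cons] at e'
  rcases List.append_eq_append_iff.1 e with ⟨C, rfl, rfl⟩ | ⟨C, rfl, h2⟩
  · rw [List.append_assoc C, List.cons_append, rot_eq hz fun x hx => hA x (by simp [hx])]
    simp
  · rcases C with _ | ⟨y, C⟩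
    · simp only [List.nil_append] at h2
      subst h2
      have := rot_eq (A := []) (B := B ++ A) hz (by simp)
      simp only [List.nil_append] at this
      simp [this]
    · simp only [List.cons_append, List.cons.injEq] at h2
      obtain ⟨rfl, rfl⟩ := h2
      have h3 : ∀ x ∈ Q ++ A, x.fin = false := by
        intro x hx
        simp only [List.mem_append] at hx
        exact hx.elim (fun hx => hB x (by simp [hx])) (hA x)
      rw [← List.append_assoc, rot_eq hz h3]
      have : (C ++ Q).length + (A ++ z :: C).length = C.length + (A ++ z :: (C ++ Q)).length := by
        simp; omega
      rw [this, Nat.add_mod_right]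

theorem oneFinal_of_mem_cutAt {j : ℕ} {ts : List ℕ} {V : List Letter} {S : List (List Letter)}
    (h : OneFinal (lobe j V)) (hS : S ∈ cutAt ts V) : OneFinal (lobe j S.flatten) := by
  obtain ⟨A, z, B, e, hz, hA, hB⟩ := h
  refine oneFinal_of_filter (z := z) ?_
  have h1 : (lobe j V).filter (·.fin) = [z] := by
    rw [e, List.filter_append, List.filter_cons_of_pos hz, List.filter_eq_nil_iff.2,
      List.filter_eq_nil_iff.2]
    · rfl
    · simpa using hB
    · simpa using hA
  rw [← h1, lobe, lobe, List.filter_filter, List.filter_filter]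
  have := congrArg (List.filter fun x : Letter => decide (x.lab =
    j)) (filter_fin_of_mem_cutAt _ _ _ hS)
  rw [List.filter_filter, List.filter_filter] at this
  simpa [Bool.and_comm] using this

/-- Filling an inner lobe of a composed word. -/
theorem fill_fill {i j m l : ℕ} {X w : List Letter} {S R : List (List Letter)} (hj : j < m)
    (h : OneFinal (lobe i X)) (hS : S ∈ cutAt (slotTags i X) w)
    (h2 : OneFinal (lobe (i + j) w)) :
    slotTags (i + j) (fill i m X S) = slotTags (i + j) S.flatten ∧
    (R.length = (lobe (i + j) S.flatten).length → fill (i + j) l (fill i m X S) R =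
      fill i (m + l - 1) X (subs (i + j) (outer (i + j) l) S
        (R.rotate (rot (lobe (i + j) S.flatten))))) := by
  have hl := length_eq_of_mem_cutAt_slotTags h hS
  have hb : rot (lobe i X) ≤ S.length := by rw [hl]; exact rot_le _
  have ho := oneFinal_of_mem_cutAt h2 hS
  have h3 : lobe (i + j) (fill i m X S) =
      lobe (i + j) (S.drop (rot (lobe i X))).flatten ++
        lobe (i + j) (S.take (rot (lobe i X))).flatten := by
    rw [fill, lobe_sub_inner _ _ (by simpa using hl), flatten_rotate _ _ hb, lobe_append]
    intro x _ hx
    unfold outer; split_ifs <;> omega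
  have h4 : lobe (i + j) S.flatten =
      lobe (i + j) (S.take (rot (lobe i X))).flatten ++
        lobe (i + j) (S.drop (rot (lobe i X))).flatten := by
    rw [← lobe_append, ← List.flatten_append, List.take_append_drop]
  rw [h4] at ho
  constructor
  · rw [slotTags, cyc, h3, ← fromZero_append_comm ho, ← h4]; rfl
  · intro hR
    rw [fill, h3, rot_append_comm ho (by rw [← h4, hR]), ← h4, fill,
      sub_sub (h := outer i (m + l - 1)) _ _ _ (by simpa using hl), fill]
    · congr 1
      generalize hQ : R.rotate (rot (lobe (i + j) S.flatten)) = Q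
      have hQl : Q.length = (lobe (i + j) S.flatten).length := by rw [← hQ]; simpa using hR
      rw [h4, List.length_append] at hQl
      rw [rotate_eq_append hb, rotate_eq_append (R := Q) (by omega),
        subs_append (by simp; omega), rotate_eq_append (R := subs _ _ S Q) (by simpa using hb)]
      have := subs_append (j := i + j) (g := outer (i + j) l) (S := S.take (rot (lobe i X)))
        (S' := S.drop (rot (lobe i X)))
        (R := Q.take (lobe (i + j) (S.take (rot (lobe i X))).flatten).length)
        (R' := Q.drop (lobe (i + j) (S.take (rot (lobe i X))).flatten).length) (by simp; omega)
      rw [List.take_append_drop, List.take_append_drop] at this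
      rw [this, List.drop_left' (by simp; omega), List.take_left' (by simp; omega)]
    · intro x _ hx
      unfold outer; constructor <;> split_ifs <;> omega

theorem frees_numbered (k : Type*) [CommRing k] (a : ℕ) (w : List Arc) :
    sgn k (frees (numbered a w)) = 1 := by
  refine sgn_of_sorted (List.Pairwise.sublist (frees_sublist _) ?_)
  rw [tags_numbered]
  exact List.pairwise_lt_range'

theorem tw_numbered (k : Type*) [CommRing k] (a : ℕ) (τ : Cell) :
    tw k (numbered a τ.walk) = Finsupp.single τ 1 := by
  rw [tw, frees_numbered, one_smul, forget_numbered, ofWalk_walk]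

theorem isTagged_numbered (a : ℕ) (τ : Cell) : IsTagged τ.arity (numbered a τ.walk) :=
  ⟨by simpa using τ.isWord, by rw [tags_numbered]; exact List.nodup_range'⟩

theorem mem_numbered {a : ℕ} {w : List Arc} {x : Letter} (h : x ∈ numbered a w) :
    a ≤ x.tag ∧ x.tag < a + w.length := by
  have := List.mem_map_of_mem (f := Letter.tag) h
  rw [tags_numbered, List.mem_range'_1] at this
  exact this

variable {k : Type*} [CommRing k]

theorem circ_lsum_left {α : Type*} (i : ℕ) (L : List α) (f : α → CC k) (b : CC k) :
    circ k i (lsum L f) b = lsum L fun x => circ k i (f x) b :=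
  map_lsum ((circ k i).flip b) L f

theorem outer_add (i j l x : ℕ) (h : x ≠ j) : outer j l x + i = outer (i + j) l (x + i) := by
  unfold outer; split_ifs <;> omega

/-- Both sides are sums over the ways to cut the word `V` at the slots of `X`, and `W` at the slots
of `V`; the difference is the order in which this is done, see `lsum_cutAt_fill`. -/
theorem circ_circ_tw {n m l i j : ℕ} {X V W : List Letter} (hX : IsTagged n X)
    (hV : IsTagged m V) (hW : IsTagged l W) (hi : i < n) (hj : j < m)
    (hXV : ∀ x ∈ X, ∀ y ∈ V, x.tag < y.tag) (hVW : ∀ x ∈ V, ∀ y ∈ W, x.tag < y.tag)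
    (hXW : ∀ x ∈ X, ∀ y ∈ W, x.tag < y.tag) :
    circ k (i + j) (circ k i (tw k X) (tw k V)) (tw k W) =
      circ k i (tw k X) (circ k j (tw k V) (tw k W)) := by
  have hoX := hX.oneFinal hi
  have hoV := hV.oneFinal hj
  have hoV' : OneFinal (lobe (i + j) (V.map (Letter.mapLab (· + i)))) := by
    rw [lobe_map (i := j) _ (fun x _ => by simp only [Letter.mapLab_lab]; omega)]
    obtain ⟨A, z, B, e, hz, hA, hB⟩ := hoV
    exact ⟨A.map (Letter.mapLab (· + i)), z.mapLab (· + i), B.map (Letter.mapLab (· + i)),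
      by rw [e, List.map_append, List.map_cons], hz, by simpa using hA, by simpa using hB⟩
  rw [circ_tw k hX hV hi hXV, circ_tw k hV hW hj hVW]
  have e1 : circ k (i + j) (lsum (cutAt (slotTags i X) (V.map (Letter.mapLab (· + i)))) fun S =>
      tw k (fill i m X S)) (tw k W) =
      lsum (cutAt (slotTags i X) (V.map (Letter.mapLab (· + i)))) fun S =>
        lsum (cutAt (slotTags (i + j) S.flatten) (W.map (Letter.mapLab (· + (i + j))))) fun R =>
          tw k (fill i (m + l - 1) X (subs (i + j) (outer (i + j) l) S
            (R.rotate (rot (lobe (i + j) S.flatten))))) := by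
    rw [circ_lsum_left]
    refine lsum_congr fun S hS => ?_
    rw [circ_tw k (hX.fill hi hV hXV hS) hW (by omega),
      (fill_fill (R := []) (l := 0) hj hoX hS hoV').1]
    · refine lsum_congr fun R hR => ?_
      rw [(fill_fill hj hoX hS hoV').2]
      exact length_eq_of_mem_cutAt_slotTags (oneFinal_of_mem_cutAt hoV' hS) hR
    · intro x hx y hy
      rcases mem_tags_fill hoX hS hx with ⟨x', hx', e⟩ | ⟨x', hx', e⟩
      · rw [← e]; exact hXW x' hx' y hy
      · rw [← e]; exact hVW x' hx' y hy
  have e2 : circ k i (tw k X) (lsum (cutAt (slotTags j V) (W.map (Letter.mapLab (· + j)))) fun R =>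
      tw k (fill j l V R)) =
      lsum (cutAt (slotTags (i + j) (V.map (Letter.mapLab (· + i))))
        (W.map (Letter.mapLab (· + (i + j))))) fun R =>
        lsum (cutAt (slotTags i X) (sub (i + j) (outer (i + j) l) (V.map (Letter.mapLab (· + i)))
          (R.rotate (rot (lobe (i + j) (V.map (Letter.mapLab (· + i)))))))) fun S =>
          tw k (fill i (m + l - 1) X S) := by
    have h1 : slotTags (i + j) (V.map (Letter.mapLab (· + i))) = slotTags j V := by
      have := slotTags_map (i := j) (i' := i + j) (Letter.mapLab (· + i)) id (X := V)
        (fun x _ => by simp only [Letter.mapLab_lab]; omega) (fun _ _ => rfl) fun _ _ => rfl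
      simpa using this
    have h2 : W.map (Letter.mapLab (· + (i + j))) =
        (W.map (Letter.mapLab (· + j))).map (Letter.mapLab (· + i)) := by
      rw [List.map_map]
      refine List.map_congr_left fun x _ => ?_
      simp only [Letter.mapLab, Function.comp_apply, Letter.mk.injEq, and_self, and_true]; omega
    have h3 := cutAt_map (Letter.mapLab (· + i)) id (slotTags j V) (W.map (Letter.mapLab (· + j)))
      (fun _ _ _ _ => rfl)
    rw [List.map_id] at h3
    rw [h1, h2, h3, lsum_map, map_lsum]
    refine lsum_congr fun R hR => ?_
    rw [circ_tw k hX (hV.fill hj hW hVW hR) hi]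
    · have h4 := fill_map (i := j) (i' := i + j) (m := l) (Letter.mapLab (· + i))
        (Letter.mapLab (· + i)) (X := V) R (fun x _ => by simp only [Letter.mapLab_lab]; omega)
        (fun _ _ => rfl) (fun x _ hx => by
          simp only [Letter.mapLab, Letter.mk.injEq, and_self, and_true]
          exact outer_add i j l x.lab hx)
      rw [h4, fill]
    · intro x hx y hy
      rcases mem_tags_fill hoV hR hy with ⟨y', hy', e⟩ | ⟨y', hy', e⟩
      · rw [← e]; exact hXV x hx y' hy'
      · rw [← e]; exact hXW x hx y' hy'
  rw [e1, e2]
  exact lsum_cutAt_fill (slotTags i X) _ hoV' fun S => tw k (fill i (m + l - 1) X S)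

/-- Sequential associativity: `(σ ∘ᵢ τ) ∘ᵢ₊ⱼ ρ = σ ∘ᵢ (τ ∘ⱼ ρ)`. -/
theorem circ_circ_single {i j : ℕ} (σ τ ρ : Cell) (hi : i < σ.arity) (hj : j < τ.arity) :
    circ k (i + j) (circ k i (Finsupp.single σ 1) (Finsupp.single τ 1)) (Finsupp.single ρ 1) =
      circ k i (Finsupp.single σ 1)
        (circ k j (Finsupp.single τ 1) (Finsupp.single ρ 1)) := by
  rw [← tw_numbered k 0 σ, ← tw_numbered k σ.walk.length τ,
    ← tw_numbered k (σ.walk.length + τ.walk.length) ρ]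
  refine circ_circ_tw (isTagged_numbered _ _) (isTagged_numbered _ _) (isTagged_numbered _ _) hi hj
    ?_ ?_ ?_ <;>
  · intro x hx y hy
    have := mem_numbered hx
    have := mem_numbered hy
    omega

/-! ### Compositions in different lobes -/

/-- Substitutions for the arcs of two different lobes of the same word commute. -/
theorem sub_sub_comm {i j j' : ℕ} {f f' g g' : ℕ → ℕ} (hij : i ≠ j) :
    ∀ (X : List Letter) (S R : List (List Letter)),
    (∀ x ∈ X, x.lab ≠ i → (f x.lab = j' ↔ x.lab = j)) →
    (∀ x ∈ X, x.lab ≠ j → (g x.lab = i ↔ x.lab = i)) →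
    (∀ x ∈ X, x.lab ≠ i → x.lab ≠ j → f' (f x.lab) = g' (g x.lab)) →
    (∀ s ∈ S, ∀ y ∈ s, y.lab ≠ j') → (∀ r ∈ R, ∀ y ∈ r, y.lab ≠ i) →
    sub j' f' (sub i f X S) (R.map (List.map (Letter.mapLab g'))) =
      sub i g' (sub j g X R) (S.map (List.map (Letter.mapLab f')))
  | [], _, _, _, _, _, _, _ => by simp
  | x :: X, S, R, h1, h2, h3, hS, hR => by
    have ih := fun S R => sub_sub_comm (i := i) (j := j) (j' := j') (f := f) (f' := f') (g := g)
      (g' := g') hij X S R (fun y hy => h1 y (by simp [hy])) (fun y hy => h2 y (by simp [hy]))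
      (fun y hy => h3 y (by simp [hy]))
    by_cases hxi : x.lab = i
    · have hxj : x.lab ≠ j := fun e => hij (hxi.symm.trans e)
      have hgi : (x.mapLab g).lab = i := (h2 x (by simp) hxj).2 hxi
      have hh : lobe j' (S.headD []) = [] := by
        rcases S with _ | ⟨s, S⟩
        · simp
        · simp only [List.headD_cons, lobe, List.filter_eq_nil_iff, decide_eq_true_eq]
          exact hS s (by simp)
      rw [sub_cons_pos _ _ hxi, sub_cons_neg _ _ hxj, sub_cons_pos _ _ hgi, sub_append,
        sub_of_lobe_eq_nil _ hh, hh, List.length_nil, List.drop_zero, ih _ _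
          (fun s hs => hS s (List.mem_of_mem_tail hs)) hR]
      cases S <;> simp
    · by_cases hxj : x.lab = j
      · have hfj : (x.mapLab f).lab = j' := (h1 x (by simp) hxi).2 hxj
        have hh : lobe i (R.headD []) = [] := by
          rcases R with _ | ⟨r, R⟩
          · simp
          · simp only [List.headD_cons, lobe, List.filter_eq_nil_iff, decide_eq_true_eq]
            exact hR r (by simp)
        rw [sub_cons_neg _ _ hxi, sub_cons_pos _ _ hxj, sub_cons_pos _ _ hfj, sub_append,
          sub_of_lobe_eq_nil _ hh, hh, List.length_nil, List.drop_zero, ← ih _ _ hS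
            (fun r hr => hR r (List.mem_of_mem_tail hr))]
        cases R <;> simp
      · rw [sub_cons_neg _ _ hxi, sub_cons_neg _ _ hxj,
          sub_cons_neg _ _ (mt (h1 x (by simp) hxi).1 hxj),
          sub_cons_neg _ _ (mt (h2 x (by simp) hxj).1 hxi), ih _ _ hS hR]
        congr 1
        simp [Letter.mapLab, h3 x (by simp) hxi hxj]

theorem outer_of_lt {i j : ℕ} (m x : ℕ) (h : i < j) : x + (j + m - 1) = outer i m (x + j) := by
  unfold outer; rw [if_neg (by omega)]; omega

/-- Parallel associativity. -/
theorem circ_circ_comm_single {i j : ℕ} (σ τ ρ : Cell) (hij : i < j) (hj : j < σ.arity) :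
    circ k i (circ k j (Finsupp.single σ 1) (Finsupp.single ρ 1)) (Finsupp.single τ 1) =
      (-1 : k) ^ (τ.degree * ρ.degree) • circ k (j + τ.arity - 1)
        (circ k i (Finsupp.single σ 1) (Finsupp.single τ 1)) (Finsupp.single ρ 1) := by
  set m := τ.arity with hm
  set l := ρ.arity with hl
  have hi : i < σ.arity := by omega
  -- `V` and `V'` are the same word, with names before and after those of `W`
  set a := σ.walk.length with ha
  set b := τ.walk.length with hb
  set c := ρ.walk.length with hc
  obtain ⟨X, hXe⟩ : ∃ X, X = numbered 0 σ.walk := ⟨_, rfl⟩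
  obtain ⟨V, hVe⟩ : ∃ V, V = numbered a τ.walk := ⟨_, rfl⟩
  obtain ⟨W, hWe⟩ : ∃ W, W = numbered (a + b) ρ.walk := ⟨_, rfl⟩
  obtain ⟨V', hVe'⟩ : ∃ V', V' = numbered (a + b + c) τ.walk := ⟨_, rfl⟩
  have hX : IsTagged σ.arity X := hXe ▸ isTagged_numbered _ _
  have hV : IsTagged m V := hVe ▸ isTagged_numbered _ _
  have hW : IsTagged l W := hWe ▸ isTagged_numbered _ _
  have hV' : IsTagged m V' := hVe' ▸ isTagged_numbered _ _
  have tX : ∀ x ∈ X, x.tag < a := fun x hx => by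
    rw [hXe] at hx; have := mem_numbered hx; omega
  have tV : ∀ x ∈ V, a ≤ x.tag ∧ x.tag < a + b := fun x hx => by
    rw [hVe] at hx; exact mem_numbered hx
  have tW : ∀ x ∈ W, a + b ≤ x.tag ∧ x.tag < a + b + c := fun x hx => by
    rw [hWe] at hx; exact mem_numbered hx
  have tV' : ∀ x ∈ V', a + b + c ≤ x.tag ∧ x.tag < a + b + c + b := fun x hx => by
    rw [hVe'] at hx; exact mem_numbered hx
  obtain ⟨h, hdef⟩ : ∃ h : ℕ → ℕ, h = fun t => if a ≤ t ∧ t < a + b then t + (b + c) else t :=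
    ⟨_, rfl⟩
  have eV' : V' = V.map (Letter.retag h) := by
    rw [hVe, hVe']
    refine List.ext_getElem (by simp [numbered]) fun p h1 h2 => ?_
    have h3 : p < b := by simpa [numbered] using h1
    simp only [numbered, List.getElem_map, List.getElem_zipIdx, Letter.retag, Letter.mk.injEq,
      true_and, hdef]
    rw [if_pos (by omega)]; omega
  have eX : X.map (Letter.retag h) = X := by
    conv_rhs => rw [← List.map_id X]
    refine List.map_congr_left fun x hx => ?_
    have := tX x hx
    simp only [Letter.retag, hdef, id_eq]
    rw [if_neg (by omega)]
  have eW : W.map (Letter.retag h) = W := by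
    conv_rhs => rw [← List.map_id W]
    refine List.map_congr_left fun x hx => ?_
    have := tW x hx
    simp only [Letter.retag, hdef, id_eq]
    rw [if_neg (by omega)]
  have hoX := hX.oneFinal hi
  have hoXj := hX.oneFinal hj
  have hXV : ∀ x ∈ X, ∀ y ∈ V, x.tag < y.tag := fun x hx y hy => by
    have := tX x hx; have := tV y hy; omega
  have hXW : ∀ x ∈ X, ∀ y ∈ W, x.tag < y.tag := fun x hx y hy => by
    have := tX x hx; have := tW y hy; omega
  have e0 : circ k i (circ k j (Finsupp.single σ 1) (Finsupp.single ρ 1)) (Finsupp.single τ 1) =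
      circ k i (circ k j (tw k X) (tw k W)) (tw k V') := by
    rw [hXe, hWe, hVe', tw_numbered, tw_numbered, tw_numbered]
  have e0' : circ k (j + m - 1) (circ k i (Finsupp.single σ 1) (Finsupp.single τ 1))
      (Finsupp.single ρ 1) = circ k (j + m - 1) (circ k i (tw k X) (tw k V)) (tw k W) := by
    rw [hXe, hWe, hVe, tw_numbered, tw_numbered, tw_numbered]
  have inV : ∀ {S}, S ∈ cutAt (slotTags i X) (V.map (Letter.mapLab (· + i))) →
      ∀ s ∈ S, ∀ y ∈ s, i ≤ y.lab ∧ y.lab < i + m := fun hS s hs y hy =>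
    inner_of_mem_cutAt hV.word hS y (List.mem_flatten.2 ⟨s, hs, hy⟩)
  have inW : ∀ {R}, R ∈ cutAt (slotTags j X) (W.map (Letter.mapLab (· + j))) →
      ∀ s ∈ R, ∀ y ∈ s, j ≤ y.lab ∧ y.lab < j + l := fun hS s hs y hy =>
    inner_of_mem_cutAt hW.word hS y (List.mem_flatten.2 ⟨s, hs, hy⟩)
  have lobeL : ∀ {S}, S ∈ cutAt (slotTags i X) (V.map (Letter.mapLab (· + i))) →
      lobe (j + m - 1) (fill i m X S) = (lobe j X).map (Letter.mapLab (outer i m)) := by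
    intro S hS
    refine lobe_sub_outer (by omega) _ _ (fun x _ hx => ?_) fun s hs y hy => ?_
    · unfold outer; split_ifs <;> omega
    · have := inV hS s (List.mem_rotate.1 hs) y hy; omega
  have lobeR : ∀ {R}, R ∈ cutAt (slotTags j X) (W.map (Letter.mapLab (· + j))) →
      lobe i (fill j l X R) = (lobe i X).map (Letter.mapLab (outer j l)) := by
    intro R hR
    refine lobe_sub_outer (by omega) _ _ (fun x _ hx => ?_) fun s hs y hy => ?_
    · unfold outer; split_ifs <;> omega
    · have := inW hR s (List.mem_rotate.1 hs) y hy; omega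
  have slot : ∀ (f : ℕ → ℕ) (j j' : ℕ) (Y : List Letter), lobe j' Y =
    (lobe j X).map (Letter.mapLab f) →
      slotTags j' Y = slotTags j X ∧ rot (lobe j' Y) = rot (lobe j X) := by
    intro f j j' Y e
    constructor
    · rw [slotTags, cyc, e, fromZero_map (Letter.mapLab f) (fun _ _ => rfl), ← List.map_dropLast,
      List.map_map]; rfl
    · rw [e, rot_map (Letter.mapLab f) fun _ _ => rfl]
  have eL : circ k (j + m - 1) (circ k i (tw k X) (tw k V)) (tw k W) =
      lsum (cutAt (slotTags i X) (V.map (Letter.mapLab (· + i)))) fun S =>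
        lsum (cutAt (slotTags j X) (W.map (Letter.mapLab (· + j)))) fun R =>
          tw k (fill (j + m - 1) l (fill i m X S) (R.map (List.map (Letter.mapLab (outer i m))))) := by
    rw [circ_tw k hX hV hi hXV, circ_lsum_left]
    refine lsum_congr fun S hS => ?_
    rw [circ_tw k (hX.fill hi hV hXV hS) hW (by omega),
      (slot _ j _ _ (lobeL hS)).1]
    · have h2 : W.map (Letter.mapLab (· + (j + m - 1))) =
          (W.map (Letter.mapLab (· + j))).map (Letter.mapLab (outer i m)) := by
        rw [List.map_map]
        refine List.map_congr_left fun x _ => ?_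
        simp only [Letter.mapLab, Function.comp_apply, Letter.mk.injEq, and_self, and_true]
        exact outer_of_lt m x.lab hij
      have h3 := cutAt_map (Letter.mapLab (outer i m)) id (slotTags j X)
        (W.map (Letter.mapLab (· + j))) (fun _ _ _ _ => rfl)
      rw [List.map_id] at h3
      rw [h2, h3, lsum_map]
    · intro x hx y hy
      rcases mem_tags_fill hoX hS hx with ⟨x', hx', e⟩ | ⟨x', hx', e⟩
      · rw [← e]; exact hXW x' hx' y hy
      · rw [← e]; have := tV x' hx'; have := tW y hy; omega
  have eR : circ k i (circ k j (tw k X) (tw k W)) (tw k V') =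
      lsum (cutAt (slotTags j X) (W.map (Letter.mapLab (· + j)))) fun R =>
        lsum (cutAt (slotTags i X) (V'.map (Letter.mapLab (· + i)))) fun S =>
          tw k (fill i m (fill j l X R) S) := by
    rw [circ_tw k hX hW hj hXW, circ_lsum_left]
    refine lsum_congr fun R hR => ?_
    rw [circ_tw k (hX.fill hj hW hXW hR) hV' (by omega),
      (slot _ i _ _ (lobeR hR)).1]
    intro x hx y hy
    rcases mem_tags_fill hoXj hR hx with ⟨x', hx', e⟩ | ⟨x', hx', e⟩
    · rw [← e]; have := tX x' hx'; have := tV' y hy; omega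
    · rw [← e]; have := tW x' hx'; have := tV' y hy; omega
  have hts : ∀ j, j < σ.arity → (slotTags j X).map h = slotTags j X := by
    intro j hj
    have := slotTags_map (i := j) (i' := j) (Letter.retag h) h (X := X) (fun _ _ => Iff.rfl)
      (fun _ _ => rfl) fun _ _ => rfl
    rw [← this, eX]
  have ecut : cutAt (slotTags i X) (V'.map (Letter.mapLab (· + i))) =
      (cutAt (slotTags i X) (V.map (Letter.mapLab (· + i)))).map
        (List.map (List.map (Letter.retag h))) := by
    rw [← cutAt_map _ h _ _ fun _ _ _ _ => rfl, hts i hi, eV']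
    simp only [List.map_map]; rfl
  have ecutW : cutAt (slotTags j X) (W.map (Letter.mapLab (· + j))) =
      (cutAt (slotTags j X) (W.map (Letter.mapLab (· + j)))).map
        (List.map (List.map (Letter.retag h))) := by
    rw [← cutAt_map _ h _ _ fun _ _ _ _ => rfl, hts j hj]
    conv_lhs => rw [← eW]
    simp only [List.map_map]; rfl
  rw [e0, e0', eL, eR, ecutW, lsum_map, lsum_comm, ← lsum_smul, ecut, lsum_map, ← ecutW]
  refine lsum_congr fun S hS => ?_
  rw [← lsum_smul]
  refine lsum_congr fun R hR => ?_
  obtain ⟨Y, hY⟩ : ∃ Y, Y = fill (j + m - 1) l (fill i m X S)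
    (R.map (List.map (Letter.mapLab (outer i m)))) := ⟨_, rfl⟩
  have hYR : fill i m (fill j l X R) (S.map (List.map (Letter.mapLab (outer (j + m - 1) l)))) =
      Y := by
    have rL := (slot _ j _ _ (lobeL hS)).2
    have rR := (slot _ i _ _ (lobeR hR)).2
    have e1 : ∀ i m X S, fill i m X S = sub i (outer i m) X (S.rotate (rot (lobe i X))) :=
      fun _ _ _ _ => rfl
    rw [hY, e1 i m (fill j l X R), rR, e1 (j + m - 1), rL, e1 i m X, e1 j l X, ← List.map_rotate,
      ← List.map_rotate]
    refine (sub_sub_comm (by omega) _ _ _ (fun x _ _ => ?_) (fun x _ _ => ?_) (fun x _ _ _ => ?_)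
      (fun s hs y hy => ?_) fun s hs y hy => ?_).symm
    · unfold outer; split_ifs <;> omega
    · unfold outer; split_ifs <;> omega
    · unfold outer; split_ifs <;> omega
    · have := inV hS s (List.mem_rotate.1 hs) y hy; omega
    · have := inW hR s (List.mem_rotate.1 hs) y hy; omega
  have hSf : S.map (List.map (Letter.mapLab (outer (j + m - 1) l))) = S := by
    conv_rhs => rw [← List.map_id S]
    refine List.map_congr_left fun s hs => ?_
    conv_rhs => rw [id, ← List.map_id s]
    refine List.map_congr_left fun y hy => ?_
    have := inV hS s hs y hy
    have e : outer (j + m - 1) l y.lab = y.lab := by unfold outer; rw [if_pos (by omega)]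
    rw [Letter.mapLab, e]; rfl
  have hYR' : fill i m (fill j l X (R.map (List.map (Letter.retag h))))
      (S.map (List.map (Letter.retag h))) = Y.map (Letter.retag h) := by
    rw [← hYR, hSf, fill_map (i' := i) (Letter.retag h) (Letter.retag h) _ (fun _ _ => Iff.rfl)
      (fun _ _ => rfl) (fun _ _ _ => rfl), fill_map (i' := j) (Letter.retag h) (Letter.retag h) _
      (fun _ _ => Iff.rfl) (fun _ _ => rfl) (fun _ _ _ => rfl), eX]
  rw [hYR', ← hY, tw, tw, frees_map_retag, forget_map_retag, smul_smul]
  congr 1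
  -- the comparison of the two orders of the coordinates
  have hp1 := perm_frees_fill (m := m) hoX hS
  have hS2 : R.map (List.map (Letter.mapLab (outer i m))) ∈
      cutAt (slotTags (j + m - 1) (fill i m X S)) (W.map (Letter.mapLab (· + (j + m - 1)))) := by
    rw [(slot _ j _ _ (lobeL hS)).1]
    have h2 : W.map (Letter.mapLab (· + (j + m - 1))) =
        (W.map (Letter.mapLab (· + j))).map (Letter.mapLab (outer i m)) := by
      rw [List.map_map]
      refine List.map_congr_left fun x _ => ?_
      simp only [Letter.mapLab, Function.comp_apply, Letter.mk.injEq, and_self, and_true]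
      exact outer_of_lt m x.lab hij
    have h3 := cutAt_map (Letter.mapLab (outer i m)) id (slotTags j X)
      (W.map (Letter.mapLab (· + j))) (fun _ _ _ _ => rfl)
    rw [List.map_id] at h3
    rw [h2, h3]
    exact List.mem_map_of_mem hR
  have hp2 := perm_frees_fill (m := l) ((hX.fill hi hV hXV hS).oneFinal (by omega)) hS2
  rw [← hY] at hp2
  have hp := hp2.trans (hp1.append_right _)
  have fX : (frees X).map h = frees X := by rw [← frees_map_retag, eX]
  have fV : (frees V).map h = frees V' := by rw [← frees_map_retag, eV']
  have fW : (frees W).map h = frees W := by rw [← frees_map_retag, eW]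
  have hmap : (frees X ++ frees V ++ frees W).map h = frees X ++ (frees V' ++ frees W) := by
    simp [fX, fV, fW]
  have mX : ∀ x ∈ frees X, x < a := by
    intro x hx; obtain ⟨y, hy, rfl⟩ := List.mem_map.1 hx; exact tX y (List.mem_of_mem_filter hy)
  have mV : ∀ x ∈ frees V, a ≤ x ∧ x < a + b := by
    intro x hx; obtain ⟨y, hy, rfl⟩ := List.mem_map.1 hx; exact tV y (List.mem_of_mem_filter hy)
  have mW : ∀ x ∈ frees W, a + b ≤ x ∧ x < a + b + c := by
    intro x hx; obtain ⟨y, hy, rfl⟩ := List.mem_map.1 hx; exact tW y (List.mem_of_mem_filter hy)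
  have mV' : ∀ x ∈ frees V', a + b + c ≤ x := by
    intro x hx; obtain ⟨y, hy, rfl⟩ := List.mem_map.1 hx
    exact (tV' y (List.mem_of_mem_filter hy)).1
  have hnodup : (frees X ++ (frees V' ++ frees W)).Nodup := by
    refine (hX.nodup.sublist (frees_sublist _)).append
      ((hV'.nodup.sublist (frees_sublist _)).append (hW.nodup.sublist (frees_sublist _)) ?_) ?_
    · intro t h1 h2; have := mV' t h1; have := mW t h2; omega
    · intro t h1 h2
      have := mX t h1
      rcases List.mem_append.1 h2 with h2 | h2
      · have := mV' t h2; omega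
      · have := mW t h2; omega
  have hs := sgn_mul_sgn_map (k := k) hp h ((hp.map h).nodup_iff.2 (by rw [hmap]; exact hnodup))
  have s1 : sgn k (frees X) = 1 := by rw [hXe]; exact frees_numbered k _ _
  have s2 : sgn k (frees V) = 1 := by rw [hVe]; exact frees_numbered k _ _
  have s3 : sgn k (frees W) = 1 := by rw [hWe]; exact frees_numbered k _ _
  have s4 : sgn k (frees V') = 1 := by rw [hVe']; exact frees_numbered k _ _
  rw [hmap, sgn_append _ (frees V' ++ _), sgn_append' (frees V'), sgn_append _ (frees W),
    sgn_append (frees X), s1, s2, s3, s4] at hs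
  · have d1 : (frees V').length = τ.degree := by
      rw [length_frees, hVe', forget_numbered, τ.degree_eq]
    have d2 : (frees W).length = ρ.degree := by
      rw [length_frees, hWe, forget_numbered, ρ.degree_eq]
    rw [d1, d2] at hs
    have := neg_one_pow_mul_self (k := k) (τ.degree * ρ.degree)
    generalize (-1 : k) ^ (τ.degree * ρ.degree) = e at *
    linear_combination -e * hs - sgn k ((frees Y).map h) * this
  · intro x hx y hy; have := mX x hx; have := mV y hy; omega
  · intro x hx y hy
    have := mW y hy
    rcases List.mem_append.1 hx with hx | hx
    · have := mX x hx; omega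
    · have := mV x hx; omega
  · intro x hx y hy; have := mV' x hx; have := mW y hy; omega
  · intro x hx y hy
    have := mX x hx
    rcases List.mem_append.1 hy with hy | hy
    · have := mV' y hy; omega
    · have := mW y hy; omega

end

section

/-! ### Faces -/

/-- The word without the arc that ends at the point `t`. -/
def dropTag (t : ℕ) (X : List Letter) : List Letter := X.filter fun x => x.tag ≠ t

/-- Make the end `t` of an arc a local zero. -/
def Letter.finalize (t : ℕ) (x : Letter) : Letter := if x.tag = t then ⟨x.lab, true, x.tag⟩ else x

/-- Contract the arc of the lobe `l` that ends at the local zero, so that the local zero moves to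
the point `t`. -/
def shrink (l t : ℕ) (X : List Letter) : List Letter :=
  (X.filter fun x => ¬(x.lab = l ∧ x.fin = true)).map (Letter.finalize t)

/-- The number of elements of a list that are smaller than `t`. -/
def rk (t : ℕ) (L : List ℕ) : ℕ := L.countP (· < t)

/-- The labels of the arcs that end at a local zero. -/
def finLabs (X : List Letter) : List ℕ := (X.filter (·.fin)).map Letter.lab

@[simp] theorem Letter.finalize_lab (t : ℕ) (x : Letter) : (x.finalize t).lab = x.lab := by
  unfold Letter.finalize; split_ifs <;> rfl
@[simp] theorem Letter.finalize_tag (t : ℕ) (x : Letter) : (x.finalize t).tag = x.tag := by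
  unfold Letter.finalize; split_ifs <;> rfl
theorem Letter.finalize_of_ne {t : ℕ} {x : Letter} (h : x.tag ≠ t) : x.finalize t = x := if_neg h
theorem Letter.finalize_fin (t : ℕ) (x : Letter) :
    (x.finalize t).fin = (x.fin || decide (x.tag = t)) := by
  unfold Letter.finalize; split_ifs with h <;> simp [h]

theorem rk_perm {L L' : List ℕ} (h : L.Perm L') (t : ℕ) : rk t L = rk t L' := h.countP_eq _
@[simp] theorem rk_append (t : ℕ) (L L' : List ℕ) : rk t (L ++ L') = rk t L + rk t L' :=
  List.countP_append
@[simp] theorem rk_nil (t : ℕ) : rk t [] = 0 := rfl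
@[simp] theorem rk_cons (t s : ℕ) (L : List ℕ) : rk t (s :: L) =
    rk t L + if s < t then 1 else 0 := by
  simp [rk, List.countP_cons]

section
variable (k : Type*) [CommRing k]

/-- The face at which the arc that ends at the special point `t` is contracted. -/
def faceF (t : ℕ) (X : List Letter) : CC k := (-1 : k) ^ rk t (frees X) • tw k (dropTag t X)

/-- The face at which the arc that ends at the local zero of the lobe `l` is contracted. Here it is
the last special point of the lobe that becomes the local zero. -/
def faceT (l : ℕ) (X : List Letter) : CC k :=
  match (slotTags l X).getLast? with
  | none => 0
  | some t => (-1 : k) ^ rk t (frees X) • tw k (shrink l t X)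

end

@[simp] theorem dropTag_append (t : ℕ) (X Y : List Letter) :
    dropTag t (X ++ Y) = dropTag t X ++ dropTag t Y := by simp [dropTag]
theorem dropTag_of_forall {t : ℕ} {X : List Letter} (h : ∀ x ∈ X, x.tag ≠ t) : dropTag t X = X := by
  rw [dropTag, List.filter_eq_self]; simpa using h
theorem dropTag_cons_self (x : Letter) (X : List Letter) : dropTag x.tag (x :: X) =
    dropTag x.tag X := by
  simp [dropTag]
theorem dropTag_cons_of_ne {t : ℕ} {x : Letter} (h : x.tag ≠ t) (X : List Letter) :
    dropTag t (x :: X) = x :: dropTag t X := by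
  simp [dropTag, h]

@[simp] theorem shrink_append (l t : ℕ) (X Y : List Letter) :
    shrink l t (X ++ Y) = shrink l t X ++ shrink l t Y := by simp [shrink]
theorem shrink_cons_pos {l t : ℕ} {x : Letter} (h : x.lab = l) (h' : x.fin = true)
    (X : List Letter) : shrink l t (x :: X) = shrink l t X := by simp [shrink, h, h']
theorem shrink_cons_neg {l t : ℕ} {x : Letter} (h : x.lab = l → x.fin = false) (X : List Letter) :
    shrink l t (x :: X) = x.finalize t :: shrink l t X := by
  rw [shrink, List.filter_cons_of_pos]
  · rfl
  · simpa [imp_iff_not_or] using h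
theorem shrink_of_forall {l t : ℕ} {X : List Letter} (h : ∀ x ∈ X, x.lab = l → x.fin = false)
    (h' : ∀ x ∈ X, x.tag ≠ t) : shrink l t X = X := by
  rw [shrink, List.filter_eq_self.2]
  · conv_rhs => rw [← List.map_id X]
    exact List.map_congr_left fun x hx => Letter.finalize_of_ne (h' x hx)
  · simpa [imp_iff_not_or] using h

/-! ### The contracted arc -/

theorem find?_reverse_range' {p : ℕ → Bool} {a c : ℕ} : ∀ {m : ℕ}, a ≤ c → c < a + m → p c = true →
    (∀ q, c < q → q < a + m → p q = false) → (List.range' a m).reverse.find? p = some c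
  | 0, h1, h2, _, _ => by omega
  | m + 1, h1, h2, h3, h4 => by
    rw [List.range'_1_concat, List.reverse_append, List.reverse_singleton, List.singleton_append,
      List.find?_cons]
    rcases Nat.lt_or_ge c (a + m) with h | h
    · rw [h4 _ h (by omega)]
      exact find?_reverse_range' h1 h h3 fun q hq hq' => h4 q hq (by omega)
    · obtain rfl : c = a + m := by omega
      rw [h3]

theorem find?_reverse_range'_eq_none {p : ℕ → Bool} {a m : ℕ}
    (h : ∀ q, a ≤ q → q < a + m → p q = false) : (List.range' a m).reverse.find? p = none := by
  rw [List.find?_eq_none]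
  intro q hq
  rw [List.mem_reverse, List.mem_range'_1] at hq
  simp [h q hq.1 hq.2]

theorem prevArc_eq (w : List Arc) (p : ℕ) : prevArc w p =
    ((List.range' 0 p).reverse.find? fun q => w[q]?.map Prod.fst == w[p]?.map Prod.fst).or
    ((List.range' (p + 1) (w.length - (p + 1))).reverse.find?
      fun q => w[q]?.map Prod.fst == w[p]?.map Prod.fst) := by
  rw [prevArc, List.find?_append, List.range_eq_range']

theorem prevArc_left {A B C : List Arc} {x y : Arc} (h : y.1 = x.1)
    (hB : ∀ z ∈ B, z.1 ≠ x.1) : prevArc (A ++ y :: (B ++ x :: C)) (A ++ y :: B).length =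
      some A.length := by
  have hx : (A ++ y :: (B ++ x :: C))[(A ++ y :: B).length]? = some x := by
    have : A ++ y :: (B ++ x :: C) = (A ++ y :: B) ++ x :: C := by simp
    rw [this, List.getElem?_append_right le_rfl]; simp
  rw [prevArc_eq, find?_reverse_range' (c := A.length), Option.some_or]
  · omega
  · simp
  · rw [hx]; simp [h]
  · intro q h1 h2
    simp only [List.length_append, List.length_cons] at h2
    rw [hx, List.getElem?_append_right (by omega), show q - A.length =
      (q - A.length - 1) + 1 by omega,
      List.getElem?_cons_succ, List.getElem?_append_left (by omega),
      List.getElem?_eq_getElem (by omega)]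
    simpa using hB _ (List.getElem_mem _)

theorem prevArc_right {A B C : List Arc} {x y : Arc} (h : y.1 = x.1) (hA : ∀ z ∈ A, z.1 ≠ x.1)
    (hC : ∀ z ∈ C, z.1 ≠ x.1) : prevArc (A ++ x :: (B ++ y :: C)) A.length =
      some (A ++ x :: B).length := by
  have hx : (A ++ x :: (B ++ y :: C))[A.length]? = some x := by simp
  rw [prevArc_eq, find?_reverse_range'_eq_none, Option.none_or,
    find?_reverse_range' (c := (A ++ x :: B).length)]
  · simp
  · simp
  · have : A ++ x :: (B ++ y :: C) = (A ++ x :: B) ++ y :: C := by simp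
    rw [hx, this, List.getElem?_append_right le_rfl]; simp [h]
  · intro q h1 h2
    simp only [List.length_append, List.length_cons] at h1 h2
    have : A ++ x :: (B ++ y :: C) = (A ++ x :: (B ++ [y])) ++ C := by simp
    rw [hx, this, List.getElem?_append_right (by simp; omega),
      List.getElem?_eq_getElem (by simp; omega)]
    simpa using hC _ (List.getElem_mem _)
  · intro q _ h2
    rw [hx, List.getElem?_append_left (by omega), List.getElem?_eq_getElem (by omega)]
    simpa using hA _ (List.getElem_mem _)

theorem prevArc_eq_none {A B : List Arc} {x : Arc} (hA : ∀ z ∈ A, z.1 ≠ x.1)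
    (hB : ∀ z ∈ B, z.1 ≠ x.1) : prevArc (A ++ x :: B) A.length = none := by
  have hx : (A ++ x :: B)[A.length]? = some x := by simp
  rw [prevArc_eq, find?_reverse_range'_eq_none, Option.none_or, find?_reverse_range'_eq_none]
  · intro q h1 h2
    simp only [List.length_append, List.length_cons] at h1 h2
    have : A ++ x :: B = (A ++ [x]) ++ B := by simp
    rw [hx, this, List.getElem?_append_right (by simp; omega),
      List.getElem?_eq_getElem (by simp; omega)]
    simpa using hB _ (List.getElem_mem _)
  · intro q _ h2
    rw [hx, List.getElem?_append_left (by omega), List.getElem?_eq_getElem (by omega)]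
    simpa using hA _ (List.getElem_mem _)

theorem exists_last_of_label {A : List Arc} {l : ℕ} (h : ∃ z ∈ A, z.1 = l) :
    ∃ B y C, A = B ++ y :: C ∧ y.1 = l ∧ ∀ z ∈ C, z.1 ≠ l := by
  induction A using List.reverseRecOn with
  | nil => simp at h
  | append_singleton A a ih =>
    by_cases ha : a.1 = l
    · exact ⟨A, a, [], rfl, ha, by simp⟩
    · obtain ⟨z, hz, e⟩ := h
      rw [List.mem_append, List.mem_singleton] at hz
      obtain ⟨B, y, C, rfl, hy, hC⟩ := ih ⟨z, hz.resolve_right fun e' => ha (e' ▸ e), e⟩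
      refine ⟨B, y, C ++ [a], by simp, hy, ?_⟩
      intro w hw
      rw [List.mem_append, List.mem_singleton] at hw
      rcases hw with hw | rfl
      · exact hC w hw
      · exact ha

theorem exists_prevArc {A B : List Arc} {x : Arc} (h : ∃ z ∈ A ++ B, z.1 = x.1) :
    ∃ q, prevArc (A ++ x :: B) A.length = some q := by
  by_cases hA : ∃ z ∈ A, z.1 = x.1
  · obtain ⟨C, y, D, rfl, hy, hD⟩ := exists_last_of_label hA
    exact ⟨_, by simpa using prevArc_left (C := B) hy hD⟩
  · have hB : ∃ z ∈ B, z.1 = x.1 := by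
      obtain ⟨z, hz, e⟩ := h
      exact ⟨z, (List.mem_append.1 hz).resolve_left fun hz => hA ⟨z, hz, e⟩, e⟩
    obtain ⟨C, y, D, rfl, hy, hD⟩ := exists_last_of_label hB
    push Not at hA
    exact ⟨_, prevArc_right hy hA hD⟩

section
variable (k : Type*) [CommRing k]

theorem faceTerm_free {A B : List Arc} {x : Arc} (hx : x.2 = false)
    (h : ∃ z ∈ A ++ B, z.1 = x.1) :
    faceTerm k (A ++ x :: B) A.length = (-1 : k) ^ numFree A • ofWalk k (A ++ B) := by
  obtain ⟨q, hq⟩ := exists_prevArc h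
  rw [faceTerm, hq]
  simp [List.getD, hx, List.eraseIdx_append_of_length_le]

theorem faceTerm_single {A B : List Arc} {x : Arc} (hA : ∀ z ∈ A, z.1 ≠ x.1)
    (hB : ∀ z ∈ B, z.1 ≠ x.1) : faceTerm k (A ++ x :: B) A.length = 0 := by
  rw [faceTerm, prevArc_eq_none hA hB]

theorem faceTerm_left {A B C : List Arc} {x y : Arc} (hx : x.2 = true) (h : y.1 = x.1)
    (hB : ∀ z ∈ B, z.1 ≠ x.1) :
    faceTerm k (A ++ y :: (B ++ x :: C)) (A ++ y :: B).length =
      -((-1 : k) ^ numFree A • ofWalk k (A ++ (y.1, true) :: (B ++ C))) := by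
  rw [faceTerm, prevArc_left h hB]
  have e : A ++ y :: (B ++ x :: C) = (A ++ y :: B) ++ x :: C := by simp
  have h1 : (A ++ y :: (B ++ x :: C)).getD (A ++ y :: B).length (0, false) = x := by
    rw [e, List.getD_append_right _ _ _ _ le_rfl]; simp
  have h2 : (A ++ y :: (B ++ x :: C)).getD A.length (0, false) = y := by
    rw [List.getD_append_right _ _ _ _ le_rfl]; simp
  simp only [h1, h2, hx, if_true]
  congr 3
  · simp
  · have : (A ++ y :: (B ++ x :: C)).set A.length (y.1, true) =
        (A ++ (y.1, true) :: B) ++ x :: C := by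
      rw [List.set_append_right _ _ le_rfl]; simp
    rw [this, show (A ++ y :: B).length = (A ++ (y.1, true) :: B).length by simp,
      List.eraseIdx_append_of_length_le le_rfl]
    simp

theorem faceTerm_right {A B C : List Arc} {x y : Arc} (hx : x.2 = true) (h : y.1 = x.1)
    (hA : ∀ z ∈ A, z.1 ≠ x.1) (hC : ∀ z ∈ C, z.1 ≠ x.1) :
    faceTerm k (A ++ x :: (B ++ y :: C)) A.length =
      -((-1 : k) ^ numFree (A ++ B) • ofWalk k (A ++ (B ++ (y.1, true) :: C))) := by
  rw [faceTerm, prevArc_right h hA hC]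
  have e : A ++ x :: (B ++ y :: C) = (A ++ x :: B) ++ y :: C := by simp
  have h1 : (A ++ x :: (B ++ y :: C)).getD A.length (0, false) = x := by
    rw [List.getD_append_right _ _ _ _ le_rfl]; simp
  have h2 : (A ++ x :: (B ++ y :: C)).getD (A ++ x :: B).length (0, false) = y := by
    rw [e, List.getD_append_right _ _ _ _ le_rfl]; simp
  simp only [h1, h2, hx, if_true]
  congr 3
  · rw [e, List.take_left]
    simp [numFree, hx]
  · have : (A ++ x :: (B ++ y :: C)).set (A ++ x :: B).length (y.1, true) =
        A ++ x :: (B ++ (y.1, true) :: C) := by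
      rw [e, List.set_append_right _ _ le_rfl]; simp
    rw [this, List.eraseIdx_append_of_length_le le_rfl]
    simp

end

end

section

/-! ### The boundary of a word with named coordinates -/

theorem tag_ne_of_nodup {A B : List Letter} {x : Letter}
    (h : ((A ++ x :: B).map Letter.tag).Nodup) :
    (∀ a ∈ A, a.tag ≠ x.tag) ∧ ∀ b ∈ B, b.tag ≠ x.tag := by
  simp only [List.map_append, List.map_cons, List.nodup_append, List.nodup_cons, List.mem_map,
    List.mem_cons] at h
  exact ⟨fun a ha => h.2.2 _ ⟨a, ha, rfl⟩ _ (Or.inl rfl),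
    fun b hb e => h.2.1.1 ⟨b, hb, e⟩⟩

theorem dropTag_append_cons {A B : List Letter} {x : Letter}
    (h : ((A ++ x :: B).map Letter.tag).Nodup) : dropTag x.tag (A ++ x :: B) = A ++ B := by
  obtain ⟨h1, h2⟩ := tag_ne_of_nodup h
  rw [dropTag_append, dropTag_cons_self, dropTag_of_forall h1, dropTag_of_forall h2]

theorem lobe_eq_nil_or (l : ℕ) (A : List Letter) : lobe l A = [] ∨
    ∃ B y C, A = B ++ y :: C ∧ y.lab = l ∧ lobe l C = [] := by
  induction A using List.reverseRecOn with
  | nil => simp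
  | append_singleton A a ih =>
    by_cases ha : a.lab = l
    · exact Or.inr ⟨A, a, [], rfl, ha, rfl⟩
    · rw [lobe_append, lobe_cons, if_neg ha, lobe_nil, List.append_nil]
      rcases ih with ih | ⟨B, y, C, rfl, hy, hC⟩
      · exact Or.inl ih
      · exact Or.inr ⟨B, y, C ++ [a], by simp, hy, by simp [hC, lobe_cons, ha]⟩

theorem lobe_eq_nil_iff {l : ℕ} {A : List Letter} : lobe l A = [] ↔ ∀ x ∈ A, x.lab ≠ l := by
  simp [lobe, List.filter_eq_nil_iff]

theorem forget_ne_of_lobe {l : ℕ} {A : List Letter} (h : lobe l A = []) :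
    ∀ z ∈ forget A, z.1 ≠ l := by
  intro z hz
  obtain ⟨x, hx, rfl⟩ := List.mem_map.1 hz
  exact lobe_eq_nil_iff.1 h x hx

theorem IsTagged.lobe_free {n : ℕ} {A B : List Letter} {z : Letter} (h : IsTagged n (A ++ z :: B))
    (hz : z.fin = true) :
    (∀ x ∈ lobe z.lab A, x.fin = false) ∧ ∀ x ∈ lobe z.lab B, x.fin = false := by
  obtain ⟨w, hw⟩ := h.word.filter_lobe (i := z.lab) (lt_of_isWord h.word (by simp))
  rw [lobe_append, lobe_cons, if_pos rfl, List.filter_append, List.filter_cons_of_pos hz] at hw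
  have h1 := congrArg List.length hw
  simp only [List.length_append, List.length_cons, List.length_nil] at h1
  have h2 : (lobe z.lab A).filter (·.fin) = [] := List.length_eq_zero_iff.1 (by omega)
  have h3 : (lobe z.lab B).filter Letter.fin = [] := List.length_eq_zero_iff.1 (by omega)
  rw [List.filter_eq_nil_iff] at h2 h3
  exact ⟨by simpa using h2, by simpa using h3⟩

theorem free_of_lobe_free {l : ℕ} {A : List Letter} (h : ∀ x ∈ lobe l A, x.fin = false) :
    ∀ x ∈ A, x.lab = l → x.fin = false :=
  fun x hx e => h x (List.mem_filter.2 ⟨hx, by simpa using e⟩)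

theorem shrink_left {l : ℕ} {C D B : List Letter} {y z : Letter} (hy : y.lab = l)
    (hz : z.lab = l) (hzf : z.fin = true)
    (hn : ((C ++ y :: (D ++ z :: B)).map Letter.tag).Nodup)
    (h1 : ∀ x ∈ lobe l (C ++ y :: D), x.fin = false) (h2 : ∀ x ∈ lobe l B, x.fin = false) :
    shrink l y.tag (C ++ y :: (D ++ z :: B)) = C ++ ⟨l, true, y.tag⟩ :: (D ++ B) := by
  have h1 := free_of_lobe_free h1
  obtain ⟨n1, n2⟩ := tag_ne_of_nodup hn
  rw [shrink_append, shrink_cons_neg (h1 y (by simp)), shrink_append, shrink_cons_pos hz hzf,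
    shrink_of_forall (fun x hx => h1 x (by simp [hx])) n1,
    shrink_of_forall (fun x hx => h1 x (by simp [hx])) fun x hx => n2 x (by simp [hx]),
    shrink_of_forall (free_of_lobe_free h2) fun x hx => n2 x (by simp [hx])]
  simp [Letter.finalize, hy]

theorem shrink_right {l : ℕ} {A C D : List Letter} {y z : Letter} (hy : y.lab = l)
    (hz : z.lab = l) (hzf : z.fin = true)
    (hn : ((A ++ z :: (C ++ y :: D)).map Letter.tag).Nodup)
    (h1 : ∀ x ∈ lobe l A, x.fin = false) (h2 : ∀ x ∈ lobe l (C ++ y :: D), x.fin = false) :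
    shrink l y.tag (A ++ z :: (C ++ y :: D)) = A ++ (C ++ ⟨l, true, y.tag⟩ :: D) := by
  have h2 := free_of_lobe_free h2
  have e : A ++ z :: (C ++ y :: D) = (A ++ z :: C) ++ y :: D := by simp
  rw [e] at hn
  obtain ⟨n1, n2⟩ := tag_ne_of_nodup hn
  rw [shrink_append, shrink_cons_pos hz hzf, shrink_append, shrink_cons_neg (h2 y (by simp)),
    shrink_of_forall (free_of_lobe_free h1) fun x hx => n1 x (by simp [hx]),
    shrink_of_forall (fun x hx => h2 x (by simp [hx])) fun x hx => n1 x (by simp [hx]),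
    shrink_of_forall (fun x hx => h2 x (by simp [hx])) n2]
  simp [Letter.finalize, hy]

section
variable (k : Type*) [CommRing k]

theorem sgn_frees_split {P Q : List ℕ} {t : ℕ} (h : t ∉ P) :
    sgn k (P ++ t :: Q) * (-1) ^ P.length = (-1) ^ rk t (P ++ t :: Q) * sgn k (P ++ Q) := by
  have := sgn_append_cons (k := k) P Q t h
  rw [mul_comm, this]
  congr 2
  simp [rk]

/-- Contraction of an arc that ends at a special point other than the local zero. -/
theorem sgn_smul_faceTerm_free {n : ℕ} {A B : List Letter} {x : Letter}
    (h : IsTagged n (A ++ x :: B)) (hx : x.fin = false) :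
    sgn k (frees (A ++ x :: B)) • faceTerm k (forget (A ++ x :: B)) A.length =
      faceF k x.tag (A ++ x :: B) := by
  have h1 : ∃ z ∈ forget A ++ forget B, z.1 = x.arc.1 := by
    obtain ⟨P, z, Q, e, hz, -⟩ := h.oneFinal (i := x.lab) (lt_of_isWord h.word (by simp))
    have hm : z ∈ lobe x.lab (A ++ x :: B) := by rw [e]; simp
    obtain ⟨hm, hl⟩ := List.mem_filter.1 hm
    have hne : z ≠ x := fun e => by simp [e, hx] at hz
    refine ⟨z.arc, ?_, by simpa [Letter.arc] using hl⟩
    rw [← forget_append]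
    refine List.mem_map_of_mem ?_
    simp only [List.mem_append, List.mem_cons] at hm ⊢
    tauto
  have hl : A.length = (forget A).length := by simp [forget]
  rw [forget_append, forget_cons, hl, faceTerm_free k hx h1, faceF, dropTag_append_cons h.nodup, tw,
    smul_smul, smul_smul, ← length_frees, forget_append]
  congr 1
  rw [frees_append, frees_append, frees_cons, if_neg (by simp [hx])]
  refine sgn_frees_split k ?_
  intro hm
  obtain ⟨a, ha, e⟩ := List.mem_map.1 hm
  exact (tag_ne_of_nodup h.nodup).1 a (List.mem_of_mem_filter ha) e

/-- Contraction of the arc that ends at the local zero. In the cell it is the last special point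
that loses its coordinate, wherever it is on the outside circle. -/
theorem sgn_smul_faceTerm_fin {n : ℕ} {A B : List Letter} {z : Letter}
    (h : IsTagged n (A ++ z :: B)) (hz : z.fin = true) :
    sgn k (frees (A ++ z :: B)) • faceTerm k (forget (A ++ z :: B)) A.length =
      -faceT k z.lab (A ++ z :: B) := by
  obtain ⟨hA, hB⟩ := h.lobe_free hz
  have hs := slotTags_split (i := z.lab) (X2 := B) rfl hz hA
  rcases lobe_eq_nil_or z.lab A with eA | ⟨C, y, D, rfl, hy, hD⟩
  · rcases lobe_eq_nil_or z.lab B with eB | ⟨C, y, D, rfl, hy, hD⟩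
    · have hl : A.length = (forget A).length := by simp [forget]
      rw [faceT, hs, eA, eB, forget_append, forget_cons, hl,
        faceTerm_single k (forget_ne_of_lobe eA) (forget_ne_of_lobe eB)]
      simp
    · have hl : A.length = (forget A).length := by simp [forget]
      have e1 : (slotTags z.lab (A ++ z :: (C ++ y :: D))).getLast? = some y.tag := by
        rw [hs, eA, lobe_append, lobe_cons, if_pos hy, hD]; simp
      have e2 : A ++ z :: (C ++ y :: D) = (A ++ z :: C) ++ y :: D := by simp
      have hyf : y.fin = false := free_of_lobe_free hB y (by simp) hy
      rw [faceT, e1]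
      dsimp only
      rw [shrink_right hy rfl hz h.nodup hA hB, forget_append, forget_cons, forget_append,
        forget_cons, hl, faceTerm_right k hz hy (forget_ne_of_lobe eA) (forget_ne_of_lobe hD), tw,
        smul_neg, smul_smul, smul_smul, ← forget_append, ← length_frees]
      have e3 : ∀ b, frees (A ++ (C ++ ⟨z.lab, true, b⟩ :: D)) = frees (A ++ C) ++ frees D := by
        simp [frees_cons]
      have e4 : frees (A ++ z :: (C ++ y :: D)) = frees (A ++ C) ++ y.tag :: frees D := by
        simp [frees_cons, hz, hyf]
      rw [e3, e4, sgn_frees_split]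
      · simp [Letter.arc, hy]
      · intro hm
        obtain ⟨a, ha, e⟩ := List.mem_map.1 hm
        have hn := h.nodup
        rw [e2] at hn
        have := List.mem_of_mem_filter ha
        refine (tag_ne_of_nodup hn).1 a ?_ e
        simp only [List.mem_append, List.mem_cons] at this ⊢
        tauto
  · have hl : (C ++ y :: D).length = (forget C ++ y.arc :: forget D).length := by simp [forget]
    have e1 : (slotTags z.lab (C ++ y :: D ++ z :: B)).getLast? = some y.tag := by
      rw [hs, lobe_append, lobe_cons, if_pos hy, hD]; simp
    have e2 : C ++ y :: D ++ z :: B = C ++ y :: (D ++ z :: B) := by simp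
    have hyf : y.fin = false := free_of_lobe_free hA y (by simp) hy
    have hn := h.nodup
    rw [faceT, e1]
    dsimp only
    rw [e2] at hn ⊢
    rw [shrink_left hy rfl hz hn hA hB, forget_append, forget_cons, forget_append,
      forget_cons, hl, faceTerm_left k hz hy (forget_ne_of_lobe hD), tw,
      smul_neg, smul_smul, smul_smul, ← length_frees]
    have e3 : ∀ b, frees (C ++ ⟨z.lab, true, b⟩ :: (D ++ B)) = frees C ++ frees (D ++ B) := by
      simp [frees_cons]
    have e4 : frees (C ++ y :: (D ++ z :: B)) = frees C ++ y.tag :: frees (D ++ B) := by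
      simp [frees_cons, hz, hyf]
    rw [e3, e4, sgn_frees_split]
    · simp [Letter.arc, hy]
    · intro hm
      obtain ⟨a, ha, e⟩ := List.mem_map.1 hm
      exact (tag_ne_of_nodup hn).1 a (List.mem_of_mem_filter ha) e

/-- The face of a word at which the given arc is contracted. -/
def faceAt (X : List Letter) (x : Letter) : CC k :=
  if x.fin then -faceT k x.lab X else faceF k x.tag X

theorem lsum_faceAt (X : List Letter) : ∀ Y : List Letter, lsum Y (faceAt k X) =
    lsum (frees Y) (fun t => faceF k t X) - lsum (finLabs Y) fun l => faceT k l X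
  | [] => by simp [finLabs]
  | y :: Y => by
    rw [lsum_cons, lsum_faceAt X Y, frees_cons]
    by_cases hy : y.fin = true
    · simp only [faceAt, hy, if_true, finLabs, List.filter_cons_of_pos, List.map_cons, lsum_cons]
      abel
    · simp only [faceAt, hy, finLabs]
      rw [List.filter_cons_of_neg (by simpa using hy)]
      simp only [Bool.false_eq_true, if_false, lsum_cons]
      abel

theorem degen_dropTag {A B : List Letter} {x y : Letter} (h1 : x.lab = y.lab)
    (h2 : x.fin = false) {t : ℕ} (hx : x.tag ≠ t) (hy : y.tag ≠ t) :
    Degen (dropTag t (A ++ x :: y :: B)) := by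
  rw [dropTag_append, dropTag_cons_of_ne hx, dropTag_cons_of_ne hy]
  exact ⟨_, x, y, _, rfl, h1, h2⟩

theorem degen_shrink {A B : List Letter} {x y : Letter} (h1 : x.lab = y.lab)
    (h2 : x.fin = false) {l t : ℕ} (hx : x.tag ≠ t) (hy : y.lab = l → y.fin = false) :
    Degen (shrink l t (A ++ x :: y :: B)) := by
  rw [shrink_append, shrink_cons_neg fun _ => h2, shrink_cons_neg hy,
    Letter.finalize_of_ne hx]
  exact ⟨_, x, _, _, rfl, by simpa using h1, h2⟩

/-- The last special point of a lobe is not the end of an arc that is followed by an arc of the same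
lobe, unless that arc ends at the local zero. -/
theorem faceT_degen {n l : ℕ} {A B : List Letter} {x y : Letter}
    (h : IsTagged n (A ++ x :: y :: B)) (h1 : x.lab = y.lab) (h2 : x.fin = false)
    (hy : y.lab = l → y.fin = false) (hl : l < n) : faceT k l (A ++ x :: y :: B) = 0 := by
  rw [faceT]
  split
  · rfl
  · rename_i t ht
    have hx : x.tag ≠ t := by
      rintro rfl
      obtain ⟨X1, z, X2, e, hzl, hzf, f1, f2⟩ := (h.oneFinal hl).exists_split
      have hn := (tag_ne_of_nodup h.nodup).2
      rw [e, slotTags_split hzl hzf f1, ← List.map_append] at ht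
      -- the last letter
      obtain ⟨w, hw, hwt⟩ : ∃ w, (lobe l X2 ++ lobe l X1).getLast? = some w ∧ w.tag = x.tag := by
        rw [List.getLast?_map, Option.map_eq_some_iff] at ht
        exact ht
      have hwm := List.mem_of_getLast? hw
      have hwX : w ∈ A ++ x :: y :: B := by
        rw [e]
        simp only [List.mem_append, List.mem_cons, lobe, List.mem_filter] at hwm ⊢
        tauto
      have hwl : w.lab = l := by
        simp only [List.mem_append, lobe, List.mem_filter, decide_eq_true_eq] at hwm
        tauto
      obtain rfl : w = x := by
        have hA := (tag_ne_of_nodup h.nodup).1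
        simp only [List.mem_append, List.mem_cons] at hwX
        rcases hwX with hw' | rfl | rfl | hw'
        · exact absurd hwt (hA w hw')
        · rfl
        · exact absurd hwt (hn w (by simp))
        · exact absurd hwt (hn w (by simp [hw']))
      have hyl : y.lab = l := h1 ▸ hwl
      have key : ∀ P Q, lobe l X2 ++ lobe l X1 = P ++ w :: y :: Q → False := by
        intro P Q e'
        rw [e', List.getLast?_append, List.getLast?_cons_cons] at hw
        obtain ⟨v, hv⟩ : ∃ v, (y :: Q).getLast? = some v :=
          Option.ne_none_iff_exists'.1 (by simp)
        rw [hv, Option.some_or, Option.some.injEq] at hw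
        subst hw
        have hvm := List.mem_of_getLast? hv
        have hnd : ((lobe l X2 ++ lobe l X1).map Letter.tag).Nodup := by
          have hn' := h.nodup
          rw [e] at hn'
          rw [List.map_append, List.nodup_append_comm, ← List.map_append]
          exact hn'.sublist ((List.filter_sublist.append
            (List.filter_sublist.trans (List.sublist_cons_self _ _))).map _)
        rw [e'] at hnd
        exact (tag_ne_of_nodup hnd).2 v hvm rfl
      have hyz : y ≠ z := fun e' => by rw [← e', hy hyl] at hzf; simp at hzf
      rcases List.append_eq_append_iff.1 e with ⟨C, rfl, e2⟩ | ⟨C, rfl, e2⟩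
      · rcases C with _ | ⟨c, _ | ⟨c', C⟩⟩
        · simp only [List.nil_append, List.cons.injEq] at e2
          rw [← e2.1, h2] at hzf; simp at hzf
        · simp only [List.cons_append, List.nil_append, List.cons.injEq] at e2
          exact hyz e2.2.1
        · simp only [List.cons_append, List.cons.injEq] at e2
          obtain ⟨rfl, rfl, rfl⟩ := e2
          refine key (lobe l X2 ++ lobe l A) (lobe l C) ?_
          simp [lobe_cons, hwl, hyl]
      · rcases C with _ | ⟨c, C⟩
        · simp only [List.nil_append, List.cons.injEq] at e2
          rw [e2.1, h2] at hzf; simp at hzf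
        · simp only [List.cons_append, List.cons.injEq] at e2
          obtain ⟨rfl, rfl⟩ := e2
          refine key (lobe l C) (lobe l B ++ lobe l X1) ?_
          simp [lobe_cons, hwl, hyl]
    rw [tw_eq_zero k (degen_shrink h1 h2 hx hy), smul_zero]

/-- The faces of a degenerate word cancel: those at the two successive arcs of the same lobe are
opposite to each other, and the others are degenerate as well. -/
theorem lsum_faceAt_degen {n : ℕ} {X : List Letter} (h : IsTagged n X) (hd : Degen X) :
    lsum X (faceAt k X) = 0 := by
  obtain ⟨A, x, y, B, rfl, h1, h2⟩ := hd
  have hn1 := tag_ne_of_nodup h.nodup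
  have hn2 := tag_ne_of_nodup (A := A ++ [x]) (x := y) (B := B) (by simpa using h.nodup)
  have h0 : ∀ u ∈ A ++ x :: y :: B, u.tag ≠ x.tag → u.tag ≠ y.tag →
      faceAt k (A ++ x :: y :: B) u = 0 := by
    intro u hu hux huy
    rw [faceAt]
    split_ifs with hf
    · rw [faceT_degen k h h1 h2 ?_ (lt_of_isWord h.word hu), neg_zero]
      intro e
      by_contra hyf
      have hyf : y.fin = true := by simpa using hyf
      have h3 := IsTagged.lobe_free (A := A ++ [x]) (B := B) (by simpa using h) hyf
      have : u ∈ A ++ [x] ∨ u ∈ B := by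
        simp only [List.mem_append, List.mem_cons] at hu ⊢
        rcases hu with hu | rfl | rfl | hu
        · exact Or.inl (Or.inl hu)
        · exact absurd rfl hux
        · exact absurd rfl huy
        · exact Or.inr hu
      have : u.fin = false := this.elim (fun hu => free_of_lobe_free h3.1 u hu e.symm)
        fun hu => free_of_lobe_free h3.2 u hu e.symm
      simp [hf] at this
    · rw [faceF, tw_eq_zero k (degen_dropTag h1 h2 hux.symm huy.symm), smul_zero]
  rw [lsum_append, lsum_cons, lsum_cons, lsum_eq_zero fun u hu => h0 u (by simp [hu])
    (hn1.1 u hu) (hn2.1 u (by simp [hu])), lsum_eq_zero fun u hu => h0 u (by simp [hu])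
    (hn1.2 u (by simp [hu])) (hn2.2 u hu), zero_add, add_zero]
  have e1 : faceAt k (A ++ x :: y :: B) x =
      ((-1) ^ (frees A).length * sgn k (frees (A ++ x :: y :: B))) •
        ofWalk k (forget (A ++ y :: B)) := by
    rw [faceAt, if_neg (by simp [h2]), faceF, dropTag_append_cons h.nodup, tw, smul_smul]
    congr 1
    simp only [frees_append]
    rw [frees_cons x, if_neg (by simp [h2]), ← sgn_frees_split, mul_comm]
    intro hm
    obtain ⟨a, ha, e⟩ := List.mem_map.1 hm
    exact hn1.1 a (List.mem_of_mem_filter ha) e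
  rw [e1]
  by_cases hyf : y.fin = true
  · have h3 := IsTagged.lobe_free (A := A ++ [x]) (B := B) (by simpa using h) hyf
    have e2 : faceT k y.lab (A ++ x :: y :: B) = (-1 : k) ^ rk x.tag (frees (A ++ x :: y :: B)) •
        tw k (A ++ ⟨y.lab, true, x.tag⟩ :: B) := by
      have hs := slotTags_split (i := y.lab) (X1 := A ++ [x]) (X2 := B) rfl hyf h3.1
      simp only [List.append_assoc, List.singleton_append] at hs
      have : (slotTags y.lab (A ++ x :: y :: B)).getLast? = some x.tag := by
        rw [hs, lobe_append, lobe_cons, if_pos h1]; simp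
      have h4 := shrink_left (C := A) (D := []) (B := B) h1 rfl hyf (by simpa using h.nodup) h3.1 h3.2
      simp only [List.nil_append] at h4
      rw [faceT, this]
      dsimp only
      rw [h4]
    rw [faceAt, if_pos hyf, e2, tw, smul_smul]
    have e3 : forget (A ++ ⟨y.lab, true, x.tag⟩ :: B) = forget (A ++ y :: B) := by
      simp [Letter.arc, hyf]
    have e4 : frees (A ++ ⟨y.lab, true, x.tag⟩ :: B) = frees A ++ frees B := by simp [frees_cons]
    have e5 : frees (A ++ x :: y :: B) = frees A ++ x.tag :: frees B := by
      simp [frees_cons, h2, hyf]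
    rw [e3, e4, e5, ← sgn_frees_split, mul_comm, add_neg_cancel]
    intro hm
    obtain ⟨a, ha, e⟩ := List.mem_map.1 hm
    exact hn1.1 a (List.mem_of_mem_filter ha) e
  · have hyf : y.fin = false := by simpa using hyf
    have e2 : faceAt k (A ++ x :: y :: B) y =
        ((-1) ^ ((frees A).length + 1) * sgn k (frees (A ++ x :: y :: B))) •
          ofWalk k (forget (A ++ y :: B)) := by
      have h3 : dropTag y.tag (A ++ x :: y :: B) = A ++ x :: B := by
        have := dropTag_append_cons (A := A ++ [x]) (x := y) (B := B) (by simpa using h.nodup)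
        simpa using this
      have h4 : forget (A ++ x :: B) = forget (A ++ y :: B) := by simp [Letter.arc, h1, h2, hyf]
      rw [faceAt, if_neg (by simp [hyf]), faceF, h3, tw, smul_smul, h4]
      congr 1
      have h5 : frees (A ++ x :: y :: B) = (frees A ++ [x.tag]) ++ y.tag :: frees B := by
        simp [frees_cons, h2, hyf]
      have h6 : frees (A ++ x :: B) = (frees A ++ [x.tag]) ++ frees B := by
        simp [frees_cons, h2]
      rw [h5, h6, ← sgn_frees_split, List.length_append, List.length_singleton, mul_comm]
      intro hm
      simp only [List.mem_append, List.mem_singleton] at hm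
      rcases hm with hm | hm
      · obtain ⟨a, ha, e⟩ := List.mem_map.1 hm
        exact hn2.1 a (by simp [List.mem_of_mem_filter ha]) e
      · exact hn2.1 x (by simp) hm.symm
    rw [e2, ← add_smul, pow_succ]
    rw [show ∀ a b : k, a * b + a * -1 * b = 0 by intros; ring, zero_smul]

/-- The boundary of a word is the sum of its faces. This holds for degenerate words, too, so that no
case distinctions are needed when words are composed. -/
theorem boundary_tw_eq {n : ℕ} {X : List Letter} (h : IsTagged n X) :
    boundary k (tw k X) = lsum X (faceAt k X) := by
  by_cases hd : Nondeg (forget X)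
  · obtain ⟨τ, hτ, -⟩ := h.word.exists_cell hd
    rw [tw, ← hτ, ofWalk_walk, map_smul, boundary, Finsupp.linearCombination_single, one_smul,
      sum_range_splits, hτ, ← lsum_smul]
    have e : splits (forget X) =
        (splits X).map fun s => (forget s.1, s.2.1.arc, forget s.2.2) := by
      generalize X = Y
      induction Y with
      | nil => rfl
      | cons y Y ih =>
        simp only [forget, List.map_cons, splits, List.cons.injEq, List.map_map] at ih ⊢
        refine ⟨rfl, ?_⟩
        rw [ih, List.map_map]; rfl
    rw [e, lsum_map, ← lsum_splits (faceAt k X)]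
    refine lsum_congr fun s hs => ?_
    have hs := eq_of_mem_splits hs
    obtain ⟨A, x, B⟩ := s
    simp only at hs ⊢
    subst hs
    have hl : (forget A).length = A.length := by simp [forget]
    rw [hl, faceAt]
    split_ifs with hx
    · exact sgn_smul_faceTerm_fin k h hx
    · exact sgn_smul_faceTerm_free k h (by simpa using hx)
  · rw [tw, ofWalk_eq_zero k hd, smul_zero, map_zero,
      lsum_faceAt_degen k h (not_nondeg_iff.1 hd)]

/-- The boundary of a word, in terms of the names of the coordinates. -/
theorem boundary_tw {n : ℕ} {X : List Letter} (h : IsTagged n X) :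
    boundary k (tw k X) =
      lsum (frees X) (fun t => faceF k t X) - lsum (finLabs X) fun l => faceT k l X := by
  rw [boundary_tw_eq k h, lsum_faceAt]

end

end

section

/-! ### The square of the boundary -/

theorem mem_frees {X : List Letter} {t : ℕ} :
    t ∈ frees X ↔ ∃ x ∈ X, x.fin = false ∧ x.tag = t := by
  simp only [frees, List.mem_map, List.mem_filter, Bool.not_eq_true']
  tauto

theorem frees_dropTag (t : ℕ) (X : List Letter) :
    frees (dropTag t X) = (frees X).filter (· ≠ t) := by
  rw [frees, dropTag, List.filter_filter, frees, List.filter_map, List.filter_filter]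
  congr 1
  refine List.filter_congr fun x _ => ?_
  simp [Bool.and_comm]

theorem frees_shrink (l t : ℕ) (X : List Letter) :
    frees (shrink l t X) = (frees X).filter (· ≠ t) := by
  rw [frees, shrink, List.filter_map, List.filter_filter, List.map_map, frees, List.filter_map,
    List.filter_filter]
  have : (Letter.tag ∘ Letter.finalize t) = Letter.tag := by funext x; simp
  rw [this]
  congr 1
  refine List.filter_congr fun x _ => ?_
  simp only [Function.comp_apply, Letter.finalize_fin]
  cases x.fin <;> simp

theorem finLabs_eq (X : List Letter) : finLabs X = finalLabels (forget X) :=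
  (finalLabels_forget X).symm

theorem eq_of_tag_eq {X : List Letter} (h : (X.map Letter.tag).Nodup) {x y : Letter} (hx : x ∈ X)
    (hy : y ∈ X) (e : x.tag = y.tag) : x = y :=
  List.inj_on_of_nodup_map h hx hy e

theorem fin_false_of_mem_frees {X : List Letter} (h : (X.map Letter.tag).Nodup) {t : ℕ}
    (ht : t ∈ frees X) {x : Letter} (hx : x ∈ X) (e : x.tag = t) : x.fin = false := by
  obtain ⟨y, hy, hyf, rfl⟩ := mem_frees.1 ht
  rwa [eq_of_tag_eq h hx hy e]

theorem IsTagged.dropTag {n t : ℕ} {X : List Letter} (h : IsTagged n X) (ht : t ∈ frees X) :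
    IsTagged n (dropTag t X) where
  word := by
    refine ⟨?_, fun x hx => ?_, ?_⟩
    · rw [← finLabs_eq, finLabs, Cacti.dropTag, List.filter_filter]
      have : X.filter (fun x => x.fin && decide (x.tag ≠ t)) = X.filter (·.fin) := by
        refine List.filter_congr fun x hx => ?_
        by_cases e : x.tag = t
        · simp [fin_false_of_mem_frees h.nodup ht hx e]
        · simp [e]
      rw [this, ← finalLabels_forget]
      exact h.word.perm
    · obtain ⟨y, hy, rfl⟩ := List.mem_map.1 hx
      exact h.word.lt _ (List.mem_map_of_mem (List.mem_of_mem_filter hy))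
    · have := h.word.nc
      rw [labels_forget] at this ⊢
      exact this.sublist (List.filter_sublist.map _)
  nodup := h.nodup.sublist (List.filter_sublist.map _)

theorem mem_slotTags {n l t : ℕ} {X : List Letter} (h : IsTagged n X) (hl : l < n) :
    t ∈ slotTags l X ↔ ∃ x ∈ X, x.lab = l ∧ x.fin = false ∧ x.tag = t := by
  rw [← (frees_lobe_perm (h.oneFinal hl)).mem_iff, mem_frees]
  simp only [lobe, List.mem_filter, decide_eq_true_eq]
  constructor
  · rintro ⟨x, ⟨h1, h2⟩, h3⟩; exact ⟨x, h1, h2, h3⟩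
  · rintro ⟨x, h1, h2, h3⟩; exact ⟨x, ⟨h1, h2⟩, h3⟩

theorem slotTags_subset_frees {n l : ℕ} {X : List Letter} (h : IsTagged n X) (hl : l < n) {t : ℕ}
    (ht : t ∈ slotTags l X) : t ∈ frees X := by
  obtain ⟨x, hx, -, h2⟩ := (mem_slotTags h hl).1 ht
  exact mem_frees.2 ⟨x, hx, h2⟩

theorem lab_of_mem_slotTags {n l : ℕ} {X : List Letter} (h : IsTagged n X) (hl : l < n) {t : ℕ}
    (ht : t ∈ slotTags l X) {x : Letter} (hx : x ∈ X) (e : x.tag = t) :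
    x.lab = l ∧ x.fin = false := by
  obtain ⟨y, hy, h1, h2, h3⟩ := (mem_slotTags h hl).1 ht
  rw [eq_of_tag_eq h.nodup hx hy (e.trans h3.symm)]
  exact ⟨h1, h2⟩

theorem nodup_slotTags {n l : ℕ} {X : List Letter} (h : IsTagged n X) (hl : l < n) :
    (slotTags l X).Nodup :=
  (frees_lobe_perm (h.oneFinal hl)).nodup_iff.1
    ((h.nodup.sublist (List.filter_sublist.map _)).sublist (frees_sublist _))

theorem tags_shrink (l t : ℕ) (X : List Letter) : (shrink l t X).map Letter.tag =
    (X.filter fun x => ¬(x.lab = l ∧ x.fin = true)).map Letter.tag := by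
  rw [shrink, List.map_map]
  congr 1; funext x; simp

theorem labels_shrink (l t : ℕ) (X : List Letter) : (shrink l t X).map Letter.lab =
    (X.filter fun x => ¬(x.lab = l ∧ x.fin = true)).map Letter.lab := by
  rw [shrink, List.map_map]
  congr 1; funext x; simp

theorem finLabs_shrink_perm {n l t : ℕ} {X : List Letter} (h : IsTagged n X) (hl : l < n)
    (ht : t ∈ slotTags l X) : (finLabs (shrink l t X)).Perm (finLabs X) := by
  obtain ⟨y, hy, hyl, hyf, rfl⟩ := (mem_slotTags h hl).1 ht
  obtain ⟨P, Q, rfl⟩ := List.append_of_mem hy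
  obtain ⟨X1, z, X2, e, hz, hzf, h1, h2⟩ := (h.oneFinal hl).exists_split
  have hn := tag_ne_of_nodup h.nodup
  have key : ∀ Y : List Letter, (∀ x ∈ Y, x.tag ≠ y.tag) →
      finLabs (shrink l y.tag Y) =
          (Y.filter fun x => x.fin && decide (x.lab ≠ l)).map Letter.lab := by
    intro Y hY
    rw [finLabs, shrink, List.filter_map, List.map_map, List.filter_filter]
    have e1 : Y.filter (fun x => ((fun x : Letter => x.fin) ∘ Letter.finalize y.tag) x &&
        decide ¬(x.lab = l ∧ x.fin = true)) = Y.filter fun x => x.fin && decide (x.lab ≠ l) := by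
      refine List.filter_congr fun x hx => ?_
      simp only [Function.comp_apply, Letter.finalize_of_ne (hY x hx)]
      cases x.fin <;> simp
    rw [e1]
    congr 1; funext x; simp
  have k2 : finLabs (shrink l y.tag (P ++ y :: Q)) =
      finLabs (shrink l y.tag P) ++ l :: finLabs (shrink l y.tag Q) := by
    rw [shrink_append, shrink_cons_neg fun _ => hyf]
    simp [finLabs, Letter.finalize, hyl]
  rw [k2, key P hn.1, key Q hn.2]
  have k3 : ((P ++ y :: Q).filter fun x => x.fin && decide (x.lab ≠ l)).map Letter.lab =
      (P.filter fun x => x.fin && decide (x.lab ≠ l)).map Letter.lab ++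
        (Q.filter fun x => x.fin && decide (x.lab ≠ l)).map Letter.lab := by
    simp [List.filter_append, hyf]
  refine List.perm_middle.trans ?_
  rw [← k3, e]
  have f1 := free_of_lobe_free h1
  have f2 := free_of_lobe_free h2
  have k4 : ∀ Y : List Letter, (∀ x ∈ Y, x.lab = l → x.fin = false) →
      (Y.filter fun x => x.fin && decide (x.lab ≠ l)) = Y.filter (·.fin) := by
    intro Y hY
    refine List.filter_congr fun x hx => ?_
    by_cases e : x.lab = l
    · simp [hY x hx e]
    · simp [e]
  rw [List.filter_append, List.filter_cons_of_neg (by simp [hz]), k4 _ f1, k4 _ f2, finLabs,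
    List.filter_append, List.filter_cons_of_pos hzf, List.map_append, List.map_append,
    List.map_cons, hz]
  exact List.perm_middle.symm

theorem IsTagged.shrink {n l t : ℕ} {X : List Letter} (h : IsTagged n X) (hl : l < n)
    (ht : t ∈ slotTags l X) : IsTagged n (shrink l t X) where
  word := by
    refine ⟨?_, fun x hx => ?_, ?_⟩
    · rw [← finLabs_eq]
      refine (finLabs_shrink_perm h hl ht).trans ?_
      rw [finLabs_eq]
      exact h.word.perm
    · obtain ⟨y, hy, rfl⟩ := List.mem_map.1 hx
      obtain ⟨z, hz, rfl⟩ := List.mem_map.1 hy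
      have := h.word.lt _ (List.mem_map_of_mem (List.mem_of_mem_filter hz))
      simpa [Letter.arc] using this
    · have := h.word.nc
      rw [labels_forget] at this ⊢
      rw [labels_shrink]
      exact this.sublist (List.filter_sublist.map _)
  nodup := by
    rw [tags_shrink]
    exact h.nodup.sublist (List.filter_sublist.map _)

theorem lobe_dropTag (l t : ℕ) (X : List Letter) : lobe l (dropTag t X) = dropTag t (lobe l X) := by
  simp only [lobe, dropTag, List.filter_filter, Bool.and_comm]

theorem tags_dropTag (t : ℕ) (X : List Letter) :
    (dropTag t X).map Letter.tag = (X.map Letter.tag).filter (· ≠ t) := by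
  rw [dropTag, List.filter_map]; rfl

theorem slotTags_dropTag {n l t : ℕ} {X : List Letter} (h : IsTagged n X) (hl : l < n)
    (ht : t ∈ frees X) : slotTags l (dropTag t X) = (slotTags l X).filter (· ≠ t) := by
  obtain ⟨X1, z, X2, rfl, hz, hzf, h1, h2⟩ := (h.oneFinal hl).exists_split
  have hzt : z.tag ≠ t := fun e => by
    have := fin_false_of_mem_frees h.nodup ht (x := z) (by simp) e
    simp [hzf] at this
  rw [slotTags_split hz hzf h1, dropTag_append, dropTag_cons_of_ne hzt, slotTags_split hz hzf,
    lobe_dropTag, lobe_dropTag, tags_dropTag, tags_dropTag, List.filter_append]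
  rw [lobe_dropTag]
  exact fun x hx => h1 x (List.mem_of_mem_filter hx)

theorem lobe_shrink_of_ne {n l l' t : ℕ} {X : List Letter} (h : IsTagged n X) (hl : l < n)
    (ht : t ∈ slotTags l X) (hne : l' ≠ l) : lobe l' (shrink l t X) = lobe l' X := by
  rw [lobe, shrink, List.filter_map, List.filter_filter]
  have e1 : X.filter (fun x => ((fun x : Letter => decide (x.lab = l')) ∘ Letter.finalize t) x &&
      decide ¬(x.lab = l ∧ x.fin = true)) = lobe l' X := by
    refine List.filter_congr fun x _ => ?_
    simp only [Function.comp_apply, Letter.finalize_lab]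
    by_cases e : x.lab = l'
    · simp [e, hne]
    · simp [e]
  rw [e1]
  conv_rhs => rw [← List.map_id (lobe l' X)]
  refine List.map_congr_left fun x hx => Letter.finalize_of_ne fun e => ?_
  obtain ⟨hx, hx'⟩ := List.mem_filter.1 hx
  exact hne ((by simpa using hx' : x.lab = l').symm.trans (lab_of_mem_slotTags h hl ht hx e).1)

theorem slotTags_shrink_of_ne {n l l' t : ℕ} {X : List Letter} (h : IsTagged n X) (hl : l < n)
    (ht : t ∈ slotTags l X) (hne : l' ≠ l) : slotTags l' (shrink l t X) = slotTags l' X := by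
  rw [slotTags, cyc, lobe_shrink_of_ne h hl ht hne]; rfl

theorem tags_lobe_shrink {l t : ℕ} {X : List Letter} (hX : ∀ x ∈ X, x.lab = l → x.fin = false) :
    (lobe l (shrink l t X)).map Letter.tag = (lobe l X).map Letter.tag := by
  induction X with
  | nil => rfl
  | cons x X ih =>
    rw [shrink_cons_neg (hX x (by simp)), lobe_cons, lobe_cons, Letter.finalize_lab]
    split_ifs <;> simp [ih fun y hy => hX y (by simp [hy])]

theorem fin_lobe_shrink {l t : ℕ} {X : List Letter} (hX : ∀ x ∈ X, x.lab = l → x.fin = false)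
    (h : ∀ x ∈ lobe l X, x.tag ≠ t) : ∀ x ∈ lobe l (shrink l t X), x.fin = false := by
  intro x hx
  obtain ⟨hx, hl⟩ := List.mem_filter.1 hx
  obtain ⟨y, hy, rfl⟩ := List.mem_map.1 hx
  have hl : y.lab = l := by simpa using hl
  have hy := List.mem_of_mem_filter hy
  rw [Letter.finalize_of_ne (h y (List.mem_filter.2 ⟨hy, by simpa using hl⟩))]
  exact hX y hy hl

/-- The last special point becomes the local zero, and the others keep their order. -/
theorem slotTags_shrink_self {n l t : ℕ} {ts : List ℕ} {X : List Letter} (h : IsTagged n X)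
    (hl : l < n) (ht : slotTags l X = ts ++ [t]) : slotTags l (shrink l t X) = ts := by
  obtain ⟨X1, z, X2, rfl, hz, hzf, h1, h2⟩ := (h.oneFinal hl).exists_split
  rw [slotTags_split hz hzf h1] at ht
  have f1 := free_of_lobe_free h1
  have f2 := free_of_lobe_free h2
  have hnd : ((lobe l X2).map Letter.tag ++ (lobe l X1).map Letter.tag).Nodup := by
    have := nodup_slotTags h hl
    rwa [slotTags_split hz hzf h1] at this
  rw [shrink_append, shrink_cons_pos hz hzf]
  rcases lobe_eq_nil_or l X1 with e1 | ⟨C, y, D, rfl, hy, hD⟩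
  · rw [e1, List.map_nil, List.append_nil] at ht
    rcases lobe_eq_nil_or l X2 with e2 | ⟨C, y, D, rfl, hy, hD⟩
    · simp [e2] at ht
    · rw [lobe_append, lobe_cons, if_pos hy, hD, List.map_append] at ht
      obtain ⟨rfl, ht⟩ := List.append_inj' ht rfl
      obtain rfl : y.tag = t := by simpa using ht
      have hyf := f2 y (by simp) hy
      have e3 : y.finalize y.tag = ⟨l, true, y.tag⟩ := by simp [Letter.finalize, hy]
      have hyn : ∀ x ∈ lobe l C, x.tag ≠ y.tag := by
        intro x hx e
        rw [e1, lobe_append, lobe_cons, if_pos hy, hD] at hnd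
        simp only [List.map_nil, List.append_nil, List.map_append, List.map_cons] at hnd
        refine (List.nodup_append.1 hnd).2.2 x.tag (List.mem_map_of_mem hx) y.tag (by simp) e
      have e4 : lobe l (shrink l y.tag X1) = [] := by
        have := tags_lobe_shrink (t := y.tag) f1
        rw [e1, List.map_nil, List.map_eq_nil_iff] at this
        exact this
      have e5 : lobe l (shrink l y.tag D) = [] := by
        have := tags_lobe_shrink (l := l) (t := y.tag) (X := D) fun x hx => f2 x (by simp [hx])
        rw [hD, List.map_nil, List.map_eq_nil_iff] at this
        exact this
      have fC : ∀ x ∈ C, x.lab = l → x.fin = false := fun x hx => f2 x (by simp [hx])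
      rw [shrink_append, shrink_cons_neg fun _ => hyf, e3, ← List.append_assoc,
        slotTags_split (i := l) (z := ⟨l, true, y.tag⟩) rfl rfl,
        e5, lobe_append, e4, List.nil_append, List.map_nil, List.nil_append, tags_lobe_shrink fC]
      rw [lobe_append, e4, List.nil_append]
      exact fin_lobe_shrink fC hyn
  · rw [lobe_append, lobe_cons, if_pos hy, hD, List.map_append, ← List.append_assoc] at ht
    obtain ⟨rfl, ht⟩ := List.append_inj' ht rfl
    obtain rfl : y.tag = t := by simpa using ht
    have hyf := f1 y (by simp) hy
    have e3 : y.finalize y.tag = ⟨l, true, y.tag⟩ := by simp [Letter.finalize, hy]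
    have hyn : ∀ x ∈ lobe l C, x.tag ≠ y.tag := by
      intro x hx e
      rw [lobe_append, lobe_cons, if_pos hy, hD] at hnd
      have := (List.nodup_append.1 hnd).2.1
      simp only [List.map_append, List.map_cons, List.map_nil] at this
      exact (List.nodup_append.1 this).2.2 x.tag (List.mem_map_of_mem hx) y.tag (by simp) e
    have e5 : lobe l (shrink l y.tag D) = [] := by
      have := tags_lobe_shrink (l := l) (t := y.tag) (X := D) fun x hx => f1 x (by simp [hx])
      rw [hD, List.map_nil, List.map_eq_nil_iff] at this
      exact this
    have fC : ∀ x ∈ C, x.lab = l → x.fin = false := fun x hx => f1 x (by simp [hx])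
    rw [shrink_append, shrink_cons_neg fun _ => hyf, e3, List.append_assoc, List.cons_append,
      slotTags_split (i := l) (z := ⟨l, true, y.tag⟩) rfl rfl, lobe_append, e5, List.nil_append,
        tags_lobe_shrink f2,
      tags_lobe_shrink fC]
    exact fin_lobe_shrink fC hyn

theorem dropTag_dropTag (s t : ℕ) (X : List Letter) :
    dropTag s (dropTag t X) = dropTag t (dropTag s X) := by
  simp only [dropTag, List.filter_filter, Bool.and_comm]

/-- The effect of a contraction on a single letter. -/
def shrinkLetter (l t : ℕ) (x : Letter) : Option Letter :=
  if x.lab = l ∧ x.fin = true then none else some (x.finalize t)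

theorem shrink_eq_filterMap (l t : ℕ) (X : List Letter) :
    shrink l t X = X.filterMap (shrinkLetter l t) := by
  induction X with
  | nil => rfl
  | cons x X ih =>
    rw [List.filterMap_cons, shrinkLetter]
    split_ifs with h
    · rw [shrink_cons_pos h.1 h.2, ih]
    · rw [shrink_cons_neg (by simpa using h), ih]

theorem shrink_dropTag (l s t : ℕ) (X : List Letter) :
    shrink l t (dropTag s X) = dropTag s (shrink l t X) := by
  rw [shrink, dropTag, dropTag, shrink, List.filter_map, List.filter_filter, List.filter_filter]
  congr 1
  refine List.filter_congr fun x _ => ?_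
  simp [Bool.and_comm]

theorem shrink_shrink {l l' t t' : ℕ} (hl : l ≠ l') {X : List Letter}
    (h : ∀ x ∈ X, x.tag = t → x.lab = l) (h' : ∀ x ∈ X, x.tag = t' → x.lab = l') :
    shrink l' t' (shrink l t X) = shrink l t (shrink l' t' X) := by
  simp only [shrink_eq_filterMap, List.filterMap_filterMap]
  refine List.filterMap_congr fun x hx => ?_
  have h := h x hx
  have h' := h' x hx
  obtain ⟨a, b, c⟩ := x
  simp only [shrinkLetter, Letter.finalize] at *
  by_cases e1 : c = t <;> by_cases e2 : c = t' <;> by_cases e3 : a = l <;> by_cases e4 : a = l' <;>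
    cases b <;> simp_all [shrinkLetter, Letter.finalize]

/-- The first contraction makes `t` the local zero, and the second one deletes the arc that ends
there, as if it had been dropped at the outset. -/
theorem shrink_shrink_self {l t t' : ℕ} (ht : t' ≠ t) {X : List Letter}
    (h : ∀ x ∈ X, x.tag = t → x.lab = l) :
    shrink l t' (shrink l t X) = shrink l t' (dropTag t X) := by
  rw [shrink_dropTag, shrink_eq_filterMap l t' (shrink _ _ _), shrink_eq_filterMap l t X,
    List.filterMap_filterMap, dropTag, shrink_eq_filterMap, List.filter_filterMap]
  refine List.filterMap_congr fun x hx => ?_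
  have h := h x hx
  obtain ⟨a, b, c⟩ := x
  simp only [shrinkLetter, Letter.finalize] at *
  by_cases e1 : c = t <;> by_cases e2 : c = t' <;> by_cases e3 : a = l <;>
    cases b <;> simp_all [shrinkLetter, Letter.finalize, Option.filter]

variable {k : Type*} [CommRing k]

theorem rk_filter {F : List ℕ} (hF : F.Nodup) {t : ℕ} (ht : t ∈ F) (s : ℕ) :
    rk s F = rk s (F.filter (· ≠ t)) + if t < s then 1 else 0 := by
  obtain ⟨P, Q, rfl⟩ := List.append_of_mem ht
  rw [List.nodup_append, List.nodup_cons] at hF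
  have e1 : P.filter (· ≠ t) = P := List.filter_eq_self.2 fun x hx => by
    simpa using hF.2.2 x hx t (by simp)
  have e2 : Q.filter (· ≠ t) = Q := List.filter_eq_self.2 fun x hx => by
    rw [decide_eq_true_eq]
    rintro rfl; exact hF.2.1.1 hx
  rw [List.filter_append, List.filter_cons_of_neg (by simp), e1, e2]
  simp; omega

/-- The sign rule by which the faces of faces cancel: the coordinates `s` and `t` are removed in
either order. -/
theorem sign_antisymm {F : List ℕ} (hF : F.Nodup) {s t : ℕ} (hs : s ∈ F) (ht : t ∈ F)
    (hst : s ≠ t) : (-1 : k) ^ rk t F * (-1) ^ rk s (F.filter (· ≠ t)) =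
      -((-1) ^ rk s F * (-1) ^ rk t (F.filter (· ≠ s))) := by
  rw [rk_filter hF ht s, rk_filter hF hs t]
  rcases Nat.lt_or_gt_of_ne hst with h | h
  · rw [if_pos h, if_neg (by omega)]; ring
  · rw [if_pos h, if_neg (by omega)]; ring

theorem lsum_antisymm {ι M : Type*} [AddCommGroup M] {f : ι → ι → M} : ∀ l : List ι,
    (∀ a ∈ l, f a a = 0) → (∀ a ∈ l, ∀ b ∈ l, f a b + f b a = 0) →
    lsum l (fun a => lsum l (f a)) = 0
  | [], _, _ => rfl
  | a :: l, h1, h2 => by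
    simp only [lsum_cons, lsum_add]
    rw [h1 a (by simp), lsum_antisymm l (fun b hb => h1 b (by simp [hb]))
      fun b hb c hc => h2 b (by simp [hb]) c (by simp [hc]), zero_add, add_zero, ← lsum_add]
    exact lsum_eq_zero fun b hb => h2 b (by simp [hb]) a (by simp)

theorem finLabs_perm {n : ℕ} {X : List Letter} (h : IsTagged n X) :
    (finLabs X).Perm (List.range n) := by
  rw [finLabs_eq]; exact h.word.perm

variable (k) in
theorem boundary_tw' {n : ℕ} {X : List Letter} (h : IsTagged n X) :
    boundary k (tw k X) =
      lsum (frees X) (fun t => faceF k t X) - lsum (List.range n) fun l => faceT k l X := by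
  rw [boundary_tw k h, lsum_perm (finLabs_perm h)]

theorem faceT_of_nil {l : ℕ} {X : List Letter} (h : slotTags l X = []) : faceT k l X = 0 := by
  rw [faceT, h]; rfl

theorem faceT_of_concat {l t : ℕ} {ts : List ℕ} {X : List Letter} (h : slotTags l X = ts ++ [t]) :
    faceT k l X = (-1 : k) ^ rk t (frees X) • tw k (shrink l t X) := by
  rw [faceT, h, List.getLast?_concat]

/-- Faces of faces come in pairs with opposite signs. The partner of two successive contractions at
the local zero of a lobe is the contraction at its last special point, followed by one at the
local zero. -/
theorem boundary_boundary_tw {n : ℕ} {X : List Letter} (h : IsTagged n X) :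
    boundary k (boundary k (tw k X)) = 0 := by
  set F := frees X with hF
  have hFn : F.Nodup := h.nodup.sublist (frees_sublist X)
  -- the faces of the faces of the first kind
  have b1 : ∀ t ∈ F, boundary k (faceF k t X) =
      lsum F (fun s => if s ≠ t then
        ((-1 : k) ^ rk t F * (-1) ^ rk s (F.filter (· ≠ t))) • tw k (dropTag s (dropTag t X))
        else 0) - lsum (List.range n) fun l => (-1 : k) ^ rk t F • faceT k l (dropTag t X) := by
    intro t ht
    rw [faceF, map_smul, boundary_tw' k (h.dropTag ht), frees_dropTag, smul_sub, ← lsum_smul,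
      ← lsum_smul, lsum_filter]
    congr 1
    refine lsum_congr fun s _ => ?_
    simp only [decide_eq_true_eq, faceF, frees_dropTag, smul_smul]
    rfl
  -- the faces of the faces of the second kind
  have b2 : ∀ l < n, ∀ u ∈ slotTags l X, boundary k (tw k (shrink l u X)) =
      lsum F (fun s => if s ≠ u then
        (-1 : k) ^ rk s (F.filter (· ≠ u)) • tw k (dropTag s (shrink l u X)) else 0) -
        lsum (List.range n) fun l' => faceT k l' (shrink l u X) := by
    intro l hl u hu
    rw [boundary_tw' k (h.shrink hl hu), frees_shrink, lsum_filter]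
    congr 1
    refine lsum_congr fun s _ => ?_
    simp only [decide_eq_true_eq, faceF, frees_shrink]
    rfl
  -- `D l m` is the face of a face at the local zeros of `l` and then of `m`
  obtain ⟨D, hD⟩ : ∃ D : ℕ → ℕ → CC k, D = fun l l' => match (slotTags l X).getLast? with
      | none => 0
      | some u => (-1 : k) ^ rk u F • faceT k l' (shrink l u X) := ⟨_, rfl⟩
  have D0 : ∀ l l', slotTags l X = [] → D l l' = 0 := by
    intro l l' e; rw [hD]; simp only [e]; rfl
  have D1 : ∀ l l' ts u, slotTags l X = ts ++ [u] →
      D l l' = (-1 : k) ^ rk u F • faceT k l' (shrink l u X) := by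
    intro l l' ts u e; rw [hD]; simp only [e, List.getLast?_concat]
  -- the mixed faces cancel, except for those at the last special point of `l`, which give `D l l`
  have b3 : ∀ l < n, lsum F (fun t => (-1 : k) ^ rk t F • faceT k l (dropTag t X)) +
      boundary k (faceT k l X) = D l l - lsum (List.range n) (D l) := by
    intro l hl
    rcases List.eq_nil_or_concat (slotTags l X) with e | ⟨ts, u, e⟩
    · rw [faceT_of_nil e, map_zero, D0 _ _ e, lsum_eq_zero fun l' _ => D0 l l' e,
        lsum_eq_zero fun t ht => ?_]
      · simp
      · rw [faceT_of_nil (by rw [slotTags_dropTag h hl ht, e]; rfl), smul_zero]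
    · rw [List.concat_eq_append] at e
      have hu : u ∈ slotTags l X := by simp [e]
      have huF : u ∈ F := slotTags_subset_frees h hl hu
      rw [faceT_of_concat e, map_smul, b2 l hl u hu, smul_sub, ← lsum_smul, ← lsum_smul,
        lsum_congr (f := D l) fun l' _ => D1 l l' ts u e, ← add_sub_assoc, ← lsum_add]
      congr 1
      have hus : u ∉ ts := by
        have := nodup_slotTags h hl
        rw [e] at this
        intro hm
        exact (List.nodup_append.1 this).2.2 u hm u (by simp) rfl
      have e0 : slotTags l (dropTag u X) = ts := by
        rw [slotTags_dropTag h hl huF, e, List.filter_append, List.filter_eq_self.2]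
        · simp
        · intro s hs
          rw [decide_eq_true_eq]
          rintro rfl; exact hus hs
      have eD : D l l = (-1 : k) ^ rk u F • faceT k l (dropTag u X) := by
        rw [D1 l l ts u e]
        congr 1
        have e1 := slotTags_shrink_self h hl e
        rcases List.eq_nil_or_concat ts with rfl | ⟨ts', u', rfl⟩
        · rw [faceT_of_nil e1, faceT_of_nil e0]
        · rw [List.concat_eq_append] at e0 e1 hus
          rw [faceT_of_concat e1, faceT_of_concat e0, frees_shrink, frees_dropTag,
            shrink_shrink_self]
          · rintro rfl; simp at hus
          · exact fun x hx e => (lab_of_mem_slotTags h hl hu hx e).1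
      rw [eD]
      obtain ⟨P, Q, hPQ⟩ := List.append_of_mem huF
      have hne : ∀ s ∈ P ++ Q, s ≠ u := by
        rw [hPQ, List.nodup_append, List.nodup_cons] at hFn
        intro s hs
        rcases List.mem_append.1 hs with hs | hs
        · exact hFn.2.2 s hs u (by simp)
        · rintro rfl; exact hFn.2.1.1 hs
      have hz : ∀ s ∈ P ++ Q, (-1 : k) ^ rk s F • faceT k l (dropTag s X) +
          (-1 : k) ^ rk u F • (if s ≠ u then
            (-1 : k) ^ rk s (F.filter (· ≠ u)) • tw k (dropTag s (shrink l u X)) else 0) = 0 := by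
        intro s hs
        have hsu := hne s hs
        have hsF : s ∈ F := by
          rw [hPQ]; simp only [List.mem_append, List.mem_cons] at hs ⊢; tauto
        have e2 : slotTags l (dropTag s X) = ts.filter (· ≠ s) ++ [u] := by
          rw [slotTags_dropTag h hl hsF, e, List.filter_append, List.filter_cons_of_pos (by
            simpa using hsu.symm)]
          rfl
        rw [faceT_of_concat e2, if_pos hsu, smul_smul, smul_smul, shrink_dropTag, ← add_smul,
          frees_dropTag, sign_antisymm hFn huF hsF hsu.symm, neg_add_cancel, zero_smul]
      rw [hPQ, lsum_append, lsum_cons, ← hPQ, lsum_eq_zero fun s hs => hz s (by simp [hs]),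
        lsum_eq_zero fun s hs => hz s (by simp [hs]), if_neg (by simp), smul_zero]
      simp
  -- the faces at the local zeros of different lobes anticommute
  have b4 : lsum (List.range n) (fun l => lsum (List.range n) fun l' =>
      if l = l' then 0 else D l l') = 0 := by
    refine lsum_antisymm _ (fun l _ => if_pos rfl) fun l hl l' hl' => ?_
    rw [List.mem_range] at hl hl'
    by_cases hne : l = l'
    · rw [if_pos hne, if_pos hne.symm, add_zero]
    · rw [if_neg hne, if_neg (Ne.symm hne)]
      rcases List.eq_nil_or_concat (slotTags l X) with e | ⟨ts, u, e⟩
      · rw [D0 _ _ e]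
        rcases List.eq_nil_or_concat (slotTags l' X) with e' | ⟨ts', u', e'⟩
        · rw [D0 _ _ e', add_zero]
        · rw [List.concat_eq_append] at e'
          rw [D1 _ _ _ _ e', faceT_of_nil, smul_zero, add_zero]
          rw [slotTags_shrink_of_ne h hl' (by simp [e']) hne, e]
      · rw [List.concat_eq_append] at e
        have hu : u ∈ slotTags l X := by simp [e]
        rcases List.eq_nil_or_concat (slotTags l' X) with e' | ⟨ts', u', e'⟩
        · rw [D0 _ _ e', add_zero, D1 _ _ _ _ e, faceT_of_nil, smul_zero]
          rw [slotTags_shrink_of_ne h hl hu (Ne.symm hne), e']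
        · rw [List.concat_eq_append] at e'
          have hu' : u' ∈ slotTags l' X := by simp [e']
          have huu : u ≠ u' := by
            rintro rfl
            obtain ⟨x, hx, h1, -, h2⟩ := (mem_slotTags h hl).1 hu
            exact hne (h1.symm.trans (lab_of_mem_slotTags h hl' hu' hx h2).1)
          rw [D1 _ _ _ _ e, D1 _ _ _ _ e',
            faceT_of_concat ((slotTags_shrink_of_ne h hl hu (Ne.symm hne)).trans e'),
            faceT_of_concat ((slotTags_shrink_of_ne h hl' hu' hne).trans e),
            frees_shrink, frees_shrink, smul_smul, smul_smul,
            shrink_shrink hne (fun x hx e => (lab_of_mem_slotTags h hl hu hx e).1)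
              (fun x hx e => (lab_of_mem_slotTags h hl' hu' hx e).1), ← add_smul,
            sign_antisymm hFn (slotTags_subset_frees h hl' hu') (slotTags_subset_frees h hl hu)
              huu.symm, neg_add_cancel, zero_smul]
  have b5 : lsum (List.range n) (fun l => D l l - lsum (List.range n) (D l)) = 0 := by
    rw [← neg_eq_zero, ← lsum_neg, ← b4]
    refine lsum_congr fun l hl => ?_
    obtain ⟨P, Q, hPQ⟩ := List.append_of_mem hl
    have hnd : (List.range n).Nodup := List.nodup_range
    rw [hPQ, List.nodup_append, List.nodup_cons] at hnd
    rw [hPQ]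
    simp only [lsum_append, lsum_cons, if_true]
    rw [lsum_congr (l := P) (f := fun l' => if l = l' then 0 else D l l') (g := D l),
      lsum_congr (l := Q) (f := fun l' => if l = l' then 0 else D l l') (g := D l)]
    · abel
    · intro x hx
      rw [if_neg]
      rintro rfl; exact hnd.2.1.1 hx
    · intro x hx
      exact if_neg fun e => hnd.2.2 x hx l (by simp) e.symm
  rw [boundary_tw' k h, _root_.map_sub, map_lsum, map_lsum, lsum_congr b1, lsum_sub,
    lsum_comm F (List.range n), lsum_antisymm, zero_sub, ← neg_add', ← lsum_add,
    lsum_congr fun l hl => b3 l (List.mem_range.1 hl), b5, neg_zero]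
  · intro t _; simp
  · intro s hs t ht
    by_cases e : s = t
    · simp [e]
    · rw [if_pos (Ne.symm e), if_pos e, dropTag_dropTag, ← add_smul,
        sign_antisymm hFn ht hs (Ne.symm e), neg_add_cancel, zero_smul]

theorem boundary_boundary (a : CC k) : boundary k (boundary k a) = 0 := by
  have : boundary k ∘ₗ boundary k = 0 := by
    refine Finsupp.lhom_ext' fun τ => LinearMap.ext_ring ?_
    simp only [LinearMap.comp_apply, Finsupp.lsingle_apply, LinearMap.zero_apply]
    rw [← tw_numbered k 0 τ]
    exact boundary_boundary_tw (isTagged_numbered 0 τ)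
  exact LinearMap.congr_fun this a

end

section

/-! ### Faces of cuts -/

section
variable {M : Type*} [AddCommMonoid M]

theorem map_dropTag_appendHead {t : ℕ} {x : Letter} (hx : x.tag ≠ t) {S : List (List Letter)} :
    (appendHead [x] S).map (dropTag t) = appendHead [x] (S.map (dropTag t)) := by
  cases S <;> simp [appendHead, dropTag, hx]

theorem map_dropTag_of_mem_cutAt {t : ℕ} : ∀ (ts : List ℕ) (w : List Letter), t ∉ ts →
    (∀ x ∈ w, x.tag ≠ t) → ∀ S ∈ cutAt ts w, S.map (dropTag t) = S := by
  intro ts w ht hw S hS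
  conv_rhs => rw [← List.map_id S]
  refine List.map_congr_left fun s hs => dropTag_of_forall fun y hy => ?_
  rcases mem_flatten_of_mem_cutAt _ _ _ hS y (List.mem_flatten.2 ⟨s, hs, hy⟩) with h | ⟨z, hz, u,
    hu, rfl⟩
  · exact hw y h
  · rintro rfl; exact ht hu

/-- What remains of the cuts when the points `t` are removed. Two successive cuts of the same arc
give an empty segment; if the two segments that meet at `t` contain ends of arcs, then the cut is
now at the end of an arc. -/
theorem lsum_cutAt_dropTag {t : ℕ} {ts2 : List ℕ} (h2 : t ∉ ts2) :
    ∀ (ts1 : List ℕ) (w : List Letter), t ∉ ts1 → (∀ x ∈ w, x.tag ≠ t) →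
    ∀ G : List (List Letter) → M,
    lsum (cutAt (ts1 ++ t :: ts2) w) (fun S => G (S.map (dropTag t))) +
      (if ts2 = [] then lsum (cutAt ts1 w) (fun S => G (S ++ [[]])) else 0) =
    lsum (cutAt (ts1 ++ ts2) w) (fun S => G (S.take ts1.length ++ [] :: S.drop ts1.length)) +
      lsum (splits w) fun s => lsum (cutAt ts1 (s.1 ++ [s.2.1])) fun S1 =>
        lsum (cutAt ts2 s.2.2) fun S2 => G (S1 ++ S2) := by
  refine cutAt_induction ?_ ?_ ?_
  · intro w _
    induction w with
    | nil =>
      intro _ G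
      rcases ts2 with _ | ⟨t2, ts2⟩ <;> simp [splits]
    | cons x w ih =>
      intro hw G
      have hx : x.tag ≠ t := hw x (by simp)
      have ih := ih (fun y hy => hw y (by simp [hy])) fun S => G (appendHead [x] S)
      simp only [List.nil_append, cutAt_nil, lsum_nil, add_zero, List.length_nil, List.take_zero,
        List.drop_zero, splits, lsum_cons, lsum_map, List.cons_append, lsum_cutAt_cons_cons,
        List.map_cons] at ih ⊢
      have e1 : lsum (cutAt ts2 (x :: w)) (fun S => G (dropTag t [x.cut t] :: S.map (dropTag t))) =
          lsum (cutAt ts2 (x :: w)) fun S => G ([] :: S) := by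
        refine lsum_congr fun S hS => ?_
        rw [map_dropTag_of_mem_cutAt _ _ h2 hw S hS]
        simp [dropTag]
      have e2 : lsum (cutAt (t :: ts2) w) (fun S => G ((appendHead [x] S).map (dropTag t))) =
          lsum (cutAt (t :: ts2) w) fun S => G (appendHead [x] (S.map (dropTag t))) := by
        simp only [map_dropTag_appendHead hx]
      rw [e1, e2]
      have e3 : ∀ (s s' : List Letter) (S : List (List Letter)),
          appendHead s (s' :: S) = (s ++ s') :: S := fun _ _ _ => rfl
      simp only [e3, List.append_nil, List.singleton_append] at ih ⊢
      rw [add_assoc, ih]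
  · intro t1 ts1 ht hw G
    rcases ts1 with _ | ⟨t1', ts1⟩ <;> simp [splits]
  · intro t1 ts1 x w ih1 ih2 ht hw G
    have hx : x.tag ≠ t := hw x (by simp)
    have ht1 : t1 ≠ t := by rintro rfl; simp at ht
    have ih1 := ih1 (by simp at ht; tauto) hw fun S => G ([x.cut t1] :: S)
    have ih2 := ih2 ht (fun y hy => hw y (by simp [hy])) fun S => G (appendHead [x] S)
    simp only [List.cons_append, lsum_cutAt_cons_cons, List.map_cons, List.length_cons,
      List.take_succ_cons, List.drop_succ_cons] at ih1 ih2 ⊢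
    have e1 : lsum (cutAt (ts1 ++ t :: ts2) (x :: w))
        (fun S => G (dropTag t [x.cut t1] :: S.map (dropTag t))) =
        lsum (cutAt (ts1 ++ t :: ts2) (x :: w)) fun S => G ([x.cut t1] :: S.map (dropTag t)) := by
      have : dropTag t [x.cut t1] = [x.cut t1] := dropTag_of_forall (by simpa using ht1)
      rw [this]
    have e2 : lsum (cutAt (t1 :: (ts1 ++ t :: ts2)) w)
        (fun S => G ((appendHead [x] S).map (dropTag t))) =
        lsum (cutAt (t1 :: (ts1 ++ t :: ts2)) w) fun S => G (appendHead [x] (S.map (dropTag t))) := by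
      simp only [map_dropTag_appendHead hx]
    have e3 : lsum (cutAt (t1 :: ts1) w) (fun S => G (appendHead [x] S ++ [[]])) =
        lsum (cutAt (t1 :: ts1) w) fun S => G (appendHead [x] (S ++ [[]])) := by
      refine lsum_congr fun S hS => ?_
      rw [appendHead_append _ _ (ne_nil_of_mem_cutAt hS)]
    have e4 : lsum (cutAt (t1 :: (ts1 ++ ts2)) w)
        (fun S => G ((appendHead [x] S).take (ts1.length + 1) ++ [] ::
          (appendHead [x] S).drop (ts1.length + 1))) =
        lsum (cutAt (t1 :: (ts1 ++ ts2)) w) fun S => G (appendHead [x] (S.take (ts1.length + 1) ++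
          [] :: S.drop (ts1.length + 1))) := by
      refine lsum_congr fun S hS => ?_
      obtain ⟨s, S, rfl⟩ := List.exists_cons_of_ne_nil (ne_nil_of_mem_cutAt hS)
      rfl
    have e5 : lsum (splits (x :: w)) (fun s => lsum (cutAt (t1 :: ts1) (s.1 ++ [s.2.1])) fun S1 =>
        lsum (cutAt ts2 s.2.2) fun S2 => G (S1 ++ S2)) =
        lsum (splits (x :: w)) (fun s => lsum (cutAt ts1 (s.1 ++ [s.2.1])) fun S1 =>
          lsum (cutAt ts2 s.2.2) fun S2 => G ([x.cut t1] :: (S1 ++ S2))) +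
        lsum (splits w) fun s => lsum (cutAt (t1 :: ts1) (s.1 ++ [s.2.1])) fun S1 =>
          lsum (cutAt ts2 s.2.2) fun S2 => G (appendHead [x] (S1 ++ S2)) := by
      simp only [splits, lsum_cons, lsum_map, List.nil_append, List.cons_append,
        lsum_cutAt_cons_cons, cutAt_cons_nil, lsum_nil, add_zero, lsum_add]
      rw [add_assoc]
      congr 2
      refine lsum_congr fun s _ => lsum_congr fun S hS => ?_
      simp only [appendHead_append _ _ (ne_nil_of_mem_cutAt hS)]
    rw [e1, e2, e4, e5]
    split_ifs at ih1 ih2 ⊢ with h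
    · rw [e3, add_add_add_comm, ih1, ih2, add_add_add_comm]
    · rw [add_zero] at ih1 ih2 ⊢
      rw [ih1, ih2, add_add_add_comm]

theorem lsum_cutAt_cut_cons {y : Letter} (B : List Letter) :
    ∀ (ts : List ℕ) (G : List (List Letter) → M),
    lsum (cutAt ts (y :: B)) G = lsum (cutAt ts B) (fun S => G (appendHead [y] S)) +
      lsum (splits ts) fun s => lsum (cutAt s.1 [y.cut s.2.1]) fun S1 =>
        lsum (cutAt s.2.2 B) fun S2 => G (S1 ++ appendHead [y] S2)
  | [], G => by simp [splits, appendHead]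
  | t :: ts, G => by
    rw [lsum_cutAt_cons_cons, lsum_cutAt_cut_cons B ts, add_comm]
    congr 1
    simp only [splits, lsum_cons, lsum_map, cutAt_nil, lsum_cutAt_cons_cons,
      cutAt_cons_nil, lsum_nil, add_zero, List.cons_append, List.nil_append, Letter.cut_cut]

/-- The cuts of a word, according to whether a given arc is cut or not. -/
theorem lsum_cutAt_cut (y : Letter) (B : List Letter) :
    ∀ (ts : List ℕ) (A : List Letter) (H : List (List Letter) → M),
    lsum (cutAt ts (A ++ y :: B)) H = (lsum (unappend ts) fun s => lsum (cutAt s.1 A) fun S =>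
        lsum (cutAt s.2 B) fun R => H (glue S (appendHead [y] R))) +
      lsum (splits ts) fun s => lsum (cutAt s.1 (A ++ [y.cut s.2.1])) fun S1 =>
        lsum (cutAt s.2.2 B) fun S2 => H (S1 ++ appendHead [y] S2) := by
  refine cutAt_induction ?_ ?_ ?_
  · intro A H
    simp [splits, unappend, appendHead]
  · intro t ts H
    rw [List.nil_append, lsum_cutAt_cut_cons]
    congr 1
    simp only [unappend, lsum_cons, lsum_map, cutAt_nil, cutAt_cons_nil, lsum_nil,
      lsum_zero, add_zero, glue_singleton]
    refine lsum_congr fun S _ => ?_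
    simp [appendHead]
  · intro t ts x A ih1 ih2 H
    rw [List.cons_append, lsum_cutAt_cons_cons, ← List.cons_append, ih1, ih2]
    have u1 : (lsum (unappend (t :: ts)) fun s => lsum (cutAt s.1 (x :: A)) fun S =>
        lsum (cutAt s.2 B) fun R => H (glue S (appendHead [y] R))) =
        (lsum (unappend ts) fun s => lsum (cutAt s.1 (x :: A)) fun S =>
          lsum (cutAt s.2 B) fun R => H ([x.cut t] :: glue S (appendHead [y] R))) +
        lsum (unappend (t :: ts)) fun s => lsum (cutAt s.1 A) fun S =>
          lsum (cutAt s.2 B) fun R => H (appendHead [x] (glue S (appendHead [y] R))) := by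
      simp only [unappend, lsum_cons, lsum_map, cutAt_nil, lsum_nil, add_zero, lsum_cutAt_cons_cons,
        lsum_add]
      rw [add_left_comm]
      congr 1
      · refine lsum_congr fun s _ => lsum_congr fun S hS => ?_
        simp only [glue_cons _ _ (ne_nil_of_mem_cutAt hS)]
      · congr 1
        · refine lsum_congr fun s _ => lsum_congr fun S hS => ?_
          simp only [glue_appendHead _ _ _ (ne_nil_of_mem_cutAt hS)]
    have u2 : (lsum (splits (t :: ts)) fun s => lsum (cutAt s.1 (x :: A ++ [y.cut s.2.1])) fun S1 =>
        lsum (cutAt s.2.2 B) fun S2 => H (S1 ++ appendHead [y] S2)) =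
        (lsum (splits ts) fun s => lsum (cutAt s.1 (x :: A ++ [y.cut s.2.1])) fun S1 =>
          lsum (cutAt s.2.2 B) fun S2 => H ([x.cut t] :: (S1 ++ appendHead [y] S2))) +
        lsum (splits (t :: ts)) fun s => lsum (cutAt s.1 (A ++ [y.cut s.2.1])) fun S1 =>
          lsum (cutAt s.2.2 B) fun S2 => H (appendHead [x] (S1 ++ appendHead [y] S2)) := by
      simp only [splits, lsum_cons, lsum_map, cutAt_nil, lsum_nil, add_zero, lsum_cutAt_cons_cons,
        lsum_add, List.cons_append, List.nil_append]
      rw [add_left_comm]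
      congr 2
      refine lsum_congr fun s _ => lsum_congr fun S hS => ?_
      simp only [appendHead_append _ _ (ne_nil_of_mem_cutAt hS)]
    rw [u1, u2]
    abel

/-- The cuts of a word, where a function that ignores an arc is summed over the cuts that do not
cut this arc. -/
theorem lsum_cutAt_cut' (y : Letter) (A B : List Letter) (ts : List ℕ)
    (H H' : List (List Letter) → M)
    (h : ∀ ts1 ts2 S R, ts1 ++ ts2 = ts → S ∈ cutAt ts1 A → R ∈ cutAt ts2 B →
      H (glue S (appendHead [y] R)) = H' (glue S R)) :
    lsum (cutAt ts (A ++ y :: B)) H = lsum (cutAt ts (A ++ B)) H' +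
      lsum (splits ts) fun s => lsum (cutAt s.1 (A ++ [y.cut s.2.1])) fun S1 =>
        lsum (cutAt s.2.2 B) fun S2 => H (S1 ++ appendHead [y] S2) := by
  rw [lsum_cutAt_cut, lsum_cutAt_append B ts A H']
  congr 1
  refine lsum_congr fun s hs => lsum_congr fun S hS => lsum_congr fun R hR => ?_
  refine h s.1 s.2 S R ?_ hS hR
  clear h hS hR
  induction ts generalizing s with
  | nil => simp only [unappend, List.mem_singleton] at hs; simp [hs]
  | cons t ts ih =>
    simp only [unappend, List.mem_cons, List.mem_map] at hs
    rcases hs with rfl | ⟨s', hs', rfl⟩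
    · rfl
    · simp [ih s' hs']

end

/-- Cuts add special points before the ends of arcs only, so that the last arc of a lobe stays the
last one. -/
theorem getLast?_lobe_of_mem_cutAt (l : ℕ) : ∀ (ts : List ℕ) (w : List Letter), ∀ S ∈ cutAt ts w,
    (lobe l S.flatten).getLast? = (lobe l w).getLast? := by
  refine cutAt_induction ?_ ?_ ?_
  · simp
  · simp
  · intro t ts x w ih1 ih2 S hS
    rw [cutAt_cons_cons, List.mem_append, List.mem_map, List.mem_map] at hS
    rcases hS with ⟨S', hS', rfl⟩ | ⟨S', hS', rfl⟩
    · rw [List.flatten_cons, List.singleton_append, lobe_cons, ← ih1 S' hS', Letter.cut_lab]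
      split_ifs with h
      · have h1 := ih1 S' hS'
        rw [lobe_cons, if_pos h] at h1
        obtain ⟨v, hv⟩ : ∃ v, (lobe l S'.flatten).getLast? = some v := by
          rw [h1]; exact Option.ne_none_iff_exists'.1 (by simp)
        rw [List.getLast?_cons, hv]; rfl
      · rfl
    · rw [flatten_appendHead, List.singleton_append, lobe_cons, lobe_cons]
      split_ifs
      · rw [List.getLast?_cons, List.getLast?_cons, ih2 S' hS']
      · exact ih2 S' hS'

end

/-! ### Faces of composed words -/

theorem filterMap_sub {i : ℕ} {f f' : ℕ → ℕ} {φ ψ : Letter → Option Letter} :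
    ∀ (X : List Letter) (T : List (List Letter)),
    (∀ x ∈ X, x.lab = i → ∃ x', φ x = some x' ∧ x'.lab = i) →
    (∀ x ∈ X, x.lab ≠ i →
      ψ (x.mapLab f) = (φ x).map (Letter.mapLab f') ∧ ∀ x' ∈ φ x, x'.lab ≠ i) →
    (sub i f X T).filterMap ψ = sub i f' (X.filterMap φ) (T.map (List.filterMap ψ))
  | [], T, _, _ => by simp
  | x :: X, T, h1, h2 => by
    have ih := fun T => filterMap_sub (f := f) (f' := f') (φ := φ) (ψ := ψ) X T
      (fun y hy => h1 y (by simp [hy])) fun y hy => h2 y (by simp [hy])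
    by_cases hx : x.lab = i
    · obtain ⟨x', e, hx'⟩ := h1 x (by simp) hx
      rw [sub_cons_pos _ _ hx, List.filterMap_append, ih, List.filterMap_cons_some e,
        sub_cons_pos _ _ hx']
      cases T <;> simp
    · obtain ⟨e, hx'⟩ := h2 x (by simp) hx
      rw [sub_cons_neg _ _ hx]
      rcases h : φ x with _ | x'
      · rw [h] at e
        rw [List.filterMap_cons_none e, List.filterMap_cons_none h, ih]
      · rw [h] at e
        rw [List.filterMap_cons_some e, List.filterMap_cons_some h,
          sub_cons_neg _ _ (hx' x' (by simp [h])), ih]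

theorem filterMap_fill {i m : ℕ} {ψ : Letter → Option Letter} (X : List Letter)
    (S : List (List Letter))
    (h : ∀ x ∈ X, x.lab ≠ i → ψ (x.mapLab (outer i m)) = some (x.mapLab (outer i m))) :
    (fill i m X S).filterMap ψ = fill i m X (S.map (List.filterMap ψ)) := by
  rw [fill, filterMap_sub (φ := some) (f' := outer i m) _ _ (fun x _ hx => ⟨x, rfl, hx⟩), fill,
    List.map_rotate, List.filterMap_some]
  intro x hx hxi
  refine ⟨h x hx hxi, ?_⟩
  rintro x' hx'
  obtain rfl : x = x' := by simpa using hx'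
  exact hxi

/-- The effect on a single letter of dropping the arc that ends at `t`. -/
def dropLetter (t : ℕ) (x : Letter) : Option Letter := if x.tag = t then none else some x

theorem dropTag_eq_filterMap (t : ℕ) : dropTag t = List.filterMap (dropLetter t) := by
  funext X
  induction X with
  | nil => rfl
  | cons x X ih =>
    rw [List.filterMap_cons, dropLetter]
    split_ifs with h
    · rw [← h, dropTag_cons_self, h, ih]
    · rw [dropTag_cons_of_ne h, ih]

theorem dropTag_fill {i m t : ℕ} {X : List Letter} (S : List (List Letter))
    (h : ∀ x ∈ X, x.lab ≠ i → x.tag ≠ t) :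
    dropTag t (fill i m X S) = fill i m X (S.map (dropTag t)) := by
  rw [dropTag_eq_filterMap, filterMap_fill]
  intro x hx hxi
  simp [dropLetter, h x hx hxi]

theorem dropTag_fill_outer {i m t : ℕ} {X : List Letter} {S : List (List Letter)}
    (h : ∀ x ∈ X, x.lab = i → x.tag ≠ t) (hS : ∀ s ∈ S, ∀ y ∈ s, y.tag ≠ t) :
    dropTag t (fill i m X S) = fill i m (dropTag t X) S := by
  have e1 : lobe i (dropTag t X) = lobe i X := by
    rw [lobe_dropTag]
    refine dropTag_of_forall fun x hx => ?_
    obtain ⟨hx, hl⟩ := List.mem_filter.1 hx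
    exact h x hx (by simpa using hl)
  have e2 : ∀ S' : List (List Letter), (∀ s ∈ S', ∀ y ∈ s, y.tag ≠ t) →
      S'.map (dropTag t) = S' := by
    intro S' hS'
    conv_rhs => rw [← List.map_id S']
    exact List.map_congr_left fun s hs => dropTag_of_forall (hS' s hs)
  rw [fill, fill, e1, dropTag_eq_filterMap, filterMap_sub (φ := dropLetter t) (f' := outer i m),
    ← dropTag_eq_filterMap, e2]
  · exact fun s hs => hS s (List.mem_rotate.1 hs)
  · exact fun x hx hxi => ⟨x, by simp [dropLetter, h x hx hxi], hxi⟩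
  · intro x hx hxi
    by_cases e : x.tag = t <;> simp [dropLetter, e, hxi]

theorem shrink_fill {i m l t : ℕ} {X : List Letter} (S : List (List Letter))
    (h : ∀ x ∈ X, x.lab ≠ i → x.tag ≠ t ∧ outer i m x.lab ≠ l) :
    shrink l t (fill i m X S) = fill i m X (S.map (shrink l t)) := by
  have e : shrink l t = List.filterMap (shrinkLetter l t) := funext (shrink_eq_filterMap l t)
  rw [e, filterMap_fill]
  intro x hx hxi
  obtain ⟨h1, h2⟩ := h x hx hxi
  rw [shrinkLetter, if_neg (by simp [h2]), Letter.finalize_of_ne (by simpa using h1)]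

theorem shrink_fill_outer {i m l t : ℕ} {X : List Letter} {S : List (List Letter)} (hli : l ≠ i)
    (h : ∀ x ∈ X, x.lab = i → x.tag ≠ t)
    (hl : ∀ x ∈ X, x.lab ≠ i → (outer i m x.lab = outer i m l ↔ x.lab = l))
    (hS : ∀ s ∈ S, ∀ y ∈ s, y.tag ≠ t ∧ y.lab ≠ outer i m l)
    (hrot : lobe i (shrink l t X) = lobe i X) :
    shrink (outer i m l) t (fill i m X S) = fill i m (shrink l t X) S := by
  rw [fill, fill, hrot, shrink_eq_filterMap,
    filterMap_sub (φ := shrinkLetter l t) (f' := outer i m), ← shrink_eq_filterMap]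
  · congr 1
    rw [List.map_rotate]
    congr 1
    conv_rhs => rw [← List.map_id S]
    refine List.map_congr_left fun s hs => ?_
    rw [← shrink_eq_filterMap]
    exact shrink_of_forall (fun y hy e => absurd e (hS s hs y hy).2) fun y hy => (hS s hs y hy).1
  · intro x hx hxi
    refine ⟨x, ?_, hxi⟩
    rw [shrinkLetter, if_neg fun e => hli (e.1.symm.trans hxi),
      Letter.finalize_of_ne (h x hx hxi)]
  · intro x hx hxi
    have := hl x hx hxi
    by_cases e : x.lab = l ∧ x.fin = true
    · have e' : (x.mapLab (outer i m)).lab = outer i m l ∧ (x.mapLab (outer i m)).fin = true :=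
        ⟨this.2 e.1, e.2⟩
      rw [shrinkLetter, shrinkLetter, if_pos e, if_pos e']
      simp
    · have e' : ¬((x.mapLab (outer i m)).lab = outer i m l ∧ (x.mapLab (outer i m)).fin = true) :=
        fun e' => e ⟨this.1 e'.1, e'.2⟩
      rw [shrinkLetter, shrinkLetter, if_neg e, if_neg e']
      constructor
      · by_cases e3 : x.tag = t <;> simp [Letter.finalize, e3, Letter.mapLab]
      · intro x' hx'
        obtain rfl : x.finalize t = x' := by simpa using hx'
        simpa using hxi

theorem fill_split {i m : ℕ} {X1 X2 : List Letter} {z : Letter} (hz : z.lab = i)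
    (hzf : z.fin = true) (h1 : ∀ x ∈ lobe i X1, x.fin = false) {S1 S2 : List (List Letter)}
    {s : List Letter} (hS1 : S1.length = (lobe i X1).length)
    (hS2 : S2.length = (lobe i X2).length) :
    fill i m (X1 ++ z :: X2) (S2 ++ (S1 ++ [s])) =
      sub i (outer i m) X1 S1 ++ (s ++ sub i (outer i m) X2 S2) := by
  rw [fill, rot_split hz hzf h1, ← hS2, List.rotate_append_length_eq, List.append_assoc,
    sub_append' hS1, List.singleton_append, sub_cons_pos _ _ hz]
  rfl

/-- An arc that is replaced by the empty segment could also be contracted before the composition. -/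
theorem fill_dropTag {n i m t : ℕ} {ts1 ts2 : List ℕ} {X : List Letter} (h : IsTagged n X)
    (hi : i < n) (ht : slotTags i X = ts1 ++ t :: ts2) {S : List (List Letter)}
    (hS : S.length = ts1.length + ts2.length + 1) :
    fill i m (dropTag t X) S = fill i m X (S.take ts1.length ++ [] :: S.drop ts1.length) := by
  have hnd := nodup_slotTags h hi
  obtain ⟨X1, z, X2, rfl, hz, hzf, h1, h2⟩ := (h.oneFinal hi).exists_split
  rw [ht] at hnd
  rw [slotTags_split hz hzf h1] at ht
  have uniq : ∀ P Q, P ++ t :: Q = ts1 ++ t :: ts2 → P = ts1 ∧ Q = ts2 := by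
    intro P Q e
    have h4 := List.nodup_append.1 (e ▸ hnd)
    have := (List.append_cons_inj_of_notMem (fun hm => h4.2.2 t hm t (by simp) rfl)
      (List.nodup_cons.1 h4.2.1).1).1 e
    exact ⟨this.1, this.2.2⟩
  have hn := h.nodup
  have hmem : t ∈ (lobe i X2).map Letter.tag ++ (lobe i X1).map Letter.tag := by simp [ht]
  rcases List.mem_append.1 hmem with hm | hm
  · obtain ⟨y, hy, rfl⟩ := List.mem_map.1 hm
    obtain ⟨hy, hyl⟩ := List.mem_filter.1 hy
    have hyl : y.lab = i := by simpa using hyl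
    obtain ⟨C, D, rfl⟩ := List.append_of_mem hy
    obtain ⟨rfl, rfl⟩ := uniq ((lobe i C).map Letter.tag)
      ((lobe i D).map Letter.tag ++ (lobe i X1).map Letter.tag)
      (by rw [← ht, lobe_append, lobe_cons, if_pos hyl]; simp)
    have e : X1 ++ z :: (C ++ y :: D) = (X1 ++ z :: C) ++ y :: D := by simp
    rw [e] at hn
    rw [e, dropTag_append_cons hn, ← e]
    simp only [List.length_append, List.length_map] at hS ⊢
    obtain ⟨SC, SD, S1, s, rfl, hC, hD, hS1⟩ : ∃ SC SD S1 s, S = SC ++ (SD ++ (S1 ++ [s])) ∧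
        SC.length = (lobe i C).length ∧ SD.length = (lobe i D).length ∧
        S1.length = (lobe i X1).length := by
      refine ⟨S.take (lobe i C).length, (S.drop (lobe i C).length).take (lobe i D).length,
        ((S.drop (lobe i C).length).drop (lobe i D).length).take (lobe i X1).length,
        S[S.length - 1]'(by omega), ?_, by simp; omega, by simp; omega, by simp; omega⟩
      have : [S[S.length - 1]'(by omega)] =
          ((S.drop (lobe i C).length).drop (lobe i D).length).drop (lobe i X1).length := by
        rw [List.drop_drop, List.drop_drop, List.drop_eq_getElem_cons (by omega),
          List.drop_of_length_le
          (by omega)]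
        congr 2; omega
      rw [this, List.take_append_drop, List.take_append_drop, List.take_append_drop]
    have e1 : X1 ++ z :: C ++ D = X1 ++ z :: (C ++ D) := by simp
    rw [List.take_left' hC, List.drop_left' hC, e1, ← List.append_assoc SC, fill_split hz hzf h1 hS1
      (by simp [hC, hD])]
    have e2 : SC ++ [] :: (SD ++ (S1 ++ [s])) = (SC ++ [] :: SD) ++ (S1 ++ [s]) := by simp
    rw [e2, fill_split hz hzf h1 hS1 (by simp [lobe_cons, hyl, hC, hD]), sub_append' hC,
      sub_append' hC, sub_cons_pos _ _ hyl]
    simp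
  · obtain ⟨y, hy, rfl⟩ := List.mem_map.1 hm
    obtain ⟨hy, hyl⟩ := List.mem_filter.1 hy
    have hyl : y.lab = i := by simpa using hyl
    obtain ⟨C, D, rfl⟩ := List.append_of_mem hy
    obtain ⟨rfl, rfl⟩ := uniq ((lobe i X2).map Letter.tag ++ (lobe i C).map Letter.tag)
      ((lobe i D).map Letter.tag)
      (by rw [← ht, lobe_append, lobe_cons, if_pos hyl]; simp)
    have e : C ++ y :: D ++ z :: X2 = C ++ y :: (D ++ z :: X2) := by simp
    rw [e] at hn
    rw [e, dropTag_append_cons hn, ← e]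
    simp only [List.length_append, List.length_map] at hS ⊢
    obtain ⟨S2, SC, SD, s, rfl, hS2, hC, hD⟩ : ∃ S2 SC SD s, S = S2 ++ (SC ++ (SD ++ [s])) ∧
        S2.length = (lobe i X2).length ∧ SC.length = (lobe i C).length ∧
        SD.length = (lobe i D).length := by
      refine ⟨S.take (lobe i X2).length, (S.drop (lobe i X2).length).take (lobe i C).length,
        ((S.drop (lobe i X2).length).drop (lobe i C).length).take (lobe i D).length,
        S[S.length - 1]'(by omega), ?_, by simp; omega, by simp; omega, by simp; omega⟩
      have : [S[S.length - 1]'(by omega)] =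
          ((S.drop (lobe i X2).length).drop (lobe i C).length).drop (lobe i D).length := by
        rw [List.drop_drop, List.drop_drop, List.drop_eq_getElem_cons (by omega),
          List.drop_of_length_le
          (by omega)]
        congr 2; omega
      rw [this, List.take_append_drop, List.take_append_drop, List.take_append_drop]
    have hl : (S2 ++ SC).length = (lobe i X2).length + (lobe i C).length := by simp [hS2, hC]
    rw [← List.append_assoc S2, List.take_left' hl, List.drop_left' hl]
    have hCf : ∀ x ∈ lobe i (C ++ D), x.fin = false := fun x hx => h1 x (by
      rw [lobe_append, List.mem_append] at hx ⊢
      rw [lobe_cons, if_pos hyl, List.mem_cons]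
      tauto)
    have e1 : C ++ (D ++ z :: X2) = (C ++ D) ++ z :: X2 := by simp
    have e2 : S2 ++ SC ++ (SD ++ [s]) = S2 ++ ((SC ++ SD) ++ [s]) := by simp
    have e3 : S2 ++ SC ++ [] :: (SD ++ [s]) = S2 ++ ((SC ++ [] :: SD) ++ [s]) := by simp
    rw [e1, e2, e3, fill_split hz hzf hCf (by simp [hC, hD]) hS2,
      fill_split hz hzf h1 (by simp [lobe_cons, hyl, hC, hD]) hS2, sub_append' hC, sub_append' hC,
      sub_cons_pos _ _ hyl]
    simp

/-- If the arc that ends at the local zero is replaced by the empty segment, then it could also be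
contracted before the composition. -/
theorem fill_shrink {n i m t : ℕ} {ts : List ℕ} {X : List Letter} (h : IsTagged n X)
    (hi : i < n) (ht : slotTags i X = ts ++ [t]) {S : List (List Letter)}
    (hS : S.length = ts.length + 1) :
    fill i m (shrink i t X) S = fill i m X (S ++ [[]]) := by
  have hlab : ∀ x ∈ X, x.lab ≠ i → x.tag ≠ t := fun x hx hxi e =>
    hxi (lab_of_mem_slotTags h hi (by simp [ht]) hx e).1
  have hnd := nodup_slotTags h hi
  obtain ⟨X1, z, X2, rfl, hz, hzf, h1, h2⟩ := (h.oneFinal hi).exists_split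
  rw [ht] at hnd
  rw [slotTags_split hz hzf h1] at ht
  have f1 := free_of_lobe_free h1
  have f2 := free_of_lobe_free h2
  have hn := h.nodup
  rcases lobe_eq_nil_or i X1 with e1 | ⟨C, y, D, rfl, hy, hD⟩
  · rcases lobe_eq_nil_or i X2 with e2 | ⟨C, y, D, rfl, hy, hD⟩
    · simp [e1, e2] at ht
    · rw [e1, lobe_append, lobe_cons, if_pos hy, hD, List.map_nil, List.append_nil,
        List.map_append] at ht
      obtain ⟨rfl, ht⟩ := List.append_inj' ht rfl
      obtain rfl : y.tag = t := by simpa using ht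
      obtain ⟨SC, s, rfl⟩ : ∃ SC s, S = SC ++ [s] := by
        rcases List.eq_nil_or_concat S with rfl | ⟨SC, s, rfl⟩
        · simp at hS
        · exact ⟨SC, s, by simp⟩
      have hC : SC.length = (lobe i C).length := by simpa using hS
      rw [shrink_right hy hz hzf hn h1 h2, ← List.append_assoc]
      have hXC : ∀ x ∈ lobe i (X1 ++ C), x.fin = false := by
        intro x hx
        rw [lobe_append, e1, List.nil_append] at hx
        exact h2 x (by rw [lobe_append]; simp [hx])
      have e3 := fill_split (i := i) (m := m) (z := ⟨i, true, y.tag⟩) (X1 := X1 ++ C) (X2 := D)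
        (S1 := SC) (S2 := []) (s := s) rfl rfl hXC (by simp [e1, hC]) (by simp [hD])
      have e4 := fill_split (i := i) (m := m) (X1 := X1) (X2 := C ++ y :: D)
        (S1 := []) (S2 := SC ++ [s]) (s := []) hz hzf h1 (by simp [e1])
        (by simp [hC, lobe_cons, hy, hD])
      simp only [List.nil_append] at e3 e4
      rw [e3, e4, sub_append' hC, sub_cons_pos _ _ hy]
      have e5 := sub_append' (i := i) (f := outer i m) (X := X1) (Y := C) (S := []) (T := SC)
        (by simp [e1])
      rw [List.nil_append] at e5
      rw [e5]
      simp
  · rw [lobe_append, lobe_cons, if_pos hy, hD, List.map_append, ← List.append_assoc] at ht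
    obtain ⟨rfl, ht⟩ := List.append_inj' ht rfl
    obtain rfl : y.tag = t := by simpa using ht
    simp only [List.length_append, List.length_map] at hS
    obtain ⟨S2, SC, s, rfl, hS2, hC⟩ : ∃ S2 SC s, S = S2 ++ (SC ++ [s]) ∧
        S2.length = (lobe i X2).length ∧ SC.length = (lobe i C).length := by
      refine ⟨S.take (lobe i X2).length, (S.drop (lobe i X2).length).take (lobe i C).length,
        S[S.length - 1]'(by omega), ?_, by simp; omega, by simp; omega⟩
      have : [S[S.length - 1]'(by omega)] =
          (S.drop (lobe i X2).length).drop (lobe i C).length := by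
        rw [List.drop_drop, List.drop_eq_getElem_cons (by omega), List.drop_of_length_le (by omega)]
        congr 2; omega
      rw [this, List.take_append_drop, List.take_append_drop]
    have e0 : C ++ y :: D ++ z :: X2 = C ++ y :: (D ++ z :: X2) := by simp
    rw [e0] at hn
    rw [e0, shrink_left hy hz hzf hn h1 h2, ← e0]
    have hCf : ∀ x ∈ lobe i C, x.fin = false := fun x hx => h1 x (by rw [lobe_append]; simp [hx])
    rw [fill_split (i := i) (X1 := C) (X2 := D ++ X2) rfl rfl hCf hC (by simp [hD, hS2])]
    have e2 : S2 ++ (SC ++ [s]) ++ [[]] = S2 ++ ((SC ++ [s]) ++ [[]]) := by simp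
    rw [e2, fill_split hz hzf h1 (by simp [hC, lobe_cons, hy, hD]) hS2, sub_append' hC,
      sub_cons_pos _ _ hy]
    have e5 := sub_append' (i := i) (f := outer i m) (X := D) (Y := X2) (S := []) (T := S2)
      (by simp [hD])
    rw [List.nil_append] at e5
    rw [e5]
    simp

section

/-! ### Faces of compositions at the arcs of the outer word -/

theorem perm_frees_lobe_others {n i : ℕ} {X : List Letter} (h : IsTagged n X) (hi : i < n) :
    (frees X).Perm (slotTags i X ++ frees (others i X)) := by
  have h1 := frees_perm (perm_lobe_others i X)
  rw [frees_append] at h1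
  exact h1.trans ((frees_lobe_perm (h.oneFinal hi)).append_right _)

theorem perm_frees_fill' {n i m : ℕ} {X : List Letter} (h : IsTagged n X) (hi : i < n)
    {S : List (List Letter)} (hl : S.length = (slotTags i X).length + 1) :
    (slotTags i X ++ frees (fill i m X S)).Perm (frees X ++ frees S.flatten) := by
  have hlen : S.length = (lobe i X).length := by
    have := length_lobe_pos (h.oneFinal hi)
    rw [hl, length_slotTags]; omega
  have h1 := frees_perm (perm_fill (m := m) hlen)
  rw [frees_append, frees_map_mapLab] at h1
  refine (h1.append_left _).trans ?_
  rw [← List.append_assoc]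
  exact (perm_frees_lobe_others h hi).symm.append_right _

theorem perm_frees_fill_of_perm {n i m : ℕ} {X : List Letter} (h : IsTagged n X) (hi : i < n)
    {S : List (List Letter)} (hl : S.length = (slotTags i X).length + 1) {L : List ℕ}
    (hL : (frees S.flatten).Perm (slotTags i X ++ L)) :
    (frees (fill i m X S)).Perm (frees X ++ L) := by
  rw [← List.perm_append_left_iff (slotTags i X)]
  refine (perm_frees_fill' h hi hl).trans ((hL.append_left _).trans ?_)
  rw [← List.append_assoc, ← List.append_assoc]
  exact List.perm_append_comm.append_right _

theorem slotTags_fill_inner {n i m J : ℕ} {X : List Letter} (h : IsTagged n X) (hi : i < n)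
    {S : List (List Letter)} (hl : S.length = (slotTags i X).length + 1)
    (hJ : ∀ l, l ≠ i → outer i m l ≠ J) (ho : OneFinal (lobe J S.flatten)) :
    slotTags J (fill i m X S) = slotTags J S.flatten := by
  have hlen : S.length = (lobe i X).length := by
    have := length_lobe_pos (h.oneFinal hi)
    rw [hl, length_slotTags]; omega
  have hb : rot (lobe i X) ≤ S.length := by rw [hlen]; exact rot_le _
  have h3 : lobe J (fill i m X S) = lobe J (S.drop (rot (lobe i X))).flatten ++
      lobe J (S.take (rot (lobe i X))).flatten := by
    rw [fill, lobe_sub_inner _ _ (by simpa using hlen), flatten_rotate _ _ hb, lobe_append]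
    exact fun x _ hx => hJ _ hx
  have h4 : lobe J S.flatten = lobe J (S.take (rot (lobe i X))).flatten ++
      lobe J (S.drop (rot (lobe i X))).flatten := by
    rw [← lobe_append, ← List.flatten_append, List.take_append_drop]
  rw [h4] at ho
  rw [slotTags, cyc, h3, ← fromZero_append_comm ho, ← h4]; rfl

theorem length_glue {α : Type*} : ∀ {S T : List (List α)}, S ≠ [] → T ≠ [] →
    (glue S T).length + 1 = S.length + T.length
  | [s], T, _, hT => by
    cases T with
    | nil => exact absurd rfl hT
    | cons t T => simp [glue, appendHead]; omega
  | s :: s' :: S, T, _, hT => by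
    have := length_glue (S := s' :: S) (by simp) hT
    simp only [glue, List.length_cons] at this ⊢; omega

theorem map_filterMap_appendHead {α : Type*} (ψ : α → Option α) (s : List α) (S : List (List α)) :
    (appendHead s S).map (List.filterMap ψ) =
      appendHead (s.filterMap ψ) (S.map (List.filterMap ψ)) := by
  cases S <;> simp [appendHead]

theorem map_filterMap_glue {α : Type*} (ψ : α → Option α) : ∀ S T : List (List α),
    (glue S T).map (List.filterMap ψ) =
      glue (S.map (List.filterMap ψ)) (T.map (List.filterMap ψ))
  | [], T => rfl
  | [s], T => by simp [map_filterMap_appendHead]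
  | s :: s' :: S, T => by
    have := map_filterMap_glue ψ (s' :: S) T
    simp only [glue, List.map_cons] at this ⊢
    rw [this]

theorem map_filterMap_eq {ψ : Letter → Option Letter} {φ : Letter → Letter} {S : List (List Letter)}
    (h : ∀ y ∈ S.flatten, ψ y = some (φ y)) : S.map (List.filterMap ψ) = S.map (List.map φ) := by
  refine List.map_congr_left fun s hs => ?_
  rw [← List.filterMap_eq_map]
  exact List.filterMap_congr fun y hy => h y (List.mem_flatten.2 ⟨s, hs, hy⟩)

theorem map_filterMap_eq_self {ψ : Letter → Option Letter} {S : List (List Letter)}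
    (h : ∀ y ∈ S.flatten, ψ y = some y) : S.map (List.filterMap ψ) = S := by
  rw [map_filterMap_eq (φ := id) h]; simp

theorem rk_of_lt {F L : List ℕ} {t : ℕ} (h : ∀ y ∈ L, t < y) : rk t (F ++ L) = rk t F := by
  rw [rk_append, show rk t L = 0 from List.countP_eq_zero.2 fun y hy => by
    have := h y hy; simp; omega, add_zero]

theorem rk_of_gt {F L : List ℕ} {t : ℕ} (h : ∀ y ∈ F, y < t) :
    rk t (F ++ L) = F.length + rk t L := by
  rw [rk_append, show rk t F = F.length from List.countP_eq_length.2 fun y hy => by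
    simpa using h y hy]

variable {k : Type*} [CommRing k] {n m i : ℕ} {X V : List Letter}

theorem frees_lt (hXV : ∀ x ∈ X, ∀ y ∈ V, x.tag < y.tag) :
    ∀ s ∈ frees X, ∀ t ∈ frees V, s < t := by
  intro s hs t ht
  obtain ⟨x, hx, -, rfl⟩ := mem_frees.1 hs
  obtain ⟨y, hy, -, rfl⟩ := mem_frees.1 ht
  exact hXV x hx y hy

theorem tag_of_mem_cut {ts : List ℕ} {S : List (List Letter)}
    (hS : S ∈ cutAt ts (V.map (Letter.mapLab (· + i)))) {y : Letter} (hy : y ∈ S.flatten) :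
    (∃ v ∈ V, v.tag = y.tag) ∨ y.tag ∈ ts := by
  rcases mem_flatten_of_mem_cutAt _ _ _ hS y hy with h | ⟨z, hz, t, ht, rfl⟩
  · obtain ⟨v, hv, rfl⟩ := List.mem_map.1 h
    exact Or.inl ⟨v, hv, rfl⟩
  · exact Or.inr ht

/-- The faces of a composition at the special points of the other lobes of the outer word. -/
theorem circ_faceF_outer (hX : IsTagged n X) (hV : IsTagged m V) (hi : i < n)
    (hXV : ∀ x ∈ X, ∀ y ∈ V, x.tag < y.tag) {t : ℕ} (ht : t ∈ frees X) (hti : t ∉ slotTags i X) :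
    circ k i (faceF k t X) (tw k V) =
      lsum (cutAt (slotTags i X) (V.map (Letter.mapLab (· + i)))) fun S =>
        faceF k t (fill i m X S) := by
  have e : slotTags i (dropTag t X) = slotTags i X := by
    rw [slotTags_dropTag hX hi ht, List.filter_eq_self]
    intro s hs
    rw [decide_eq_true_eq]
    rintro rfl; exact hti hs
  rw [faceF, map_smul, LinearMap.smul_apply, circ_tw k (hX.dropTag ht) hV hi
    fun x hx => hXV x (List.mem_of_mem_filter hx), e, ← lsum_smul]
  refine lsum_congr fun S hS => ?_
  have hp := perm_frees_fill (m := m) (hX.oneFinal hi) hS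
  rw [faceF, rk_perm hp, rk_of_lt fun y hy => frees_lt hXV t ht y hy, dropTag_fill_outer]
  · intro x hx hxi e
    refine hti ((mem_slotTags hX hi).2 ⟨x, hx, hxi, fin_false_of_mem_frees hX.nodup ht hx e, e⟩)
  · intro s hs y hy
    rintro rfl
    rcases tag_of_mem_cut hS (List.mem_flatten.2 ⟨s, hs, hy⟩) with ⟨v, hv, e⟩ | h
    · obtain ⟨x, hx, -, e'⟩ := mem_frees.1 ht
      have := hXV x hx v hv
      omega
    · exact hti h

theorem outer_inj {i m a b : ℕ} (ha : a ≠ i) (hb : b ≠ i) : outer i m a = outer i m b ↔ a = b := by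
  unfold outer; split_ifs <;> omega

theorem lobe_fill_outer (hV : IsTagged m V) {l : ℕ} (hli : l ≠ i) {ts : List ℕ}
    {S : List (List Letter)} (hS : S ∈ cutAt ts (V.map (Letter.mapLab (· + i)))) :
    lobe (outer i m l) (fill i m X S) = (lobe l X).map (Letter.mapLab (outer i m)) := by
  refine lobe_sub_outer hli _ _ (fun x _ hx => outer_inj hx hli) fun s hs y hy e => ?_
  have := inner_of_mem_cutAt hV.word hS y
    (List.mem_flatten.2 ⟨s, List.mem_rotate.1 hs, hy⟩)
  rw [e] at this
  exact outer_not_inner hli this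

/-- The faces of a composition at the local zeros of the other lobes of the outer word. -/
theorem circ_faceT_outer (hX : IsTagged n X) (hV : IsTagged m V) (hi : i < n)
    (hXV : ∀ x ∈ X, ∀ y ∈ V, x.tag < y.tag) {l : ℕ} (hl : l < n) (hli : l ≠ i) :
    circ k i (faceT k l X) (tw k V) =
      lsum (cutAt (slotTags i X) (V.map (Letter.mapLab (· + i)))) fun S =>
        faceT k (outer i m l) (fill i m X S) := by
  have hs : ∀ S ∈ cutAt (slotTags i X) (V.map (Letter.mapLab (· + i))),
      slotTags (outer i m l) (fill i m X S) = slotTags l X := by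
    intro S hS
    rw [slotTags, cyc, lobe_fill_outer hV hli hS,
      fromZero_map (Letter.mapLab (outer i m)) (fun _ _ => rfl), ← List.map_dropLast, List.map_map]
    rfl
  rcases List.eq_nil_or_concat (slotTags l X) with e | ⟨ts, t, e⟩
  · rw [faceT_of_nil e, map_zero, LinearMap.zero_apply, lsum_eq_zero fun S hS => ?_]
    exact faceT_of_nil ((hs S hS).trans e)
  · rw [List.concat_eq_append] at e
    have ht : t ∈ slotTags l X := by simp [e]
    have e0 : slotTags i (shrink l t X) = slotTags i X := slotTags_shrink_of_ne hX hl ht hli.symm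
    have hlt : ∀ x ∈ shrink l t X, ∀ y ∈ V, x.tag < y.tag := by
      intro x hx y hy
      obtain ⟨x', hx', rfl⟩ := List.mem_map.1 hx
      rw [Letter.finalize_tag]
      exact hXV x' (List.mem_of_mem_filter hx') y hy
    have hti : ∀ x ∈ X, x.lab = i → x.tag ≠ t := fun x hx hxi e' =>
      hli ((lab_of_mem_slotTags hX hl ht hx e').1.symm.trans hxi)
    rw [faceT_of_concat e, map_smul, LinearMap.smul_apply, circ_tw k (hX.shrink hl ht) hV hi hlt,
      e0,
      ← lsum_smul]
    refine lsum_congr fun S hS => ?_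
    have htX := slotTags_subset_frees hX hl ht
    have hp := perm_frees_fill (m := m) (hX.oneFinal hi) hS
    rw [faceT_of_concat ((hs S hS).trans e), rk_perm hp,
      rk_of_lt fun y hy => frees_lt hXV t htX y hy,
      shrink_fill_outer hli hti (fun x _ hxi => outer_inj hxi hli) _
        (lobe_shrink_of_ne hX hl ht hli.symm)]
    intro s hs y hy
    have hy' := List.mem_flatten.2 ⟨s, hs, hy⟩
    constructor
    · rintro rfl
      rcases tag_of_mem_cut hS hy' with ⟨v, hv, e⟩ | h
      · obtain ⟨x, hx, -, e'⟩ := mem_frees.1 htX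
        have := hXV x hx v hv
        omega
      · obtain ⟨x, hx, h1, -, h2⟩ := (mem_slotTags hX hi).1 h
        exact hti x hx h1 h2
    · intro e
      have := inner_of_mem_cutAt hV.word hS y hy'
      rw [e] at this
      exact outer_not_inner hli this

/-- The faces of a composition at a special point of the lobe in which the composition takes place.
Contracting the first part of an arc of the inner word that is cut there moves the cut to the end of
the previous arc; if there is no end of an arc before it, then this leaves an empty segment, which
comes from a face of the outer word. -/
theorem lsum_faceF_slot (hX : IsTagged n X) (hV : IsTagged m V) (hi : i < n)
    (hXV : ∀ x ∈ X, ∀ y ∈ V, x.tag < y.tag) {ts1 ts2 : List ℕ} {t : ℕ}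
    (hts : slotTags i X = ts1 ++ t :: ts2) :
    lsum (cutAt (slotTags i X) (V.map (Letter.mapLab (· + i)))) (fun S =>
        faceF k t (fill i m X S)) +
      (if ts2 = [] then circ k i (faceT k i X) (tw k V) else 0) =
    circ k i (faceF k t X) (tw k V) +
      lsum (splits (V.map (Letter.mapLab (· + i)))) fun s => lsum (cutAt ts1 (s.1 ++ [s.2.1])) fun S1 =>
        lsum (cutAt ts2 s.2.2) fun S2 => (-1 : k) ^ rk t (frees X) • tw k (fill i m X (S1 ++ S2)) := by
  have hm : t ∈ slotTags i X := by simp [hts]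
  have ht := slotTags_subset_frees hX hi hm
  have hnd := nodup_slotTags hX hi
  rw [hts] at hnd
  have hnd' := List.nodup_append.1 hnd
  have ht1 : t ∉ ts1 := fun h => hnd'.2.2 t h t (by simp) rfl
  have ht2 : t ∉ ts2 := (List.nodup_cons.1 hnd'.2.1).1
  have htV : ∀ x ∈ V.map (Letter.mapLab (· + i)), x.tag ≠ t := by
    intro x hx
    obtain ⟨v, hv, rfl⟩ := List.mem_map.1 hx
    obtain ⟨x, hx, -, e'⟩ := mem_frees.1 ht
    have := hXV x hx v hv
    simp only [Letter.mapLab_tag]; omega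
  have key := lsum_cutAt_dropTag ht2 ts1 (V.map (Letter.mapLab (· + i))) ht1 htV
    fun S => (-1 : k) ^ rk t (frees X) • tw k (fill i m X S)
  have e1 : lsum (cutAt (slotTags i X) (V.map (Letter.mapLab (· + i)))) (fun S =>
        faceF k t (fill i m X S)) = lsum (cutAt (ts1 ++ t :: ts2) (V.map (Letter.mapLab (· + i))))
        fun S => (-1 : k) ^ rk t (frees X) • tw k (fill i m X (S.map (dropTag t))) := by
    rw [← hts]
    refine lsum_congr fun S hS => ?_
    have hp := perm_frees_fill (m := m) (hX.oneFinal hi) hS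
    rw [faceF, rk_perm hp, rk_of_lt fun y hy => frees_lt hXV t ht y hy, dropTag_fill]
    exact fun x hx hxi e => hxi (lab_of_mem_slotTags hX hi hm hx e).1
  have e2 : (if ts2 = [] then circ k i (faceT k i X) (tw k V) else 0) = if ts2 = [] then
      lsum (cutAt ts1 (V.map (Letter.mapLab (· + i)))) (fun S =>
        (-1 : k) ^ rk t (frees X) • tw k (fill i m X (S ++ [[]]))) else 0 := by
    split_ifs with h
    · subst h
      have hlt : ∀ x ∈ shrink i t X, ∀ y ∈ V, x.tag < y.tag := by
        intro x hx y hy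
        obtain ⟨x', hx', rfl⟩ := List.mem_map.1 hx
        rw [Letter.finalize_tag]
        exact hXV x' (List.mem_of_mem_filter hx') y hy
      rw [faceT_of_concat hts, map_smul, LinearMap.smul_apply,
        circ_tw k (hX.shrink hi hm) hV hi hlt,
        slotTags_shrink_self hX hi hts, ← lsum_smul]
      refine lsum_congr fun S hS => ?_
      rw [fill_shrink hX hi hts (length_of_mem_cutAt _ _ _ hS)]
    · rfl
  have e3 : circ k i (faceF k t X) (tw k V) = lsum (cutAt (ts1 ++ ts2)
      (V.map (Letter.mapLab (· + i)))) fun S => (-1 : k) ^ rk t (frees X) •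
        tw k (fill i m X (S.take ts1.length ++ [] :: S.drop ts1.length)) := by
    have e : slotTags i (dropTag t X) = ts1 ++ ts2 := by
      rw [slotTags_dropTag hX hi ht, hts, List.filter_append, List.filter_cons_of_neg (by simp),
        List.filter_eq_self.2, List.filter_eq_self.2]
      · intro s hs
        rw [decide_eq_true_eq]
        rintro rfl; exact ht2 hs
      · intro s hs
        rw [decide_eq_true_eq]
        rintro rfl; exact ht1 hs
    rw [faceF, map_smul, LinearMap.smul_apply, circ_tw k (hX.dropTag ht) hV hi
      fun x hx => hXV x (List.mem_of_mem_filter hx), e, ← lsum_smul]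
    refine lsum_congr fun S hS => ?_
    rw [fill_dropTag hX hi hts]
    rw [length_of_mem_cutAt _ _ _ hS, List.length_append]
  rw [e1, e2, e3]
  exact key

end

section

/-! ### Faces of composed words at cut arcs -/

variable {k : Type*} [CommRing k] {n m i : ℕ} {X V : List Letter}

/-- Cut an arc, given by the name of its end, and forget its second part. -/
def Letter.cutIf (u t : ℕ) (x : Letter) : Letter := if x.tag = u then x.cut t else x

theorem cutAt_concat_cut {A : List Letter} {y : Letter} {t : ℕ} {ts : List ℕ}
    (hA : ∀ x ∈ A, x.tag ≠ y.tag) (hts : ∀ s ∈ ts, s ≠ y.tag) :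
    cutAt ts (A ++ [y.cut t]) =
      (cutAt ts (A ++ [y])).map (List.map (List.map (Letter.cutIf y.tag t))) := by
  have h3 := cutAt_map (Letter.cutIf y.tag t) id ts (A ++ [y]) (fun x _ s hs => by
    rw [Letter.cutIf, Letter.cutIf, if_neg (show (x.cut s).tag ≠ y.tag from hts s hs)]
    split_ifs <;> rfl)
  have h4 : (A ++ [y]).map (Letter.cutIf y.tag t) = A ++ [y.cut t] := by
    rw [List.map_append, List.map_singleton]
    congr 1
    · conv_rhs => rw [← List.map_id A]
      exact List.map_congr_left fun x hx => if_neg (hA x hx)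
    · simp [Letter.cutIf]
  rwa [List.map_id, h4] at h3

/-- Contracting the second part of an arc of the inner word that is cut moves the cut to the end of
this arc. -/
theorem faceAt_of_cut (hX : IsTagged n X) (hV : IsTagged m V) (hi : i < n)
    (hXV : ∀ x ∈ X, ∀ y ∈ V, x.tag < y.tag) {A B : List Letter} {y : Letter}
    (hVe : V.map (Letter.mapLab (· + i)) = A ++ y :: B) {ts1 ts2 : List ℕ} {t : ℕ}
    (hts : slotTags i X = ts1 ++ t :: ts2) {S1 S2 : List (List Letter)}
    (hS1 : S1 ∈ cutAt ts1 (A ++ [y])) (hS2 : S2 ∈ cutAt ts2 B) :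
    faceAt k (fill i m X (S1.map (List.map (Letter.cutIf y.tag t)) ++ appendHead [y] S2)) y =
      -((-1 : k) ^ rk t (frees X) • tw k (fill i m X (S1 ++ S2))) := by
  have hW : ∀ x ∈ A ++ y :: B, ∃ v ∈ V, v.tag = x.tag := by
    intro x hx
    rw [← hVe] at hx
    obtain ⟨v, hv, rfl⟩ := List.mem_map.1 hx
    exact ⟨v, hv, rfl⟩
  have hWn : ((A ++ y :: B).map Letter.tag).Nodup := by
    rw [← hVe, tags_map_mapLab]; exact hV.nodup
  have hfW : frees V = frees (A ++ y :: B) := by rw [← hVe, frees_map_mapLab]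
  obtain ⟨nA, nB⟩ := tag_ne_of_nodup hWn
  have hm : t ∈ slotTags i X := by simp [hts]
  have ht := slotTags_subset_frees hX hi hm
  have hlt : ∀ s ∈ slotTags i X, ∀ x ∈ A ++ y :: B, s < x.tag := by
    intro s hs x hx
    obtain ⟨v, hv, e⟩ := hW x hx
    obtain ⟨x', hx', -, e'⟩ := mem_frees.1 (slotTags_subset_frees hX hi hs)
    have := hXV x' hx' v hv
    omega
  have hty : t < y.tag := hlt t hm y (by simp)
  have hnd := nodup_slotTags hX hi
  rw [hts] at hnd
  have hnd' := List.nodup_append.1 hnd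
  have ht1 : t ∉ ts1 := fun h => hnd'.2.2 t h t (by simp) rfl
  have ht2 : t ∉ ts2 := (List.nodup_cons.1 hnd'.2.1).1
  have hl1 := length_of_mem_cutAt _ _ _ hS1
  have hl2 := length_of_mem_cutAt _ _ _ hS2
  have hy1 : ∀ x ∈ S1.flatten, (x.tag = y.tag → x = y) ∧ x.tag ≠ t := by
    intro x hx
    rcases mem_flatten_of_mem_cutAt _ _ _ hS1 x hx with h | ⟨z, hz, s, hs, rfl⟩
    · constructor
      · intro e
        rcases List.mem_append.1 h with h | h
        · exact absurd e (nA x h)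
        · simpa using h
      · have : x ∈ A ++ y :: B := by
          simp only [List.mem_append, List.mem_cons] at h ⊢; tauto
        have := hlt t hm x this
        omega
    · have h1 := hlt s (by simp [hts, hs]) y (by simp)
      refine ⟨fun e => ?_, ?_⟩
      · simp only [Letter.cut_tag] at e; omega
      · rintro rfl; exact ht1 hs
  have hy2 : ∀ x ∈ S2.flatten, x.tag ≠ y.tag ∧ x.tag ≠ t := by
    intro x hx
    rcases mem_flatten_of_mem_cutAt _ _ _ hS2 x hx with h | ⟨z, hz, s, hs, rfl⟩
    · have := hlt t hm x (by simp [h])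
      exact ⟨nB x h, by omega⟩
    · have h1 := hlt s (by simp [hts, hs]) y (by simp)
      refine ⟨?_, ?_⟩
      · simp only [Letter.cut_tag]; omega
      · rintro rfl; exact ht2 hs
  have hXy : ∀ x ∈ X, x.tag ≠ y.tag := by
    intro x hx
    obtain ⟨v, hv, e⟩ := hW y (by simp)
    have := hXV x hx v hv
    omega
  have hXt : ∀ x ∈ X, x.lab ≠ i → x.tag ≠ t := fun x hx hxi e =>
    hxi (lab_of_mem_slotTags hX hi hm hx e).1
  have hap : appendHead [y] S2 ≠ [] := by simp [appendHead]
  have hne2 := ne_nil_of_mem_cutAt hS2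
  have hlen : (S1.map (List.map (Letter.cutIf y.tag t)) ++ appendHead [y] S2).length =
      (slotTags i X).length + 1 := by
    rw [hts]; simp [hl1, hl2]; omega
  have hlen' : (S1 ++ S2).length = (slotTags i X).length + 1 := by
    rw [hts]; simp [hl1, hl2]; omega
  have hp1 := perm_frees_of_mem_cutAt _ _ _ hS1
  have hp2 := perm_frees_of_mem_cutAt _ _ _ hS2
  -- `S1` with the arc `y` cut at `t`
  have hS1c : S1.map (List.map (Letter.cutIf y.tag t)) ∈ cutAt ts1 (A ++ [y.cut t]) := by
    rw [cutAt_concat_cut nA fun s hs => (hlt s (by simp [hts, hs]) y (by simp)).ne]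
    exact List.mem_map_of_mem hS1
  have hp1c := perm_frees_of_mem_cutAt _ _ _ hS1c
  have hgood : (frees (S1.map (List.map (Letter.cutIf y.tag t)) ++ appendHead [y] S2).flatten).Perm
      (slotTags i X ++ frees V) := by
    rw [List.flatten_append, flatten_appendHead, hfW, hts]
    simp only [frees_append] at hp1c hp2 ⊢
    refine (hp1c.append (hp2.append_left _)).trans ?_
    have e1 : frees [y.cut t] = [t] := by simp
    have e2 : frees (y :: B) = frees [y] ++ frees B := by
      rw [← frees_append, List.singleton_append]
    rw [e1, e2, List.perm_iff_count]
    intro a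
    simp only [List.count_append, List.count_cons, List.count_nil]
    omega
  have hfS := perm_frees_fill_of_perm (m := m) hX hi hlen hgood
  have hfY : (slotTags i X ++ frees (fill i m X (S1 ++ S2))).Perm
      (frees X ++ (ts1 ++ (frees (A ++ [y]) ++ (ts2 ++ frees B)))) := by
    refine (perm_frees_fill' hX hi hlen').trans (List.Perm.append_left _ ?_)
    rw [List.flatten_append, frees_append, ← List.append_assoc]
    exact hp1.append hp2
  by_cases hyf : y.fin = true
  · -- the arc ends at a local zero
    rw [faceAt, if_pos hyf]
    have hyl : i ≤ y.lab ∧ y.lab < i + m := by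
      have : y ∈ V.map (Letter.mapLab (· + i)) := by rw [hVe]; simp
      obtain ⟨v, hv, rfl⟩ := List.mem_map.1 this
      have := lt_of_isWord hV.word hv
      simp only [Letter.mapLab_lab]; omega
    have hV' : ∀ x ∈ A ++ y :: B, x.lab = y.lab → x.fin = true → x = y := by
      intro x hx hxl hxf
      rw [← hVe] at hx
      have hy : y ∈ V.map (Letter.mapLab (· + i)) := by rw [hVe]; simp
      obtain ⟨v, hv, rfl⟩ := List.mem_map.1 hx
      obtain ⟨w, hw, rfl⟩ := List.mem_map.1 hy
      simp only [Letter.mapLab_lab, Nat.add_right_cancel_iff, Letter.mapLab_fin] at hxl hxf hyf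
      obtain ⟨P, Q, rfl⟩ := List.append_of_mem hw
      obtain ⟨f1, f2⟩ := hV.lobe_free hyf
      rcases List.mem_append.1 hv with h | h
      · simp [free_of_lobe_free f1 v h hxl] at hxf
      · rcases List.mem_cons.1 h with rfl | h
        · rfl
        · simp [free_of_lobe_free f2 v h hxl] at hxf
    have hfree : ∀ x ∈ A ++ B, x.lab = y.lab → x.fin = false := by
      intro x hx e
      by_contra hf
      obtain rfl := hV' x (by simp only [List.mem_append, List.mem_cons] at hx ⊢; tauto) e
        (by simpa using hf)
      rcases List.mem_append.1 hx with h | h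
      · exact nA x h rfl
      · exact nB x h rfl
    have hf1 : ∀ x ∈ (S1.map (List.map (Letter.cutIf y.tag t))).flatten, x.lab = y.lab →
        x.fin = false := by
      intro x hx e
      rcases mem_flatten_of_mem_cutAt _ _ _ hS1c x hx with h | ⟨z, hz, s, hs, rfl⟩
      · rcases List.mem_append.1 h with h | h
        · exact hfree x (by simp [h]) e
        · obtain rfl : x = y.cut t := by simpa using h
          rfl
      · rfl
    have hf2 : ∀ x ∈ S2.flatten, x.lab = y.lab → x.fin = false := by
      intro x hx e
      rcases mem_flatten_of_mem_cutAt _ _ _ hS2 x hx with h | ⟨z, hz, s, hs, rfl⟩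
      · exact hfree x (by simp [h]) e
      · rfl
    have hfl : (S1.map (List.map (Letter.cutIf y.tag t)) ++ appendHead [y] S2).flatten =
        (S1.map (List.map (Letter.cutIf y.tag t))).flatten ++ y :: S2.flatten := by
      rw [List.flatten_append, flatten_appendHead]; rfl
    have hlf : ∀ x ∈ lobe y.lab (S1.map (List.map (Letter.cutIf y.tag t))).flatten,
        x.fin = false := fun x hx => by
      obtain ⟨hx, e⟩ := List.mem_filter.1 hx
      exact hf1 x hx (by simpa using e)
    have hlf2 : ∀ x ∈ lobe y.lab S2.flatten, x.fin = false := fun x hx => by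
      obtain ⟨hx, e⟩ := List.mem_filter.1 hx
      exact hf2 x hx (by simpa using e)
    have hslot : ∃ ts', slotTags y.lab
        (fill i m X (S1.map (List.map (Letter.cutIf y.tag t)) ++ appendHead [y] S2)) =
          ts' ++ [t] := by
      rw [slotTags_fill_inner hX hi hlen, hfl, slotTags_split rfl hyf hlf]
      · have := getLast?_lobe_of_mem_cutAt y.lab _ _ _ hS1c
        rw [lobe_append, lobe_cons, if_pos (by rfl), lobe_nil, List.getLast?_concat,
          List.getLast?_eq_some_iff] at this
        obtain ⟨P, e⟩ := this
        rw [e]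
        exact ⟨(lobe y.lab S2.flatten).map Letter.tag ++ P.map Letter.tag, by simp⟩
      · intro l hl e
        exact outer_not_inner (m := m) hl (e ▸ hyl)
      · rw [hfl]
        exact ⟨lobe y.lab (S1.map (List.map (Letter.cutIf y.tag t))).flatten, y,
          lobe y.lab S2.flatten, by rw [lobe_append, lobe_cons, if_pos rfl], hyf, hlf, hlf2⟩
    obtain ⟨ts', hslot⟩ := hslot
    rw [faceT_of_concat hslot, rk_perm hfS, rk_of_lt fun y hy => frees_lt hXV t ht y hy]
    congr 2
    rw [shrink_fill]
    swap
    · intro x hx hxi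
      refine ⟨hXt x hx hxi, fun e => outer_not_inner (m := m) hxi (e ▸ hyl)⟩
    -- the arc `y` is renamed
    have hre : fill i m X ((S1.map (List.map (Letter.cutIf y.tag t)) ++ appendHead [y] S2).map
        (shrink y.lab t)) = (fill i m X (S1 ++ S2)).map
          (Letter.retag fun s => if s = y.tag then t else s) := by
      rw [← List.filterMap_eq_map (f := Letter.retag fun s => if s = y.tag then t else s),
        filterMap_fill]
      · congr 1
        have e : shrink y.lab t = List.filterMap (shrinkLetter y.lab t) :=
          funext (shrink_eq_filterMap _ t)
        rw [List.map_append, List.map_append, e, map_filterMap_appendHead, List.map_map]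
        congr 1
        · refine List.map_congr_left fun s hs => ?_
          rw [Function.comp_apply, List.filterMap_map]
          refine List.filterMap_congr fun x hx => ?_
          have hxS := List.mem_flatten.2 ⟨s, hs, hx⟩
          have hxS' : x.cutIf y.tag t ∈ (S1.map (List.map (Letter.cutIf y.tag t))).flatten := by
            rw [← List.map_flatten]; exact List.mem_map_of_mem hxS
          have h1 := hf1 _ hxS'
          rw [Function.comp_apply, shrinkLetter, if_neg (by
            rintro ⟨h2, h3⟩; simp [h1 h2] at h3)]
          obtain ⟨h2, h3⟩ := hy1 x hxS
          by_cases e' : x.tag = y.tag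
          · obtain rfl := h2 e'
            simp [Letter.cutIf, Letter.finalize, Letter.retag, Letter.cut, hyf]
          · simp [Letter.cutIf, Letter.finalize, Letter.retag, e', h3]
        · have e1 : List.filterMap (shrinkLetter y.lab t) [y] = [] := by
            simp [shrinkLetter, hyf]
          rw [e1, map_filterMap_eq_self, map_filterMap_eq_self, appendHead_nil hne2]
          · intro x hx
            simp [Letter.retag, (hy2 x hx).1]
          · intro x hx
            rw [shrinkLetter, if_neg, Letter.finalize_of_ne (hy2 x hx).2]
            rintro ⟨h2, h3⟩
            simp [hf2 x hx h2] at h3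
      · intro x hx _
        simp [Letter.retag, Letter.mapLab, hXy x hx]
    rw [hre, tw, tw, forget_map_retag, frees_map_retag]
    congr 2
    conv_rhs => rw [← List.map_id (frees (fill i m X (S1 ++ S2)))]
    refine List.map_congr_left fun s hs => if_neg ?_
    rintro rfl
    have : y.tag ∈ frees X ++ (ts1 ++ (frees (A ++ [y]) ++ (ts2 ++ frees B))) :=
      hfY.subset (by simp [hs])
    simp only [frees_append, List.mem_append] at this
    have k1 : ∀ s ∈ slotTags i X, y.tag ≠ s := fun s hs e => by
      have := hlt s hs y (by simp); omega
    have k2 : ∀ C : List Letter, (∀ c ∈ C, c.tag ≠ y.tag) → y.tag ∉ frees C := by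
      intro C hC h
      obtain ⟨c, hc, -, e⟩ := mem_frees.1 h
      exact hC c hc e
    rcases this with h | h | (h | h) | h | h
    · exact k2 X hXy h
    · exact k1 y.tag (by simp [hts, h]) rfl
    · exact k2 A nA h
    · simp [frees_cons, hyf] at h
    · exact k1 y.tag (by simp [hts, h]) rfl
    · exact k2 B nB h
  · -- the arc ends at a special point
    have hyf : y.fin = false := by simpa using hyf
    rw [faceAt, if_neg (by simp [hyf]), faceF, dropTag_fill _ fun x hx _ => hXy x hx]
    have hre : fill i m X ((S1.map (List.map (Letter.cutIf y.tag t)) ++ appendHead [y] S2).map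
        (dropTag y.tag)) = (fill i m X (S1 ++ S2)).map
          (Letter.retag fun s => if s = y.tag then t else s) := by
      rw [← List.filterMap_eq_map (f := Letter.retag fun s => if s = y.tag then t else s),
        filterMap_fill]
      · congr 1
        rw [List.map_append, List.map_append, dropTag_eq_filterMap, map_filterMap_appendHead,
          List.map_map]
        congr 1
        · refine List.map_congr_left fun s hs => ?_
          rw [Function.comp_apply, List.filterMap_map]
          refine List.filterMap_congr fun x hx => ?_
          have hxS := List.mem_flatten.2 ⟨s, hs, hx⟩
          obtain ⟨h2, h3⟩ := hy1 x hxS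
          by_cases e' : x.tag = y.tag
          · obtain rfl := h2 e'
            have : t ≠ x.tag := by omega
            simp [Letter.cutIf, dropLetter, Letter.retag, Letter.cut, hyf, this]
          · simp [Letter.cutIf, dropLetter, Letter.retag, e']
        · have e1 : List.filterMap (dropLetter y.tag) [y] = [] := by simp [dropLetter]
          rw [e1, map_filterMap_eq_self, map_filterMap_eq_self, appendHead_nil hne2]
          · intro x hx
            simp [Letter.retag, (hy2 x hx).1]
          · intro x hx
            simp [dropLetter, (hy2 x hx).1]
      · intro x hx _
        simp [Letter.retag, Letter.mapLab, hXy x hx]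
    rw [hre, tw, tw, forget_map_retag, frees_map_retag, rk_perm hfS]
    -- the places of the two coordinates
    have hfX : (frees X ++ frees V).Perm (t :: frees (fill i m X (S1 ++ S2))) := by
      rw [← List.perm_append_left_iff (ts1 ++ ts2), hfW]
      have e1 : (ts1 ++ ts2 ++ t :: frees (fill i m X (S1 ++ S2))).Perm
          (slotTags i X ++ frees (fill i m X (S1 ++ S2))) := by
        rw [hts, List.perm_iff_count]
        intro a
        simp only [List.count_append, List.count_cons]
        omega
      refine (List.Perm.trans ?_ hfY.symm).trans e1.symm
      rw [List.perm_iff_count]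
      intro a
      simp only [List.count_append, frees_append, frees_cons, hyf, Bool.false_eq_true, if_false,
        List.count_cons, frees_nil, List.count_nil]
      omega
    have hyfr : y.tag ∈ frees (fill i m X (S1 ++ S2)) := by
      have h1 : y.tag ∈ frees X ++ frees V := by
        rw [hfW]; simp [frees_cons, hyf]
      rcases List.mem_cons.1 (hfX.subset h1) with h | h
      · omega
      · exact h
    have hnodup : (t :: frees (fill i m X (S1 ++ S2))).Nodup := by
      rw [← hfX.nodup_iff]
      refine (hX.nodup.sublist (frees_sublist X)).append (hV.nodup.sublist (frees_sublist V)) ?_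
      intro a h1 h2
      have := frees_lt hXV a h1 a h2
      omega
    obtain ⟨P, Q, hPQ⟩ := List.append_of_mem hyfr
    rw [hPQ] at hfX hnodup ⊢
    have hnd2 := List.nodup_cons.1 hnodup
    have hnd3 := List.nodup_append.1 hnd2.2
    have hyP : y.tag ∉ P := fun h => hnd3.2.2 _ h _ (by simp) rfl
    have hyQ : y.tag ∉ Q := (List.nodup_cons.1 hnd3.2.1).1
    have htP : t ∉ P := fun h => hnd2.1 (by simp [h])
    have hmap : (P ++ y.tag :: Q).map (fun s => if s = y.tag then t else s) = P ++ t :: Q := by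
      have : ∀ R : List ℕ, y.tag ∉ R → R.map (fun s => if s = y.tag then t else s) = R := by
        intro R hR
        conv_rhs => rw [← List.map_id R]
        refine List.map_congr_left fun s hs => if_neg ?_
        rintro rfl; exact hR hs
      rw [List.map_append, List.map_cons, this P hyP, this Q hyQ, if_pos rfl]
    have r1 : rk y.tag (frees X ++ frees V) = rk y.tag (P ++ Q) + 1 := by
      rw [rk_perm hfX]; simp [hty]
    have r2 : rk t (frees X) = rk t (P ++ Q) := by
      rw [← rk_of_lt (L := frees V) fun y hy => frees_lt hXV t ht y hy, rk_perm hfX]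
      simp; omega
    have hs := sgn_replace (k := k) P Q y.tag t hyP htP
    change (-1) ^ rk y.tag (P ++ Q) * _ = (-1) ^ rk t (P ++ Q) * _ at hs
    rw [hmap, r1, r2, smul_smul, smul_smul, ← neg_smul]
    congr 1
    have q1 := neg_one_pow_mul_self (k := k) (rk y.tag (P ++ Q))
    have q2 := neg_one_pow_mul_self (k := k) (rk t (P ++ Q))
    rw [pow_succ]
    generalize (-1 : k) ^ rk y.tag (P ++ Q) = a at *
    generalize (-1 : k) ^ rk t (P ++ Q) = b at *
    linear_combination (a * b) * hs + a * sgn k (P ++ t :: Q) * q2 - b * sgn k (P ++ y.tag :: Q) * q1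

end

section

/-! ### The Leibniz rule for compositions -/

variable {k : Type*} [CommRing k] {n m i : ℕ} {X V : List Letter}

theorem getLast?_slotTags {l : ℕ} {A B A' B' : List Letter} {y : Letter} (hl : y.lab = l)
    (hy : y.fin = true) (hA : ∀ x ∈ lobe l A, x.fin = false)
    (hA' : ∀ x ∈ lobe l A', x.fin = false) (h1 : (lobe l A').getLast? = (lobe l A).getLast?)
    (h2 : (lobe l B').getLast? = (lobe l B).getLast?) :
    (slotTags l (A' ++ y :: B')).getLast? = (slotTags l (A ++ y :: B)).getLast? := by
  rw [slotTags_split hl hy hA, slotTags_split hl hy hA', List.getLast?_append, List.getLast?_append,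
    List.getLast?_map, List.getLast?_map, List.getLast?_map, List.getLast?_map, h1, h2]

theorem faceT_of_getLast? {l t : ℕ} {X : List Letter} (h : (slotTags l X).getLast? = some t) :
    faceT k l X = (-1 : k) ^ rk t (frees X) • tw k (shrink l t X) := by
  obtain ⟨ts, e⟩ := List.getLast?_eq_some_iff.1 h
  exact faceT_of_concat e

theorem shrink_map_mapLab {l t i : ℕ} (V : List Letter) :
    (shrink l t V).map (Letter.mapLab (· + i)) =
      shrink (l + i) t (V.map (Letter.mapLab (· + i))) := by
  rw [shrink, shrink, List.filter_map, List.map_map, List.map_map]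
  congr 1
  · funext x
    by_cases h : x.tag = t <;> simp [Letter.finalize, h, Letter.mapLab]
  · refine List.filter_congr fun x _ => ?_
    simp

theorem dropTag_map_mapLab {t : ℕ} (f : ℕ → ℕ) (V : List Letter) :
    (dropTag t V).map (Letter.mapLab f) = dropTag t (V.map (Letter.mapLab f)) := by
  rw [dropTag, dropTag, List.filter_map]
  rfl

theorem map_filterMap_glue_appendHead {ψ : Letter → Option Letter} {φ : Letter → Letter}
    {y : Letter} (hy : ψ y = none) {S R : List (List Letter)} (hR : R ≠ [])
    (h1 : ∀ x ∈ S.flatten, ψ x = some (φ x)) (h2 : ∀ x ∈ R.flatten, ψ x = some (φ x)) :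
    (glue S (appendHead [y] R)).map (List.filterMap ψ) = (glue S R).map (List.map φ) := by
  have e : ([y].filterMap ψ) = [] := by simp [hy]
  have e' : List.map φ = List.filterMap (some ∘ φ) := by funext l; rw [List.filterMap_eq_map]
  rw [map_filterMap_glue, map_filterMap_appendHead, e, appendHead_nil (by simpa using hR),
    map_filterMap_eq h1, map_filterMap_eq h2, e', map_filterMap_glue]

/-- The faces of a composition at an arc of the inner word. The terms in which this arc is cut are
faces at the cut, with the opposite sign. -/
theorem lsum_faceAt_inner (hX : IsTagged n X) (hV : IsTagged m V) (hi : i < n)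
    (hXV : ∀ x ∈ X, ∀ y ∈ V, x.tag < y.tag) {A B : List Letter} {y : Letter}
    (hVe : V = A ++ y :: B) :
    lsum (cutAt (slotTags i X) (V.map (Letter.mapLab (· + i)))) (fun S =>
        faceAt k (fill i m X S) (y.mapLab (· + i))) =
      (-1 : k) ^ (frees X).length • circ k i (tw k X) (faceAt k V y) -
      lsum (splits (slotTags i X)) fun s =>
        lsum (cutAt s.1 (A.map (Letter.mapLab (· + i)) ++ [y.mapLab (· + i)])) fun S1 =>
          lsum (cutAt s.2.2 (B.map (Letter.mapLab (· + i)))) fun S2 =>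
            (-1 : k) ^ rk s.2.1 (frees X) • tw k (fill i m X (S1 ++ S2)) := by
  set W := V.map (Letter.mapLab (· + i)) with hW
  set A' := A.map (Letter.mapLab (· + i)) with hA'
  set B' := B.map (Letter.mapLab (· + i)) with hB'
  set y' := y.mapLab (· + i) with hy'
  have hWe : W = A' ++ y' :: B' := by rw [hW, hVe, List.map_append, List.map_cons]
  obtain ⟨H', hH, hC⟩ : ∃ H' : List (List Letter) → CC k,
      (∀ ts1 ts2 S R, ts1 ++ ts2 = slotTags i X → S ∈ cutAt ts1 A' → R ∈ cutAt ts2 B' →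
        faceAt k (fill i m X (glue S (appendHead [y'] R))) y' = H' (glue S R)) ∧
      lsum (cutAt (slotTags i X) (A' ++ B')) H' =
        (-1 : k) ^ (frees X).length • circ k i (tw k X) (faceAt k V y) := by
    have hWn : ((A' ++ y' :: B').map Letter.tag).Nodup := by
      rw [← hWe, hW, tags_map_mapLab]; exact hV.nodup
    obtain ⟨nA, nB⟩ := tag_ne_of_nodup hWn
    have hts : ∀ t ∈ slotTags i X, ∀ x ∈ V, t < x.tag := by
      intro t ht x hx
      obtain ⟨x', hx', -, e'⟩ := mem_frees.1 (slotTags_subset_frees hX hi ht)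
      have := hXV x' hx' x hx
      omega
    have hyV : y ∈ V := by simp [hVe]
    -- the coordinates of the composition
    have hfr : ∀ ts1 ts2 S R, ts1 ++ ts2 = slotTags i X → S ∈ cutAt ts1 A' → R ∈ cutAt ts2 B' →
        (frees (fill i m X (glue S (appendHead [y'] R)))).Perm (frees X ++ frees V) ∧
        (glue S (appendHead [y'] R)).flatten = S.flatten ++ y' :: R.flatten ∧
        (glue S (appendHead [y'] R)).length = (slotTags i X).length + 1 := by
      intro ts1 ts2 S R e hS hR
      have hS0 := ne_nil_of_mem_cutAt hS
      have e1 : (glue S (appendHead [y'] R)).flatten = S.flatten ++ y' :: R.flatten := by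
        rw [flatten_glue, flatten_appendHead]; rfl
      have hl : (glue S (appendHead [y'] R)).length = (slotTags i X).length + 1 := by
        have h1 := length_glue hS0 (T := appendHead [y'] R) (by simp [appendHead])
        have h2 : (appendHead [y'] R).length = R.length := by
          have := List.length_pos_of_ne_nil (ne_nil_of_mem_cutAt hR)
          rw [length_appendHead]; omega
        rw [h2, length_of_mem_cutAt _ _ _ hS, length_of_mem_cutAt _ _ _ hR] at h1
        rw [← e, List.length_append]; omega
      refine ⟨perm_frees_fill_of_perm hX hi hl ?_, e1, hl⟩
      have p1 := perm_frees_of_mem_cutAt _ _ _ hS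
      have p2 := perm_frees_of_mem_cutAt _ _ _ hR
      have e2 : frees V = frees A' ++ (frees [y'] ++ frees B') := by
        rw [← frees_append, ← frees_append, List.singleton_append, ← hWe, hW, frees_map_mapLab]
      have e3 : frees (y' :: R.flatten) = frees [y'] ++ frees R.flatten := by
        rw [← frees_append, List.singleton_append]
      rw [e1, frees_append, e3, e2, ← e, List.perm_iff_count]
      intro a
      have c1 := p1.count_eq a
      have c2 := p2.count_eq a
      simp only [List.count_append] at c1 c2 ⊢
      omega
    have hXy : ∀ x ∈ X, x.tag ≠ y'.tag := fun x hx => (hXV x hx y hyV).ne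
    have hne : ∀ ts1 ⊆ slotTags i X, ∀ C : List Letter, (∀ c ∈ C, c.tag ≠ y'.tag) →
        ∀ S ∈ cutAt ts1 C, ∀ x ∈ S.flatten, x.tag ≠ y'.tag := by
      intro ts1 hs C hC S hS x hx
      rcases mem_flatten_of_mem_cutAt _ _ _ hS x hx with h | ⟨z, hz, t, ht, rfl⟩
      · exact hC x h
      · exact (hts t (hs ht) y hyV).ne
    by_cases hyf : y.fin = true
    · have hyf' : y'.fin = true := hyf
      have hyw := lt_of_isWord hV.word hyV
      have hyl : i ≤ y'.lab ∧ y'.lab < i + m := by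
        simp only [hy', Letter.mapLab_lab]; omega
      subst hVe
      obtain ⟨f1, f2⟩ := hV.lobe_free hyf
      have g : ∀ C : List Letter, (∀ x ∈ lobe y.lab C, x.fin = false) →
          ∀ x ∈ C.map (Letter.mapLab (· + i)), x.lab = y'.lab → x.fin = false := by
        intro C hC x hx e
        obtain ⟨c, hc, rfl⟩ := List.mem_map.1 hx
        refine free_of_lobe_free hC c hc ?_
        simpa [hy'] using e
      have g1 := g A f1
      have g2 := g B f2
      have gc : ∀ ts1 (C : List Letter), (∀ x ∈ C, x.lab = y'.lab → x.fin = false) →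
          ∀ S ∈ cutAt ts1 C, ∀ x ∈ S.flatten, x.lab = y'.lab → x.fin = false := by
        intro ts1 C hC S hS x hx e
        rcases mem_flatten_of_mem_cutAt _ _ _ hS x hx with h | ⟨z, hz, t, ht, rfl⟩
        · exact hC x h e
        · rfl
      have lf : ∀ C : List Letter, (∀ x ∈ C, x.lab = y'.lab → x.fin = false) →
          ∀ x ∈ lobe y'.lab C, x.fin = false := by
        intro C hC x hx
        obtain ⟨hx, e⟩ := List.mem_filter.1 hx
        exact hC x hx (by simpa using e)
      have hsl : ∀ ts1 ts2 S R, ts1 ++ ts2 = slotTags i X → S ∈ cutAt ts1 A' → R ∈ cutAt ts2 B' →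
          (slotTags y'.lab (fill i m X (glue S (appendHead [y'] R)))).getLast? =
            (slotTags y'.lab (A' ++ y' :: B')).getLast? := by
        intro ts1 ts2 S R e hS hR
        obtain ⟨h1, h2, h3⟩ := hfr ts1 ts2 S R e hS hR
        have q1 := lf _ (gc _ _ g1 _ hS)
        have q2 := lf _ (gc _ _ g2 _ hR)
        rw [slotTags_fill_inner hX hi h3, h2]
        · exact getLast?_slotTags rfl hyf' (lf _ g1) q1
            (getLast?_lobe_of_mem_cutAt _ _ _ _ hS) (getLast?_lobe_of_mem_cutAt _ _ _ _ hR)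
        · intro l hl e
          exact outer_not_inner (m := m) hl (e ▸ hyl)
        · rw [h2]
          exact ⟨lobe y'.lab S.flatten, y', lobe y'.lab R.flatten,
            by rw [lobe_append, lobe_cons, if_pos rfl], hyf', q1, q2⟩
      have hsV : slotTags y'.lab (A' ++ y' :: B') = slotTags y.lab (A ++ y :: B) := by
        rw [← hWe, hW, slotTags_map (i := y.lab) (Letter.mapLab (· + i)) id]
        · simp
        · simp [hy']
        · intro x _; simp
        · simp
      rw [faceAt, if_pos hyf]
      rcases hu : (slotTags y.lab (A ++ y :: B)).getLast? with _ | u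
      · refine ⟨fun _ => 0, ?_, ?_⟩
        · intro ts1 ts2 S R e hS hR
          have := hsl ts1 ts2 S R e hS hR
          rw [hsV, hu, List.getLast?_eq_none_iff] at this
          rw [faceAt, if_pos hyf', faceT_of_nil this, neg_zero]
        · rw [faceT_of_nil (List.getLast?_eq_none_iff.1 hu)]
          simp
      · have hum : u ∈ slotTags y.lab (A ++ y :: B) := List.mem_of_getLast? hu
        have huV := slotTags_subset_frees hV hyw hum
        have hXu : ∀ x ∈ X, x.tag < u := by
          obtain ⟨v, hv, -, e⟩ := mem_frees.1 huV
          intro x hx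
          have := hXV x hx v hv
          omega
        have htu : ∀ t ∈ slotTags i X, t ≠ u := by
          obtain ⟨v, hv, -, e⟩ := mem_frees.1 huV
          intro t ht
          have := hts t ht v hv
          omega
        refine ⟨fun T => -((-1 : k) ^ ((frees X).length + rk u (frees (A ++ y :: B))) •
          tw k (fill i m X (T.map (List.map (Letter.finalize u))))), ?_, ?_⟩
        · intro ts1 ts2 S R e hS hR
          have h0 := hsl ts1 ts2 S R e hS hR
          rw [hsV, hu] at h0
          rw [faceAt, if_pos hyf', faceT_of_getLast? h0, rk_perm (hfr ts1 ts2 S R e hS hR).1,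
            rk_of_gt, shrink_fill]
          · congr 4
            have e' : shrink y'.lab u = List.filterMap (shrinkLetter y'.lab u) :=
              funext (shrink_eq_filterMap _ _)
            have q : ∀ x : Letter, (x.lab = y'.lab → x.fin = false) →
                shrinkLetter y'.lab u x = some (x.finalize u) := by
              intro x hx
              rw [shrinkLetter, if_neg]
              rintro ⟨h1, h2⟩
              simp [hx h1] at h2
            rw [e', map_filterMap_glue_appendHead (φ := Letter.finalize u) (by simp [shrinkLetter, hyf'])
              (ne_nil_of_mem_cutAt hR) (fun x hx => q x (gc _ _ g1 _ hS x hx))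
              (fun x hx => q x (gc _ _ g2 _ hR x hx))]
          · intro x hx hxi
            exact ⟨(hXu x hx).ne, fun e => outer_not_inner (m := m) hxi (e ▸ hyl)⟩
          · intro t ht
            obtain ⟨x, hx, -, rfl⟩ := mem_frees.1 ht
            exact hXu x hx
        · have hlt : ∀ x ∈ X, ∀ z ∈ shrink y.lab u (A ++ y :: B), x.tag < z.tag := by
            intro x hx z hz
            obtain ⟨z', hz', rfl⟩ := List.mem_map.1 hz
            rw [Letter.finalize_tag]
            exact hXV x hx z' (List.mem_of_mem_filter hz')
          have e1 : (shrink y.lab u (A ++ y :: B)).map (Letter.mapLab (· + i)) =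
              (A' ++ B').map (Letter.finalize u) := by
            rw [shrink_map_mapLab, ← hW, hWe, shrink, List.filter_append,
              List.filter_cons_of_neg (by simp [hy', hyf]), List.filter_eq_self.2,
              List.filter_eq_self.2]
            · intro x hx
              have := g2 x hx
              simp only [hy', Letter.mapLab_lab] at this
              simpa [imp_iff_not_or] using this
            · intro x hx
              have := g1 x hx
              simp only [hy', Letter.mapLab_lab] at this
              simpa [imp_iff_not_or] using this
          have e2 : cutAt (slotTags i X) ((A' ++ B').map (Letter.finalize u)) =
              (cutAt (slotTags i X) (A' ++ B')).map (List.map (List.map (Letter.finalize u))) := by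
            have := cutAt_map (Letter.finalize u) id (slotTags i X) (A' ++ B') (fun x hx t ht => by
              rw [Letter.finalize_of_ne (x := x.cut t) (htu t ht)]
              simp [Letter.cut])
            rwa [List.map_id] at this
          rw [faceT_of_getLast? hu, map_neg, map_smul, circ_tw k hX (hV.shrink hyw hum) hi hlt, e1,
            e2, lsum_map, ← lsum_smul, ← lsum_neg, ← lsum_smul]
          refine lsum_congr fun S _ => ?_
          rw [smul_neg, smul_smul, ← pow_add]
    · have hyf0 : y.fin = false := by simpa using hyf
      have hyr : y.tag ∈ frees V := mem_frees.2 ⟨y, hyV, hyf0, rfl⟩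
      rw [faceAt, if_neg hyf]
      refine ⟨fun T => (-1 : k) ^ ((frees X).length + rk y.tag (frees V)) •
        tw k (fill i m X T), ?_, ?_⟩
      · intro ts1 ts2 S R e hS hR
        rw [faceAt, if_neg (show ¬ y'.fin = true from hyf), faceF,
          rk_perm (hfr ts1 ts2 S R e hS hR).1, rk_of_gt, dropTag_fill]
        · congr 3
          rw [dropTag_eq_filterMap, map_filterMap_glue_appendHead (φ := id) (by simp [dropLetter])
            (ne_nil_of_mem_cutAt hR), List.map_id_fun, List.map_id_fun, id]
          · intro x hx
            simp [dropLetter, hne ts1 (by rw [← e]; simp) A' nA S hS x hx]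
          · intro x hx
            simp [dropLetter, hne ts2 (by rw [← e]; simp) B' nB R hR x hx]
        · intro x hx _
          exact hXy x hx
        · intro t ht
          obtain ⟨x, hx, -, rfl⟩ := mem_frees.1 ht
          exact hXV x hx y hyV
      · have e1 : (dropTag y.tag V).map (Letter.mapLab (· + i)) = A' ++ B' := by
          rw [dropTag_map_mapLab, ← hW, hWe]
          exact dropTag_append_cons (x := y') hWn
        rw [faceF, map_smul, circ_tw k hX (hV.dropTag hyr) hi
          (fun x hx z hz => hXV x hx z (List.mem_of_mem_filter hz)), e1, ← lsum_smul, ← lsum_smul]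
        refine lsum_congr fun S _ => ?_
        rw [smul_smul, ← pow_add]
  rw [hWe, lsum_cutAt_cut' y' A' B' (slotTags i X) _ H' hH, hC, sub_eq_add_neg, ← lsum_neg]
  congr 1
  refine lsum_congr fun s hs => ?_
  have hts := eq_of_mem_splits hs
  have hWn : ((A' ++ y' :: B').map Letter.tag).Nodup := by
    rw [← hWe, hW, tags_map_mapLab]; exact hV.nodup
  obtain ⟨nA, nB⟩ := tag_ne_of_nodup hWn
  have hlt : ∀ t ∈ slotTags i X, t < y'.tag := by
    intro t ht
    obtain ⟨x', hx', -, e'⟩ := mem_frees.1 (slotTags_subset_frees hX hi ht)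
    have := hXV x' hx' y (by simp [hVe])
    simp only [hy', Letter.mapLab_tag]; omega
  rw [cutAt_concat_cut nA fun t ht => (hlt t (by rw [hts]; simp [ht])).ne, lsum_map, ← lsum_neg]
  refine lsum_congr fun S1 hS1 => ?_
  rw [← lsum_neg]
  refine lsum_congr fun S2 hS2 => ?_
  exact faceAt_of_cut hX hV hi hXV hWe hts hS1 hS2

theorem splits_map {α β : Type*} (f : α → β) : ∀ l : List α,
    splits (l.map f) = (splits l).map fun s => (s.1.map f, f s.2.1, s.2.2.map f)
  | [] => rfl
  | x :: l => by simp [splits, splits_map f l, Function.comp_def]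

theorem lsum_splits_ite {α M : Type*} [AddCommMonoid M] (c : M) : ∀ l : List α,
    (lsum (splits l) fun s => if s.2.2 = [] then c else 0) = if l = [] then 0 else c
  | [] => by simp [splits]
  | [x] => by simp [splits]
  | x :: y :: l => by
    have := lsum_splits_ite c (y :: l)
    rw [splits, lsum_cons, lsum_map, this]
    simp

theorem finLabs_of_perm {X Y : List Letter} (h : X.Perm Y) : (finLabs X).Perm (finLabs Y) :=
  (h.filter _).map _

theorem finLabs_append (X Y : List Letter) : finLabs (X ++ Y) = finLabs X ++ finLabs Y := by
  simp [finLabs]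

theorem finLabs_map_mapLab (f : ℕ → ℕ) (X : List Letter) :
    finLabs (X.map (Letter.mapLab f)) = (finLabs X).map f := by
  simp [finLabs, List.filter_map, Function.comp_def]

theorem finLabs_perm_others (hX : IsTagged n X) (hi : i < n) :
    (finLabs X).Perm (i :: finLabs (others i X)) := by
  have h := finLabs_of_perm (perm_lobe_others i X)
  rw [finLabs_append] at h
  obtain ⟨z, hz⟩ := hX.word.filter_lobe hi
  have hm : z ∈ (lobe i X).filter (·.fin) := by simp [hz]
  have hzl : z.lab = i := by
    simpa using (List.mem_filter.1 (List.mem_of_mem_filter hm)).2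
  have e : finLabs (lobe i X) = [i] := by rw [finLabs, hz, List.map_singleton, hzl]
  rwa [e] at h

variable (k) in
/-- The composition of words is compatible with the boundary. The faces at the special points of
the lobe `i`, at which two cuts of the inner word come together, cancel against the faces at the
cuts of the arcs of the inner word. -/
theorem boundary_circ_tw (hX : IsTagged n X) (hV : IsTagged m V) (hi : i < n)
    (hXV : ∀ x ∈ X, ∀ y ∈ V, x.tag < y.tag) :
    boundary k (circ k i (tw k X) (tw k V)) = circ k i (boundary k (tw k X)) (tw k V) +
      (-1 : k) ^ (frees X).length • circ k i (tw k X) (boundary k (tw k V)) := by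
  set W := V.map (Letter.mapLab (· + i)) with hW
  have pX := perm_frees_lobe_others hX hi
  have hnd : (slotTags i X ++ frees (others i X)).Nodup :=
    pX.nodup_iff.1 (hX.nodup.sublist (frees_sublist X))
  -- the faces of the composed words
  have h1 : ∀ S ∈ cutAt (slotTags i X) W, boundary k (tw k (fill i m X S)) =
      (lsum (frees (others i X)) fun t => faceF k t (fill i m X S)) -
        (lsum (finLabs (others i X)) fun l => faceT k (outer i m l) (fill i m X S)) +
        (lsum (slotTags i X) fun t => faceF k t (fill i m X S)) +
        lsum V fun y => faceAt k (fill i m X S) (y.mapLab (· + i)) := by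
    intro S hS
    have p1 : (frees (fill i m X S)).Perm (frees (others i X) ++ slotTags i X ++ frees W) := by
      refine (perm_frees_fill (m := m) (hX.oneFinal hi) hS).trans ?_
      rw [hW, frees_map_mapLab]
      exact (pX.trans List.perm_append_comm).append_right _
    have p2 : (finLabs (fill i m X S)).Perm
        ((finLabs (others i X)).map (outer i m) ++ finLabs W) := by
      have h := finLabs_of_perm
        (perm_fill (m := m) (length_eq_of_mem_cutAt_slotTags (hX.oneFinal hi) hS))
      rw [finLabs_append, finLabs_map_mapLab] at h
      have e : finLabs S.flatten = finLabs W := by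
        rw [finLabs, filter_fin_of_mem_cutAt _ _ _ hS, finLabs]
      rwa [e] at h
    have e := lsum_faceAt (k := k) (fill i m X S) W
    rw [hW, lsum_map, ← hW] at e
    rw [boundary_tw k (hX.fill hi hV hXV hS), lsum_perm p1, lsum_perm p2, e]
    simp only [lsum_append, lsum_map]
    abel
  rw [circ_tw k hX hV hi hXV, map_lsum, lsum_congr h1]
  simp only [lsum_add, lsum_sub]
  -- the faces away from the lobe
  have a1 : (lsum (cutAt (slotTags i X) W) fun S => lsum (frees (others i X)) fun t =>
      faceF k t (fill i m X S)) =
        lsum (frees (others i X)) fun t => circ k i (faceF k t X) (tw k V) := by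
    rw [lsum_comm]
    refine lsum_congr fun t ht => (circ_faceF_outer hX hV hi hXV ?_ ?_).symm
    · exact pX.symm.subset (List.mem_append_right _ ht)
    · exact fun h => (List.nodup_append.1 hnd).2.2 t h t ht rfl
  have a2 : (lsum (cutAt (slotTags i X) W) fun S => lsum (finLabs (others i X)) fun l =>
      faceT k (outer i m l) (fill i m X S)) =
        lsum (finLabs (others i X)) fun l => circ k i (faceT k l X) (tw k V) := by
    rw [lsum_comm]
    refine lsum_congr fun l hl => ?_
    obtain ⟨x, hx, rfl⟩ := List.mem_map.1 hl
    obtain ⟨hx, hxi⟩ := List.mem_filter.1 (List.mem_of_mem_filter hx)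
    exact (circ_faceT_outer hX hV hi hXV (lt_of_isWord hX.word hx) (by simpa using hxi)).symm
  -- the faces at the special points of the lobe
  have a3 : (lsum (cutAt (slotTags i X) W) fun S => lsum (slotTags i X) fun t =>
      faceF k t (fill i m X S)) + circ k i (faceT k i X) (tw k V) =
      (lsum (slotTags i X) fun t => circ k i (faceF k t X) (tw k V)) +
      lsum (splits (slotTags i X)) fun s => lsum (splits V) fun s' =>
        lsum (cutAt s.1 (s'.1.map (Letter.mapLab (· + i)) ++ [s'.2.1.mapLab (· + i)])) fun S1 =>
          lsum (cutAt s.2.2 (s'.2.2.map (Letter.mapLab (· + i)))) fun S2 =>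
            (-1 : k) ^ rk s.2.1 (frees X) • tw k (fill i m X (S1 ++ S2)) := by
    have e : circ k i (faceT k i X) (tw k V) = lsum (splits (slotTags i X)) fun s =>
        if s.2.2 = [] then circ k i (faceT k i X) (tw k V) else 0 := by
      rw [lsum_splits_ite]
      split_ifs with h
      · rw [faceT_of_nil h, map_zero, LinearMap.zero_apply]
      · rfl
    rw [e, lsum_comm, ← lsum_splits, ← lsum_splits (fun t => circ k i (faceF k t X) (tw k V)),
      ← lsum_add, ← lsum_add]
    refine lsum_congr fun s hs => ?_
    have := lsum_faceF_slot (k := k) hX hV hi hXV (eq_of_mem_splits hs)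
    rw [splits_map, lsum_map] at this
    exact this
  -- the faces at the arcs of the inner word
  have a4 : (lsum (cutAt (slotTags i X) W) fun S => lsum V fun y =>
      faceAt k (fill i m X S) (y.mapLab (· + i))) =
      (-1 : k) ^ (frees X).length • circ k i (tw k X) (boundary k (tw k V)) -
      lsum (splits (slotTags i X)) fun s => lsum (splits V) fun s' =>
        lsum (cutAt s.1 (s'.1.map (Letter.mapLab (· + i)) ++ [s'.2.1.mapLab (· + i)])) fun S1 =>
          lsum (cutAt s.2.2 (s'.2.2.map (Letter.mapLab (· + i)))) fun S2 =>
            (-1 : k) ^ rk s.2.1 (frees X) • tw k (fill i m X (S1 ++ S2)) := by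
    rw [lsum_comm, ← lsum_splits, lsum_congr fun s hs =>
      lsum_faceAt_inner (k := k) hX hV hi hXV (eq_of_mem_splits hs), lsum_sub, lsum_comm,
      boundary_tw_eq k hV, map_lsum, ← lsum_smul,
      ← lsum_splits (fun y => (-1 : k) ^ (frees X).length • circ k i (tw k X) (faceAt k V y))]
  have a5 : circ k i (boundary k (tw k X)) (tw k V) =
      (lsum (slotTags i X) fun t => circ k i (faceF k t X) (tw k V)) +
      (lsum (frees (others i X)) fun t => circ k i (faceF k t X) (tw k V)) -
      (circ k i (faceT k i X) (tw k V) +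
      lsum (finLabs (others i X)) fun l => circ k i (faceT k l X) (tw k V)) := by
    rw [boundary_tw k hX, lsum_perm pX, lsum_perm (finLabs_perm_others hX hi), lsum_append,
      lsum_cons]
    simp only [_root_.map_sub, map_add, LinearMap.sub_apply, LinearMap.add_apply, circ_lsum_left]
  rw [a1, a2, a4, a5, ← sub_eq_zero]
  rw [← eq_sub_iff_add_eq] at a3
  rw [a3]
  abel

theorem boundary_circ_single {i : ℕ} (σ τ : Cell) (hi : i < σ.arity) :
    boundary k (circ k i (Finsupp.single σ 1) (Finsupp.single τ 1)) =
      circ k i (boundary k (Finsupp.single σ 1)) (Finsupp.single τ 1) +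
      (-1 : k) ^ σ.degree • circ k i (Finsupp.single σ 1) (boundary k (Finsupp.single τ 1)) := by
  have h := boundary_circ_tw k (isTagged_numbered 0 σ) (isTagged_numbered σ.walk.length τ) hi
    (fun x hx y hy => by
      have h1 := mem_numbered hx
      have h2 := mem_numbered hy
      omega)
  rw [tw_numbered, tw_numbered, length_frees, forget_numbered, ← Cell.degree_eq] at h
  exact h

end

section

variable {k : Type*} [CommRing k]

/-! ### Arities and degrees -/

variable (k) in
/-- The chains on the cacti with `n` lobes. -/
def ofArity (n : ℕ) : Submodule k (CC k) := Finsupp.supported k k {τ | τ.arity = n}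

theorem single_mem_ofArity (τ : Cell) : Finsupp.single τ (1 : k) ∈ ofArity k τ.arity :=
  Finsupp.single_mem_supported k 1 rfl

theorem single_mem_chains (τ : Cell) : Finsupp.single τ (1 : k) ∈ chains k τ.arity τ.degree :=
  Finsupp.single_mem_supported k 1 ⟨rfl, rfl⟩

theorem chains_le_ofArity (n p : ℕ) : chains k n p ≤ ofArity k n :=
  Finsupp.supported_mono fun _ h => h.1

/-- Linear maps on the chains with `n` lobes are determined by their values on the cells. -/
theorem map_eq_of_mem_ofArity {M : Type*} [AddCommGroup M] [Module k M] {f g : CC k →ₗ[k] M} {n : ℕ}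
    (h : ∀ τ : Cell, τ.arity = n → f (Finsupp.single τ 1) = g (Finsupp.single τ 1))
    {a : CC k} (ha : a ∈ ofArity k n) : f a = g a := by
  rw [ofArity, Finsupp.supported_eq_span_single] at ha
  refine LinearMap.eqOn_span ?_ ha
  rintro _ ⟨τ, hτ, rfl⟩
  exact h τ hτ

theorem map_eq_of_mem_chains {M : Type*} [AddCommGroup M] [Module k M] {f g : CC k →ₗ[k] M}
    {n p : ℕ} (h : ∀ τ : Cell, τ.arity = n → τ.degree = p →
      f (Finsupp.single τ 1) = g (Finsupp.single τ 1))
    {a : CC k} (ha : a ∈ chains k n p) : f a = g a := by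
  rw [chains, Finsupp.supported_eq_span_single] at ha
  refine LinearMap.eqOn_span ?_ ha
  rintro _ ⟨τ, hτ, rfl⟩
  exact h τ hτ.1 hτ.2

theorem map_mem_of_mem_chains {M : Type*} [AddCommGroup M] [Module k M] {f : CC k →ₗ[k] M}
    {n p : ℕ} {N : Submodule k M} (h : ∀ τ : Cell, τ.arity = n → τ.degree = p →
      f (Finsupp.single τ 1) ∈ N) {a : CC k} (ha : a ∈ chains k n p) : f a ∈ N := by
  rw [chains, Finsupp.supported_eq_span_single] at ha
  refine Submodule.mem_comap.1 (Submodule.span_le.2 ?_ ha)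
  rintro _ ⟨τ, hτ, rfl⟩
  exact h τ hτ.1 hτ.2

theorem map_mem_of_mem_ofArity {M : Type*} [AddCommGroup M] [Module k M] {f : CC k →ₗ[k] M}
    {n : ℕ} {N : Submodule k M} (h : ∀ τ : Cell, τ.arity = n →
      f (Finsupp.single τ 1) ∈ N) {a : CC k} (ha : a ∈ ofArity k n) : f a ∈ N := by
  rw [ofArity, Finsupp.supported_eq_span_single] at ha
  refine Submodule.mem_comap.1 (Submodule.span_le.2 ?_ ha)
  rintro _ ⟨τ, hτ, rfl⟩
  exact h τ hτ

theorem lsum_mem {ι M : Type*} [AddCommGroup M] [Module k M] {N : Submodule k M} {l : List ι}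
    {f : ι → M} (h : ∀ x ∈ l, f x ∈ N) : lsum l f ∈ N := by
  refine list_sum_mem fun y hy => ?_
  obtain ⟨x, hx, rfl⟩ := List.mem_map.1 hy
  exact h x hx

theorem tw_mem_chains {n p : ℕ} {X : List Letter} (h : IsTagged n X) (hp : (frees X).length = p) :
    tw k X ∈ chains k n p := by
  by_cases hX : Nondeg (forget X)
  · obtain ⟨τ, h1, h2, h3⟩ := h.word.tw_eq (k := k) hX
    rw [h3]
    refine Submodule.smul_mem _ _ (Finsupp.single_mem_supported k 1 ⟨h2, ?_⟩)
    rw [Cell.degree_eq, h1, ← length_frees, hp]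
  · rw [tw, ofWalk_eq_zero k hX, smul_zero]
    exact Submodule.zero_mem _

theorem length_frees_numbered (a : ℕ) (τ : Cell) :
    (frees (numbered a τ.walk)).length = τ.degree := by
  rw [length_frees, forget_numbered, ← Cell.degree_eq]

theorem circ_mem_chains {i n m p q : ℕ} (hi : i < n) {x y : CC k} (hx : x ∈ chains k n p)
    (hy : y ∈ chains k m q) : circ k i x y ∈ chains k (n + m - 1) (p + q) := by
  refine map_mem_of_mem_chains (f := (circ k i).flip y) (fun σ h1 h2 => ?_) hx
  rw [LinearMap.flip_apply]
  refine map_mem_of_mem_chains (fun τ h3 h4 => ?_) hy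
  subst h1 h2 h3 h4
  have hlt : ∀ x ∈ numbered 0 σ.walk, ∀ y ∈ numbered σ.walk.length τ.walk, x.tag < y.tag := by
    intro x hx y hy
    have := mem_numbered hx
    have := mem_numbered hy
    omega
  have hX := isTagged_numbered 0 σ
  have hV := isTagged_numbered σ.walk.length τ
  rw [← tw_numbered k 0 σ, ← tw_numbered k σ.walk.length τ, circ_tw k hX hV hi hlt]
  refine lsum_mem fun S hS => tw_mem_chains (hX.fill hi hV hlt hS) ?_
  rw [(perm_frees_fill (hX.oneFinal hi) hS).length_eq, List.length_append, length_frees_numbered,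
    length_frees_numbered]

theorem circ_mem_ofArity {i n m : ℕ} (hi : i < n) {x y : CC k} (hx : x ∈ ofArity k n)
    (hy : y ∈ ofArity k m) : circ k i x y ∈ ofArity k (n + m - 1) := by
  refine map_mem_of_mem_ofArity (f := (circ k i).flip y) (fun σ h1 => ?_) hx
  rw [LinearMap.flip_apply]
  refine map_mem_of_mem_ofArity (fun τ h3 => ?_) hy
  subst h1 h3
  exact chains_le_ofArity _ _ (circ_mem_chains hi (single_mem_chains σ) (single_mem_chains τ))

theorem length_filter_ne {F : List ℕ} (hF : F.Nodup) {t : ℕ} (ht : t ∈ F) :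
    (F.filter (· ≠ t)).length + 1 = F.length := by
  have h1 := List.length_eq_countP_add_countP (· ≠ t) (l := F)
  have h2 : F.countP (fun a => decide ¬decide (a ≠ t) = true) = 1 := by
    rw [← List.count_eq_one_of_mem hF ht, List.count]
    exact List.countP_congr fun x _ => by simp
  rw [← List.countP_eq_length_filter]
  omega

theorem boundary_tw_mem {n p : ℕ} {X : List Letter} (h : IsTagged n X)
    (hp : (frees X).length = p + 1) : boundary k (tw k X) ∈ chains k n p := by
  have hn := h.nodup.sublist (frees_sublist X)
  rw [boundary_tw' k h]
  refine Submodule.sub_mem _ (lsum_mem fun t ht => ?_) (lsum_mem fun l hl => ?_)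
  · refine Submodule.smul_mem _ _ (tw_mem_chains (h.dropTag ht) ?_)
    have := length_filter_ne hn ht
    rw [frees_dropTag]; omega
  · have hl := List.mem_range.1 hl
    rcases List.eq_nil_or_concat (slotTags l X) with e | ⟨ts, t, e⟩
    · rw [faceT_of_nil e]; exact Submodule.zero_mem _
    · rw [List.concat_eq_append] at e
      have ht : t ∈ slotTags l X := by simp [e]
      rw [faceT_of_concat e]
      refine Submodule.smul_mem _ _ (tw_mem_chains (h.shrink hl ht) ?_)
      have := length_filter_ne hn (slotTags_subset_frees h hl ht)
      rw [frees_shrink]; omega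

theorem boundary_tw_eq_zero {n : ℕ} {X : List Letter} (h : IsTagged n X) (hp : frees X = []) :
    boundary k (tw k X) = 0 := by
  rw [boundary_tw' k h, hp, lsum_nil, zero_sub, neg_eq_zero]
  refine lsum_eq_zero fun l hl => faceT_of_nil ?_
  rw [List.eq_nil_iff_forall_not_mem]
  intro t ht
  have := slotTags_subset_frees h (List.mem_range.1 hl) ht
  simp [hp] at this

theorem boundary_mem_chains {n p : ℕ} {a : CC k} (ha : a ∈ chains k n (p + 1)) :
    boundary k a ∈ chains k n p := by
  refine map_mem_of_mem_chains (fun τ h1 h2 => ?_) ha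
  rw [← tw_numbered k 0 τ]
  exact boundary_tw_mem (h1 ▸ isTagged_numbered 0 τ) (by rw [length_frees_numbered, h2])

theorem boundary_eq_zero {n : ℕ} {a : CC k} (ha : a ∈ chains k n 0) : boundary k a = 0 := by
  refine map_eq_of_mem_chains (f := boundary k) (g := 0) (fun τ h1 h2 => ?_) ha
  rw [← tw_numbered k 0 τ, LinearMap.zero_apply]
  exact boundary_tw_eq_zero (isTagged_numbered 0 τ)
    (List.length_eq_zero_iff.1 (by rw [length_frees_numbered, h2]))

theorem boundary_mem_ofArity {n : ℕ} {a : CC k} (ha : a ∈ ofArity k n) :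
    boundary k a ∈ ofArity k n := by
  refine map_mem_of_mem_ofArity (fun τ h1 => ?_) ha
  have h := single_mem_chains (k := k) τ
  subst h1
  rcases hd : τ.degree with _ | p
  · rw [hd] at h
    rw [boundary_eq_zero h]
    exact Submodule.zero_mem _
  · rw [hd] at h
    exact chains_le_ofArity _ _ (boundary_mem_chains h)

/-! ### The relations of the operad, for chains -/

theorem circ_circ {i j n m : ℕ} (hi : i < n) (hj : j < m) {x y : CC k} (hx : x ∈ ofArity k n)
    (hy : y ∈ ofArity k m) (z : CC k) :
    circ k (i + j) (circ k i x y) z = circ k i x (circ k j y z) := by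
  refine map_eq_of_mem_ofArity (f := (circ k (i + j)).flip z ∘ₗ (circ k i).flip y)
    (g := (circ k i).flip (circ k j y z)) (fun σ h1 => ?_) hx
  simp only [LinearMap.comp_apply, LinearMap.flip_apply]
  refine map_eq_of_mem_ofArity (f := (circ k (i + j)).flip z ∘ₗ circ k i (Finsupp.single σ 1))
    (g := circ k i (Finsupp.single σ 1) ∘ₗ (circ k j).flip z) (fun τ h2 => ?_) hy
  simp only [LinearMap.comp_apply, LinearMap.flip_apply]
  have e : circ k (i + j) (circ k i (Finsupp.single σ 1) (Finsupp.single τ 1)) =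
      circ k i (Finsupp.single σ 1) ∘ₗ circ k j (Finsupp.single τ 1) := by
    refine Finsupp.lhom_ext' fun ρ => LinearMap.ext_ring ?_
    simp only [LinearMap.comp_apply, Finsupp.lsingle_apply]
    exact circ_circ_single σ τ ρ (h1 ▸ hi) (h2 ▸ hj)
  rw [e, LinearMap.comp_apply]

theorem circ_circ_comm {i j n m l p q : ℕ} (hij : i < j) (hj : j < n) {x y z : CC k}
    (hx : x ∈ ofArity k n) (hy : y ∈ chains k m p) (hz : z ∈ chains k l q) :
    circ k i (circ k j x z) y =
      (-1 : k) ^ (p * q) • circ k (j + m - 1) (circ k i x y) z := by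
  refine map_eq_of_mem_ofArity (f := (circ k i).flip y ∘ₗ (circ k j).flip z)
    (g := (-1 : k) ^ (p * q) • (circ k (j + m - 1)).flip z ∘ₗ (circ k i).flip y)
    (fun σ h1 => ?_) hx
  simp only [LinearMap.comp_apply, LinearMap.flip_apply, LinearMap.smul_apply]
  refine map_eq_of_mem_chains (f := circ k i (circ k j (Finsupp.single σ 1) z))
    (g := (-1 : k) ^ (p * q) • (circ k (j + m - 1)).flip z ∘ₗ circ k i (Finsupp.single σ 1))
    (fun τ h2 h3 => ?_) hy
  simp only [LinearMap.comp_apply, LinearMap.flip_apply, LinearMap.smul_apply]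
  refine map_eq_of_mem_chains
    (f := (circ k i).flip (Finsupp.single τ 1) ∘ₗ circ k j (Finsupp.single σ 1))
    (g := (-1 : k) ^ (p * q) •
      circ k (j + m - 1) (circ k i (Finsupp.single σ 1) (Finsupp.single τ 1)))
    (fun ρ h4 h5 => ?_) hz
  simp only [LinearMap.comp_apply, LinearMap.flip_apply, LinearMap.smul_apply]
  subst h1 h2 h3 h5
  exact circ_circ_comm_single σ τ ρ hij hj

theorem boundary_circ {i n p : ℕ} (hi : i < n) {x : CC k} (hx : x ∈ chains k n p) (y : CC k) :
    boundary k (circ k i x y) =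
      circ k i (boundary k x) y + (-1 : k) ^ p • circ k i x (boundary k y) := by
  refine map_eq_of_mem_chains (f := boundary k ∘ₗ (circ k i).flip y)
    (g := (circ k i).flip y ∘ₗ boundary k + (-1 : k) ^ p • (circ k i).flip (boundary k y))
    (fun σ h1 h2 => ?_) hx
  simp only [LinearMap.comp_apply, LinearMap.flip_apply, LinearMap.smul_apply, LinearMap.add_apply]
  have e : boundary k ∘ₗ circ k i (Finsupp.single σ 1) =
      circ k i (boundary k (Finsupp.single σ 1)) +
        (-1 : k) ^ p • circ k i (Finsupp.single σ 1) ∘ₗ boundary k := by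
    refine Finsupp.lhom_ext' fun τ => LinearMap.ext_ring ?_
    simp only [LinearMap.comp_apply, Finsupp.lsingle_apply, LinearMap.smul_apply,
      LinearMap.add_apply]
    subst h1 h2
    exact boundary_circ_single σ τ hi
  exact LinearMap.congr_fun e y

/-! ### Relabelling -/

/-- A permutation of the labels `0, …, n - 1`. -/
def PermutesRange (n : ℕ) (f : ℕ → ℕ) : Prop := ((List.range n).map f).Perm (List.range n)

theorem PermutesRange.lt {n : ℕ} {f : ℕ → ℕ} (h : PermutesRange n f) {l : ℕ} (hl : l < n) :
    f l < n :=
  List.mem_range.1 (h.subset (List.mem_map_of_mem (List.mem_range.2 hl)))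

theorem PermutesRange.inj {n : ℕ} {f : ℕ → ℕ} (h : PermutesRange n f) {a b : ℕ} (ha : a < n)
    (hb : b < n) (e : f a = f b) : a = b :=
  List.inj_on_of_nodup_map (h.nodup_iff.2 List.nodup_range) (List.mem_range.2 ha)
    (List.mem_range.2 hb) e

theorem isTagged_map_mapLab {n : ℕ} {f : ℕ → ℕ} (hf : PermutesRange n f) {X : List Letter}
    (h : IsTagged n X) : IsTagged n (X.map (Letter.mapLab f)) := by
  have hl : ∀ x ∈ (forget X).map (·.1), x < n := by
    intro x hx
    obtain ⟨y, hy, rfl⟩ := List.mem_map.1 hx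
    exact h.word.lt y hy
  have e : (forget (X.map (Letter.mapLab f))).map (·.1) = ((forget X).map (·.1)).map f := by
    simp [forget, Function.comp_def, Letter.arc]
  refine ⟨⟨?_, ?_, ?_⟩, by rw [tags_map_mapLab]; exact h.nodup⟩
  · rw [← finLabs_eq, finLabs_map_mapLab]
    exact ((finLabs_perm h).map f).trans hf
  · intro x hx
    have : x.1 ∈ ((forget X).map (·.1)).map f := e ▸ List.mem_map_of_mem hx
    obtain ⟨l, hl', e'⟩ := List.mem_map.1 this
    rw [← e']
    exact hf.lt (hl l hl')
  · rw [e]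
    exact h.word.nc.map f fun x hx y hy => hf.inj (hl x hx) (hl y hy)

theorem relabel_tw {n : ℕ} (f : ℕ → ℕ) {X : List Letter} (h : IsTagged n X) :
    relabel k f (tw k X) = tw k (X.map (Letter.mapLab f)) := by
  by_cases hX : Nondeg (forget X)
  · obtain ⟨τ, h1, h2, h3⟩ := h.word.tw_eq (k := k) hX
    rw [h3, map_smul, relabel, Finsupp.linearCombination_single, one_smul, h1, tw, frees_map_mapLab]
    congr 2
    simp [forget, Function.comp_def, Letter.arc]
  · have hd := not_nondeg_iff.1 hX
    rw [tw_eq_zero k hd, tw_eq_zero k (hd.map_mapLab f), map_zero]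

/-- Compositions are equivariant. -/
theorem relabel_circ {i i' n m : ℕ} {π ψ : ℕ → ℕ} (hi : i < n) (hπ : PermutesRange n π)
    (hi' : π i = i') (h1 : ∀ l < n, l ≠ i → outer i' m (π l) = ψ (outer i m l))
    (h2 : ∀ l < m, ψ (l + i) = l + i') {x y : CC k} (hx : x ∈ ofArity k n) (hy : y ∈ ofArity k m) :
    relabel k ψ (circ k i x y) = circ k i' (relabel k π x) y := by
  refine map_eq_of_mem_ofArity (f := relabel k ψ ∘ₗ (circ k i).flip y)
    (g := (circ k i').flip y ∘ₗ relabel k π) (fun σ e1 => ?_) hx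
  simp only [LinearMap.comp_apply, LinearMap.flip_apply]
  refine map_eq_of_mem_ofArity (f := relabel k ψ ∘ₗ circ k i (Finsupp.single σ 1))
    (g := circ k i' (relabel k π (Finsupp.single σ 1))) (fun τ e2 => ?_) hy
  subst e1 e2
  have hX := isTagged_numbered 0 σ
  have hV := isTagged_numbered σ.walk.length τ
  have hlt : ∀ x ∈ numbered 0 σ.walk, ∀ y ∈ numbered σ.walk.length τ.walk, x.tag < y.tag := by
    intro x hx y hy
    have := mem_numbered hx
    have := mem_numbered hy
    omega
  rw [LinearMap.comp_apply, ← tw_numbered k 0 σ, ← tw_numbered k σ.walk.length τ]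
  generalize numbered 0 σ.walk = X at *
  generalize numbered σ.walk.length τ.walk = V at *
  have hXπ := isTagged_map_mapLab hπ hX
  have hlt' : ∀ x ∈ X.map (Letter.mapLab π), ∀ y ∈ V, x.tag < y.tag := by
    intro x hx y hy
    obtain ⟨x', hx', rfl⟩ := List.mem_map.1 hx
    exact hlt x' hx' y hy
  have hl : ∀ x ∈ X, (x.mapLab π).lab = i' ↔ x.lab = i := by
    intro x hx
    rw [Letter.mapLab_lab]
    constructor
    · intro e
      exact hπ.inj (lt_of_isWord hX.word hx) hi (e.trans hi'.symm)
    · intro e; rw [e, hi']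
  have hs : slotTags i' (X.map (Letter.mapLab π)) = slotTags i X := by
    rw [slotTags_map (Letter.mapLab π) id hl (fun _ _ => rfl) (fun _ _ => rfl), List.map_id]
  have hW : V.map (Letter.mapLab (· + i')) =
      (V.map (Letter.mapLab (· + i))).map (Letter.mapLab ψ) := by
    rw [List.map_map]
    refine List.map_congr_left fun v hv => ?_
    have := h2 v.lab (lt_of_isWord hV.word hv)
    simp [Letter.mapLab, this]
  have hC : cutAt (slotTags i X) (V.map (Letter.mapLab (· + i'))) =
      (cutAt (slotTags i X) (V.map (Letter.mapLab (· + i)))).map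
        (List.map (List.map (Letter.mapLab ψ))) := by
    have := cutAt_map (Letter.mapLab ψ) id (slotTags i X) (V.map (Letter.mapLab (· + i)))
      fun _ _ _ _ => rfl
    rw [List.map_id] at this
    rw [hW, this]
  rw [circ_tw k hX hV hi hlt, relabel_tw π hX, circ_tw k hXπ hV (hi' ▸ hπ.lt hi) hlt', hs, hC,
    lsum_map, map_lsum]
  refine lsum_congr fun S hS => ?_
  rw [relabel_tw ψ (hX.fill hi hV hlt hS), fill_map (Letter.mapLab π) (Letter.mapLab ψ) S hl]
  · intro _ _; rfl
  · intro x hx hxi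
    have := h1 x.lab (lt_of_isWord hX.word hx) hxi
    simp [Letter.mapLab, this]

end

section

/-! ### Explicit computations -/

/-- A linear combination of walks with integral coefficients. -/
abbrev Comb := List (ℤ × List Arc)

/-- The walks of a linear combination are walks of cells with `n` lobes. -/
def IsComb (n : ℕ) (L : Comb) : Prop := ∀ x ∈ L, IsWord n x.2 ∧ Nondeg x.2

/-- A decidable form of `IsWord`: only labels of the word can cross. -/
theorem isWord_iff {n : ℕ} {w : List Arc} : IsWord n w ↔
    (finalLabels w).Perm (List.range n) ∧ (∀ x ∈ w, x.1 < n) ∧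
      ∀ a ∈ w.map (·.1), ∀ b ∈ w.map (·.1), a ≠ b → ¬ [a, b, a, b].Sublist (w.map (·.1)) :=
  ⟨fun h => ⟨h.perm, h.lt, fun a _ b _ => h.nc a b⟩, fun h => ⟨h.1, h.2.1, fun a b hab hs =>
    h.2.2 a (hs.subset (by simp)) b (hs.subset (by simp)) hab hs⟩⟩

instance (n : ℕ) (w : List Arc) : Decidable (IsWord n w) := decidable_of_iff _ isWord_iff.symm

instance (n : ℕ) (L : Comb) : Decidable (IsComb n L) :=
  inferInstanceAs (Decidable (∀ x ∈ L, _))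

/-- Add a term to a linear combination. -/
def addTerm (c : ℤ) (w : List Arc) : Comb → Comb
  | [] => [(c, w)]
  | (d, v) :: L => if v = w then (c + d, v) :: L else (d, v) :: addTerm c w L

/-- Collect the terms with the same walk, and omit the terms that vanish. -/
def collect (L : Comb) : Comb :=
  (L.foldr (fun x M => addTerm x.1 x.2 M) []).filter fun x => x.1 ≠ 0 ∧ Nondeg x.2

/-- A multiple of a linear combination. -/
def scaleComb (c : ℤ) (L : Comb) : Comb := L.map fun x => (c * x.1, x.2)

/-- The composition, computed with walks; the labels of `M` are `0, …, m - 1`. -/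
def circComb (i m : ℕ) (L M : Comb) : Comb :=
  collect (L.flatMap fun x => M.flatMap fun y => (insertions i m x.2 y.2).map fun v =>
    (x.1 * y.1 * (-1) ^ inversions (coordTags v), v.map fun z => (z.label, z.final)))

/-- The face `faceTerm`, computed with walks. -/
def faceComb (w : List Arc) (p : ℕ) : Comb :=
  match prevArc w p with
  | none => []
  | some q =>
    if (w.getD p (0, false)).2 = true then
      [(-(-1) ^ numFree (w.take q), (w.set q ((w.getD q (0, false)).1, true)).eraseIdx p)]
    else [((-1) ^ numFree (w.take p), w.eraseIdx p)]

/-- The boundary, computed with walks. -/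
def boundaryComb (L : Comb) : Comb :=
  L.flatMap fun x => (List.range x.2.length).flatMap fun p => scaleComb x.1 (faceComb x.2 p)

/-- Relabelling, computed with walks. -/
def relabelComb (f : ℕ → ℕ) (L : Comb) : Comb :=
  L.map fun x => (x.1, x.2.map fun y => (f y.1, y.2))

variable (k : Type*) [CommRing k]

/-- The chain that is given by a linear combination of walks. -/
def chainOf (L : Comb) : CC k := lsum L fun x => (x.1 : k) • ofWalk k x.2

@[simp] theorem chainOf_nil : chainOf k [] = 0 := rfl

@[simp] theorem chainOf_cons (x : ℤ × List Arc) (L : Comb) :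
    chainOf k (x :: L) = (x.1 : k) • ofWalk k x.2 + chainOf k L := lsum_cons ..

@[simp] theorem chainOf_append (L M : Comb) : chainOf k (L ++ M) = chainOf k L + chainOf k M :=
  lsum_append ..

theorem chainOf_flatMap {α : Type*} (l : List α) (f : α → Comb) :
    chainOf k (l.flatMap f) = lsum l fun x => chainOf k (f x) := by
  induction l with
  | nil => rfl
  | cons x l ih => rw [List.flatMap_cons, chainOf_append, ih, lsum_cons]

theorem chainOf_scaleComb (c : ℤ) (L : Comb) : chainOf k (scaleComb c L) =
    (c : k) • chainOf k L := by
  rw [chainOf, chainOf, scaleComb, lsum_map, ← lsum_smul]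
  refine lsum_congr fun x _ => ?_
  rw [smul_smul, Int.cast_mul]

theorem chainOf_addTerm (c : ℤ) (w : List Arc) : ∀ L : Comb,
    chainOf k (addTerm c w L) = (c : k) • ofWalk k w + chainOf k L
  | [] => by simp [addTerm]
  | (d, v) :: L => by
    rw [addTerm]
    split_ifs with h
    · subst h
      simp only [chainOf_cons, Int.cast_add, add_smul, add_assoc]
    · simp only [chainOf_cons, chainOf_addTerm c w L]
      abel

theorem chainOf_filter (L : Comb) :
    chainOf k (L.filter fun x => x.1 ≠ 0 ∧ Nondeg x.2) = chainOf k L := by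
  induction L with
  | nil => rfl
  | cons x L ih =>
    by_cases h : x.1 ≠ 0 ∧ Nondeg x.2
    · rw [List.filter_cons_of_pos (by simpa using h), chainOf_cons, ih, chainOf_cons]
    · rw [List.filter_cons_of_neg (by simpa using h), ih, chainOf_cons]
      have : (x.1 : k) • ofWalk k x.2 = 0 := by
        by_cases h1 : x.1 = 0
        · simp [h1]
        · rw [ofWalk_eq_zero k fun h2 => h ⟨h1, h2⟩, smul_zero]
      rw [this, zero_add]

theorem chainOf_collect (L : Comb) : chainOf k (collect L) = chainOf k L := by
  rw [collect, chainOf_filter]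
  induction L with
  | nil => rfl
  | cons x L ih => rw [List.foldr_cons, chainOf_addTerm, ih, chainOf_cons]

/-- The criterion by which equations between explicit chains are checked. -/
theorem chainOf_eq_of_collect {L M : Comb} (h : collect (L ++ scaleComb (-1) M) = []) :
    chainOf k L = chainOf k M := by
  have e := chainOf_collect k (L ++ scaleComb (-1) M)
  rw [h, chainOf_append, chainOf_scaleComb, chainOf_nil] at e
  rw [← sub_eq_zero, e]
  simp [sub_eq_add_neg]

variable {k}

theorem IsComb.exists_cell {n : ℕ} {L : Comb} (h : IsComb n L) {x : ℤ × List Arc} (hx : x ∈ L) :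
    ∃ τ : Cell, τ.walk = x.2 ∧ τ.arity = n ∧ ofWalk k x.2 = Finsupp.single τ 1 := by
  obtain ⟨τ, h1, h2⟩ := (h x hx).1.exists_cell (h x hx).2
  exact ⟨τ, h1, h2, by rw [← h1, ofWalk_walk]⟩

theorem chainOf_mem_chains {n p : ℕ} {L : Comb} (h : IsComb n L) (hp : ∀ x ∈ L, numFree x.2 = p) :
    chainOf k L ∈ chains k n p := by
  refine lsum_mem fun x hx => Submodule.smul_mem _ _ ?_
  obtain ⟨τ, h1, h2, h3⟩ := h.exists_cell (k := k) hx
  rw [h3]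
  exact Finsupp.single_mem_supported k 1 ⟨h2, by rw [Cell.degree_eq, h1, hp x hx]⟩

theorem circ_chainOf {i n m : ℕ} {L M : Comb} (hi : i < n) (hL : IsComb n L) (hM : IsComb m M) :
    circ k i (chainOf k L) (chainOf k M) = chainOf k (circComb i m L M) := by
  rw [circComb, chainOf_collect, chainOf_flatMap, chainOf, circ_lsum_left]
  refine lsum_congr fun x hx => ?_
  rw [chainOf_flatMap, chainOf, map_lsum]
  refine lsum_congr fun y hy => ?_
  obtain ⟨σ, h1, h2, h3⟩ := hL.exists_cell (k := k) hx
  obtain ⟨τ, h4, h5, h6⟩ := hM.exists_cell (k := k) hy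
  rw [h3, h6, map_smul, map_smul, LinearMap.smul_apply, circ_single, if_pos (h2 ▸ hi), h1, h4, h5,
    circWalk, smul_smul, chainOf, lsum_map, mul_comm]
  change _ • lsum _ _ = _
  rw [← lsum_smul]
  refine lsum_congr fun v _ => ?_
  simp only [smul_smul, Int.cast_mul, Int.cast_pow, Int.cast_neg, Int.cast_one]

theorem chainOf_faceComb (w : List Arc) (p : ℕ) : chainOf k (faceComb w p) = faceTerm k w p := by
  rw [faceComb, faceTerm]
  rcases prevArc w p with _ | q
  · rfl
  · simp only
    split_ifs <;> simp

theorem boundary_chainOf {n : ℕ} {L : Comb} (hL : IsComb n L) :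
    boundary k (chainOf k L) = chainOf k (boundaryComb L) := by
  rw [boundaryComb, chainOf_flatMap, chainOf, map_lsum]
  refine lsum_congr fun x hx => ?_
  obtain ⟨σ, h1, h2, h3⟩ := hL.exists_cell (k := k) hx
  rw [h3, map_smul, boundary, Finsupp.linearCombination_single, one_smul, h1, chainOf_flatMap]
  simp only [chainOf_scaleComb, chainOf_faceComb]
  rw [lsum_smul, lsum]
  rfl

theorem relabel_chainOf {n : ℕ} {L : Comb} (hL : IsComb n L) (f : ℕ → ℕ) :
    relabel k f (chainOf k L) = chainOf k (relabelComb f L) := by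
  rw [relabelComb, chainOf, chainOf, map_lsum, lsum_map]
  refine lsum_congr fun x hx => ?_
  obtain ⟨σ, h1, h2, h3⟩ := hL.exists_cell (k := k) hx
  rw [h3, map_smul, relabel, Finsupp.linearCombination_single, one_smul, h1]

end

section

/-! ### The chains of the operations -/

variable (k : Type*) [CommRing k]

/-- The product, the cell `tauTwoB`. -/
def muComb : Comb := [(1, [(0, true), (1, true)])]

/-- The cell `tauOne`. -/
def tauComb : Comb := [(1, [(0, false), (1, true), (0, true)])]

/-- The BV operator, the opposite of the cell `oPrime`. -/
def bvComb : Comb := [(-1, [(0, true), (0, false)])]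

/-- The bracket, the sum of the two cells with the underlying tree of `tauOne`. -/
def lieComb : Comb :=
  [(1, [(0, false), (1, true), (0, true)]), (1, [(1, false), (0, true), (1, true)])]

/-- The circle with its local zero at the global zero: the unit of the operad. -/
def circleComb : Comb := [(1, [(0, true)])]

/-- The homotopy for the odd Poisson identity: the lobes `1` and `2` are attached to the lobe `0`,
in this order. This is the brace operation `a{b, c}`, up to sign. -/
def poissonComb : Comb := [(-1, [(0, false), (1, true), (0, false), (2, true), (0, true)])]

/-- The homotopy between the bracket and the deviation of the BV operator from a derivation. -/
def bvLieComb : Comb :=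
  [(1, [(0, true), (0, false), (1, true), (0, false)]),
    (-1, [(1, false), (0, true), (1, true), (1, false)])]

/-- The homotopy for the seven term relation: a solution of the linear equation `seven_chains`,
which determines it up to cycles. -/
def sevenComb : Comb :=
  [(1, [(0, true), (0, false), (1, true), (0, false), (2, true)]),
    (1, [(0, false), (1, true), (0, true), (2, true), (0, false)]),
    (1, [(2, false), (0, true), (2, true), (1, true), (2, false)]),
    (-1, [(0, true), (1, true), (0, false), (2, true), (2, false)]),
    (1, [(1, true), (2, false), (0, true), (2, true), (1, false)]),
    (-1, [(1, false), (0, true), (1, true), (1, false), (2, true)]),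
    (1, [(1, false), (0, true), (1, true), (2, true), (1, false)]),
    (-1, [(1, true), (2, false), (0, true), (2, true), (2, false)])]

/-- The chain of the product. -/
def mu : CC k := chainOf k muComb
/-- The chain of the operation `γ(τ₁; -, -)`. -/
def tau : CC k := chainOf k tauComb
/-- The chain of the BV operator. -/
def bv : CC k := chainOf k bvComb
/-- The chain of the bracket. -/
def lie : CC k := chainOf k lieComb

theorem isComb_mu : IsComb 2 muComb := by decide
theorem isComb_tau : IsComb 2 tauComb := by decide
theorem isComb_bv : IsComb 1 bvComb := by decide
theorem isComb_lie : IsComb 2 lieComb := by decide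
theorem mu_mem : mu k ∈ chains k 2 0 := chainOf_mem_chains isComb_mu (by decide)
theorem tau_mem : tau k ∈ chains k 2 1 := chainOf_mem_chains isComb_tau (by decide)
theorem bv_mem : bv k ∈ chains k 1 1 := chainOf_mem_chains isComb_bv (by decide)
theorem lie_mem : lie k ∈ chains k 2 1 := chainOf_mem_chains isComb_lie (by decide)

theorem poisson_mem : chainOf k poissonComb ∈ chains k 3 2 :=
  chainOf_mem_chains (by decide +kernel) (by decide)

theorem bvLie_mem : chainOf k bvLieComb ∈ chains k 2 2 :=
  chainOf_mem_chains (by decide +kernel) (by decide)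

theorem seven_mem : chainOf k sevenComb ∈ chains k 3 2 :=
  chainOf_mem_chains (by decide +kernel) (by decide)

theorem single_tauTwoB : Finsupp.single tauTwoB (1 : k) = mu k := by
  rw [← ofWalk_walk]; simp [mu, chainOf, muComb]; rfl

theorem single_tauOne : Finsupp.single tauOne (1 : k) = tau k := by
  rw [← ofWalk_walk]; simp [tau, chainOf, tauComb]; rfl

theorem neg_single_oPrime : -Finsupp.single oPrime (1 : k) = bv k := by
  rw [← ofWalk_walk]; simp [bv, chainOf, bvComb]; rfl

theorem single_unitCell : Finsupp.single unitCell (1 : k) = chainOf k [(1, [])] := by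
  rw [← ofWalk_walk]; simp [chainOf]; rfl

theorem boundary_mu : boundary k (mu k) = 0 := boundary_eq_zero (mu_mem k)

theorem boundary_bv : boundary k (bv k) = 0 := by
  rw [bv, boundary_chainOf isComb_bv]
  exact chainOf_eq_of_collect k (M := []) (by decide)

theorem boundary_lie : boundary k (lie k) = 0 := by
  rw [lie, boundary_chainOf isComb_lie]
  exact chainOf_eq_of_collect k (M := []) (by decide)

/-- The bracket symmetrizes the operation `γ(τ₁; -, -)`. -/
theorem relabel_tau : relabel k (swapBlocks 1 1) (tau k) = lie k - tau k := by
  rw [tau, lie, relabel_chainOf isComb_tau, eq_sub_iff_add_eq, ← chainOf_append]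
  exact chainOf_eq_of_collect k (by decide)

theorem relabel_lie : relabel k (swapBlocks 1 1) (lie k) = lie k := by
  rw [lie, relabel_chainOf isComb_lie]
  exact chainOf_eq_of_collect k (by decide)

theorem boundary_tau : boundary k (tau k) = relabel k (swapBlocks 1 1) (mu k) - mu k := by
  rw [tau, mu, relabel_chainOf isComb_mu, boundary_chainOf isComb_tau, eq_sub_iff_add_eq,
    ← chainOf_append]
  exact chainOf_eq_of_collect k (by decide)

theorem mu_circ_mu : circ k 0 (mu k) (mu k) = circ k 1 (mu k) (mu k) := by
  rw [mu, circ_chainOf (by decide) isComb_mu isComb_mu,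
    circ_chainOf (by decide) isComb_mu isComb_mu]
  exact chainOf_eq_of_collect k (by decide)

theorem bv_circ_bv : circ k 0 (bv k) (bv k) = 0 := by
  rw [bv, circ_chainOf (by decide) isComb_bv isComb_bv]
  exact chainOf_eq_of_collect k (M := []) (by decide)

theorem mu_circ_unit {i : ℕ} (hi : i < 2) :
    circ k i (mu k) (Finsupp.single unitCell 1) = chainOf k circleComb := by
  rw [single_unitCell, mu, circ_chainOf hi isComb_mu (show IsComb 0 _ by decide)]
  interval_cases i <;> exact chainOf_eq_of_collect k (by decide)

/-- The Jacobi identity for the bracket, without a homotopy. -/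
theorem jacobi_chains : circ k 1 (lie k) (lie k) + circ k 0 (lie k) (lie k) +
    relabel k (swapBlocks 1 1) (circ k 1 (lie k) (lie k)) = 0 := by
  rw [lie, circ_chainOf (by decide) isComb_lie isComb_lie,
    circ_chainOf (by decide) isComb_lie isComb_lie, relabel_chainOf (n := 3) (by decide +kernel),
    ← chainOf_append, ← chainOf_append]
  exact chainOf_eq_of_collect k (M := []) (by decide +kernel)

/-- The bracket is a derivation of the product, up to the boundary of the brace cell. -/
theorem poisson_chains : circ k 1 (lie k) (mu k) - circ k 0 (mu k) (lie k) -
    relabel k (swapBlocks 1 1) (circ k 1 (mu k) (lie k)) = boundary k (chainOf k poissonComb) := by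
  rw [lie, mu, circ_chainOf (by decide) isComb_lie isComb_mu,
    circ_chainOf (by decide) isComb_mu isComb_lie, circ_chainOf (by decide) isComb_mu isComb_lie,
    relabel_chainOf (n := 3) (by decide +kernel), boundary_chainOf (n := 3) (by decide +kernel),
    sub_eq_iff_eq_add, sub_eq_iff_eq_add, ← chainOf_append, ← chainOf_append]
  exact chainOf_eq_of_collect k (by decide +kernel)

/-- The bracket measures the deviation of the BV operator from a derivation of the product. -/
theorem bvLie_chains : lie k - (circ k 0 (bv k) (mu k) - circ k 0 (mu k) (bv k) -
    circ k 1 (mu k) (bv k)) = boundary k (chainOf k bvLieComb) := by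
  rw [lie, mu, bv, circ_chainOf (by decide) isComb_bv isComb_mu,
    circ_chainOf (by decide) isComb_mu isComb_bv, circ_chainOf (by decide) isComb_mu isComb_bv,
    boundary_chainOf (n := 2) (by decide +kernel)]
  have e : ∀ a b c d : CC k, a - (b - c - d) = a + c + d - b := by
    intros; abel
  rw [e, sub_eq_iff_eq_add]
  simp only [← chainOf_append]
  exact chainOf_eq_of_collect k (by decide +kernel)

/-- The seven term relation of the BV operator. -/
theorem seven_chains : circ k 0 (bv k) (circ k 0 (mu k) (mu k)) -
    (circ k 0 (mu k) (circ k 0 (bv k) (mu k)) + circ k 1 (mu k) (circ k 0 (bv k) (mu k)) +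
      relabel k (swapBlocks 1 1) (circ k 1 (mu k) (circ k 0 (bv k) (mu k))) -
      circ k 0 (mu k) (circ k 0 (mu k) (bv k)) - circ k 0 (mu k) (circ k 1 (mu k) (bv k)) -
      circ k 0 (circ k 1 (mu k) (bv k)) (mu k)) = boundary k (chainOf k sevenComb) := by
  rw [mu, bv, circ_chainOf (by decide) isComb_bv isComb_mu,
    circ_chainOf (by decide) isComb_mu isComb_bv, circ_chainOf (by decide) isComb_mu isComb_bv,
    circ_chainOf (by decide) isComb_mu isComb_mu,
    circ_chainOf (m := 3) (by decide) isComb_bv (by decide +kernel),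
    circ_chainOf (m := 2) (by decide) isComb_mu (M := circComb 0 2 bvComb muComb) (by decide +kernel),
    circ_chainOf (m := 2) (by decide) isComb_mu (M := circComb 0 2 bvComb muComb) (by decide +kernel),
    circ_chainOf (m := 2) (by decide) isComb_mu (by decide +kernel),
    circ_chainOf (m := 2) (by decide) isComb_mu (by decide +kernel),
    circ_chainOf (n := 2) (by decide) (by decide +kernel) isComb_mu,
    relabel_chainOf (n := 3) (by decide +kernel),
    boundary_chainOf (n := 3) (by decide +kernel)]
  have e : ∀ a b c d e f g : CC k, a - (b + c + d - e - f - g) = a + e + f + g - (b + c + d) := by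
    intros; abel
  rw [e, sub_eq_iff_eq_add]
  simp only [← chainOf_append]
  exact chainOf_eq_of_collect k (by decide +kernel)

end

section

variable {k : Type*} [CommRing k]

/-! ### The operations as iterated compositions -/

theorem gammaFrom_singleton (i : ℕ) (x b : CC k) : gammaFrom i x [b] = circ k i x b := by
  have e : circ k i x = Finsupp.linearCombination k fun τ => circ k i x (Finsupp.single τ 1) := by
    refine Finsupp.lhom_ext' fun ρ => LinearMap.ext_ring ?_
    simp
  rw [e, Finsupp.linearCombination_apply]
  rfl

theorem gammaFrom_add (as : List (CC k)) : ∀ (i : ℕ) (x y : CC k),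
    gammaFrom i (x + y) as = gammaFrom i x as + gammaFrom i y as := by
  induction as with
  | nil => intro i x y; rfl
  | cons a as ih =>
    intro i x y
    simp only [gammaFrom, map_add, LinearMap.add_apply, ih, smul_add, Finsupp.sum_add]

theorem gammaFrom_smul (as : List (CC k)) : ∀ (i : ℕ) (r : k) (x : CC k),
    gammaFrom i (r • x) as = r • gammaFrom i x as := by
  induction as with
  | nil => intro i r x; rfl
  | cons a as ih =>
    intro i r x
    simp only [gammaFrom, map_smul, LinearMap.smul_apply, ih, Finsupp.smul_sum]
    exact Finsupp.sum_congr fun τ _ => smul_comm _ _ _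

/-- The recursion for the insertion of cells depends on their arities only, so that it holds for
chains of one arity. -/
theorem gammaFrom_cons {n : ℕ} (i : ℕ) (x : CC k) {a : CC k} (ha : a ∈ ofArity k n)
    (as : List (CC k)) : gammaFrom i x (a :: as) = gammaFrom (i + n) (circ k i x a) as := by
  let φ : CC k →ₗ[k] CC k :=
    { toFun := fun y => gammaFrom (i + n) y as
      map_add' := gammaFrom_add as _
      map_smul' := gammaFrom_smul as _ }
  have e : (Finsupp.linearCombination k fun τ =>
      gammaFrom (i + τ.arity) (circ k i x (Finsupp.single τ 1)) as) a = (φ ∘ₗ circ k i x) a := by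
    refine map_eq_of_mem_ofArity (fun τ h => ?_) ha
    simp [φ, h]
  rw [Finsupp.linearCombination_apply] at e
  exact e

theorem gamma_two {n : ℕ} (x : CC k) {a : CC k} (ha : a ∈ ofArity k n) (b : CC k) :
    gamma x [a, b] = circ k n (circ k 0 x a) b := by
  rw [gamma, gammaFrom_cons 0 x ha, gammaFrom_singleton, zero_add]

theorem gamma_three {n m : ℕ} (x : CC k) {a b : CC k} (ha : a ∈ ofArity k n) (hb : b ∈ ofArity k m)
    (c : CC k) : gamma x [a, b, c] = circ k (n + m) (circ k n (circ k 0 x a) b) c := by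
  rw [gamma, gammaFrom_cons 0 x ha, gammaFrom_cons _ _ hb, gammaFrom_singleton, zero_add]

theorem cmul_eq {n : ℕ} {a : CC k} (ha : a ∈ ofArity k n) (b : CC k) :
    cmul a b = circ k n (circ k 0 (mu k) a) b := by
  rw [cmul, single_tauTwoB, gamma_two _ ha]

theorem delta_eq (a : CC k) : delta a = circ k 0 (bv k) a := by
  rw [delta, neg_single_oPrime, gamma, gammaFrom_singleton]

/-- The product as a bilinear map. -/
def cmulₗ : CC k →ₗ[k] CC k →ₗ[k] CC k :=
  Finsupp.linearCombination k fun σ => circ k σ.arity (circ k 0 (mu k) (Finsupp.single σ 1))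

theorem cmul_eq_cmulₗ (a b : CC k) : cmul a b = cmulₗ a b := by
  rw [cmul, single_tauTwoB, cmulₗ, Finsupp.linearCombination_apply, Finsupp.sum,
    LinearMap.sum_apply]
  simp only [gamma, gammaFrom, Finsupp.sum, zero_add]
  refine Finset.sum_congr rfl fun τ _ => ?_
  rw [LinearMap.smul_apply, ← gammaFrom_singleton τ.arity]
  rfl

/-! ### Nested operations -/

theorem PermutesRange.swapBlocks {m n r : ℕ} (h : m + n ≤ r) : PermutesRange r (swapBlocks m n) := by
  have hn : ((List.range r).map (Cacti.swapBlocks m n)).Nodup := by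
    refine List.Nodup.map_on (fun x hx y hy e => ?_) List.nodup_range
    unfold Cacti.swapBlocks at e
    split_ifs at e <;> omega
  refine (List.subperm_of_subset hn fun x hx => ?_).perm_of_length_le (by simp)
  obtain ⟨y, hy, rfl⟩ := List.mem_map.1 hx
  rw [List.mem_range] at hy ⊢
  unfold Cacti.swapBlocks
  split_ifs <;> omega

/-- Exchange of the first two arguments. -/
theorem relabel_two {n m r p q : ℕ} (hr : 2 ≤ r) {x a b : CC k} (hx : x ∈ ofArity k r)
    (ha : a ∈ chains k n p) (hb : b ∈ chains k m q) :
    relabel k (swapBlocks m n) (circ k m (circ k 0 x b) a) =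
      (-1 : k) ^ (p * q) • circ k n (circ k 0 (relabel k (swapBlocks 1 1) x) a) b := by
  have ha' := chains_le_ofArity _ _ ha
  have hb' := chains_le_ofArity _ _ hb
  have h1 := circ_circ_comm (i := 0) (j := 1) one_pos (by omega) hx hb ha
  rw [Nat.add_sub_cancel_left] at h1
  have h2 : circ k m (circ k 0 x b) a =
      (-1 : k) ^ (p * q) • circ k 0 (circ k 1 x a) b := by
    rw [h1, smul_smul, mul_comm q p, neg_one_pow_mul_self, one_smul]
  have h3 : relabel k (swapBlocks 1 n) (circ k 1 x a) =
      circ k 0 (relabel k (swapBlocks 1 1) x) a := by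
    refine relabel_circ (n := r) (m := n) (π := swapBlocks 1 1) (ψ := swapBlocks 1 n) (by omega)
      (.swapBlocks (by omega)) (by simp [swapBlocks]) ?_ ?_ hx ha'
    · intro l hl hli
      unfold outer swapBlocks
      split_ifs <;> omega
    · intro l hl
      unfold swapBlocks
      split_ifs <;> omega
  have h4 : relabel k (swapBlocks m n) (circ k 0 (circ k 1 x a) b) =
      circ k n (relabel k (swapBlocks 1 n) (circ k 1 x a)) b := by
    refine relabel_circ (n := r + n - 1) (m := m) (π := swapBlocks 1 n) (ψ := swapBlocks m n)
      (by omega) (.swapBlocks (by omega)) (by simp [swapBlocks]) ?_ ?_ (circ_mem_ofArity (by omega) hx ha') hb'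
    · intro l hl hli
      unfold outer swapBlocks
      split_ifs <;> omega
    · intro l hl
      unfold swapBlocks
      split_ifs <;> omega
  rw [h2, map_smul, h4, h3]

/-- Exchange of the first two of three arguments. -/
theorem relabel_three {n m l p q : ℕ} {x a b c : CC k} (hx : x ∈ ofArity k 3)
    (ha : a ∈ chains k n p) (hb : b ∈ chains k m q) (hc : c ∈ ofArity k l) :
    relabel k (swapBlocks m n) (circ k (m + n) (circ k m (circ k 0 x b) a) c) =
      (-1 : k) ^ (p * q) •
        circ k (n + m) (circ k n (circ k 0 (relabel k (swapBlocks 1 1) x) a) b) c := by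
  have ha' := chains_le_ofArity _ _ ha
  have hb' := chains_le_ofArity _ _ hb
  have h1 := circ_mem_ofArity (i := 0) (by omega) hx hb'
  have h2 := circ_mem_ofArity (i := m) (by omega) h1 ha'
  have h := relabel_circ (i := m + n) (i' := n + m) (n := 3 + m - 1 + n - 1) (m := l)
    (π := swapBlocks m n) (ψ := swapBlocks m n) (by omega) (.swapBlocks (by omega))
    (by unfold swapBlocks; split_ifs <;> omega) ?_ ?_ h2 hc
  · rw [h, relabel_two (by omega) hx ha hb, map_smul, LinearMap.smul_apply]
  · intro j hj hji
    unfold outer swapBlocks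
    split_ifs <;> omega
  · intro j hj
    unfold swapBlocks
    split_ifs <;> omega

/-- Insertion of a composition of two chains as the second argument. -/
theorem circ_circ_second {n p q r s : ℕ} (hr : 2 ≤ r) {x y a : CC k} (hx : x ∈ ofArity k r)
    (ha : a ∈ chains k n p) (hy : y ∈ chains k s q) :
    circ k n (circ k 0 x a) y = (-1 : k) ^ (p * q) • circ k 0 (circ k 1 x y) a := by
  have h1 := circ_circ_comm (i := 0) (j := 1) one_pos (by omega) hx ha hy
  rw [Nat.add_sub_cancel_left] at h1
  rw [h1, smul_smul, neg_one_pow_mul_self, one_smul]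

section
variable {n m l p q d e : ℕ} {x y a b c : CC k}

/-- `γ(x; γ(y; a, b), c) = γ(x ∘₁ y; a, b, c)` -/
theorem nest_left (hx : x ∈ ofArity k 2) (hy : y ∈ ofArity k 2) (ha : a ∈ ofArity k n)
    (b c : CC k) :
    circ k (n + m) (circ k 0 x (circ k n (circ k 0 y a) b)) c =
      circ k (n + m) (circ k n (circ k 0 (circ k 0 x y) a) b) c := by
  have h2 := circ_circ (i := 0) (j := 0) (by omega) (by omega) hx hy a
  have h1 := circ_circ (i := 0) (j := n) (n := 2) (m := 2 + n - 1) (by omega) (by omega) hx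
    (circ_mem_ofArity (i := 0) (by omega) hy ha) b
  rw [Nat.zero_add] at h1 h2
  rw [← h1, ← h2]

/-- `γ(x; a, γ(y; b, c)) = ± γ(x ∘₂ y; a, b, c)` -/
theorem nest_right (hx : x ∈ ofArity k 2) (hy : y ∈ chains k 2 e) (ha : a ∈ chains k n p)
    (hb : b ∈ ofArity k m) (c : CC k) :
    circ k n (circ k 0 x a) (circ k m (circ k 0 y b) c) =
      (-1 : k) ^ (p * e) • circ k (n + m) (circ k n (circ k 0 (circ k 1 x y) a) b) c := by
  have ha' := chains_le_ofArity _ _ ha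
  have hy' := chains_le_ofArity _ _ hy
  have hxa := circ_mem_ofArity (i := 0) (by omega) hx ha'
  rw [← circ_circ (n := 2 + n - 1) (m := 2 + m - 1) (by omega) (by omega) hxa
      (circ_mem_ofArity (i := 0) (by omega) hy' hb) c]
  have h2 := circ_circ (i := n) (j := 0) (by omega) (by omega) hxa hy' b
  rw [Nat.add_zero] at h2
  rw [← h2, circ_circ_second le_rfl hx ha hy]
  simp only [map_smul, LinearMap.smul_apply]

/-- `γ(x; γ(y; a, b)) = γ(x ∘₁ y; a, b)` -/
theorem nest_unary (hx : x ∈ ofArity k 1) (hy : y ∈ ofArity k 2) (ha : a ∈ ofArity k n)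
    (b : CC k) :
    circ k 0 x (circ k n (circ k 0 y a) b) = circ k n (circ k 0 (circ k 0 x y) a) b := by
  have h2 := circ_circ (i := 0) (j := 0) (by omega) (by omega) hx hy a
  have h1 := circ_circ (i := 0) (j := n) (n := 1) (m := 2 + n - 1) (by omega) (by omega) hx
    (circ_mem_ofArity (i := 0) (by omega) hy ha) b
  rw [Nat.zero_add] at h1 h2
  rw [← h1, ← h2]

/-- `γ(x; γ(y; a, b, c)) = γ(x ∘₁ y; a, b, c)` -/
theorem nest_unary_three (hx : x ∈ ofArity k 1) (hy : y ∈ ofArity k 3) (ha : a ∈ ofArity k n)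
    (hb : b ∈ ofArity k m) (c : CC k) :
    circ k 0 x (circ k (n + m) (circ k n (circ k 0 y a) b) c) =
      circ k (n + m) (circ k n (circ k 0 (circ k 0 x y) a) b) c := by
  have h1 := circ_circ (i := 0) (j := 0) (by omega) (by omega) hx hy a
  have hya := circ_mem_ofArity (i := 0) (by omega) hy ha
  have hyb := circ_mem_ofArity (i := n) (by omega) hya hb
  have h2 := circ_circ (i := 0) (j := n) (by omega) (by omega) hx hya b
  have h3 := circ_circ (i := 0) (j := n + m) (by omega) (by omega) hx hyb c
  rw [Nat.zero_add] at h1 h2 h3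
  rw [← h3, ← h2, ← h1]

/-- `γ(x; γ(y; a), b) = γ(x ∘₁ y; a, b)` -/
theorem nest_unary_left (hx : x ∈ ofArity k 2) (hy : y ∈ ofArity k 1) (a b : CC k) :
    circ k n (circ k 0 x (circ k 0 y a)) b = circ k n (circ k 0 (circ k 0 x y) a) b := by
  have h2 := circ_circ (i := 0) (j := 0) (by omega) (by omega) hx hy a
  rw [Nat.zero_add] at h2
  rw [← h2]

/-- `γ(x; a, γ(y; b)) = ± γ(x ∘₂ y; a, b)` -/
theorem nest_unary_right (hx : x ∈ ofArity k 2) (hy : y ∈ chains k 1 e) (ha : a ∈ chains k n p)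
    (b : CC k) :
    circ k n (circ k 0 x a) (circ k 0 y b) =
      (-1 : k) ^ (p * e) • circ k n (circ k 0 (circ k 1 x y) a) b := by
  have ha' := chains_le_ofArity _ _ ha
  have hy' := chains_le_ofArity _ _ hy
  have hxa := circ_mem_ofArity (i := 0) (by omega) hx ha'
  have h2 := circ_circ (i := n) (j := 0) (by omega) (by omega) hxa hy' b
  rw [Nat.add_zero] at h2
  rw [← h2, circ_circ_second le_rfl hx ha hy]
  simp only [map_smul, LinearMap.smul_apply]

theorem two_mem_chains (hx : x ∈ chains k 2 d) (ha : a ∈ chains k n p) (hb : b ∈ chains k m q) :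
    circ k n (circ k 0 x a) b ∈ chains k (n + m) (d + p + q) := by
  have h := circ_mem_chains (i := n) (n := 2 + n - 1) (by omega)
    (circ_mem_chains (i := 0) (by omega) hx ha) hb
  rwa [show 2 + n - 1 + m - 1 = n + m by omega] at h

theorem two_mem_ofArity (hx : x ∈ ofArity k 2) (ha : a ∈ ofArity k n) (hb : b ∈ ofArity k m) :
    circ k n (circ k 0 x a) b ∈ ofArity k (n + m) := by
  have h := circ_mem_ofArity (i := n) (n := 2 + n - 1) (by omega)
    (circ_mem_ofArity (i := 0) (by omega) hx ha) hb
  rwa [show 2 + n - 1 + m - 1 = n + m by omega] at h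

/-- Operations are compatible with the differentials. -/
theorem boundary_two (hx : x ∈ chains k 2 d) (ha : a ∈ chains k n p) (b : CC k) :
    boundary k (circ k n (circ k 0 x a) b) = circ k n (circ k 0 (boundary k x) a) b +
      (-1 : k) ^ d • (circ k n (circ k 0 x (boundary k a)) b +
        (-1 : k) ^ p • circ k n (circ k 0 x a) (boundary k b)) := by
  rw [boundary_circ (n := 2 + n - 1) (by omega) (circ_mem_chains (by omega) hx ha),
    boundary_circ (by omega) hx, pow_add]
  simp only [map_add, map_smul, LinearMap.add_apply, LinearMap.smul_apply, smul_add, smul_smul]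
  abel

theorem boundary_three (hx : x ∈ chains k 3 d) (ha : a ∈ chains k n p) (hb : b ∈ chains k m q)
    (c : CC k) :
    boundary k (circ k (n + m) (circ k n (circ k 0 x a) b) c) =
      circ k (n + m) (circ k n (circ k 0 (boundary k x) a) b) c +
      (-1 : k) ^ d • (circ k (n + m) (circ k n (circ k 0 x (boundary k a)) b) c +
        (-1 : k) ^ p • circ k (n + m) (circ k n (circ k 0 x a) (boundary k b)) c +
        (-1 : k) ^ (p + q) • circ k (n + m) (circ k n (circ k 0 x a) b) (boundary k c)) := by
  have h1 := circ_mem_chains (i := 0) (by omega) hx ha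
  rw [boundary_circ (n := 3 + n - 1 + m - 1) (by omega) (circ_mem_chains (by omega) h1 hb),
    boundary_circ (n := 3 + n - 1) (by omega) h1, boundary_circ (by omega) hx]
  simp only [pow_add, map_add, map_smul, LinearMap.add_apply, LinearMap.smul_apply, smul_add,
    smul_smul, mul_assoc]
  abel

/-- By the Leibniz rule for compositions, the differential of an operation is the operation of the
boundary. -/
theorem opDiffTwo_eq (hx : x ∈ chains k 2 d) (ha : a ∈ chains k n p) (b : CC k) :
    opDiffTwo x d p a b = circ k n (circ k 0 (boundary k x) a) b := by
  have ha' := chains_le_ofArity _ _ ha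
  rw [opDiffTwo, gamma_two _ ha', gamma_two _ (boundary_mem_ofArity ha'), gamma_two _ ha',
    boundary_two hx ha]
  abel

theorem opDiffThree_eq (hx : x ∈ chains k 3 d) (ha : a ∈ chains k n p) (hb : b ∈ chains k m q)
    (c : CC k) :
    opDiffThree x d p q a b c = circ k (n + m) (circ k n (circ k 0 (boundary k x) a) b) c := by
  have ha' := chains_le_ofArity _ _ ha
  have hb' := chains_le_ofArity _ _ hb
  rw [opDiffThree, gamma_three _ ha' hb', gamma_three _ (boundary_mem_ofArity ha') hb',
    gamma_three _ ha' (boundary_mem_ofArity hb'), gamma_three _ ha' hb', boundary_three hx ha hb]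
  abel

end

/-! ### The bracket -/

theorem neg_one_pow_eq {s t : ℕ} (h : s % 2 = t % 2) : (-1 : k) ^ s = (-1) ^ t := by
  rw [neg_one_pow_eq_pow_mod_two, h, ← neg_one_pow_eq_pow_mod_two]

theorem preLie_single (σ τ : Cell) :
    preLie k (Finsupp.single σ 1) (Finsupp.single τ 1) = (-1 : k) ^ σ.degree •
      circ k σ.arity (circ k 0 (tau k) (Finsupp.single σ 1)) (Finsupp.single τ 1) := by
  simp only [preLie, Finsupp.linearCombination_single, one_smul]
  rw [single_tauOne, gamma_two _ (single_mem_ofArity σ)]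

theorem succ_mul_succ' (p q : ℕ) : (p + 1) * (q + 1) = p * q + p + q + 1 := by ring

/-- The bracket is, up to a sign, the operation of the chain `lie`. -/
theorem bracket_eq {n m p : ℕ} {a b : CC k} (ha : a ∈ chains k n p) (hb : b ∈ ofArity k m) :
    bracket k a b = (-1 : k) ^ p • circ k n (circ k 0 (lie k) a) b := by
  refine map_eq_of_mem_chains (f := (bracket k).flip b)
    (g := (-1 : k) ^ p • (circ k n).flip b ∘ₗ circ k 0 (lie k)) (fun σ h1 h2 => ?_) ha
  simp only [LinearMap.comp_apply, LinearMap.flip_apply, LinearMap.smul_apply]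
  refine map_eq_of_mem_ofArity (f := bracket k (Finsupp.single σ 1))
    (g := (-1 : k) ^ p • circ k n (circ k 0 (lie k) (Finsupp.single σ 1))) (fun τ h3 => ?_) hb
  subst h1 h2 h3
  simp only [bracket, Finsupp.linearCombination_single, one_smul, LinearMap.smul_apply]
  rw [preLie_single, preLie_single, map_smul,
    relabel_two le_rfl (chains_le_ofArity _ _ (tau_mem k)) (single_mem_chains σ)
      (single_mem_chains τ), relabel_tau, smul_smul, smul_smul, ← pow_add, ← pow_add,
    add_assoc, neg_one_pow_eq (s := (σ.degree + 1) * (τ.degree + 1) + (τ.degree + σ.degree * τ.degree))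
      (t := σ.degree + 1) (by
        have : (σ.degree + 1) * (τ.degree + 1) + (τ.degree + σ.degree * τ.degree) =
          2 * (σ.degree * τ.degree + τ.degree) + (σ.degree + 1) := by ring
        rw [this, Nat.mul_add_mod])]
  simp only [_root_.map_sub, LinearMap.sub_apply, pow_succ, mul_neg, mul_one, neg_smul, smul_sub]
  abel

/-! ### The unit -/

/-- The circle is a left unit of the operad: every word can be cut at no point in one way only. -/
theorem circ_circle (a : CC k) : circ k 0 (chainOf k circleComb) a = a := by
  have e : circ k 0 (chainOf k circleComb) = LinearMap.id := by
    refine Finsupp.lhom_ext' fun τ => LinearMap.ext_ring ?_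
    simp only [LinearMap.comp_apply, Finsupp.lsingle_apply, LinearMap.id_apply]
    have h1 : chainOf k circleComb = tw k [⟨0, true, 0⟩] := by
      simp [chainOf, circleComb, tw, frees, sgn, inversions, forget, Letter.arc]
    have h2 : IsTagged 1 [⟨0, true, 0⟩] :=
      ⟨show IsWord 1 [(0, true)] by decide, by simp⟩
    have hV := isTagged_numbered 1 τ
    rw [h1, ← tw_numbered k 1 τ, circ_tw k h2 hV one_pos]
    · have e1 : slotTags 0 [⟨0, true, 0⟩] = [] := rfl
      have e2 : (numbered 1 τ.walk).map (Letter.mapLab (· + 0)) = numbered 1 τ.walk := by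
        conv_rhs => rw [← List.map_id (numbered 1 τ.walk)]
        rfl
      rw [e1, e2, cutAt_nil, lsum_singleton]
      simp [fill, sub]
    · intro x hx y hy
      obtain rfl := List.mem_singleton.1 hx
      exact (mem_numbered hy).1
  rw [e, LinearMap.id_apply]

/-! ### The identities -/

section
variable {n m l p q r : ℕ} {a b c : CC k}

theorem cmul_mem (ha : a ∈ chains k n p) (hb : b ∈ chains k m q) :
    cmul a b ∈ chains k (n + m) (p + q) := by
  have h := two_mem_chains (mu_mem k) ha hb
  rwa [Nat.zero_add, ← cmul_eq (chains_le_ofArity _ _ ha)] at h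

theorem delta_mem (ha : a ∈ chains k n p) : delta a ∈ chains k n (p + 1) := by
  have h := circ_mem_chains (i := 0) (by omega) (bv_mem k) ha
  rwa [Nat.add_sub_cancel_left, Nat.add_comm 1 p, ← delta_eq] at h

theorem bracket_mem (ha : a ∈ chains k n p) (hb : b ∈ chains k m q) :
    bracket k a b ∈ chains k (n + m) (p + q + 1) := by
  have h := two_mem_chains (lie_mem k) ha hb
  rw [bracket_eq ha (chains_le_ofArity _ _ hb)]
  rw [show 1 + p + q = p + q + 1 by omega] at h
  exact Submodule.smul_mem _ _ h

theorem boundary_cmul (ha : a ∈ chains k n p) (b : CC k) :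
    boundary k (cmul a b) = cmul (boundary k a) b + (-1 : k) ^ p • cmul a (boundary k b) := by
  have ha' := chains_le_ofArity _ _ ha
  rw [cmul_eq ha', cmul_eq ha', cmul_eq (boundary_mem_ofArity ha'), boundary_two (mu_mem k) ha,
    boundary_mu]
  simp

theorem boundary_delta (a : CC k) : boundary k (delta a) = -delta (boundary k a) := by
  rw [delta_eq, delta_eq, boundary_circ one_pos (bv_mem k), boundary_bv]
  simp

theorem boundary_bracket (ha : a ∈ chains k n p) (hb : b ∈ chains k m q) :
    boundary k (bracket k a b) =
      bracket k (boundary k a) b + (-1 : k) ^ (p + 1) • bracket k a (boundary k b) := by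
  have hb' := chains_le_ofArity _ _ hb
  have h1 : bracket k (boundary k a) b =
      (-1 : k) ^ (p + 1) • circ k n (circ k 0 (lie k) (boundary k a)) b := by
    rcases p with _ | p
    · rw [boundary_eq_zero ha]
      simp
    · rw [bracket_eq (boundary_mem_chains ha) hb']
      congr 1
      exact neg_one_pow_eq (by omega)
  rw [h1, bracket_eq ha hb', bracket_eq ha (boundary_mem_ofArity hb'), map_smul,
    boundary_two (lie_mem k) ha, boundary_lie]
  simp only [map_zero, LinearMap.zero_apply, zero_add, pow_succ, mul_neg, mul_one, neg_smul,
    pow_zero, one_smul, one_mul, smul_add, smul_neg, smul_smul, neg_mul]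

theorem cmul_assoc (a b c : CC k) : cmul (cmul a b) c = cmul a (cmul b c) := by
  simp only [cmul_eq_cmulₗ]
  induction a using Finsupp.induction_linear with
  | zero => simp
  | add a a' h h' => simp only [map_add, LinearMap.add_apply, h, h']
  | single σ s =>
    induction b using Finsupp.induction_linear with
    | zero => simp
    | add b b' h h' => simp only [map_add, LinearMap.add_apply, h, h']
    | single τ t =>
      rw [← mul_one s, ← mul_one t, ← smul_eq_mul, ← smul_eq_mul, ← Finsupp.smul_single,
        ← Finsupp.smul_single]
      simp only [map_smul, LinearMap.smul_apply]
      congr 2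
      have hμ := chains_le_ofArity _ _ (mu_mem k)
      have hσ := single_mem_ofArity (k := k) σ
      have hτ := single_mem_ofArity (k := k) τ
      have h1 := two_mem_ofArity hμ hσ hτ
      rw [← cmul_eq_cmulₗ, ← cmul_eq_cmulₗ, ← cmul_eq_cmulₗ, ← cmul_eq_cmulₗ, cmul_eq hσ,
        cmul_eq h1,
        cmul_eq hτ, cmul_eq hσ, nest_left hμ hμ hσ,
        nest_right hμ (mu_mem k) (single_mem_chains σ) hτ, mu_circ_mu]
      simp

theorem unit_cmul (a : CC k) : cmul (Finsupp.single unitCell 1) a = a := by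
  rw [cmul_eq (n := 0) (single_mem_ofArity unitCell), mu_circ_unit k two_pos, circ_circle]

theorem cmul_unit (a : CC k) : cmul a (Finsupp.single unitCell 1) = a := by
  rw [cmul_eq_cmulₗ]
  induction a using Finsupp.induction_linear with
  | zero => simp
  | add a a' h h' => simp only [map_add, LinearMap.add_apply, h, h']
  | single σ s =>
    rw [← mul_one s, ← smul_eq_mul, ← Finsupp.smul_single, map_smul, LinearMap.smul_apply,
      ← cmul_eq_cmulₗ, cmul_eq (single_mem_ofArity σ),
      circ_circ_second le_rfl (chains_le_ofArity _ _ (mu_mem k)) (single_mem_chains σ)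
        (single_mem_chains unitCell), mu_circ_unit k one_lt_two, circ_circle,
      show unitCell.degree = 0 from rfl]
    simp

theorem cmul_comm_homotopy (ha : a ∈ chains k n p) (hb : b ∈ chains k m q) :
    (-1 : k) ^ (p * q) • relabel k (swapBlocks m n) (cmul b a) - cmul a b =
      opDiffTwo (Finsupp.single tauOne 1) 1 p a b := by
  have hμ := chains_le_ofArity _ _ (mu_mem k)
  rw [single_tauOne, opDiffTwo_eq (tau_mem k) ha, boundary_tau, cmul_eq (chains_le_ofArity _ _ hb),
    cmul_eq (chains_le_ofArity _ _ ha), relabel_two le_rfl hμ ha hb, smul_smul,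
    neg_one_pow_mul_self, one_smul]
  simp only [_root_.map_sub, LinearMap.sub_apply]

theorem bracket_antisymm (ha : a ∈ chains k n p) (hb : b ∈ chains k m q) :
    bracket k a b =
      -((-1 : k) ^ ((p + 1) * (q + 1)) • relabel k (swapBlocks m n) (bracket k b a)) := by
  have hl := chains_le_ofArity _ _ (lie_mem k)
  rw [bracket_eq ha (chains_le_ofArity _ _ hb), bracket_eq hb (chains_le_ofArity _ _ ha), map_smul,
    relabel_two le_rfl hl ha hb, relabel_lie, smul_smul, smul_smul, ← neg_smul, ← pow_add,
      ← pow_add]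
  congr 1
  have e : -(-1 : k) ^ ((p + 1) * (q + 1) + q + p * q) =
      (-1) ^ ((p + 1) * (q + 1) + q + p * q + 1) := by rw [pow_succ]; ring
  rw [e]
  refine neg_one_pow_eq ?_
  have := succ_mul_succ' p q
  omega

theorem sign_smul_congr {s t : ℕ} (h : s % 2 = t % 2) (x : CC k) :
    (-1 : k) ^ s • x = (-1 : k) ^ t • x := by rw [neg_one_pow_eq h]

theorem sign_smul_eq_neg {s t : ℕ} (h : s % 2 = (t + 1) % 2) (x : CC k) :
    (-1 : k) ^ s • x = -((-1 : k) ^ t • x) := by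
  rw [neg_one_pow_eq h, pow_succ, mul_neg_one, neg_smul]

theorem bracket_jacobi (ha : a ∈ chains k n p) (hb : b ∈ chains k m q) (hc : c ∈ chains k l r) :
    bracket k a (bracket k b c) - bracket k (bracket k a b) c -
      (-1 : k) ^ ((p + 1) * (q + 1)) •
        relabel k (swapBlocks m n) (bracket k b (bracket k a c)) = 0 := by
  have hl := chains_le_ofArity _ _ (lie_mem k)
  have ha' := chains_le_ofArity _ _ ha
  have hb' := chains_le_ofArity _ _ hb
  have hc' := chains_le_ofArity _ _ hc
  have h11 := circ_mem_ofArity (i := 1) (by omega) hl hl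
  have e1 : bracket k a (bracket k b c) = (-1 : k) ^ q • circ k (n + m) (circ k n (circ k 0
      (circ k 1 (lie k) (lie k)) a) b) c := by
    rw [bracket_eq ha (chains_le_ofArity _ _ (bracket_mem hb hc)), bracket_eq hb hc', map_smul,
      nest_right hl (lie_mem k) ha hb', smul_smul, smul_smul, ← pow_add, ← pow_add]
    exact sign_smul_congr (by omega) _
  have e2 : bracket k (bracket k a b) c = -((-1 : k) ^ q • circ k (n + m) (circ k n (circ k 0
      (circ k 0 (lie k) (lie k)) a) b) c) := by
    rw [bracket_eq (bracket_mem ha hb) hc', bracket_eq ha hb', map_smul, map_smul,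
      LinearMap.smul_apply, nest_left hl hl ha', smul_smul, ← pow_add]
    exact sign_smul_eq_neg (by omega) _
  have e3 : (-1 : k) ^ ((p + 1) * (q + 1)) •
      relabel k (swapBlocks m n) (bracket k b (bracket k a c)) =
        -((-1 : k) ^ q • circ k (n + m) (circ k n (circ k 0 (relabel k (swapBlocks 1 1)
          (circ k 1 (lie k) (lie k))) a) b) c) := by
    rw [bracket_eq hb (chains_le_ofArity _ _ (bracket_mem ha hc)), bracket_eq ha hc', map_smul,
      map_smul, nest_right hl (lie_mem k) hb ha', map_smul, map_smul, relabel_three h11 ha hb hc']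
    simp only [smul_smul, ← pow_add]
    refine sign_smul_eq_neg ?_ _
    have := succ_mul_succ' p q
    omega
  have key := congrArg (fun x => circ k (n + m) (circ k n (circ k 0 x a) b) c) (jacobi_chains k)
  simp only [map_add, LinearMap.add_apply, map_zero, LinearMap.zero_apply] at key
  rw [e1, e2, e3, sub_neg_eq_add, sub_neg_eq_add, ← smul_add, ← smul_add, key, smul_zero]

theorem poisson_homotopy (ha : a ∈ chains k n p) (hb : b ∈ chains k m q) (hc : c ∈ chains k l r) :
    (-1 : k) ^ p • (bracket k a (cmul b c) - cmul (bracket k a b) c -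
      (-1 : k) ^ ((p + 1) * q) • relabel k (swapBlocks m n) (cmul b (bracket k a c))) =
        opDiffThree (chainOf k poissonComb) 2 p q a b c := by
  have hl := chains_le_ofArity _ _ (lie_mem k)
  have hμ := chains_le_ofArity _ _ (mu_mem k)
  have ha' := chains_le_ofArity _ _ ha
  have hb' := chains_le_ofArity _ _ hb
  have hc' := chains_le_ofArity _ _ hc
  have h11 := circ_mem_ofArity (i := 1) (by omega) hμ hl
  have e1 : bracket k a (cmul b c) = (-1 : k) ^ p • circ k (n + m) (circ k n (circ k 0
      (circ k 1 (lie k) (mu k)) a) b) c := by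
    rw [bracket_eq ha (chains_le_ofArity _ _ (cmul_mem hb hc)), cmul_eq hb',
      nest_right hl (mu_mem k) ha hb', Nat.mul_zero, pow_zero, one_smul]
  have e2 : cmul (bracket k a b) c = (-1 : k) ^ p • circ k (n + m) (circ k n (circ k 0
      (circ k 0 (mu k) (lie k)) a) b) c := by
    rw [cmul_eq (chains_le_ofArity _ _ (bracket_mem ha hb)), bracket_eq ha hb', map_smul, map_smul,
      LinearMap.smul_apply, nest_left hμ hl ha']
  have e3 : (-1 : k) ^ ((p + 1) * q) • relabel k (swapBlocks m n) (cmul b (bracket k a c)) =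
      (-1 : k) ^ p • circ k (n + m) (circ k n (circ k 0 (relabel k (swapBlocks 1 1)
          (circ k 1 (mu k) (lie k))) a) b) c := by
    rw [cmul_eq hb', bracket_eq ha hc', map_smul,
      nest_right hμ (lie_mem k) hb ha', smul_smul, map_smul, relabel_three h11 ha hb hc',
      smul_smul, smul_smul, ← pow_add, ← pow_add, ← pow_add]
    refine sign_smul_congr ?_ _
    have : (p + 1) * q = p * q + q := by ring
    omega
  have hh : chainOf k poissonComb ∈ chains k 3 2 := poisson_mem k
  rw [e1, e2, e3, opDiffThree_eq hh ha hb, ← poisson_chains, ← smul_sub, ← smul_sub, smul_smul,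
    neg_one_pow_mul_self, one_smul]
  simp only [_root_.map_sub, LinearMap.sub_apply]

theorem delta_delta (a : CC k) : delta (delta a) = 0 := by
  have h := chains_le_ofArity _ _ (bv_mem k)
  have e := circ_circ (i := 0) (j := 0) one_pos one_pos h h a
  rw [Nat.add_zero] at e
  rw [delta_eq, delta_eq, ← e, bv_circ_bv]
  simp

theorem seven_term_homotopy (ha : a ∈ chains k n p) (hb : b ∈ chains k m q)
    (hc : c ∈ chains k l r) :
    delta (cmul (cmul a b) c) -
        (cmul (delta (cmul a b)) c + (-1 : k) ^ p • cmul a (delta (cmul b c)) +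
          (-1 : k) ^ ((p + 1) * q) • relabel k (swapBlocks m n) (cmul b (delta (cmul a c))) -
          cmul (cmul (delta a) b) c - (-1 : k) ^ p • cmul (cmul a (delta b)) c -
          (-1 : k) ^ (p + q) • cmul (cmul a b) (delta c)) =
        opDiffThree (chainOf k sevenComb) 2 p q a b c := by
  have hd := chains_le_ofArity _ _ (bv_mem k)
  have hμ := chains_le_ofArity _ _ (mu_mem k)
  have ha' := chains_le_ofArity _ _ ha
  have hb' := chains_le_ofArity _ _ hb
  have hc' := chains_le_ofArity _ _ hc
  have hμμ := circ_mem_ofArity (i := 0) (by omega) hμ hμ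
  have hdμ := circ_mem_chains (i := 0) (by omega) (bv_mem k) (mu_mem k)
  have hdμ' := chains_le_ofArity _ _ hdμ
  have hμd := circ_mem_ofArity (i := 0) (by omega) hμ hd
  have hμd1 := circ_mem_ofArity (i := 1) (by omega) hμ hd
  have h3 := circ_mem_ofArity (i := 1) (by omega) hμ hdμ'
  have hab := chains_le_ofArity _ _ (cmul_mem ha hb)
  have e1 : delta (cmul (cmul a b) c) = circ k (n + m) (circ k n (circ k 0
      (circ k 0 (bv k) (circ k 0 (mu k) (mu k))) a) b) c := by
    rw [delta_eq, cmul_eq hab, cmul_eq ha', nest_left hμ hμ ha', nest_unary_three hd hμμ ha' hb']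
  have e2 : cmul (delta (cmul a b)) c = circ k (n + m) (circ k n (circ k 0
      (circ k 0 (mu k) (circ k 0 (bv k) (mu k))) a) b) c := by
    rw [cmul_eq (chains_le_ofArity _ _ (delta_mem (cmul_mem ha hb))), delta_eq, cmul_eq ha',
      nest_unary hd hμ ha', nest_left hμ hdμ' ha']
  have e3 : (-1 : k) ^ p • cmul a (delta (cmul b c)) = circ k (n + m) (circ k n (circ k 0
      (circ k 1 (mu k) (circ k 0 (bv k) (mu k))) a) b) c := by
    rw [cmul_eq ha', delta_eq, cmul_eq hb', nest_unary hd hμ hb', nest_right hμ hdμ ha hb',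
      smul_smul, ← pow_add, neg_one_pow_eq (t := 0) (by omega), pow_zero, one_smul]
  have e4 : (-1 : k) ^ ((p + 1) * q) • relabel k (swapBlocks m n) (cmul b (delta (cmul a c))) =
      circ k (n + m) (circ k n (circ k 0 (relabel k (swapBlocks 1 1)
        (circ k 1 (mu k) (circ k 0 (bv k) (mu k)))) a) b) c := by
    rw [cmul_eq hb', delta_eq, cmul_eq ha', nest_unary hd hμ ha', nest_right hμ hdμ hb ha',
      map_smul, relabel_three h3 ha hb hc', smul_smul, smul_smul, ← pow_add, ← pow_add,
      neg_one_pow_eq (t := 0), pow_zero, one_smul]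
    have : (p + 1) * q = p * q + q := by ring
    omega
  have e5 : cmul (cmul (delta a) b) c = circ k (n + m) (circ k n (circ k 0
      (circ k 0 (mu k) (circ k 0 (mu k) (bv k))) a) b) c := by
    have hda := delta_mem ha
    rw [cmul_eq (chains_le_ofArity _ _ (cmul_mem hda hb)), cmul_eq (chains_le_ofArity _ _ hda),
      delta_eq, nest_unary_left hμ hd, nest_left hμ hμd ha']
  have e6 : (-1 : k) ^ p • cmul (cmul a (delta b)) c = circ k (n + m) (circ k n (circ k 0
      (circ k 0 (mu k) (circ k 1 (mu k) (bv k))) a) b) c := by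
    rw [cmul_eq (chains_le_ofArity _ _ (cmul_mem ha (delta_mem hb))), cmul_eq ha',
      delta_eq, nest_unary_right hμ (bv_mem k) ha, map_smul, map_smul, LinearMap.smul_apply,
      nest_left hμ hμd1 ha', smul_smul, ← pow_add, neg_one_pow_eq (t := 0) (by omega), pow_zero,
      one_smul]
  have e7 : (-1 : k) ^ (p + q) • cmul (cmul a b) (delta c) = circ k (n + m) (circ k n (circ k 0
      (circ k 0 (circ k 1 (mu k) (bv k)) (mu k)) a) b) c := by
    rw [cmul_eq hab, delta_eq, nest_unary_right hμ (bv_mem k) (cmul_mem ha hb), cmul_eq ha',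
      nest_left hμd1 hμ ha', smul_smul, ← pow_add, neg_one_pow_eq (t := 0) (by omega), pow_zero,
      one_smul]
  have hh : chainOf k sevenComb ∈ chains k 3 2 := seven_mem k
  rw [e1, e2, e3, e4, e5, e6, e7, opDiffThree_eq hh ha hb, ← seven_chains]
  simp only [_root_.map_sub, map_add, LinearMap.sub_apply, LinearMap.add_apply]

theorem bvLie_homotopy (ha : a ∈ chains k n p) (hb : b ∈ chains k m q) :
    (-1 : k) ^ p • bracket k a b -
        (delta (cmul a b) - cmul (delta a) b - (-1 : k) ^ p • cmul a (delta b)) =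
        opDiffTwo (chainOf k bvLieComb) 2 p a b := by
  have hd := chains_le_ofArity _ _ (bv_mem k)
  have hμ := chains_le_ofArity _ _ (mu_mem k)
  have ha' := chains_le_ofArity _ _ ha
  have hb' := chains_le_ofArity _ _ hb
  have hh : chainOf k bvLieComb ∈ chains k 2 2 := bvLie_mem k
  rw [bracket_eq ha hb', delta_eq, cmul_eq ha', nest_unary hd hμ ha',
    cmul_eq (chains_le_ofArity _ _ (delta_mem ha)), delta_eq, nest_unary_left hμ hd, cmul_eq ha',
    delta_eq, nest_unary_right hμ (bv_mem k) ha, smul_smul, smul_smul, mul_one,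
    neg_one_pow_mul_self, one_smul, one_smul, opDiffTwo_eq hh ha, ← bvLie_chains]
  simp only [_root_.map_sub, LinearMap.sub_apply]

end

end

end Cacti

end

theorem mainTheorem4 (k : Type*) [CommRing k] :
    -- the chains are a complex, the operations are homogeneous, and the operations of degree 0
    -- and 1 (product, BV operator, bracket) are compatible with the differential
    (∀ a : CC k, boundary k (boundary k a) = 0) ∧
    (∀ n, ∀ a ∈ chains k n 0, boundary k a = 0) ∧
    (∀ n p, ∀ a ∈ chains k n (p + 1), boundary k a ∈ chains k n p) ∧
    (∀ n m p q, ∀ a ∈ chains k n p, ∀ b ∈ chains k m q,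
      cmul a b ∈ chains k (n + m) (p + q) ∧
      delta a ∈ chains k n (p + 1) ∧
      bracket k a b ∈ chains k (n + m) (p + q + 1) ∧
      boundary k (cmul a b) = cmul (boundary k a) b + (-1 : k) ^ p • cmul a (boundary k b) ∧
      boundary k (delta a) = -delta (boundary k a) ∧
      boundary k (bracket k a b) =
        bracket k (boundary k a) b + (-1 : k) ^ (p + 1) • bracket k a (boundary k b)) ∧
    -- the product is associative with a unit
    (∀ a b c : CC k, cmul (cmul a b) c = cmul a (cmul b c)) ∧
    (∀ a : CC k,
      cmul (Finsupp.single unitCell 1) a = a ∧ cmul a (Finsupp.single unitCell 1) = a) ∧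
    -- the product is commutative up to the homotopy given by `tauOne`
    (∀ n m p q, ∀ a ∈ chains k n p, ∀ b ∈ chains k m q,
      (-1 : k) ^ (p * q) • relabel k (swapBlocks m n) (cmul b a) - cmul a b =
        opDiffTwo (Finsupp.single tauOne 1) 1 p a b) ∧
    -- the bracket is a Gerstenhaber bracket up to homotopy: antisymmetry,
    (∀ n m p q, ∀ a ∈ chains k n p, ∀ b ∈ chains k m q,
      bracket k a b =
        -((-1 : k) ^ ((p + 1) * (q + 1)) • relabel k (swapBlocks m n) (bracket k b a))) ∧
    -- the Jacobi identity
    (∃ h ∈ chains k 3 3, ∀ n m l p q r,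
      ∀ a ∈ chains k n p, ∀ b ∈ chains k m q, ∀ c ∈ chains k l r,
      (-1 : k) ^ q • (bracket k a (bracket k b c) - bracket k (bracket k a b) c -
        (-1 : k) ^ ((p + 1) * (q + 1)) •
          relabel k (swapBlocks m n) (bracket k b (bracket k a c))) =
        opDiffThree h 3 p q a b c) ∧
    -- and the odd Poisson identity
    (∃ h ∈ chains k 3 2, ∀ n m l p q r,
      ∀ a ∈ chains k n p, ∀ b ∈ chains k m q, ∀ c ∈ chains k l r,
      (-1 : k) ^ p • (bracket k a (cmul b c) - cmul (bracket k a b) c -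
        (-1 : k) ^ ((p + 1) * q) • relabel k (swapBlocks m n) (cmul b (bracket k a c))) =
        opDiffThree h 2 p q a b c) ∧
    -- the BV operator has square zero,
    (∀ a : CC k, delta (delta a) = 0) ∧
    -- it satisfies the seven term relation up to homotopy,
    (∃ h ∈ chains k 3 2, ∀ n m l p q r,
      ∀ a ∈ chains k n p, ∀ b ∈ chains k m q, ∀ c ∈ chains k l r,
      delta (cmul (cmul a b) c) -
        (cmul (delta (cmul a b)) c + (-1 : k) ^ p • cmul a (delta (cmul b c)) +
          (-1 : k) ^ ((p + 1) * q) • relabel k (swapBlocks m n) (cmul b (delta (cmul a c))) -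
          cmul (cmul (delta a) b) c - (-1 : k) ^ p • cmul (cmul a (delta b)) c -
          (-1 : k) ^ (p + q) • cmul (cmul a b) (delta c)) =
        opDiffThree h 2 p q a b c) ∧
    -- and it induces the bracket up to homotopy
    (∃ h ∈ chains k 2 2, ∀ n m p q, ∀ a ∈ chains k n p, ∀ b ∈ chains k m q,
      (-1 : k) ^ p • bracket k a b -
        (delta (cmul a b) - cmul (delta a) b - (-1 : k) ^ p • cmul a (delta b)) =
        opDiffTwo h 2 p a b) := by
  refine ⟨boundary_boundary, fun n a ha => boundary_eq_zero ha,
    fun n p a ha => boundary_mem_chains ha, fun n m p q a ha b hb => ⟨cmul_mem ha hb, delta_mem ha,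
      bracket_mem ha hb, boundary_cmul ha b, boundary_delta a, boundary_bracket ha hb⟩,
    cmul_assoc, fun a => ⟨unit_cmul a, cmul_unit a⟩,
    fun n m p q a ha b hb => cmul_comm_homotopy ha hb,
    fun n m p q a ha b hb => bracket_antisymm ha hb,
    ⟨0, Submodule.zero_mem _, fun n m l p q r a ha b hb c hc => ?_⟩,
    ⟨chainOf k poissonComb, poisson_mem k, fun n m l p q r a ha b hb c hc =>
      poisson_homotopy ha hb hc⟩,
    delta_delta,
    ⟨chainOf k sevenComb, seven_mem k, fun n m l p q r a ha b hb c hc =>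
      seven_term_homotopy ha hb hc⟩,
    ⟨chainOf k bvLieComb, bvLie_mem k, fun n m p q a ha b hb => bvLie_homotopy ha hb⟩⟩
  -- the Jacobi identity holds strictly
  rw [bracket_jacobi ha hb hc, smul_zero, opDiffThree_eq (Submodule.zero_mem _) ha hb]
  simp
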